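/- **Theorem (monotonicity of the Glimm functional).** *The system.* Let $\gamma>1$. Consider the steady Euler system $\partial_x W(U)+\partial_y H(U)=0$ for $U=(u,v,p,\rho)$, with $W=(\rho u,\rho u^2+p,\rho uv,\rho u(E+p/\rho))$, $H=(\rho v,\rho uv,\rho v^2+p,\rho v(E+p/\rho))$, $E=\frac12(u^2+v^2)+\frac{p}{(\gamma-1)\rho}$, in the region $p,\rho>0$, $u>c=\sqrt{\gamma p/\rho}$. With $q=\sqrt{u^2+v^2}$ the eigenvalues are $\lambda_{1,3}=\frac{uv\mp c\sqrt{q^2-c^2}}{u^2-c^2}$ and $\lambda_2=v/u$, and $r_j=k_j\big(-\lambda_j,1,\rho(\lambda_ju-v),\rho(\lambda_ju-v)/c^2\big)$, $j=1,3$, with $k_j>0$ such that $\nabla\lambda_j\cdot r_j\equiv1$. *Waves.* For $j=1,3$, $\Phi_j(\alpha;U)$ is, for $\alpha\ge0$, the point with parameter $\alpha$ on the integral curve of $r_j$ from $U$ (rarefaction); for $\alpha<0$ it is the state above a $j$-shock whose lower state is $U$ (Rankine–Hugoniot conditions with speed $s$, where $s<v/u$ if $j=1$ and $s>v/u$ if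 $j=3$, pressure increasing along particle paths), the shock curve being parametrized, like the rarefaction curve, by the increment $\alpha$ of $\lambda_j$. Further $\Phi_2(\alpha_{21},\alpha_{22};U)=(ue^{\alpha_{21}},ve^{\alpha_{21}},p,\rho e^{\alpha_{22}})$. The strength of a wave is $|\alpha|$, resp. $|\alpha_2|=|\alpha_{21}|+|\alpha_{22}|$. A front of parameter zero is no front. *Background solution.* $U_+=(u_+,0,p_+,\rho_+)$ and $U_-$ satisfy $U_+=\Phi_3(\underline S;U_-)$ with $\underline S>0$, by a rarefaction curve in $\{u>c\}$. A static gas of pressure $\bar p=p(U_-)$ lies below a free boundary $y=g(x)$, $g(0)=0$; on it $p=\bar p$ and $g'=v/u$. For $\delta_0>0$ let $D(U_+,\delta_0)$ be the set of states in $\{u>c\}$ for which each of $I(q,B)+\arctan\frac vu$, $B=q^2+\frac{2c^2}{\gamma-1}$ and $p\rho^{-\gamma}$ differs by less than $\delta_0$ from its value at $U_+$, and $\bar p-\delta_0<p<p_++\delta_0$. Here $I(q,B)=\int_{q_*}^{q}\frac{\sqrt{(\gamma+1)t^2-(\gamma-1)B}}{t\sqrt{(\gamma-1)(B-t^2)}}\,dt$,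 $q_*^2=\frac{\gamma-1}{\gamma+1}B$. *Approximate solutions.* Let $\hat\lambda$ exceed all eigenvalues on $D(U_+,\delta_0)$, and let $\delta,\mu>0$. A $\delta$-approximate solution is piecewise constant with values in $\{u>c\}$ above the free boundary, equals $U_+$ above all fronts, and its discontinuities are finitely many straight fronts, each of which carries a wave and a generation order. Physical fronts have the shock speed, $\lambda_2$, or, for a rarefaction front, $\lambda_j$ of its upper state, up to an adjustment bounded by some $\eta\ge0$; non-physical fronts (family 4) have speed $\hat\lambda$, and their strength is the Euclidean norm of the jump. Rarefaction waves $\alpha>0$ are always split into $\lceil\alpha/\delta\rceil$ equal fronts. The initial datum is piecewise constant with finitely many jumps; its jumps are resolved into 1-, 2- and 3-waves (the accurate Riemann solver), with fronts of order 1. At the corner $(0,0)$ a 3-rarefaction wave with pressure $\bar p$ below it is split into fronts of order 0. *Strong fronts* are the 3-rarefaction fronts of order 0; all others are weak. Two weak physical fronts, an $i$-front below a $j$-front, are *approaching* if $i>j$, or if $i=j$ and at least one of them is a shock. At each "time" $x=\tau$ at most one interaction occurs. It is one of the following, with amount of interaction $E_\delta(\tau-)$: 1. two approaching weak physical fronts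 meet: $E_\delta=|\alpha_i||\beta_j|$; 2. a 1-front hits the free boundary: $E_\delta=|\alpha_1|$; 3. a strong front $s$ meets a weak $i$-front from above, $i=1,2$: $E_\delta=|\alpha_i||s|$; 4. a strong front $s$ meets a weak 3-shock from below or above: $E_\delta=\min\{|\alpha_3|,|s|\}$; 5. a non-physical front $\epsilon$ meets a strong front from below: $E_\delta=|s||\epsilon|$; 6. a non-physical front $\epsilon$ meets a weak physical front from below: $E_\delta=|\alpha_i||\epsilon|$. In cases 1, 3, 4 with $E_\delta>\mu$ the accurate Riemann solver is applied to the states below and above the two fronts. In cases 1, 3, 4 with $E_\delta\le\mu$ and in cases 5, 6 the simplified solver is applied: from the lower state, waves of different families cross with unchanged parameters, the parameters of waves of the same family are added, a non-physical front leaves the physical wave unchanged, and a non-physical front restores the upper state. In case 2 the new state $U_m$ at the free boundary satisfies $p(U_m)=\bar p$ and $U_r=\Phi_3(\beta_3;U_m)$, where $U_r$ is the state above $\alpha_1$; the wave $\beta_3$ is emitted if $E_\delta>\mu$, otherwise it is replaced by a non-physical front. When an $i$-front of order $k_1$ and a $j$-front of order $k_2$ meet, outgoing $l$-fronts have order $\min\{k_1,k_2\}$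 if $l=i=j$, $k_1$ if $l=i\ne j$, $k_2$ if $l=j\ne i$, and $k_1+k_2$ otherwise; reflection keeps the order. *The functional.* At a non-interaction "time" $x$, let $L_i$ ($i=1,2,3$) be the total strength of the weak physical $i$-fronts, $L_4$ that of the non-physical fronts and $S(x)$ that of the strong fronts. Let $Q_0$ be the sum of $|\alpha||\beta|$ over all approaching pairs of weak physical fronts plus the sum of $|\alpha||\epsilon|$ over all weak physical fronts $\alpha$ lying above a non-physical front $\epsilon$. For $i=1,2$ let $Q_i=\sum|\alpha_i|\exp(K_\omega R^b_{\alpha_i})$ over the weak $i$-fronts, and let $Q_4=\sum|\epsilon|\exp(K_{np}R^a_\epsilon)$ over the non-physical fronts, where $R^b_{\alpha}$ is the total strength of the strong fronts below $\alpha$ and $R^a_{\epsilon}$ that of the strong fronts above $\epsilon$. Put $$F=KL_1+L_2+K_3L_3+L_4+K_0Q_0+K_1Q_1+K_2Q_2+K_4Q_4+K_*|S(x)-\underline S|.$$ *Claim.* For every background solution and every $\delta_0>0$ there exist positive constants $K,K_0,K_1,K_2,K_3,K_4,K_\omega,K_{np},K_*$ and $\delta^*$, depending only on the background solution and $\delta_0$,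 such that for all $\hat\lambda,\mu,\eta$ as above, every $\delta\in(0,\delta^*)$, every $\delta$-approximate solution and every interaction "time" $\tau>0$ of it with $F(\tau-)<\delta^*$, $$F(\tau+)-F(\tau-)\le-\tfrac14E_\delta(\tau-).$$ -/

import Mathlib

noncomputable section

namespace SteadyEuler

/-! ## The gas and its states -/

/-- A state `(u, v, p, ρ)` of the gas; `‖·‖` is the Euclidean norm of `ℝ⁴`. -/
abbrev State := EuclideanSpace ℝ (Fin 4)

def velX (U : State) : ℝ := U 0
def velY (U : State) : ℝ := U 1
def pres (U : State) : ℝ := U 2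
def dens (U : State) : ℝ := U 3

/-- Flow speed `q`. -/
def speed (U : State) : ℝ := √(velX U ^ 2 + velY U ^ 2)

/-- Local sonic speed `c = √(γ p / ρ)`. -/
def sonic (γ : ℝ) (U : State) : ℝ := √(γ * pres U / dens U)

/-- The region in which the system is hyperbolic in the positive `x`-direction: `u > c > 0`. -/
def Supersonic (γ : ℝ) (U : State) : Prop :=
  0 < pres U ∧ 0 < dens U ∧ sonic γ U < velX U

/-- Total energy per unit mass of a polytropic gas. -/
def energy (γ : ℝ) (U : State) : ℝ :=
  (velX U ^ 2 + velY U ^ 2) / 2 + pres U / ((γ - 1) * dens U)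

/-- The flux `W` in `∂ₓ W(U) + ∂_y H(U) = 0`. -/
def fluxW (γ : ℝ) (U : State) : State :=
  !₂[dens U * velX U, dens U * velX U ^ 2 + pres U, dens U * velX U * velY U,
    dens U * velX U * (energy γ U + pres U / dens U)]

/-- The flux `H` in `∂ₓ W(U) + ∂_y H(U) = 0`. -/
def fluxH (γ : ℝ) (U : State) : State :=
  !₂[dens U * velY U, dens U * velX U * velY U, dens U * velY U ^ 2 + pres U,
    dens U * velY U * (energy γ U + pres U / dens U)]

/-- The two genuinely nonlinear (acoustic) characteristic families, the first and the third. -/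
inductive Acoustic
  | one
  | three
  deriving DecidableEq

/-- `-1` for the first family and `+1` for the third. -/
def Acoustic.sgn : Acoustic → ℝ
  | .one => -1
  | .three => 1

/-- The eigenvalues `λ₁`, `λ₃`. -/
def lam (γ : ℝ) (j : Acoustic) (U : State) : ℝ :=
  (velX U * velY U + j.sgn * (sonic γ U * √(velX U ^ 2 + velY U ^ 2 - sonic γ U ^ 2))) /
    (velX U ^ 2 - sonic γ U ^ 2)

/-- The eigenvalue `λ₂ = v / u`. -/
def lamTwo (U : State) : ℝ := velY U / velX U

/-- The cosine of `θ ± θ_ma`, where `θ = arctan (v / u)` is the flow angle and `θ_ma` is the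
Mach angle, `sin θ_ma = c / q`; the sign is that of the family. -/
def cosAngle (γ : ℝ) (j : Acoustic) (U : State) : ℝ :=
  (velX U * √(speed U ^ 2 - sonic γ U ^ 2) - j.sgn * (velY U * sonic γ U)) / speed U ^ 2

/-- The factor `k_j > 0` for which `∇λ_j · r_j = 1`. -/
def kCoef (γ : ℝ) (j : Acoustic) (U : State) : ℝ :=
  2 * √(speed U ^ 2 - sonic γ U ^ 2) * cosAngle γ j U ^ 3 / (γ + 1)

/-- The normalized right eigenvectors `r₁`, `r₃`. -/
def eigvec (γ : ℝ) (j : Acoustic) (U : State) : State :=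
  kCoef γ j U • !₂[-lam γ j U, 1, dens U * (lam γ j U * velX U - velY U),
    dens U * (lam γ j U * velX U - velY U) / sonic γ U ^ 2]

/-! ## Elementary waves -/

/-- `Ur = Φ_j(a; Ul)` with `a ≥ 0`: the upper state `Ur` lies at parameter `a` on the integral
curve of `r_j` that starts at the lower state `Ul`. -/
def IsRarefaction (γ : ℝ) (j : Acoustic) (a : ℝ) (Ul Ur : State) : Prop :=
  ∃ ψ : ℝ → State, ψ 0 = Ul ∧ ψ a = Ur ∧
    ∀ t ∈ Set.Icc 0 a, Supersonic γ (ψ t) ∧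
      HasDerivWithinAt ψ (eigvec γ j (ψ t)) (Set.Icc 0 a) t

/-- `Ur = Φ_j(a; Ul)` with `a < 0`: the lower state `Ul` and the upper state `Ur` are joined by a
`j`-shock of speed `s`.  These are the Rankine-Hugoniot conditions, the choice of the family
(`s < v / u` for `j = 1`, `s > v / u` for `j = 3`), the entropy condition (the pressure rises along
particle paths), and the parametrization of the shock curve that continues the one of the
rarefaction curve, along which the parameter is the increment of `λ_j`. -/
def IsShock (γ : ℝ) (j : Acoustic) (a : ℝ) (Ul Ur : State) (s : ℝ) : Prop :=
  Supersonic γ Ul ∧ Supersonic γ Ur ∧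
  s • (fluxW γ Ur - fluxW γ Ul) = fluxH γ Ur - fluxH γ Ul ∧
  0 < j.sgn * (s - lamTwo Ul) ∧ 0 < j.sgn * (s - lamTwo Ur) ∧
  0 < j.sgn * (pres Ul - pres Ur) ∧
  a = lam γ j Ur - lam γ j Ul

/-- Waves and their parameters: an acoustic wave with its parameter `a` (a rarefaction wave or
front if `a > 0`, a shock if `a < 0`), a characteristic discontinuity with its parameters
`(α₂₁, α₂₂)`, a non-physical front with its strength. -/
inductive Wave
  | acoustic (j : Acoustic) (a : ℝ)
  | contact (a b : ℝ)
  | nonphysical (e : ℝ)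

/-- The number of the family; the non-physical fronts form the fourth one. -/
def Wave.family : Wave → ℕ
  | .acoustic .one _ => 1
  | .contact _ _ => 2
  | .acoustic .three _ => 3
  | .nonphysical _ => 4

/-- The strength of a wave. -/
def Wave.strength : Wave → ℝ
  | .acoustic _ a => |a|
  | .contact a b => |a| + |b|
  | .nonphysical e => |e|

def Wave.IsShock : Wave → Prop
  | .acoustic _ a => a < 0
  | _ => False

/-- `Joins γ lamHat w Ul Ur s`: the non-trivial wave `w` separates the lower state `Ul` from the
upper state `Ur`, and `s` is the speed of the corresponding front.  The speed of a rarefaction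
front is the characteristic speed at its upper state. -/
def Joins (γ lamHat : ℝ) : Wave → State → State → ℝ → Prop
  | .acoustic j a, Ul, Ur, s =>
      (0 < a ∧ IsRarefaction γ j a Ul Ur ∧ s = lam γ j Ur) ∨ (a < 0 ∧ IsShock γ j a Ul Ur s)
  | .contact a b, Ul, Ur, s =>
      ¬ (a = 0 ∧ b = 0) ∧
      velX Ur = velX Ul * Real.exp a ∧ velY Ur = velY Ul * Real.exp a ∧
      pres Ur = pres Ul ∧ dens Ur = dens Ul * Real.exp b ∧ s = lamTwo Ul
  | .nonphysical e, Ul, Ur, s => 0 < e ∧ e = ‖Ur - Ul‖ ∧ s = lamHat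

/-! ## The background solution and the neighbourhood of its rarefaction curve -/

/-- The data of a background solution: the constant supersonic states `Up = (u₊, 0, p₊, ρ₊)`
upstream and `Um` downstream are joined by a strong 3-rarefaction wave of strength `S > 0`,
`Up = Φ₃(S; Um)`, which stays in the region `u > c > 0`.  The flow is `Up` for `y ≥ λ₃(Up) x`, the
centred rarefaction wave for `λ₃(Um) x < y < λ₃(Up) x`, and `Um` between that wave and the free
boundary `y = (v₋ / u₋) x`; the pressure of the static gas below the free boundary is that
of `Um`. -/
structure IsBackground (γ : ℝ) (Up Um : State) (S : ℝ) : Prop where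
  supersonic : Supersonic γ Up
  horizontal : velY Up = 0
  strength_pos : 0 < S
  joined : IsRarefaction γ .three S Um Up

/-- `B = q² + 2 c² / (γ - 1)`. -/
def bernoulli (γ : ℝ) (U : State) : ℝ := speed U ^ 2 + 2 / (γ - 1) * sonic γ U ^ 2

/-- `I(q, B) + θ`, where `I(q, B)` is the primitive in `q` of `√(q² - c²) / (q c)` along
`q² + 2 c² / (γ - 1) = B` that vanishes where the flow is sonic, and `θ = arctan (v / u)`. -/
def riemannInv (γ : ℝ) (U : State) : ℝ :=
  (∫ t in (√((γ - 1) * bernoulli γ U / (γ + 1)))..(speed U),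
    √((γ + 1) * t ^ 2 - (γ - 1) * bernoulli γ U) /
      (t * √((γ - 1) * (bernoulli γ U - t ^ 2)))) +
  Real.arctan (velY U / velX U)

/-- `p ρ^(-γ)`. -/
def entropyFn (γ : ℝ) (U : State) : ℝ := pres U * dens U ^ (-γ)

/-- The neighbourhood `D(U₊, δ₀)` of the background rarefaction curve; `pbar` is the pressure of
the static gas. -/
def nbhdD (γ : ℝ) (Up : State) (pbar δ₀ : ℝ) : Set State :=
  {U | Supersonic γ U ∧
    |riemannInv γ U - riemannInv γ Up| < δ₀ ∧
    |bernoulli γ U - bernoulli γ Up| < δ₀ ∧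
    |entropyFn γ U - entropyFn γ Up| < δ₀ ∧
    pbar - δ₀ < pres U ∧ pres U < pres Up + δ₀}

/-! ## Fronts and the front tracking algorithm -/

/-- The parameters of the algorithm: adiabatic exponent, upstream state, pressure of the static
gas, speed of the non-physical fronts, maximal strength `δ` of rarefaction fronts, threshold `μ`
between the accurate and the simplified Riemann solver, and a bound `η` for the adjustment of the
speeds of physical fronts (which serves to avoid multiple interactions). -/
structure Params where
  γ : ℝ
  Up : State
  pbar : ℝ
  lamHat : ℝ
  δ : ℝ
  μ : ℝ
  η : ℝ

/-- A front: the half-line `y = y₀ + vel * (x - x₀)`, the wave that it carries, its generation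
order, and the constant states below and above it. -/
structure Front where
  wave : Wave
  order : ℕ
  below : State
  above : State
  x₀ : ℝ
  y₀ : ℝ
  vel : ℝ

namespace Front

def pos (f : Front) (x : ℝ) : ℝ := f.y₀ + f.vel * (x - f.x₀)

def strength (f : Front) : ℝ := f.wave.strength

/-- Strong rarefaction fronts: the 3-rarefaction fronts of generation order zero. -/
def IsStrong (f : Front) : Prop :=
  f.order = 0 ∧ ∃ a, 0 < a ∧ f.wave = .acoustic .three a

/-- Non-physical fronts. -/
def IsNP (f : Front) : Prop := f.wave.family = 4

/-- Weak physical fronts of the `i`-th family, `i = 1, 2, 3`. -/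
def IsWeakOf (i : ℕ) (f : Front) : Prop := f.wave.family = i ∧ ¬ f.IsNP ∧ ¬ f.IsStrong

/-- Weak physical fronts. -/
def IsWeak (f : Front) : Prop := ¬ f.IsNP ∧ ¬ f.IsStrong

/-- The front joins supersonic states in the prescribed way and travels with the correct speed, up
to an adjustment of at most `η` for a physical front. -/
def Admissible (P : Params) (f : Front) : Prop :=
  Supersonic P.γ f.below ∧ Supersonic P.γ f.above ∧
  ∃ s, Joins P.γ P.lamHat f.wave f.below f.above s ∧
    |f.vel - s| ≤ P.η ∧ (f.IsNP → f.vel = s)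

/-- Approaching weak physical fronts, `f` lying below `g`. -/
def Approach (f g : Front) : Prop :=
  f.IsWeak ∧ g.IsWeak ∧
    (g.wave.family < f.wave.family ∨
      (f.wave.family = g.wave.family ∧ (f.wave.IsShock ∨ g.wave.IsShock)))

end Front

/-- Fronts as they are emitted by a Riemann solver: zero waves give no front, and a
rarefaction wave `a > 0` is divided into `ν` equal fronts, `ν` being the least integer `≥ a / δ`. -/
def pieces (δ : ℝ) : Wave → List Wave
  | .acoustic j a =>
      open Classical in
      if 0 < a then List.replicate ⌈a / δ⌉₊ (.acoustic j (a / ⌈a / δ⌉₊))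
      else if a = 0 then [] else [.acoustic j a]
  | .contact a b => open Classical in if a = 0 ∧ b = 0 then [] else [.contact a b]
  | .nonphysical e => open Classical in if e = 0 then [] else [.nonphysical e]

/-- `Connects P U fs V`: the fronts `fs`, listed from below to above, are admissible, the lowest
state is `U`, the uppermost is `V`, and consecutive fronts share the state between them. -/
def Connects (P : Params) : State → List Front → State → Prop
  | U, [], V => U = V
  | U, f :: fs, V => f.below = U ∧ f.Admissible P ∧ Connects P f.above fs V

/-- The fronts `out` issue from `(x, y)`, lead from the state `U` below to the state `V` above, and
carry, from below to above, the waves `ws` (after splitting of rarefaction waves); a front of the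
`l`-th family gets the generation order `ord l`. -/
def IsFan (P : Params) (ord : ℕ → ℕ) (ws : List Wave) (x y : ℝ) (U : State) (out : List Front)
    (V : State) : Prop :=
  (∀ f ∈ out, f.x₀ = x ∧ f.y₀ = y) ∧
  Connects P U out V ∧
  out.map (fun f => (f.wave, f.order)) =
    ws.flatMap fun w => (pieces P.δ w).map fun w' => (w', ord w.family)

/-- The accurate Riemann solver for the states `U` below and `V` above. -/
def AccurateFan (P : Params) (ord : ℕ → ℕ) (x y : ℝ) (U : State) (out : List Front)
    (V : State) : Prop :=
  ∃ a₁ a₂₁ a₂₂ a₃ : ℝ,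
    IsFan P ord [.acoustic .one a₁, .contact a₂₁ a₂₂, .acoustic .three a₃] x y U out V

/-- The physical waves, from below to above, that leave the collision of the wave `w` coming from
below with the wave `w'` coming from above in the simplified Riemann solver: acoustic waves of
the same family are merged, other physical waves cross with unchanged parameters, and a
non-physical front leaves the physical wave that it overtakes unchanged. -/
def crossing : Wave → Wave → List Wave
  | .acoustic i a, .acoustic j b =>
      if i = j then [.acoustic i (a + b)] else [.acoustic j b, .acoustic i a]
  | .nonphysical _, w' => [w']
  | w, w' => [w', w]

/-- The simplified Riemann solver for the collision of `f` (below) with `g` (above): the crossed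
waves starting from the state below `f`, and a non-physical front that restores the state
above `g`. -/
def SimplifiedFan (P : Params) (ord : ℕ → ℕ) (x y : ℝ) (f g : Front) (out : List Front) : Prop :=
  ∃ e : ℝ, IsFan P ord (crossing f.wave g.wave ++ [.nonphysical e]) x y f.below out g.above

/-- The generation order of an outgoing front of the `l`-th family when fronts of the `i`-th family
and order `k₁` and of the `j`-th family and order `k₂` collide. -/
def genOrder (i k₁ j k₂ l : ℕ) : ℕ :=
  if l = i ∧ l = j then min k₁ k₂ else if l = i then k₁ else if l = j then k₂ else k₁ + k₂

/-- `Collision f g E`: the possible collisions of a front `f` with a front `g` coming from above,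
and the amount of interaction `E`. -/
inductive Collision (f g : Front) : ℝ → Prop
  | weak (h : f.Approach g) : Collision f g (f.strength * g.strength)
  | strong_weak (hf : f.IsStrong) (hg : g.IsWeakOf 1 ∨ g.IsWeakOf 2) :
      Collision f g (f.strength * g.strength)
  | strong_shock (hf : f.IsStrong) (hg : g.IsWeakOf 3) (hs : g.wave.IsShock) :
      Collision f g (min f.strength g.strength)
  | shock_strong (hf : f.IsWeakOf 3) (hs : f.wave.IsShock) (hg : g.IsStrong) :
      Collision f g (min f.strength g.strength)
  | np_strong (hf : f.IsNP) (hg : g.IsStrong) : Collision f g (f.strength * g.strength)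
  | np_weak (hf : f.IsNP) (hg : g.IsWeak) : Collision f g (f.strength * g.strength)

/-- A slab of an approximate solution, on an interval of `x` without interactions: the vertex
`(bx, by)` from which the free boundary starts, the state next to the free boundary, and all
fronts above the free boundary, listed from below to above. -/
structure Slab where
  bx : ℝ
  bY : ℝ
  bottom : State
  fronts : List Front

namespace Slab

/-- The free boundary `y = g(x)`, with `g' = v / u`. -/
def boundary (c : Slab) (x : ℝ) : ℝ := c.bY + lamTwo c.bottom * (x - c.bx)

/-- At `x`, the free boundary and the fronts lie strictly above one another in the listed order. -/
def OrderedAt (c : Slab) (x : ℝ) : Prop :=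
  (c.boundary x :: c.fronts.map fun f => f.pos x).Pairwise (· < ·)

end Slab

/-- `InitialFronts P U y fs`: the initial datum equals `U` immediately above `y ≥ 0`, is piecewise
constant with finitely many jumps above `y`, equals `Up` for large arguments, and `fs` are the
fronts obtained from all jumps above `y` by the accurate Riemann solver, with order one. -/
inductive InitialFronts (P : Params) : State → ℝ → List Front → Prop
  | nil (y : ℝ) : InitialFronts P P.Up y []
  | jump (U V : State) (y y' : ℝ) (out rest : List Front) (hy : y < y')
      (hout : AccurateFan P (fun _ => 1) 0 y' U out V) (hrest : InitialFronts P V y' rest) :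
      InitialFronts P U y (out ++ rest)

/-- The slab that starts at `x = 0`: at the corner a strong 3-rarefaction wave, divided into
fronts of order zero, joins the static pressure at the free boundary to the initial datum; the
jumps of the initial datum are resolved by the accurate Riemann solver. -/
def IsInitial (P : Params) (c : Slab) : Prop :=
  c.bx = 0 ∧ c.bY = 0 ∧ pres c.bottom = P.pbar ∧
  ∃ (U₀ : State) (S₀ : ℝ) (fan rest : List Front), 0 < S₀ ∧
    IsFan P (fun _ => 0) [.acoustic .three S₀] 0 0 c.bottom fan U₀ ∧
    InitialFronts P U₀ 0 rest ∧ c.fronts = fan ++ rest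

/-- `Interaction P c x c' E`: at `x` exactly one interaction takes place in the slab `c`, it leads
to the slab `c'`, and `E` is the amount of interaction. -/
inductive Interaction (P : Params) (c : Slab) (x : ℝ) : Slab → ℝ → Prop
  /-- Two neighbouring fronts collide.  The accurate solver is used if `E > μ` and no non-physical
  front is involved, otherwise the simplified one. -/
  | collide (lo hi out : List Front) (f g : Front) (E : ℝ)
      (hfronts : c.fronts = lo ++ f :: g :: hi)
      (hmeet : f.pos x = g.pos x)
      (honly : (c.boundary x :: (lo ++ f :: hi).map fun h => h.pos x).Pairwise (· < ·))
      (hcase : Collision f g E)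
      (hsolver :
        (¬ f.IsNP ∧ P.μ < E ∧
          AccurateFan P (genOrder f.wave.family f.order g.wave.family g.order)
            x (f.pos x) f.below out g.above) ∨
        (¬ (¬ f.IsNP ∧ P.μ < E) ∧
          SimplifiedFan P (genOrder f.wave.family f.order g.wave.family g.order)
            x (f.pos x) f g out)) :
      Interaction P c x ⟨c.bx, c.bY, c.bottom, lo ++ out ++ hi⟩ E
  /-- The lowest front, a 1-front, hits the free boundary.  The new state next to the free
  boundary has the static pressure and is the lower state of a 3-wave `b`; in the accurate solver
  this wave is emitted, in the simplified solver it is replaced by a non-physical front. -/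
  | reflect (hi out : List Front) (f : Front) (a b s : ℝ) (Um : State)
      (hfronts : c.fronts = f :: hi)
      (hwave : f.wave = .acoustic .one a)
      (hmeet : f.pos x = c.boundary x)
      (honly : ((f :: hi).map fun h => h.pos x).Pairwise (· < ·))
      (hpres : pres Um = P.pbar)
      (hjoin : Joins P.γ P.lamHat (.acoustic .three b) Um f.above s)
      (hsolver :
        (P.μ < |a| ∧
          IsFan P (fun _ => f.order) [.acoustic .three b] x (f.pos x) Um out f.above) ∨
        (¬ P.μ < |a| ∧
          ∃ e, IsFan P (fun _ => f.order) [.nonphysical e] x (f.pos x) Um out f.above)) :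
      Interaction P c x ⟨x, c.boundary x, Um, out ++ hi⟩ |a|

/-- A front tracking approximate solution with `N` interactions: slab `n` describes it for
`τ n < x < τ (n + 1)`, and at `x = τ (n + 1)`, `n < N`, an interaction with amount `E n` leads
from slab `n` to slab `n + 1`. -/
structure ApproxSolution (P : Params) where
  N : ℕ
  τ : ℕ → ℝ
  slab : ℕ → Slab
  E : ℕ → ℝ
  start : τ 0 = 0
  increasing : ∀ n ≤ N, τ n < τ (n + 1)
  initial : IsInitial P (slab 0)
  ordered : ∀ n ≤ N, ∀ x ∈ Set.Ioo (τ n) (τ (n + 1)), (slab n).OrderedAt x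
  interaction : ∀ n < N, Interaction P (slab n) (τ (n + 1)) (slab (n + 1)) (E n)

/-! ## The Glimm functional -/

structure Weights where
  K : ℝ
  K₀ : ℝ
  K₁ : ℝ
  K₂ : ℝ
  K₃ : ℝ
  K₄ : ℝ
  Kω : ℝ
  Knp : ℝ
  Kstar : ℝ

/-- All weights are positive. -/
def Weights.Positive (w : Weights) : Prop :=
  0 < w.K ∧ 0 < w.K₀ ∧ 0 < w.K₁ ∧ 0 < w.K₂ ∧ 0 < w.K₃ ∧ 0 < w.K₄ ∧ 0 < w.Kω ∧ 0 < w.Knp ∧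
    0 < w.Kstar

open Classical in
/-- Total strength `L_i` of the weak physical fronts of family `i`. -/
def weakSum (i : ℕ) (fs : List Front) : ℝ :=
  (fs.map fun f => if f.IsWeakOf i then f.strength else 0).sum

open Classical in
/-- Total strength `L₄` of the non-physical fronts. -/
def npSum (fs : List Front) : ℝ := (fs.map fun f => if f.IsNP then f.strength else 0).sum

open Classical in
/-- Total strength of the strong rarefaction fronts. -/
def strongSum (fs : List Front) : ℝ := (fs.map fun f => if f.IsStrong then f.strength else 0).sum

open Classical in
/-- The contribution to `Q₀` of the fronts `f` (below) and `g` (above): the product of the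
strengths if they are approaching weak physical fronts, or if `f` is non-physical and `g` is a
weak physical front. -/
def pairPotential (f g : Front) : ℝ :=
  if f.Approach g ∨ (f.IsNP ∧ g.IsWeak) then f.strength * g.strength else 0

/-- The interaction potential `Q₀`: sum over all pairs of fronts, listed from below to above. -/
def potentialQ₀ : List Front → ℝ
  | [] => 0
  | f :: fs => (fs.map (pairPotential f)).sum + potentialQ₀ fs

open Classical in
/-- `Q_i`, `i = 1, 2`: sum of the strengths of the weak `i`-fronts, each multiplied by
`exp (Kω * R)`, `R` being the total strength of the strong rarefaction fronts below it. -/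
def potentialBelow (Kω : ℝ) (i : ℕ) (fs : List Front) : ℝ :=
  ∑ n : Fin fs.length,
    if (fs.get n).IsWeakOf i then
      (fs.get n).strength * Real.exp (Kω * strongSum (fs.take n)) else 0

open Classical in
/-- `Q₄`: sum of the strengths of the non-physical fronts, each multiplied by `exp (Knp * R)`, `R`
being the total strength of the strong rarefaction fronts above it. -/
def potentialAbove (Knp : ℝ) (fs : List Front) : ℝ :=
  ∑ n : Fin fs.length,
    if (fs.get n).IsNP then
      (fs.get n).strength * Real.exp (Knp * strongSum (fs.drop (n + 1))) else 0

/-- The Glimm functional `F = L_w + Q + K_* |S(x) - S|`; `S` is the strength of the background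
rarefaction wave. -/
def glimm (w : Weights) (S : ℝ) (c : Slab) : ℝ :=
  (w.K * weakSum 1 c.fronts + weakSum 2 c.fronts + w.K₃ * weakSum 3 c.fronts + npSum c.fronts) +
  (w.K₀ * potentialQ₀ c.fronts +
    (w.K₁ * potentialBelow w.Kω 1 c.fronts + w.K₂ * potentialBelow w.Kω 2 c.fronts) +
    w.K₄ * potentialAbove w.Knp c.fronts) +
  w.Kstar * |strongSum c.fronts - S|

end SteadyEuler

end

noncomputable section
namespace SteadyEuler

/-! ## Algebra of the acoustic characteristics -/

/-! An interaction replaces a few neighbouring fronts by others. The claim therefore rests on three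
things: estimates of the outgoing waves by the incoming ones, one set of constants valid for all
states that can occur, and a hierarchy of weights for which every error term is paid for.

Estimates. In the coordinates X = (log p, θ, log q, log ρ) an acoustic wave is a translation X ↦ X +
G_j(σ, X), where σ is the increment of log p. For shocks G_j follows from the Hugoniot relation, the
shock polar and Bernoulli's law, for rarefactions from the entropy, Bernoulli's law and the
Prandtl-Meyer function (`ShockRel.toLog_eq`, `RarefRel.toLog_eq`). A 2-wave is a translation that
leaves log p and θ unchanged. Both branches of G_j are smooth with the same tangent at σ = 0, so the
glued curve has a Lipschitz derivative in σ (`exists_waveCurve_glue`). This alone gives Lipschitz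
dependence on σ and X and a quadratic error when two waves of one family are merged. Since λ_j has
nonzero derivative along the curve (`Supersonic.fderiv_logLam`), σ and the increment of λ_j can be
exchanged. The outgoing fan is compared with a candidate fan built from the incoming increments. The
two end states differ by a product of strengths, and a fan depends in a Lipschitz way on its end
states, because 1- and 3-waves with the same pressure change turn the flow in opposite directions
(`exists_fanEnd_bound`).

Smallness of the outgoing waves. A Riemann solver only provides some fan with the right end states,
and its waves are not known to be small. In a fan with nearby end states either the pressure
increments of the two acoustic waves have the same sign, or their turning angles do (`AcJoin.sign`).
Hence both pressure increments or both angles are small, and a small turning angle forces a small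
pressure ratio, because the supersonic flow behind a shock keeps it away from the strong end of the
polar (`ShockRel.pressure_bound`, `exists_fan_small`).

Uniform constants. The background curve is compact, so the local estimates hold near it with one
constant. A discrete Gronwall argument that descends from U₊ through the fronts shows that all
states lie near the curve if the weak fronts, the excess of the strong strength over S, and δ are
small (`Connects.norm_bottom_sub_le`).

Weights. The potentials are bilinear or multiplicative with respect to blocks of fronts, so the
change of the functional involves only the total strengths of the replaced block
(`glimm_sub_glimm_le`). A pair of approaching weak fronts is removed from Q₀. A 1- or 2-front that
crosses a strong front, or a non-physical front overtaken in this way, loses exponential weight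
proportional to the product of the strengths. A 1-front at the boundary is paid for by the large
weight K. When a strong front meets a 3-shock, L₃ with weight 2 loses twice the cancelled amount,
while |S(x) - S| gains at most once that amount; the remaining errors are products and hence small
compared with the minimum. The weights are chosen in the order Knp, K, Kω, K₀, and last comes the
bound of the functional (`GoodWeights`). -/

lemma Acoustic.sgn_sq (j : Acoustic) : j.sgn ^ 2 = 1 := by
  cases j <;> norm_num [Acoustic.sgn]

lemma Acoustic.sgn_cases (j : Acoustic) : j.sgn = 1 ∨ j.sgn = -1 := by
  cases j <;> norm_num [Acoustic.sgn]

lemma Acoustic.abs_sgn (j : Acoustic) : |j.sgn| = 1 := by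
  cases j <;> norm_num [Acoustic.sgn]

section Pointwise

variable {γ : ℝ} {U : State}

lemma Supersonic.pres_pos (h : Supersonic γ U) : 0 < pres U := h.1

lemma Supersonic.dens_pos (h : Supersonic γ U) : 0 < dens U := h.2.1

lemma Supersonic.sonic_sq (hγ : 1 < γ) (h : Supersonic γ U) :
    sonic γ U ^ 2 = γ * pres U / dens U :=
  Real.sq_sqrt (by have := h.pres_pos; have := h.dens_pos; positivity)

lemma Supersonic.sonic_pos (hγ : 1 < γ) (h : Supersonic γ U) : 0 < sonic γ U :=
  Real.sqrt_pos.2 (by have := h.pres_pos; have := h.dens_pos; positivity)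

lemma Supersonic.velX_pos (h : Supersonic γ U) : 0 < velX U :=
  (Real.sqrt_nonneg _).trans_lt h.2.2

lemma speed_sq (U : State) : speed U ^ 2 = velX U ^ 2 + velY U ^ 2 :=
  Real.sq_sqrt (by positivity)

lemma Supersonic.sonic_sq_lt (h : Supersonic γ U) : sonic γ U ^ 2 < velX U ^ 2 :=
  pow_lt_pow_left₀ h.2.2 (Real.sqrt_nonneg _) two_ne_zero

lemma Supersonic.speed_pos (h : Supersonic γ U) : 0 < speed U :=
  Real.sqrt_pos.2 (by have := h.velX_pos; positivity)

/-- `√(q² - c²)`. -/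
def machRoot (γ : ℝ) (U : State) : ℝ := √(velX U ^ 2 + velY U ^ 2 - sonic γ U ^ 2)

lemma Supersonic.machRoot_pos (h : Supersonic γ U) : 0 < machRoot γ U :=
  Real.sqrt_pos.2 (by have := h.sonic_sq_lt; nlinarith [sq_nonneg (velY U)])

lemma Supersonic.machRoot_sq (h : Supersonic γ U) :
    machRoot γ U ^ 2 = velX U ^ 2 + velY U ^ 2 - sonic γ U ^ 2 :=
  Real.sq_sqrt (by have := h.sonic_sq_lt; nlinarith [sq_nonneg (velY U)])

/-- The secant of the angle of the `j`-characteristic. -/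
def charSec (γ : ℝ) (j : Acoustic) (U : State) : ℝ :=
  (velX U * machRoot γ U + j.sgn * (sonic γ U * velY U)) / (velX U ^ 2 - sonic γ U ^ 2)

lemma lam_eq (j : Acoustic) : lam γ j U =
    (velX U * velY U + j.sgn * (sonic γ U * machRoot γ U)) /
      (velX U ^ 2 - sonic γ U ^ 2) := rfl

/-- The square of u√(q² - c²) exceeds that of cv by (u² - c²)q², so the first term decides the sign
of the numerator for both families. -/
lemma Supersonic.charSec_pos (hγ : 1 < γ) (h : Supersonic γ U) (j : Acoustic) :
    0 < charSec γ j U := by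
  have h1 := h.sonic_sq_lt
  have hc := h.sonic_pos hγ
  have hd := h.machRoot_pos
  have hd2 := h.machRoot_sq
  have hu := h.velX_pos
  refine div_pos ?_ (by linarith)
  have h2 : (sonic γ U * velY U) ^ 2 < (velX U * machRoot γ U) ^ 2 := by
    rw [mul_pow, mul_pow, hd2]
    nlinarith [mul_pos (sub_pos.2 h1) (pow_pos hu 2), mul_nonneg (sub_pos.2 h1).le (sq_nonneg (velY U))]
  have h3 := abs_lt_of_sq_lt_sq h2 (by positivity)
  rcases abs_lt.1 h3 with ⟨h4, h5⟩
  rcases j.sgn_cases with hj | hj <;> rw [hj] <;> linarith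

/-- Gas crosses a characteristic with sonic normal velocity and moves along it with velocity √(q² -
c²). `charSec` is the common factor √(1 + λ²). This identity and the next two replace the quotient
that defines λ by polynomial relations. -/
lemma Supersonic.lam_mul_sub (h : Supersonic γ U) (j : Acoustic) :
    lam γ j U * velX U - velY U = j.sgn * (sonic γ U * charSec γ j U) := by
  have h1 := h.sonic_sq_lt
  have h2 : velX U ^ 2 - sonic γ U ^ 2 ≠ 0 := by linarith
  rw [lam_eq, charSec]
  field_simp
  linear_combination (-(sonic γ U ^ 2 * velY U)) * j.sgn_sq

lemma Supersonic.add_lam_mul (h : Supersonic γ U) (j : Acoustic) :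
    velX U + lam γ j U * velY U = machRoot γ U * charSec γ j U := by
  have h1 := h.sonic_sq_lt
  have h2 : velX U ^ 2 - sonic γ U ^ 2 ≠ 0 := by linarith
  rw [lam_eq, charSec]
  field_simp
  linear_combination (-velX U) * h.machRoot_sq

/-- Lagrange's identity (1 + λ²)(u² + v²) = (λu - v)² + (u + λv)², with both squares taken from the
two preceding relations. -/
lemma Supersonic.one_add_lam_sq (h : Supersonic γ U) (j : Acoustic) :
    1 + lam γ j U ^ 2 = charSec γ j U ^ 2 := by
  have hq : velX U ^ 2 + velY U ^ 2 ≠ 0 := by have := h.velX_pos; positivity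
  have e1 := h.lam_mul_sub j
  have e2 := h.add_lam_mul j
  have : (1 + lam γ j U ^ 2) * (velX U ^ 2 + velY U ^ 2) =
      charSec γ j U ^ 2 * (velX U ^ 2 + velY U ^ 2) := by
    have : (1 + lam γ j U ^ 2) * (velX U ^ 2 + velY U ^ 2) =
      (lam γ j U * velX U - velY U) ^ 2 + (velX U + lam γ j U * velY U) ^ 2 := by ring
    rw [this, e1, e2]
    linear_combination (charSec γ j U ^ 2) * h.machRoot_sq +
      (sonic γ U ^ 2 * charSec γ j U ^ 2) * j.sgn_sq
  exact mul_right_cancel₀ hq this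

lemma Supersonic.cosAngle_mul (h : Supersonic γ U) (j : Acoustic) :
    cosAngle γ j U * charSec γ j U = 1 := by
  have h1 := h.sonic_sq_lt
  have h2 : velX U ^ 2 - sonic γ U ^ 2 ≠ 0 := by linarith
  have hq : velX U ^ 2 + velY U ^ 2 ≠ 0 := by have := h.velX_pos; positivity
  rw [cosAngle, charSec, speed_sq]
  change (velX U * machRoot γ U - _) / _ * _ = 1
  field_simp
  linear_combination (velX U ^ 2) * h.machRoot_sq - (sonic γ U ^ 2 * velY U ^ 2) * j.sgn_sq

/-- The form, free of the cosine, in which the normalization of the eigenvectors enters `curve_lam`.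
-/
lemma Supersonic.kCoef_mul (hγ : 1 < γ) (h : Supersonic γ U) (j : Acoustic) :
    kCoef γ j U * (γ + 1) * charSec γ j U ^ 3 = 2 * machRoot γ U := by
  have hc := h.cosAngle_mul j
  have h3 : cosAngle γ j U ^ 3 * charSec γ j U ^ 3 = 1 := by rw [← mul_pow, hc, one_pow]
  rw [kCoef, speed_sq]
  change 2 * machRoot γ U * _ / _ * _ * _ = _
  field_simp
  linear_combination machRoot γ U * h3

lemma Supersonic.kCoef_pos (hγ : 1 < γ) (h : Supersonic γ U) (j : Acoustic) :
    0 < kCoef γ j U := by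
  have h1 := h.kCoef_mul hγ j
  have h2 := h.charSec_pos hγ j
  have h3 := h.machRoot_pos
  by_contra! hk
  have : kCoef γ j U * ((γ + 1) * charSec γ j U ^ 3) ≤ 0 :=
    mul_nonpos_of_nonpos_of_nonneg hk (by positivity)
  nlinarith

/-- The square of the Mach number. -/
def machSqOf (γ : ℝ) (U : State) : ℝ := (velX U ^ 2 + velY U ^ 2) / sonic γ U ^ 2

lemma Supersonic.one_lt_machSqOf (hγ : 1 < γ) (h : Supersonic γ U) : 1 < machSqOf γ U := by
  have := h.sonic_pos hγ
  rw [machSqOf, one_lt_div (by positivity)]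
  nlinarith [h.sonic_sq_lt, sq_nonneg (velY U)]

/-- The characteristic polynomial evaluated at a slope `s`. -/
lemma Supersonic.charPoly (h : Supersonic γ U) (s : ℝ) :
    (velX U ^ 2 - sonic γ U ^ 2) * ((s - lam γ .one U) * (s - lam γ .three U)) =
      (velY U - s * velX U) ^ 2 - sonic γ U ^ 2 * (1 + s ^ 2) := by
  have h1 := h.sonic_sq_lt
  have h2 : velX U ^ 2 - sonic γ U ^ 2 ≠ 0 := by linarith
  rw [lam_eq, lam_eq]
  simp only [Acoustic.sgn]
  field_simp
  linear_combination (-sonic γ U ^ 2) * h.machRoot_sq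

lemma Supersonic.sgn_mul_lam_sub (hγ : 1 < γ) (h : Supersonic γ U) (j : Acoustic) :
    0 < j.sgn * (lam γ j U - lamTwo U) := by
  have h1 := h.lam_mul_sub j
  have hu := h.velX_pos
  have : j.sgn * (lam γ j U - lamTwo U) = sonic γ U * charSec γ j U / velX U := by
    rw [lamTwo]
    field_simp
    linear_combination j.sgn * h1 + (sonic γ U * charSec γ j U) * j.sgn_sq
  rw [this]
  have := h.sonic_pos hγ
  have := h.charSec_pos hγ j
  positivity

end Pointwise

/-! ## The Rankine-Hugoniot conditions -/

/-- The Rankine-Hugoniot conditions at a front of slope `s` through which gas flows. -/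
structure RHRel (γ : ℝ) (s : ℝ) (U V : State) : Prop where
  mass : dens U * (velY U - s * velX U) = dens V * (velY V - s * velX V)
  momX : dens U * (velY U - s * velX U) * (velX V - velX U) = s * (pres V - pres U)
  momY : dens U * (velY U - s * velX U) * (velY V - velY U) = -(pres V - pres U)
  bern : (velX V ^ 2 + velY V ^ 2) / 2 + γ / (γ - 1) * (pres V / dens V) =
    (velX U ^ 2 + velY U ^ 2) / 2 + γ / (γ - 1) * (pres U / dens U)

lemma RHRel.symm {γ s : ℝ} {U V : State} (h : RHRel γ s U V) : RHRel γ s V U where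
  mass := h.mass.symm
  momX := by rw [← h.mass]; linear_combination -h.momX
  momY := by rw [← h.mass]; linear_combination -h.momY
  bern := h.bern.symm

/-- The family condition excludes s = v/u, so the mass flux through the front is nonzero and can be
cancelled in the energy equation; what remains is Bernoulli's law. -/
lemma IsShock.rhRel {γ : ℝ} (hγ : 1 < γ) {j : Acoustic} {a s : ℝ} {U V : State}
    (h : IsShock γ j a U V s) : RHRel γ s U V := by
  obtain ⟨hU, hV, hrh, hs, hs', hp, ha⟩ := h
  have e0 := congrArg (fun W : State => W 0) hrh
  have e1 := congrArg (fun W : State => W 1) hrh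
  have e2 := congrArg (fun W : State => W 2) hrh
  have e3 := congrArg (fun W : State => W 3) hrh
  simp [fluxW, fluxH] at e0 e1 e2 e3
  have hm : dens U * (velY U - s * velX U) = dens V * (velY V - s * velX V) := by
    linear_combination e0
  refine ⟨hm, by linear_combination -e1 + velX V * hm, by linear_combination -e2 + velY V * hm, ?_⟩
  have hne : dens V * (velY V - s * velX V) ≠ 0 := by
    refine mul_ne_zero hV.dens_pos.ne' fun h0 => ?_
    have hu := hV.velX_pos
    have : s - lamTwo V = 0 := by rw [lamTwo]; field_simp; linarith
    simp [this] at hs'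
  have hE : ∀ W : State, Supersonic γ W → energy γ W + pres W / dens W =
      (velX W ^ 2 + velY W ^ 2) / 2 + γ / (γ - 1) * (pres W / dens W) := fun W hW => by
    have := hW.dens_pos
    have : γ - 1 ≠ 0 := by linarith
    rw [energy]; field_simp; ring
  rw [← hE U hU, ← hE V hV]
  have : (dens V * (velY V - s * velX V)) * (energy γ V + pres V / dens V) =
      (dens V * (velY V - s * velX V)) * (energy γ U + pres U / dens U) := by
    linear_combination -e3 + (energy γ U + pres U / dens U) * hm
  exact mul_left_cancel₀ hne this

section RH

variable {γ s : ℝ} {U V : State}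

/-- The Hugoniot adiabat. -/
lemma RHRel.hugoniot (hγ : 1 < γ) (hU : Supersonic γ U) (hV : Supersonic γ V)
    (h : RHRel γ s U V) (hp : pres U ≠ pres V) :
    dens V * ((γ - 1) * pres V + (γ + 1) * pres U) =
      dens U * ((γ + 1) * pres V + (γ - 1) * pres U) := by
  obtain ⟨hm, hx, hy, hb⟩ := h
  have hrU := hU.dens_pos
  have hrV := hV.dens_pos
  have h1 : γ - 1 ≠ 0 := by linarith
  set m := dens U * (velY U - s * velX U) with hm_def
  have hm0 : m ≠ 0 := by
    intro h0
    rw [h0] at hy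
    apply hp; linarith
  -- twice the jump of the kinetic energy
  have hq : m * (velX V ^ 2 + velY V ^ 2 - velX U ^ 2 - velY U ^ 2) =
      -(m * ((pres V - pres U) * (1 / dens U + 1 / dens V))) := by
    have a1 : m * (1 / dens U) = velY U - s * velX U := by rw [hm_def]; field_simp
    have a2 : m * (1 / dens V) = velY V - s * velX V := by rw [hm]; field_simp
    linear_combination (velX V + velX U) * hx + (velY V + velY U) * hy -
      (-(pres V - pres U)) * a1 - (-(pres V - pres U)) * a2
  have hq' := mul_left_cancel₀ hm0 (hq.trans (by ring : _ = m * (-((pres V - pres U) * (1 / dens U + 1 / dens V)))))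
  have key : γ / (γ - 1) * (pres V / dens V - pres U / dens U) =
      (pres V - pres U) * (1 / dens U + 1 / dens V) / 2 := by
    linear_combination hb - hq' / 2
  field_simp at key
  linear_combination -key

/-- The squared velocity normal to the front. -/
lemma RHRel.normal_sq (hγ : 1 < γ) (hU : Supersonic γ U) (hV : Supersonic γ V)
    (h : RHRel γ s U V) (hp : pres U ≠ pres V) :
    2 * dens U * (velY U - s * velX U) ^ 2 =
      (1 + s ^ 2) * ((γ + 1) * pres V + (γ - 1) * pres U) := by
  have hH := h.hugoniot hγ hU hV hp
  obtain ⟨hm, hx, hy, hb⟩ := h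
  have hrU := hU.dens_pos
  have hrV := hV.dens_pos
  -- jump of the normal velocity
  have hz : (dens U * (velY U - s * velX U)) ^ 2 * (dens U - dens V) =
      -(1 + s ^ 2) * (pres V - pres U) * (dens U * dens V) := by
    linear_combination (dens U * dens V) * (hy - s * hx) + (dens U ^ 2 * (velY U - s * velX U)) * hm
  have hp' : pres V - pres U ≠ 0 := fun h0 => hp (by linarith)
  have hA : (γ - 1) * pres V + (γ + 1) * pres U ≠ 0 := by
    have := hU.pres_pos; have := hV.pres_pos; nlinarith
  have hd : (dens U - dens V) * ((γ - 1) * pres V + (γ + 1) * pres U) =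
      -2 * dens U * (pres V - pres U) := by linear_combination -hH
  have h2 : (-dens U ^ 2 * (pres V - pres U)) * (2 * dens U * (velY U - s * velX U) ^ 2) =
      (-dens U ^ 2 * (pres V - pres U)) *
        ((1 + s ^ 2) * ((γ + 1) * pres V + (γ - 1) * pres U)) := by
    linear_combination ((γ - 1) * pres V + (γ + 1) * pres U) * hz -
      ((dens U * (velY U - s * velX U)) ^ 2) * hd -
      (1 + s ^ 2) * (pres V - pres U) * dens U * hH
  exact mul_left_cancel₀ (mul_ne_zero (neg_ne_zero.2 (pow_pos hrU 2).ne') hp') h2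

/-- A pressure jump forces a nonzero mass flux, and then the two momentum relations say that the
jump of the velocity is normal to the front. -/
lemma RHRel.tangential (h : RHRel γ s U V) (hp : pres U ≠ pres V) :
    velX V + s * velY V = velX U + s * velY U := by
  obtain ⟨hm, hx, hy, hb⟩ := h
  have hm0 : dens U * (velY U - s * velX U) ≠ 0 := by
    intro h0
    rw [h0] at hy
    apply hp; linarith
  refine mul_left_cancel₀ hm0 ?_
  linear_combination hx + s * hy

/-- Scalar product of the two velocities; together with the vector product in `RHRel.cross` it gives
the tangent of the turning angle. -/
lemma RHRel.dot (hU : Supersonic γ U) (h : RHRel γ s U V) (hp : pres U ≠ pres V) :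
    velX U * velX V + velY U * velY V =
      velX U ^ 2 + velY U ^ 2 - (pres V - pres U) / dens U := by
  obtain ⟨hm, hx, hy, hb⟩ := h
  have hr := hU.dens_pos
  have hm0 : dens U * (velY U - s * velX U) ≠ 0 := by
    intro h0
    rw [h0] at hy
    apply hp; linarith
  refine mul_left_cancel₀ hm0 ?_
  field_simp
  linear_combination velX U * hx + velY U * hy

lemma RHRel.cross (h : RHRel γ s U V) :
    dens U * (velY U - s * velX U) * (velY V * velX U - velY U * velX V) =
      -((pres V - pres U) * (velX U + s * velY U)) := by
  linear_combination velX U * h.momY - velY U * h.momX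

/-- The velocity along the front is positive; here `V` is the state behind the shock. -/
lemma RHRel.tangential_pos (hγ : 1 < γ) (hU : Supersonic γ U) (hV : Supersonic γ V)
    (h : RHRel γ s U V) (hp : pres U < pres V) : 0 < velX V + s * velY V := by
  by_contra! hw
  have hn := h.symm.normal_sq hγ hV hU hp.ne'
  have hr := hV.dens_pos
  have hu := hV.velX_pos
  have hc := hV.sonic_sq_lt
  rw [hV.sonic_sq hγ, div_lt_iff₀ hr] at hc
  set z := velY V - s * velX V
  -- Here u is split into the velocity along the front and the normal part z. If the former is not
  -- positive, then u(1 + s²) ≤ -sz, and the value of z² from `normal_sq` makes 2ρu²(1 + s²) smaller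
  -- than 2γps², against u > c.
  have h1 : velX V * (1 + s ^ 2) = (velX V + s * velY V) - s * z := by simp only [z]; ring
  have h2 : 0 ≤ velX V * (1 + s ^ 2) := by positivity
  have h3 : velX V * (1 + s ^ 2) ≤ -(s * z) := by linarith
  have h4 : (velX V * (1 + s ^ 2)) ^ 2 ≤ (s * z) ^ 2 := by
    rw [← neg_sq (s * z)]; exact pow_le_pow_left₀ h2 h3 2
  have h5 : (velX V ^ 2 * dens V) * (2 * (1 + s ^ 2)) * (1 + s ^ 2) ≤
      s ^ 2 * ((γ + 1) * pres U + (γ - 1) * pres V) * (1 + s ^ 2) := by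
    have := mul_le_mul_of_nonneg_left h4 (by positivity : 0 ≤ 2 * dens V)
    nlinarith
  have h6 := le_of_mul_le_mul_right h5 (by positivity)
  have h7 : (γ + 1) * pres U + (γ - 1) * pres V < 2 * γ * pres V := by nlinarith
  have h8 := hV.pres_pos
  have h9 : 0 ≤ s ^ 2 * (2 * γ * pres V - ((γ + 1) * pres U + (γ - 1) * pres V)) :=
    mul_nonneg (sq_nonneg s) (by linarith)
  have h10 : γ * pres V * (2 * (1 + s ^ 2)) < velX V ^ 2 * dens V * (2 * (1 + s ^ 2)) :=
    mul_lt_mul_of_pos_right hc (by positivity)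
  nlinarith [mul_pos (by linarith : 0 < γ) h8]

end RH

end SteadyEuler
end

noncomputable section
namespace SteadyEuler

/-! ## Logarithmic coordinates -/

/-- `(log p, θ, log q, log ρ)`. -/
abbrev LogState := ℝ × ℝ × ℝ × ℝ

def toLog (U : State) : LogState :=
  (Real.log (pres U), Real.arctan (velY U / velX U), Real.log (speed U), Real.log (dens U))

def ofLog (X : LogState) : State :=
  !₂[Real.exp X.2.2.1 * Real.cos X.2.1, Real.exp X.2.2.1 * Real.sin X.2.1, Real.exp X.1,
    Real.exp X.2.2.2]

/-- Because u > 0, the arctangent of v/u is the full polar angle of the velocity and no information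
is lost. -/
lemma Supersonic.ofLog_toLog {γ : ℝ} {U : State} (h : Supersonic γ U) : ofLog (toLog U) = U := by
  have hu := h.velX_pos
  have hq := h.speed_pos
  have hsq : √(1 + (velY U / velX U) ^ 2) = speed U / velX U := by
    rw [speed, ← Real.sqrt_sq hu.le, ← Real.sqrt_div (by positivity), Real.sqrt_sq hu.le]
    congr 1
    field_simp
  ext i
  fin_cases i
  · simp [ofLog, toLog, Real.exp_log hq, Real.cos_arctan, hsq]
    field_simp
    rfl
  · simp [ofLog, toLog, Real.exp_log hq, Real.sin_arctan, hsq]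
    field_simp
    rfl
  · simp [ofLog, toLog, Real.exp_log h.pres_pos]; rfl
  · simp [ofLog, toLog, Real.exp_log h.dens_pos]; rfl

/-- The square of the Mach number in logarithmic coordinates. -/
def logMach (γ : ℝ) (X : LogState) : ℝ := Real.exp (2 * X.2.2.1 + X.2.2.2 - X.1) / γ

lemma Supersonic.logMach_toLog {γ : ℝ} (hγ : 1 < γ) {U : State} (h : Supersonic γ U) :
    logMach γ (toLog U) = machSqOf γ U := by
  have hq := h.speed_pos
  have hp := h.pres_pos
  have hr := h.dens_pos
  rw [logMach, machSqOf, h.sonic_sq hγ, ← speed_sq]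
  simp only [toLog]
  rw [Real.exp_sub, Real.exp_add, Real.exp_log hp, Real.exp_log hr, two_mul, Real.exp_add,
    Real.exp_log hq]
  field_simp

/-- The increment of `log q` at constant Bernoulli quantity, `m` being the squared Mach number and
`r` the ratio of the squared sonic speeds. -/
def speedInc (γ m r : ℝ) : ℝ := Real.log (1 + 2 / ((γ - 1) * m) * (1 - r)) / 2

lemma bernoulli_ratio {γ : ℝ} (hγ : 1 < γ) {U V : State} (hU : Supersonic γ U)
    (h : bernoulli γ V = bernoulli γ U) :
    1 + 2 / ((γ - 1) * machSqOf γ U) * (1 - sonic γ V ^ 2 / sonic γ U ^ 2) =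
      speed V ^ 2 / speed U ^ 2 := by
  have h1 : γ - 1 ≠ 0 := by linarith
  have hq := hU.speed_pos
  have hc := hU.sonic_pos hγ
  rw [machSqOf, ← speed_sq]
  rw [bernoulli, bernoulli] at h
  field_simp at h ⊢
  linear_combination -h

lemma log_speed_sub {γ : ℝ} (hγ : 1 < γ) {U V : State} (hU : Supersonic γ U)
    (hV : Supersonic γ V) (h : bernoulli γ V = bernoulli γ U) :
    Real.log (speed V) - Real.log (speed U) =
      speedInc γ (machSqOf γ U) (sonic γ V ^ 2 / sonic γ U ^ 2) := by
  have hq := hU.speed_pos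
  have hq' := hV.speed_pos
  rw [speedInc, bernoulli_ratio hγ hU h, Real.log_div (by positivity) (by positivity),
    Real.log_pow, Real.log_pow]
  push_cast
  ring

lemma sonic_ratio {γ : ℝ} (hγ : 1 < γ) {U V : State} (hU : Supersonic γ U)
    (hV : Supersonic γ V) : sonic γ V ^ 2 / sonic γ U ^ 2 =
      Real.exp ((Real.log (pres V) - Real.log (pres U)) -
        (Real.log (dens V) - Real.log (dens U))) := by
  have h1 := hU.pres_pos
  have h2 := hV.pres_pos
  have h3 := hU.dens_pos
  have h4 := hV.dens_pos
  rw [hU.sonic_sq hγ, hV.sonic_sq hγ, Real.exp_sub, Real.exp_sub, Real.exp_sub, Real.exp_log h1,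
    Real.exp_log h2, Real.exp_log h3, Real.exp_log h4]
  field_simp

/-! ## Shocks in logarithmic coordinates -/

/-- The density ratio on the Hugoniot adiabat, as a function of the pressure ratio. -/
def shockDens (γ x : ℝ) : ℝ := ((γ + 1) * x + (γ - 1)) / ((γ - 1) * x + (γ + 1))

/-- The tangent of the angle by which a shock turns the flow. -/
def shockTan (γ m x : ℝ) : ℝ :=
  (x - 1) / (γ * m - (x - 1)) *
    √((2 * γ * m - (γ - 1) - (γ + 1) * x) / ((γ + 1) * x + (γ - 1)))

/-- The increment of the logarithmic coordinates over a shock, as a function of the increment of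
`log p` and of the state on one side. -/
def shockInc (γ sg : ℝ) (w : ℝ × LogState) : LogState :=
  (w.1, sg * Real.arctan (shockTan γ (logMach γ w.2) (Real.exp w.1)),
    speedInc γ (logMach γ w.2) (Real.exp (w.1 - Real.log (shockDens γ (Real.exp w.1)))),
    Real.log (shockDens γ (Real.exp w.1)))

/-- States on the two sides of a `j`-shock of slope `s`, without order. -/
structure ShockRel (γ : ℝ) (j : Acoustic) (s : ℝ) (U V : State) : Prop where
  left : Supersonic γ U
  right : Supersonic γ V
  rh : RHRel γ s U V
  ne : pres U ≠ pres V
  fam : 0 < j.sgn * (s - lamTwo U)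
  fam' : 0 < j.sgn * (s - lamTwo V)
  tang : 0 < velX U + s * velY U

lemma ShockRel.symm {γ : ℝ} {j : Acoustic} {s : ℝ} {U V : State} (h : ShockRel γ j s U V) :
    ShockRel γ j s V U :=
  ⟨h.right, h.left, h.rh.symm, h.ne.symm, h.fam', h.fam, by
    rw [h.rh.tangential h.ne]; exact h.tang⟩

lemma IsShock.shockRel {γ : ℝ} (hγ : 1 < γ) {j : Acoustic} {a s : ℝ} {U V : State}
    (h : IsShock γ j a U V s) : ShockRel γ j s U V := by
  have hrh := h.rhRel hγ
  obtain ⟨hU, hV, -, hs, hs', hp, -⟩ := h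
  have hne : pres U ≠ pres V := fun h0 => by simp [h0] at hp
  refine ⟨hU, hV, hrh, hne, hs, hs', ?_⟩
  rcases lt_or_gt_of_ne hne with h1 | h1
  · rw [← hrh.tangential hne]; exact hrh.tangential_pos hγ hU hV h1
  · exact hrh.symm.tangential_pos hγ hV hU h1

section

variable {γ : ℝ} {j : Acoustic} {s : ℝ} {U V : State}

/-- In the frame of the front the tangential velocities agree and the normal ones have the same sign
by conservation of mass. So the flow turns by less than a right angle, and the difference of the
flow angles is a single arctangent. -/
lemma ShockRel.dot_pos (h : ShockRel γ j s U V) :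
    0 < velX U * velX V + velY U * velY V := by
  have h1 := h.tang
  have h2 := h.rh.tangential h.ne
  have h3 := h.rh.mass
  have hm : dens U * (velY U - s * velX U) ≠ 0 := by
    intro h0
    have := h.rh.momY
    rw [h0] at this
    exact h.ne (by linarith)
  have hU := h.left.dens_pos
  have hV := h.right.dens_pos
  have h4 : 0 < (velY U - s * velX U) * (velY V - s * velX V) := by
    have : (dens U * dens V) * ((velY U - s * velX U) * (velY V - s * velX V)) =
        (dens U * (velY U - s * velX U)) ^ 2 := by
      linear_combination (-(dens U * (velY U - s * velX U))) * h3
    have h5 : 0 < (dens U * dens V) * ((velY U - s * velX U) * (velY V - s * velX V)) := by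
      rw [this]; positivity
    exact pos_of_mul_pos_right h5 (by positivity)
  have h6 : (1 + s ^ 2) * (velX U * velX V + velY U * velY V) =
      (velX U + s * velY U) * (velX V + s * velY V) +
        (velY U - s * velX U) * (velY V - s * velX V) := by ring
  have h7 : 0 < (1 + s ^ 2) * (velX U * velX V + velY U * velY V) := by
    rw [h6, h2]; positivity
  exact pos_of_mul_pos_right h7 (by positivity)

lemma ShockRel.normal_eq (hγ : 1 < γ) (h : ShockRel γ j s U V) :
    2 * dens U * (velY U - s * velX U) ^ 2 =
      (1 + s ^ 2) * ((γ + 1) * pres V + (γ - 1) * pres U) :=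
  h.rh.normal_sq hγ h.left h.right h.ne

lemma ShockRel.sgn_normal (h : ShockRel γ j s U V) :
    0 < -(j.sgn * (velY U - s * velX U)) := by
  have h1 := h.fam
  have hu := h.left.velX_pos
  have : -(j.sgn * (velY U - s * velX U)) = velX U * (j.sgn * (s - lamTwo U)) := by
    rw [lamTwo]; field_simp; ring
  rw [this]; positivity

/-- The tangent of the turning angle. -/
lemma ShockRel.tan_eq (hγ : 1 < γ) (h : ShockRel γ j s U V) :
    (velY V * velX U - velY U * velX V) / (velX U * velX V + velY U * velY V) =
      j.sgn * shockTan γ (machSqOf γ U) (pres V / pres U) := by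
  have hU := h.left.dens_pos
  have hp := h.left.pres_pos
  have hp' := h.right.pres_pos
  have hc := h.left.sonic_sq hγ
  have hcp := h.left.sonic_pos hγ
  have hdot := h.rh.dot h.left h.ne
  have hcross := h.rh.cross
  have hn := h.normal_eq hγ
  have hsn := h.sgn_normal
  have hdp := h.dot_pos
  have ht := h.tang
  set z := velY U - s * velX U with hz
  set w := velX U + s * velY U with hw
  have hA : 0 < (γ + 1) * pres V + (γ - 1) * pres U := by nlinarith
  have hwz : w ^ 2 + z ^ 2 = (1 + s ^ 2) * (velX U ^ 2 + velY U ^ 2) := by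
    simp only [hw, hz]; ring
  have hz0 : z ≠ 0 := by rintro h0; simp [h0] at hsn
  have hm : machSqOf γ U = (velX U ^ 2 + velY U ^ 2) * dens U / (γ * pres U) := by
    rw [machSqOf, hc]; field_simp
  -- The root in `shockTan` is the ratio of tangential to normal velocity: `hn` expresses z² by the
  -- pressures, and w² + z² = (1 + s²)q² then gives w². The sign of the family makes -(j.sgn z)
  -- equal to |z|.
  have hroot : (2 * γ * machSqOf γ U - (γ - 1) - (γ + 1) * (pres V / pres U)) /
      ((γ + 1) * (pres V / pres U) + (γ - 1)) = (w / (-(j.sgn * z))) ^ 2 := by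
    have h1 : (w / (-(j.sgn * z))) ^ 2 = w ^ 2 / z ^ 2 := by
      rw [div_pow, neg_sq, mul_pow, j.sgn_sq, one_mul]
    have hA' : (γ + 1) * (pres V / pres U) + (γ - 1) ≠ 0 := by
      have : (γ + 1) * (pres V / pres U) + (γ - 1) =
        ((γ + 1) * pres V + (γ - 1) * pres U) / pres U := by field_simp
      rw [this]; positivity
    rw [h1, hm, div_eq_div_iff hA' (by positivity)]
    field_simp
    have hs : (1 + s ^ 2) ≠ 0 := by positivity
    refine mul_left_cancel₀ hs ?_
    linear_combination (2 * dens U * z ^ 2) * (-hwz) + (w ^ 2 + z ^ 2) * hn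
  have hden : γ * machSqOf γ U - (pres V / pres U - 1) =
      (dens U / pres U) * (velX U * velX V + velY U * velY V) := by
    rw [hm, hdot]; field_simp
  rw [shockTan, hroot, Real.sqrt_sq (by positivity), hden]
  have hj : j.sgn ≠ 0 := by rcases j.sgn_cases with h | h <;> rw [h] <;> norm_num
  clear_value z w
  generalize velX U * velX V + velY U * velY V = D at hdp ⊢
  field_simp
  linear_combination hcross

lemma arctan_sub_arctan {u v u' v' : ℝ} (hu : 0 < u) (hu' : 0 < u') (h : 0 < u * u' + v * v') :
    Real.arctan (v' / u') - Real.arctan (v / u) =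
      Real.arctan ((v' * u - v * u') / (u * u' + v * v')) := by
  rw [sub_eq_add_neg, ← Real.arctan_neg, Real.arctan_add]
  · congr 1
    have : 1 - v' / u' * -(v / u) = (u * u' + v * v') / (u * u') := by field_simp; ring
    rw [this]
    field_simp
    ring
  · have : 1 - v' / u' * -(v / u) = (u * u' + v * v') / (u * u') := by field_simp; ring
    have h2 : 0 < 1 - v' / u' * -(v / u) := by rw [this]; positivity
    linarith

lemma sgn_mul_arctan (j : Acoustic) (x : ℝ) :
    Real.arctan (j.sgn * x) = j.sgn * Real.arctan x := by
  rcases j.sgn_cases with h | h <;> simp [h, Real.arctan_neg]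

lemma RHRel.bernoulli_eq (hγ : 1 < γ) (hU : Supersonic γ U) (hV : Supersonic γ V)
    (h : RHRel γ s U V) : bernoulli γ V = bernoulli γ U := by
  have h1 : γ - 1 ≠ 0 := by linarith
  have := h.bern
  rw [bernoulli, bernoulli, speed_sq, speed_sq, hU.sonic_sq hγ, hV.sonic_sq hγ]
  linear_combination 2 * this

/-- The pressure ratio and the Mach number on one side determine the density ratio, the turning
angle and, by Bernoulli's law, the speed ratio. `ShockRel` does not record which side is the lower
one, so the same formula also leads from the upper state to the lower one. -/
lemma ShockRel.toLog_eq (hγ : 1 < γ) (h : ShockRel γ j s U V) :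
    toLog V = toLog U +
      shockInc γ j.sgn (Real.log (pres V) - Real.log (pres U), toLog U) := by
  have hp := h.left.pres_pos
  have hp' := h.right.pres_pos
  have hr := h.left.dens_pos
  have hr' := h.right.dens_pos
  have hx : Real.exp (Real.log (pres V) - Real.log (pres U)) = pres V / pres U := by
    rw [Real.exp_sub, Real.exp_log hp, Real.exp_log hp']
  have hN : Real.log (shockDens γ (pres V / pres U)) =
      Real.log (dens V) - Real.log (dens U) := by
    rw [← Real.log_div hr'.ne' hr.ne']
    congr 1
    have := h.rh.hugoniot hγ h.left h.right h.ne
    have h1 : (γ - 1) * pres V + (γ + 1) * pres U ≠ 0 := by nlinarith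
    have e : shockDens γ (pres V / pres U) = ((γ + 1) * pres V + (γ - 1) * pres U) /
      ((γ - 1) * pres V + (γ + 1) * pres U) := by
      rw [shockDens]; field_simp
    rw [e, div_eq_div_iff h1 hr.ne']
    linear_combination -this
  have hth := h.tan_eq hγ
  have h1 := arctan_sub_arctan h.left.velX_pos h.right.velX_pos h.dot_pos
  rw [hth, sgn_mul_arctan] at h1
  have h2 := log_speed_sub hγ h.left h.right (h.rh.bernoulli_eq hγ h.left h.right)
  rw [sonic_ratio hγ h.left h.right] at h2
  simp only [shockInc, hx, hN, h.left.logMach_toLog hγ, ← h1, ← h2]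
  ext <;> simp [toLog]

/-- The flow behind a shock is still supersonic, which bounds the shock strength. -/
lemma ShockRel.pressure_bound (hγ : 1 < γ) (h : ShockRel γ j s U V) (hp : pres U < pres V) :
    (γ + 1) * (pres V / pres U - 1) * (γ - 1) ≤
      (γ + 1) * (2 * γ * machSqOf γ U - (γ - 1) - (γ + 1) * (pres V / pres U)) := by
  have hrU := h.left.dens_pos
  have hrV := h.right.dens_pos
  have hpU := h.left.pres_pos
  have hn := h.symm.normal_eq hγ
  have hnU := h.normal_eq hγ
  have ht := h.rh.tangential h.ne
  have hH := h.rh.hugoniot hγ h.left h.right h.ne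
  have hcV := h.right.sonic_sq_lt
  rw [h.right.sonic_sq hγ, div_lt_iff₀ hrV] at hcV
  have hm : machSqOf γ U = (velX U ^ 2 + velY U ^ 2) * dens U / (γ * pres U) := by
    rw [machSqOf, h.left.sonic_sq hγ]; field_simp
  -- `w² ρ_V = (1 + s²) q_V² ρ_V - z_V² ρ_V`
  set wU := velX U + s * velY U
  set zU := velY U - s * velX U with hzU
  set zV := velY V - s * velX V with hzV
  have h1 : wU ^ 2 = (1 + s ^ 2) * (velX V ^ 2 + velY V ^ 2) - zV ^ 2 := by
    rw [← ht]; ring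
  have h2 : wU ^ 2 = (1 + s ^ 2) * (velX U ^ 2 + velY U ^ 2) - zU ^ 2 := by
    simp only [wU, zU]; ring
  -- Supersonic flow behind the shock bounds the tangential velocity from below by the pressure
  -- jump. The limiting compression ratio (γ + 1)/(γ - 1) in `h4` then exchanges the density behind
  -- for the one in front.
  have h3 : (1 + s ^ 2) * ((γ + 1) * (pres V - pres U)) ≤ 2 * dens V * wU ^ 2 := by
    have : (1 + s ^ 2) * (γ * pres V) ≤ (1 + s ^ 2) * ((velX V ^ 2 + velY V ^ 2) * dens V) := by
      refine mul_le_mul_of_nonneg_left ?_ (by positivity)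
      nlinarith [mul_nonneg (sq_nonneg (velY V)) hrV.le]
    rw [h1]; nlinarith
  have h4 : dens V * (γ - 1) ≤ dens U * (γ + 1) := by
    by_contra! hlt
    nlinarith [mul_pos hrU hpU, mul_pos hrV hpU, mul_lt_mul_of_pos_right hlt (by linarith : 0 < pres V)]
  have h5 : (1 + s ^ 2) * ((γ + 1) * (pres V - pres U)) * (γ - 1) ≤
      (γ + 1) * (2 * dens U * wU ^ 2) := by
    have a1 := mul_le_mul_of_nonneg_right h3 (by linarith : 0 ≤ γ - 1)
    have a2 := mul_le_mul_of_nonneg_left h4 (by positivity : 0 ≤ 2 * wU ^ 2)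
    nlinarith
  have h6 : 2 * dens U * wU ^ 2 = (1 + s ^ 2) *
      (2 * (dens U * (velX U ^ 2 + velY U ^ 2)) - ((γ + 1) * pres V + (γ - 1) * pres U)) := by
    rw [h2]; linear_combination -hnU
  rw [h6] at h5
  have h7 : (1 + s ^ 2) * (((γ + 1) * (pres V - pres U)) * (γ - 1)) ≤
      (1 + s ^ 2) * ((γ + 1) * (2 * (dens U * (velX U ^ 2 + velY U ^ 2)) -
        ((γ + 1) * pres V + (γ - 1) * pres U))) := by linarith
  have h8 := le_of_mul_le_mul_left h7 (by positivity)
  rw [hm]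
  rw [← mul_le_mul_iff_left₀ hpU]
  convert h8 using 1 <;> (field_simp)
  ring

end

end SteadyEuler
end

noncomputable section
namespace SteadyEuler

/-! ## Rarefaction waves in logarithmic coordinates -/

/-- The Prandtl-Meyer function of the squared Mach number. -/
def prandtlMeyer (γ m : ℝ) : ℝ :=
  √((γ + 1) / (γ - 1)) * Real.arctan (√(m - 1) / √((γ + 1) / (γ - 1))) - Real.arctan √(m - 1)

lemma hasDerivAt_prandtlMeyer {γ m : ℝ} (hγ : 1 < γ) (hm : 1 < m) :
    HasDerivAt (prandtlMeyer γ) (√(m - 1) / (m * (2 + (γ - 1) * m))) m := by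
  have hk : 0 < (γ + 1) / (γ - 1) := div_pos (by linarith) (by linarith)
  set k := √((γ + 1) / (γ - 1)) with hkdef
  have hk0 : 0 < k := Real.sqrt_pos.2 hk
  have hk2 : k ^ 2 = (γ + 1) / (γ - 1) := Real.sq_sqrt hk.le
  have hw : HasDerivAt (fun m : ℝ => √(m - 1)) (1 / (2 * √(m - 1))) m := by
    simpa using ((hasDerivAt_id m).sub_const 1).sqrt (by simp; linarith)
  have h1 := ((hw.div_const k).arctan.const_mul k).sub hw.arctan
  refine h1.congr_deriv ?_
  have hw0 : 0 < √(m - 1) := Real.sqrt_pos.2 (by linarith)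
  have hw2 : √(m - 1) ^ 2 = m - 1 := Real.sq_sqrt (by linarith)
  set w := √(m - 1)
  have hm' : m = 1 + w ^ 2 := by linarith
  have hγ1 : γ - 1 ≠ 0 := by linarith
  have e : 2 + (γ - 1) * m = (γ - 1) * (k ^ 2 + w ^ 2) := by
    rw [hk2, hm']; field_simp; ring
  have e2 : (γ - 1) * (k ^ 2 - 1) = 2 := by rw [hk2]; field_simp; ring
  rw [e, hm']
  field_simp
  linear_combination w ^ 2 * e2

/-- The increment of the logarithmic coordinates over a rarefaction wave. -/
def rarefInc (γ sg : ℝ) (w : ℝ × LogState) : LogState :=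
  (w.1,
    sg * (prandtlMeyer γ (logMach γ w.2) -
      prandtlMeyer γ (logMach γ w.2 *
        (1 + 2 / ((γ - 1) * logMach γ w.2) * (1 - Real.exp (w.1 - w.1 / γ))) /
          Real.exp (w.1 - w.1 / γ))),
    speedInc γ (logMach γ w.2) (Real.exp (w.1 - w.1 / γ)),
    w.1 / γ)

/-- States that lie on one rarefaction curve of the `j`-th family, without order. -/
structure RarefRel (γ : ℝ) (j : Acoustic) (U V : State) : Prop where
  left : Supersonic γ U
  right : Supersonic γ V
  entropy : γ * (Real.log (dens V) - Real.log (dens U)) = Real.log (pres V) - Real.log (pres U)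
  bern : bernoulli γ V = bernoulli γ U
  turn : Real.arctan (velY V / velX V) + j.sgn * prandtlMeyer γ (machSqOf γ V) =
    Real.arctan (velY U / velX U) + j.sgn * prandtlMeyer γ (machSqOf γ U)

lemma RarefRel.symm {γ : ℝ} {j : Acoustic} {U V : State} (h : RarefRel γ j U V) :
    RarefRel γ j V U :=
  ⟨h.right, h.left, by linear_combination -h.entropy, h.bern.symm, h.turn.symm⟩

/-- The entropy gives ρ, Bernoulli's law gives q and the Prandtl-Meyer invariant gives θ, all in
terms of the pressure ratio; as for shocks, the relation is symmetric in the two states. -/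
lemma RarefRel.toLog_eq {γ : ℝ} (hγ : 1 < γ) {j : Acoustic} {U V : State}
    (h : RarefRel γ j U V) :
    toLog V = toLog U +
      rarefInc γ j.sgn (Real.log (pres V) - Real.log (pres U), toLog U) := by
  have hU := h.left
  have hV := h.right
  have hN : (Real.log (pres V) - Real.log (pres U)) / γ =
      Real.log (dens V) - Real.log (dens U) := by
    rw [div_eq_iff (by linarith)]; linear_combination -h.entropy
  have hr := sonic_ratio hγ hU hV
  have h2 := log_speed_sub hγ hU hV h.bern
  have h3 := bernoulli_ratio hγ hU h.bern
  have hm : machSqOf γ V = machSqOf γ U *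
      (1 + 2 / ((γ - 1) * machSqOf γ U) * (1 - sonic γ V ^ 2 / sonic γ U ^ 2)) /
        (sonic γ V ^ 2 / sonic γ U ^ 2) := by
    have a1 := hU.sonic_pos hγ
    have a2 := hV.sonic_pos hγ
    have a3 := hU.speed_pos
    rw [h3, machSqOf, machSqOf, ← speed_sq, ← speed_sq]
    field_simp
  rw [hr] at hm h2
  simp only [rarefInc, hN, hU.logMach_toLog hγ, ← h2, ← hm]
  have := h.turn
  ext <;> simp [toLog]
  linear_combination this

/-- The derivative of the density-like factor along an integral curve. -/
def eigScale (γ : ℝ) (j : Acoustic) (U : State) : ℝ :=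
  kCoef γ j U * (lam γ j U * velX U - velY U) / sonic γ U ^ 2

/-- `eigScale` is the derivative of log ρ along r_j. Its sign says that the pressure falls upwards
through 1-rarefactions and rises upwards through 3-rarefactions. -/
lemma Supersonic.sgn_mul_eigScale_pos {γ : ℝ} (hγ : 1 < γ) {U : State} (h : Supersonic γ U)
    (j : Acoustic) : 0 < j.sgn * eigScale γ j U := by
  have h1 := h.kCoef_pos hγ j
  have h2 := h.charSec_pos hγ j
  have h3 := h.sonic_pos hγ
  have : j.sgn * eigScale γ j U = kCoef γ j U * charSec γ j U / sonic γ U := by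
    rw [eigScale, h.lam_mul_sub j]; field_simp; linear_combination j.sgn_sq
  rw [this]; positivity

section Curve

variable {γ : ℝ} {j : Acoustic} {ψ : ℝ → State} {s : Set ℝ} {t : ℝ}

lemma hasDerivWithinAt_apply (h : HasDerivWithinAt ψ (eigvec γ j (ψ t)) s t) (i : Fin 4) :
    HasDerivWithinAt (fun t => ψ t i) (eigvec γ j (ψ t) i) s t := by
  have := ((EuclideanSpace.proj (𝕜 := ℝ) i).hasFDerivAt
    (x := ψ t)).comp_hasDerivWithinAt t h
  exact this

lemma curve_velX (h : HasDerivWithinAt ψ (eigvec γ j (ψ t)) s t) :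
    HasDerivWithinAt (fun t => velX (ψ t)) (-(kCoef γ j (ψ t) * lam γ j (ψ t))) s t := by
  refine (hasDerivWithinAt_apply h 0).congr_deriv ?_
  simp [eigvec]

lemma curve_velY (h : HasDerivWithinAt ψ (eigvec γ j (ψ t)) s t) :
    HasDerivWithinAt (fun t => velY (ψ t)) (kCoef γ j (ψ t)) s t := by
  refine (hasDerivWithinAt_apply h 1).congr_deriv ?_
  simp [eigvec]

lemma curve_pres (hγ : 1 < γ) (hS : Supersonic γ (ψ t))
    (h : HasDerivWithinAt ψ (eigvec γ j (ψ t)) s t) :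
    HasDerivWithinAt (fun t => pres (ψ t)) (γ * pres (ψ t) * eigScale γ j (ψ t)) s t := by
  refine (hasDerivWithinAt_apply h 2).congr_deriv ?_
  have := hS.dens_pos
  have := hS.pres_pos
  simp [eigvec, eigScale, hS.sonic_sq hγ]
  field_simp

lemma curve_dens (h : HasDerivWithinAt ψ (eigvec γ j (ψ t)) s t) :
    HasDerivWithinAt (fun t => dens (ψ t)) (dens (ψ t) * eigScale γ j (ψ t)) s t := by
  refine (hasDerivWithinAt_apply h 3).congr_deriv ?_
  simp [eigvec, eigScale]
  ring

lemma curve_log_pres (hγ : 1 < γ) (hS : Supersonic γ (ψ t))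
    (h : HasDerivWithinAt ψ (eigvec γ j (ψ t)) s t) :
    HasDerivWithinAt (fun t => Real.log (pres (ψ t))) (γ * eigScale γ j (ψ t)) s t := by
  have := hS.pres_pos
  refine ((curve_pres hγ hS h).log this.ne').congr_deriv ?_
  field_simp

lemma curve_log_dens (hS : Supersonic γ (ψ t))
    (h : HasDerivWithinAt ψ (eigvec γ j (ψ t)) s t) :
    HasDerivWithinAt (fun t => Real.log (dens (ψ t))) (eigScale γ j (ψ t)) s t := by
  have := hS.dens_pos
  refine ((curve_dens h).log this.ne').congr_deriv ?_
  field_simp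

lemma curve_angle (hS : Supersonic γ (ψ t))
    (h : HasDerivWithinAt ψ (eigvec γ j (ψ t)) s t) :
    HasDerivWithinAt (fun t => Real.arctan (velY (ψ t) / velX (ψ t)))
      (kCoef γ j (ψ t) * (machRoot γ (ψ t) * charSec γ j (ψ t)) / speed (ψ t) ^ 2) s t := by
  have hu := hS.velX_pos
  refine (((curve_velY h).div (curve_velX h) hu.ne').arctan).congr_deriv ?_
  have hq : 0 < velX (ψ t) ^ 2 + velY (ψ t) ^ 2 := by positivity
  rw [speed_sq, ← hS.add_lam_mul j]
  have : 1 + (velY (ψ t) / velX (ψ t)) ^ 2 ≠ 0 := by positivity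
  simp only [Pi.div_apply]
  field_simp
  ring

/-- `γ p / ρ`. -/
lemma curve_sonicSq (hγ : 1 < γ) (hS : Supersonic γ (ψ t))
    (h : HasDerivWithinAt ψ (eigvec γ j (ψ t)) s t) :
    HasDerivWithinAt (fun t => γ * pres (ψ t) / dens (ψ t))
      ((γ - 1) * sonic γ (ψ t) ^ 2 * eigScale γ j (ψ t)) s t := by
  have hr := hS.dens_pos
  refine (((curve_pres hγ hS h).const_mul γ).div (curve_dens h) hr.ne').congr_deriv ?_
  rw [hS.sonic_sq hγ]
  field_simp

lemma curve_speedSq (hγ : 1 < γ) (hS : Supersonic γ (ψ t))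
    (h : HasDerivWithinAt ψ (eigvec γ j (ψ t)) s t) :
    HasDerivWithinAt (fun t => velX (ψ t) ^ 2 + velY (ψ t) ^ 2)
      (-(2 * sonic γ (ψ t) ^ 2 * eigScale γ j (ψ t))) s t := by
  have hc := hS.sonic_pos hγ
  refine (((curve_velX h).pow 2).add ((curve_velY h).pow 2)).congr_deriv ?_
  rw [eigScale]
  field_simp
  simp only [pow_one, Nat.cast_ofNat, Nat.add_one_sub_one]
  ring

/-- The Prandtl-Meyer relation. Along r_j the square m of the Mach number changes at the rate -(2 +
(γ - 1)m) times `eigScale`, and the derivative of `prandtlMeyer` is the factor that turns this into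
the rate of rotation of the flow. -/
lemma curve_turn (hγ : 1 < γ) (hs : ∀ r ∈ s, Supersonic γ (ψ r)) (ht : t ∈ s)
    (h : HasDerivWithinAt ψ (eigvec γ j (ψ t)) s t) :
    HasDerivWithinAt (fun t => Real.arctan (velY (ψ t) / velX (ψ t)) +
      j.sgn * prandtlMeyer γ (machSqOf γ (ψ t))) 0 s t := by
  have hS := hs t ht
  have hc := hS.sonic_pos hγ
  have hr := hS.dens_pos
  have hp := hS.pres_pos
  have hq : 0 < velX (ψ t) ^ 2 + velY (ψ t) ^ 2 := by have := hS.velX_pos; positivity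
  have hc2 := hS.sonic_sq hγ
  have hm : HasDerivWithinAt (fun t => machSqOf γ (ψ t))
      (-(eigScale γ j (ψ t) * (2 + (γ - 1) * machSqOf γ (ψ t)))) s t := by
    have h1 := (curve_speedSq hγ hS h).div (curve_sonicSq hγ hS h) (by positivity)
    have h2 : HasDerivWithinAt (fun t => machSqOf γ (ψ t)) _ s t :=
      h1.congr (fun r hr => by rw [machSqOf, (hs r hr).sonic_sq hγ]; rfl)
        (by rw [machSqOf, hc2]; rfl)
    refine h2.congr_deriv ?_
    rw [← hc2, machSqOf]
    field_simp
    ring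
  have hm1 := hS.one_lt_machSqOf hγ
  have h3 := (hasDerivAt_prandtlMeyer hγ hm1).comp_hasDerivWithinAt t hm
  refine ((curve_angle hS h).add (h3.const_mul j.sgn)).congr_deriv ?_
  have hroot : √(machSqOf γ (ψ t) - 1) = machRoot γ (ψ t) / sonic γ (ψ t) := by
    rw [machRoot, ← Real.sqrt_sq hc.le, ← Real.sqrt_div' _ (by positivity), Real.sqrt_sq hc.le]
    congr 1
    rw [machSqOf]; field_simp
  have hmp : 0 < machSqOf γ (ψ t) := by linarith
  have hmp2 : 0 < 2 + (γ - 1) * machSqOf γ (ψ t) := by nlinarith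
  rw [hroot, eigScale, hS.lam_mul_sub j]
  have e : speed (ψ t) ^ 2 = machSqOf γ (ψ t) * sonic γ (ψ t) ^ 2 := by
    rw [machSqOf, speed_sq]; field_simp
  rw [e]
  generalize machSqOf γ (ψ t) = m at *
  generalize 2 + (γ - 1) * m = D at *
  field_simp
  linear_combination (-(kCoef γ j (ψ t) * machRoot γ (ψ t) * charSec γ j (ψ t))) * j.sgn_sq

lemma curve_bernoulli (hγ : 1 < γ) (hs : ∀ r ∈ s, Supersonic γ (ψ r)) (ht : t ∈ s)
    (h : HasDerivWithinAt ψ (eigvec γ j (ψ t)) s t) :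
    HasDerivWithinAt (fun t => bernoulli γ (ψ t)) 0 s t := by
  have hS := hs t ht
  have h1 := (curve_speedSq hγ hS h).add ((curve_sonicSq hγ hS h).const_mul (2 / (γ - 1)))
  have e : ∀ r ∈ s, bernoulli γ (ψ r) = ((fun t => velX (ψ t) ^ 2 + velY (ψ t) ^ 2) +
      fun t => 2 / (γ - 1) * (γ * pres (ψ t) / dens (ψ t))) r := fun r hr => by
    rw [bernoulli, speed_sq, (hs r hr).sonic_sq hγ]; rfl
  refine (h1.congr e (e t ht)).congr_deriv ?_
  have : γ - 1 ≠ 0 := by linarith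
  field_simp
  ring

lemma eq_of_deriv_zero {f : ℝ → ℝ} {a : ℝ} (ha : 0 ≤ a)
    (h : ∀ t ∈ Set.Icc 0 a, HasDerivWithinAt f 0 (Set.Icc 0 a) t) : f a = f 0 := by
  rcases ha.eq_or_lt with rfl | ha'
  · rfl
  refine constant_of_derivWithin_zero (fun t ht => (h t ht).differentiableWithinAt)
    (fun t ht => ?_) a ⟨ha, le_rfl⟩
  exact (h t ⟨ht.1, ht.2.le⟩).derivWithin (uniqueDiffOn_Icc ha' t ⟨ht.1, ht.2.le⟩)

/-- Entropy, Bernoulli quantity and Prandtl-Meyer invariant are first integrals of r_j. -/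
lemma IsRarefaction.rarefRel (hγ : 1 < γ) {a : ℝ} (ha : 0 ≤ a) {U V : State}
    (h : IsRarefaction γ j a U V) : RarefRel γ j U V := by
  obtain ⟨ψ, rfl, rfl, h⟩ := h
  have hs : ∀ r ∈ Set.Icc 0 a, Supersonic γ (ψ r) := fun r hr => (h r hr).1
  refine ⟨hs 0 ⟨le_rfl, ha⟩, hs a ⟨ha, le_rfl⟩, ?_, ?_, ?_⟩
  · have := eq_of_deriv_zero (f := fun t => γ * Real.log (dens (ψ t)) - Real.log (pres (ψ t))) ha
      (fun t ht => (((curve_log_dens (hs t ht) (h t ht).2).const_mul γ).sub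
        (curve_log_pres hγ (hs t ht) (h t ht).2)).congr_deriv (by ring))
    linear_combination this
  · exact eq_of_deriv_zero (f := fun t => bernoulli γ (ψ t)) ha
      (fun t ht => curve_bernoulli hγ hs ht (h t ht).2)
  · exact eq_of_deriv_zero (f := fun t => Real.arctan (velY (ψ t) / velX (ψ t)) +
      j.sgn * prandtlMeyer γ (machSqOf γ (ψ t))) ha
      (fun t ht => curve_turn hγ hs ht (h t ht).2)

/-! ## The characteristic speed as a parameter -/

lemma contDiffAt_lam (hγ : 1 < γ) {U : State} (hU : Supersonic γ U) (n : WithTop ℕ∞) :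
    ContDiffAt ℝ n (lam γ j) U := by
  have hp := hU.pres_pos
  have hr := hU.dens_pos
  have hc := hU.sonic_pos hγ
  have h1 := hU.sonic_sq_lt
  have c0 : ContDiffAt ℝ n velX U := (EuclideanSpace.proj (𝕜 := ℝ) (0 : Fin 4)).contDiff.contDiffAt
  have c1 : ContDiffAt ℝ n velY U := (EuclideanSpace.proj (𝕜 := ℝ) (1 : Fin 4)).contDiff.contDiffAt
  have c2 : ContDiffAt ℝ n pres U := (EuclideanSpace.proj (𝕜 := ℝ) (2 : Fin 4)).contDiff.contDiffAt
  have c3 : ContDiffAt ℝ n dens U := (EuclideanSpace.proj (𝕜 := ℝ) (3 : Fin 4)).contDiff.contDiffAt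
  have cs : ContDiffAt ℝ n (sonic γ) U :=
    ((contDiffAt_const.mul c2).div c3 hr.ne').sqrt
      (div_pos (mul_pos (by linarith) hp) hr).ne'
  have cr : ContDiffAt ℝ n (fun U => √(velX U ^ 2 + velY U ^ 2 - sonic γ U ^ 2)) U :=
    (((c0.pow 2).add (c1.pow 2)).sub (cs.pow 2)).sqrt
      (by nlinarith [sq_nonneg (velY U)])
  exact ((c0.mul c1).add (contDiffAt_const.mul (cs.mul cr))).div ((c0.pow 2).sub (cs.pow 2))
    (by linarith)

/-- Along the curve λ satisfies (λu - v)² = c²(1 + λ²). Differentiation gives a linear equation for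
the derivative of λ whose coefficient is ±2c√(q² - c²), and the choice of k_j makes the solution 1.
The direction of ψ is prescribed only at the point t, so the lemma also applies to curves that are
merely tangent to r_j there. -/
lemma curve_lam (hγ : 1 < γ) (hs : ∀ r ∈ s, Supersonic γ (ψ r)) (ht : t ∈ s)
    (hu : UniqueDiffWithinAt ℝ s t)
    (h : HasDerivWithinAt ψ (eigvec γ j (ψ t)) s t) :
    HasDerivWithinAt (fun t => lam γ j (ψ t)) 1 s t := by
  have hS := hs t ht
  have hc := hS.sonic_pos hγ
  obtain ⟨L, hL⟩ : ∃ L, HasDerivWithinAt (fun t => lam γ j (ψ t)) L s t :=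
    ⟨_, (((contDiffAt_lam hγ hS 1).differentiableAt one_ne_zero).hasFDerivAt.comp_hasDerivWithinAt
      t h)⟩
  -- differentiate the characteristic equation
  have hfun := (((hL.mul (curve_velX h)).sub (curve_velY h)).pow 2).sub
    ((curve_sonicSq hγ hS h).mul ((hL.pow 2).const_add 1))
  have hzero : ∀ r ∈ s, ((((fun t => lam γ j (ψ t)) * (fun t => velX (ψ t)) -
      fun t => velY (ψ t)) ^ 2) - (fun t => γ * pres (ψ t) / dens (ψ t)) *
      fun x => 1 + ((fun t => lam γ j (ψ t)) ^ 2) x) r = (0 : ℝ) := by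
    intro r hr
    have e := (hs r hr).lam_mul_sub j
    have e2 := (hs r hr).one_add_lam_sq j
    simp only [Pi.sub_apply, Pi.pow_apply, Pi.mul_apply]
    rw [e, e2, ← (hs r hr).sonic_sq hγ]
    linear_combination (sonic γ (ψ r) * charSec γ j (ψ r)) ^ 2 * j.sgn_sq
  have h0 : HasDerivWithinAt (fun _ : ℝ => (0 : ℝ)) _ s t :=
    hfun.congr (fun r hr => (hzero r hr).symm) (hzero t ht).symm
  have key := hu.eq_deriv _ (hasDerivWithinAt_const t s (0 : ℝ)) h0
  have e1 := hS.lam_mul_sub j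
  have e2 := hS.one_add_lam_sq j
  have e3 := hS.kCoef_mul hγ j
  have e4 := hS.add_lam_mul j
  have hsec := hS.charSec_pos hγ j
  have hd := hS.machRoot_pos
  have hd2 := hS.machRoot_sq
  have hc2 := hS.sonic_sq hγ
  simp only [Pi.sub_apply, Pi.pow_apply, Pi.mul_apply, Nat.cast_ofNat, Nat.add_one_sub_one,
    pow_one, ← hc2, eigScale] at key
  suffices hL1 : L = 1 by rwa [hL1] at hL
  have hlam : (velX (ψ t) ^ 2 - sonic γ (ψ t) ^ 2) * lam γ j (ψ t) =
      velX (ψ t) * velY (ψ t) + j.sgn * (sonic γ (ψ t) * machRoot γ (ψ t)) := by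
    have := hS.sonic_sq_lt
    rw [lam_eq, mul_div_cancel₀]; linarith
  generalize lam γ j (ψ t) = l at *
  generalize kCoef γ j (ψ t) = k at *
  generalize machRoot γ (ψ t) = d at *
  generalize charSec γ j (ψ t) = T at *
  generalize sonic γ (ψ t) = c at *
  generalize velX (ψ t) = u at *
  generalize velY (ψ t) = v at *
  have hl2 : (2 * j.sgn * c * d) * L = (2 * j.sgn * c * d) := by
    field_simp at key
    have k1 : 2 * (l * u - v) * (L * u - k * l * l - k) - ((γ - 1) * (k * (l * u - v))) * (1 + l ^ 2)
        - c ^ 2 * (2 * l * L) = 0 := by linear_combination -key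
    have k2 : L * (2 * ((u ^ 2 - c ^ 2) * l - u * v)) = k * (γ + 1) * (l * u - v) * (1 + l ^ 2) := by
      linear_combination k1
    rw [hlam, e1, e2] at k2
    linear_combination k2 + (j.sgn * c) * e3
  refine mul_left_cancel₀ ?_ (hl2.trans (mul_one _).symm)
  have hj : j.sgn ≠ 0 := by rcases j.sgn_cases with h | h <;> rw [h] <;> norm_num
  positivity

/-- With this, rarefactions and shocks alike have the increment of λ_j as parameter, and the
parameters of consecutive waves of one family add up to an increment of λ_j. -/
lemma IsRarefaction.lam_sub (hγ : 1 < γ) {a : ℝ} (ha : 0 ≤ a) {U V : State}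
    (h : IsRarefaction γ j a U V) : lam γ j V - lam γ j U = a := by
  obtain ⟨ψ, rfl, rfl, h⟩ := h
  have hs : ∀ r ∈ Set.Icc 0 a, Supersonic γ (ψ r) := fun r hr => (h r hr).1
  rcases ha.eq_or_lt with rfl | ha'
  · simp
  have := eq_of_deriv_zero (f := fun t => lam γ j (ψ t) - t) ha
    (fun t ht => ((curve_lam hγ hs ht (uniqueDiffOn_Icc ha' t ht) (h t ht).2).sub
      (hasDerivWithinAt_id t _)).congr_deriv (sub_self 1))
  linarith

/-- Sub-intervals of a rarefaction wave are rarefaction waves. -/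
lemma IsRarefaction.exists_path {a : ℝ} {U V : State} (h : IsRarefaction γ j a U V) :
    ∃ ψ : ℝ → State, ψ 0 = U ∧ ψ a = V ∧ ContinuousOn ψ (Set.Icc 0 a) ∧
      (∀ t ∈ Set.Icc 0 a, IsRarefaction γ j t U (ψ t) ∧
        IsRarefaction γ j (a - t) (ψ t) V) := by
  obtain ⟨ψ, rfl, rfl, h⟩ := h
  refine ⟨ψ, rfl, rfl, fun t ht => (h t ht).2.continuousWithinAt, fun t ht => ⟨?_, ?_⟩⟩
  · exact ⟨ψ, rfl, rfl, fun r hr => ⟨(h r ⟨hr.1, hr.2.trans ht.2⟩).1,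
      (h r ⟨hr.1, hr.2.trans ht.2⟩).2.mono (Set.Icc_subset_Icc_right ht.2)⟩⟩
  · refine ⟨fun r => ψ (t + r), by simp, by simp, fun r hr => ?_⟩
    have hm : t + r ∈ Set.Icc 0 a := ⟨add_nonneg ht.1 hr.1, by linarith [hr.2]⟩
    refine ⟨(h _ hm).1, ?_⟩
    have h1 : HasDerivWithinAt (fun r : ℝ => t + r) 1 (Set.Icc 0 (a - t)) r :=
      ((hasDerivAt_id r).const_add t).hasDerivWithinAt
    have := (h _ hm).2.scomp r h1
      (fun x hx => ⟨add_nonneg ht.1 hx.1, by linarith [hx.2]⟩)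
    simpa [Function.comp_def] using this

/-- Along a rarefaction curve the pressure is monotone and the flow angle increases. -/
lemma IsRarefaction.monotone (hγ : 1 < γ) {a : ℝ} (ha : 0 ≤ a) {U V : State}
    (h : IsRarefaction γ j a U V) :
    0 ≤ j.sgn * (Real.log (pres V) - Real.log (pres U)) ∧
      0 ≤ Real.arctan (velY V / velX V) - Real.arctan (velY U / velX U) := by
  obtain ⟨ψ, rfl, rfl, h⟩ := h
  have hs : ∀ r ∈ Set.Icc 0 a, Supersonic γ (ψ r) := fun r hr => (h r hr).1
  have mono : ∀ f f' : ℝ → ℝ, (∀ t ∈ Set.Icc 0 a, HasDerivWithinAt f (f' t) (Set.Icc 0 a) t) →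
      (∀ t ∈ Set.Icc 0 a, 0 ≤ f' t) → f 0 ≤ f a := fun f f' hf hf' =>
    (monotoneOn_of_hasDerivWithinAt_nonneg (convex_Icc 0 a)
      (fun t ht => (hf t ht).continuousWithinAt)
      (fun t ht => (hf t (interior_subset ht)).mono interior_subset)
      (fun t ht => hf' t (interior_subset ht))) ⟨le_rfl, ha⟩ ⟨ha, le_rfl⟩ ha
  constructor
  · have := mono (fun t => j.sgn * Real.log (pres (ψ t))) _
      (fun t ht => (curve_log_pres hγ (hs t ht) (h t ht).2).const_mul j.sgn)
      (fun t ht => by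
        have := (hs t ht).sgn_mul_eigScale_pos hγ j
        nlinarith)
    linarith
  · have := mono (fun t => Real.arctan (velY (ψ t) / velX (ψ t))) _
      (fun t ht => curve_angle (hs t ht) (h t ht).2)
      (fun t ht => by
        have := (hs t ht).kCoef_pos hγ j
        have := (hs t ht).charSec_pos hγ j
        have := (hs t ht).machRoot_pos
        positivity)
    linarith

end Curve

end SteadyEuler
end

noncomputable section
namespace SteadyEuler

open Set Filter Topology Metric

/-! ## Second differences and glued wave curves -/

/-- Two functions of the wave parameter and the state, glued at parameter zero. -/
def glue {E : Type*} (sg : ℝ) (R S : ℝ × E → E) (w : ℝ × E) : E :=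
  open Classical in if 0 ≤ sg * w.1 then R w else S w

lemma glue_of_nonneg {E : Type*} {sg : ℝ} {R S : ℝ × E → E} {σ : ℝ} {X : E} (h : 0 ≤ sg * σ) :
    glue sg R S (σ, X) = R (σ, X) := by simp [glue, h]

lemma glue_of_neg {E : Type*} {sg : ℝ} {R S : ℝ × E → E} {σ : ℝ} {X : E} (h : sg * σ < 0) :
    glue sg R S (σ, X) = S (σ, X) := by simp [glue, h]

section Abstract

variable {E F : Type*} [NormedAddCommGroup E] [NormedSpace ℝ E] [NormedAddCommGroup F]
  [NormedSpace ℝ F]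

lemma exists_fderiv_lipschitz {f : E → F} {x : E} (hf : ContDiffAt ℝ 2 f x) :
    ∃ C : ℝ, ∃ ε > 0, 0 ≤ C ∧ (∀ y ∈ ball x ε, DifferentiableAt ℝ f y) ∧
      (∀ y ∈ ball x ε, ‖fderiv ℝ f y‖ ≤ C) ∧
      ∀ y ∈ ball x ε, ∀ z ∈ ball x ε, ‖fderiv ℝ f y - fderiv ℝ f z‖ ≤ C * ‖y - z‖ := by
  have h1 : ContDiffAt ℝ 1 (fderiv ℝ f) x := hf.fderiv_right (by norm_num)
  obtain ⟨K, t, ht, hK⟩ := h1.exists_lipschitzOnWith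
  have h2 : ∀ᶠ y in 𝓝 x, DifferentiableAt ℝ f y := by
    have := hf.eventually (by simp)
    filter_upwards [this] with y hy using hy.differentiableAt (by simp)
  have h3 : ∀ᶠ y in 𝓝 x, ‖fderiv ℝ f y‖ < ‖fderiv ℝ f x‖ + 1 :=
    h1.continuousAt.norm.eventually (gt_mem_nhds (by linarith))
  obtain ⟨ε, hε, hb⟩ := Metric.eventually_nhds_iff_ball.1 (h2.and (h3.and ht))
  refine ⟨max K (‖fderiv ℝ f x‖ + 1), ε, hε, le_max_of_le_left K.2, fun y hy => (hb y hy).1,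
    fun y hy => (hb y hy).2.1.le.trans (le_max_right _ _), fun y hy z hz => ?_⟩
  have := hK.norm_sub_le (hb y hy).2.2 (hb z hz).2.2
  exact this.trans (by gcongr; exact le_max_left _ _)

/-- The segments from q to p and from s to r are traversed simultaneously. The Lipschitz constant of
the derivative of f controls the difference of the two rates by ‖p - r‖‖p - q‖ and a multiple of the
defect D of the parallelogram; for D = 0 only the product remains. -/
lemma second_difference {f : E → F} {x : E} (hf : ContDiffAt ℝ 2 f x) :
    ∃ C : ℝ, ∃ ε > 0, 0 ≤ C ∧ ∀ p ∈ ball x ε, ∀ q ∈ ball x ε, ∀ r ∈ ball x ε, ∀ s ∈ ball x ε,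
      ‖f p - f q - (f r - f s)‖ ≤ C * (‖(p - q) - (r - s)‖ + ‖p - r‖ * ‖p - q‖) := by
  obtain ⟨C, ε, hε, hC, hd, hM, hL⟩ := exists_fderiv_lipschitz hf
  -- The cap 1/2 gives ‖p - q‖ ≤ 1, so that ‖D‖‖p - q‖ is absorbed in ‖D‖.
  refine ⟨2 * C, min ε (1 / 2), by positivity, by positivity, fun p hp q hq r hr s hs => ?_⟩
  have hmono : ball x (min ε (1 / 2)) ⊆ ball x ε := ball_subset_ball (min_le_left _ _)
  have hpq : ‖p - q‖ ≤ 1 := by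
    have h1 := mem_ball_iff_norm.1 hp
    have h2 := mem_ball_iff_norm.1 hq
    have : p - q = (p - x) - (q - x) := by abel
    rw [this]
    have := norm_sub_le (p - x) (q - x)
    have := min_le_right ε (1 / 2)
    linarith
  set D := (p - q) - (r - s) with hD
  have hseg : ∀ a ∈ ball x ε, ∀ b ∈ ball x ε, ∀ t ∈ Icc (0:ℝ) 1, b + t • (a - b) ∈ ball x ε :=
    fun a ha b hb t ht => (convex_ball x ε).add_smul_sub_mem hb ha ht
  have hder : ∀ t ∈ Icc (0:ℝ) 1, HasDerivWithinAt
      (fun t : ℝ => f (q + t • (p - q)) - f (s + t • (r - s)))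
      (fderiv ℝ f (q + t • (p - q)) (p - q) - fderiv ℝ f (s + t • (r - s)) (r - s))
      (Icc 0 1) t := by
    intro t ht
    have hline : ∀ a b : E, HasDerivAt (fun t : ℝ => b + t • a) a t := fun a b => by
      simpa using ((hasDerivAt_id t).smul_const a).const_add b
    refine (HasDerivAt.sub ?_ ?_).hasDerivWithinAt
    · exact ((hd _ (hseg p (hmono hp) q (hmono hq) t ht)).hasFDerivAt).comp_hasDerivAt t (hline _ _)
    · exact ((hd _ (hseg r (hmono hr) s (hmono hs) t ht)).hasFDerivAt).comp_hasDerivAt t (hline _ _)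
  have hbound : ∀ t ∈ Ico (0:ℝ) 1,
      ‖fderiv ℝ f (q + t • (p - q)) (p - q) - fderiv ℝ f (s + t • (r - s)) (r - s)‖ ≤
        2 * C * (‖D‖ + ‖p - r‖ * ‖p - q‖) := by
    intro t ht
    have ht' : t ∈ Icc (0:ℝ) 1 := ⟨ht.1, ht.2.le⟩
    have m1 := hseg p (hmono hp) q (hmono hq) t ht'
    have m2 := hseg r (hmono hr) s (hmono hs) t ht'
    set y := q + t • (p - q)
    set z := s + t • (r - s)
    have e : fderiv ℝ f y (p - q) - fderiv ℝ f z (r - s) =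
        (fderiv ℝ f y - fderiv ℝ f z) (p - q) + fderiv ℝ f z D := by
      simp only [hD, map_sub, sub_apply]; abel
    have hyz : ‖y - z‖ ≤ ‖p - r‖ + ‖D‖ := by
      have : y - z = (p - r) - (1 - t) • D := by
        simp only [y, z, hD, sub_smul, one_smul, smul_sub]; abel
      rw [this]
      refine (norm_sub_le _ _).trans ?_
      rw [norm_smul, Real.norm_of_nonneg (by linarith [ht.2])]
      nlinarith [norm_nonneg D, ht.1]
    rw [e]
    calc _ ≤ ‖(fderiv ℝ f y - fderiv ℝ f z) (p - q)‖ + ‖fderiv ℝ f z D‖ := norm_add_le _ _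
      _ ≤ C * (‖p - r‖ + ‖D‖) * ‖p - q‖ + C * ‖D‖ := by
        refine add_le_add ?_ ?_
        · refine (ContinuousLinearMap.le_opNorm _ _).trans ?_
          gcongr
          exact (hL y m1 z m2).trans (by gcongr)
        · refine (ContinuousLinearMap.le_opNorm _ _).trans ?_
          gcongr
          exact hM z m2
      _ ≤ _ := by
        have a1 : ‖D‖ * ‖p - q‖ ≤ ‖D‖ := by nlinarith [norm_nonneg D]
        have a2 : 0 ≤ ‖p - r‖ * ‖p - q‖ := by positivity
        nlinarith [mul_le_mul_of_nonneg_left a1 hC, mul_nonneg hC a2]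
  have := norm_image_sub_le_of_norm_deriv_le_segment_01' hder hbound
  simp only [one_smul, zero_smul, add_zero, add_sub_cancel] at this
  convert this using 2
  abel

/-- A function that vanishes to first order at the switching point can be replaced by zero on one
side of it without losing differentiability. -/
lemma hasDerivAt_cut {sg : ℝ} (hsg : sg ≠ 0) {D : ℝ → E} {d : E} {σ : ℝ}
    (hD : HasDerivAt D d σ) (h0 : σ = 0 → D 0 = 0 ∧ d = 0) :
    HasDerivAt (fun σ => open Classical in if 0 ≤ sg * σ then (0 : E) else D σ)
      (open Classical in if 0 ≤ sg * σ then 0 else d) σ := by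
  classical
  have hcont : Continuous fun σ : ℝ => sg * σ := by fun_prop
  rcases lt_trichotomy (sg * σ) 0 with h | h | h
  · rw [if_neg (not_le.2 h)]
    refine hD.congr_of_eventuallyEq ?_
    filter_upwards [hcont.continuousAt.eventually (gt_mem_nhds h)] with y hy
    simp [not_le.2 hy]
  · have hσ : σ = 0 := by simpa [hsg] using h
    obtain ⟨h1, rfl⟩ := h0 hσ
    subst hσ
    simp only [ite_self]
    rw [hasDerivAt_iff_isLittleO] at hD ⊢
    refine Asymptotics.IsBigO.trans_isLittleO ?_ hD
    refine Asymptotics.IsBigO.of_bound 1 (Eventually.of_forall fun y => ?_)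
    simp only [h1, mul_zero, le_refl, if_true, sub_zero, smul_zero, one_mul]
    split_ifs <;> simp
  · rw [if_pos h.le]
    refine (hasDerivAt_const σ (0 : E)).congr_of_eventuallyEq ?_
    filter_upwards [hcont.continuousAt.eventually (lt_mem_nhds h)] with y hy
    simp [hy.le]

/-- The properties of a wave curve `σ ↦ X + G (σ, X)` near `(0, X₀)`. -/
structure WaveCurve (G : ℝ × E → E) (X₀ g₀ : E) (C ε : ℝ) : Prop where
  pos : 0 < ε
  nonneg : 0 ≤ C
  zero : ∀ X ∈ ball X₀ ε, G (0, X) = 0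
  deriv : HasDerivAt (fun σ => G (σ, X₀)) g₀ 0
  master : ∀ a b a' b' : ℝ, |a| < ε → |b| < ε → |a'| < ε → |b'| < ε → b - a = b' - a' →
    ∀ X ∈ ball X₀ ε, ∀ Y ∈ ball X₀ ε,
    ‖G (b, X) - G (a, X) - (G (b', Y) - G (a', Y))‖ ≤ C * (|b - a| * (|a - a'| + ‖X - Y‖))

/-- The glued curve is R plus the difference D = S - R cut off on one side. D vanishes to first
order at parameter zero, so the cut-off leaves the derivative in the parameter Lipschitz. A second
derivative need not exist at the junction, and none is needed. -/
lemma exists_waveCurve_glue {sg : ℝ} (hsg : sg ≠ 0) {R S : ℝ × E → E} {X₀ : E} {g : E → E}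
    (hR : ContDiffAt ℝ 2 R (0, X₀)) (hS : ContDiffAt ℝ 2 S (0, X₀))
    (hR0 : ∀ᶠ X in 𝓝 X₀, R (0, X) = 0) (hS0 : ∀ᶠ X in 𝓝 X₀, S (0, X) = 0)
    (hR1 : ∀ᶠ X in 𝓝 X₀, HasDerivAt (fun σ => R (σ, X)) (g X) 0)
    (hS1 : ∀ᶠ X in 𝓝 X₀, HasDerivAt (fun σ => S (σ, X)) (g X) 0) :
    ∃ C ε : ℝ, WaveCurve (glue sg R S) X₀ (g X₀) C ε := by
  classical
  obtain ⟨C₁, ε₁, hε₁, hC₁, hR2⟩ := second_difference hR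
  obtain ⟨C₂, ε₂, hε₂, hC₂, hd, hM, hL⟩ := exists_fderiv_lipschitz (hS.sub hR)
  obtain ⟨ε₃, hε₃, hb⟩ := Metric.eventually_nhds_iff_ball.1 (hR0.and (hS0.and (hR1.and hS1)))
  have hε : 0 < min ε₁ (min ε₂ ε₃) := by positivity
  set ε := min ε₁ (min ε₂ ε₃) with hεdef
  have le1 : ε ≤ ε₁ := min_le_left _ _
  have le2 : ε ≤ ε₂ := (min_le_right _ _).trans (min_le_left _ _)
  have le3 : ε ≤ ε₃ := (min_le_right _ _).trans (min_le_right _ _)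
  have hmem : ∀ a : ℝ, |a| < ε → ∀ X ∈ ball X₀ ε, ∀ e, ε ≤ e →
      ((a, X) : ℝ × E) ∈ ball ((0 : ℝ), X₀) e := fun a ha X hX e he => by
    rw [← ball_prod_same]
    exact ⟨by simpa using ha.trans_le he, ball_subset_ball he hX⟩
  set D : ℝ × E → E := fun w => S w - R w with hDdef
  -- the derivative of the difference in the direction of the parameter
  have hDd : ∀ a : ℝ, |a| < ε → ∀ X ∈ ball X₀ ε,
      HasDerivAt (fun σ => D (σ, X)) (fderiv ℝ D (a, X) (1, 0)) a := fun a ha X hX => by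
    have := (hd _ (hmem a ha X hX _ le2)).hasFDerivAt
    have h2 : HasDerivAt (fun σ : ℝ => ((σ, X) : ℝ × E)) (1, 0) a :=
      (hasDerivAt_id a).prodMk (hasDerivAt_const a X)
    exact this.comp_hasDerivAt a h2
  have hD0 : ∀ X ∈ ball X₀ ε, D (0, X) = 0 ∧ fderiv ℝ D (0, X) (1, 0) = 0 := fun X hX => by
    obtain ⟨h1, h2, h3, h4⟩ := hb X (ball_subset_ball le3 hX)
    refine ⟨by simp [hDdef, h1, h2], ?_⟩
    have := (hDd 0 (by simpa using hε) X hX).unique (h4.sub h3)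
    simpa using this
  set cut : ℝ × E → E := fun w => if 0 ≤ sg * w.1 then 0 else D w
  have hG : ∀ w, glue sg R S w = R w + cut w := fun w => by
    simp only [glue, cut, hDdef]; split_ifs <;> simp
  -- The derivative of the cut-off difference at a is that of D at `clip a`, since D has zero
  -- derivative at parameter zero. As `clip` is 1-Lipschitz, the Lipschitz bound for the derivative
  -- of D carries over.
  set clip : ℝ → ℝ := fun a => if 0 ≤ sg * a then 0 else a
  have hclip : ∀ a b, |clip a - clip b| ≤ |a - b| := fun a b => by
    simp only [clip]
    split_ifs with h1 h2 h2
    · simp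
    · push Not at h2
      rw [zero_sub, abs_neg]
      rcases lt_or_gt_of_ne hsg with h | h
      · have : a ≤ 0 := by nlinarith
        have : 0 < b := by nlinarith
        rw [abs_of_pos this, abs_of_nonpos (by linarith)]; linarith
      · have : 0 ≤ a := by nlinarith
        have : b < 0 := by nlinarith
        rw [abs_of_neg this, abs_of_nonneg (by linarith)]; linarith
    · push Not at h1
      rw [sub_zero]
      rcases lt_or_gt_of_ne hsg with h | h
      · have : b ≤ 0 := by nlinarith
        have : 0 < a := by nlinarith
        rw [abs_of_pos this, abs_of_nonneg (by linarith)]; linarith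
      · have : 0 ≤ b := by nlinarith
        have : a < 0 := by nlinarith
        rw [abs_of_neg this, abs_of_nonpos (by linarith)]; linarith
    · rfl
  have hclip' : ∀ a, |a| < ε → |clip a| < ε := fun a ha => by
    simp only [clip]; split_ifs
    · simpa using hε
    · exact ha
  have hcutd : ∀ a : ℝ, |a| < ε → ∀ X ∈ ball X₀ ε,
      HasDerivAt (fun σ => cut (σ, X)) (fderiv ℝ D (clip a, X) (1, 0)) a := fun a ha X hX => by
    have := hasDerivAt_cut hsg (hDd a ha X hX) (fun h => by subst h; exact hD0 X hX)
    refine this.congr_deriv ?_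
    simp only [clip]
    split_ifs
    · exact (hD0 X hX).2.symm
    · rfl
  refine ⟨C₁ + C₂, ε, hε, by positivity, fun X hX => ?_, ?_, ?_⟩
  · rw [glue_of_nonneg (by simp)]
    exact (hb X (ball_subset_ball le3 hX)).1
  · have h1 := (hb X₀ (mem_ball_self hε₃)).2.2.1
    have h2 := hcutd 0 (by simpa using hε) X₀ (mem_ball_self hε)
    have h3 : clip 0 = 0 := by simp [clip]
    rw [h3, (hD0 X₀ (mem_ball_self hε)).2] at h2
    have := h1.add h2
    rw [add_zero] at this
    exact this.congr_of_eventuallyEq (Eventually.of_forall fun σ => hG _)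
  · intro a b a' b' ha hb ha' hb' hab X hX Y hY
    have hRb : ‖R (b, X) - R (a, X) - (R (b', Y) - R (a', Y))‖ ≤
        C₁ * (|b - a| * (|a - a'| + ‖X - Y‖)) := by
      refine (hR2 _ (hmem b hb X hX _ le1) _ (hmem a ha X hX _ le1) _ (hmem b' hb' Y hY _ le1) _
        (hmem a' ha' Y hY _ le1)).trans ?_
      have e1 : ((b, X) - (a, X) - ((b', Y) - (a', Y)) : ℝ × E) = 0 := by
        ext <;> simp [hab]
      have e2 : ‖((b, X) - (a, X) : ℝ × E)‖ = |b - a| := by simp [Prod.norm_def]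
      have e3 : ‖((b, X) - (b', Y) : ℝ × E)‖ ≤ |a - a'| + ‖X - Y‖ := by
        have : b - b' = a - a' := by linarith
        simp only [Prod.norm_def, Prod.fst_sub, Prod.snd_sub, this, Real.norm_eq_abs]
        exact max_le (by linarith [norm_nonneg (X - Y)]) (by linarith [abs_nonneg (a - a')])
      rw [e1, e2, norm_zero, zero_add, mul_comm |b - a|]
      gcongr
    have hcut : ‖cut (b, X) - cut (a, X) - (cut (b', Y) - cut (a', Y))‖ ≤
        C₂ * (|b - a| * (|a - a'| + ‖X - Y‖)) := by
      have hpt : ∀ c d : ℝ, |c| < ε → |d| < ε → ∀ t ∈ Icc (0 : ℝ) 1, |c + t * (d - c)| < ε := by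
        intro c d hc hd t ht
        have := (convex_ball (0 : ℝ) ε).add_smul_sub_mem (x := c) (y := d)
          (by simpa using hc) (by simpa using hd) ht
        simpa using this
      have hder : ∀ t ∈ Icc (0:ℝ) 1, HasDerivWithinAt
          (fun t : ℝ => cut (a + t * (b - a), X) - cut (a' + t * (b' - a'), Y))
          ((b - a) • (fderiv ℝ D (clip (a + t * (b - a)), X) (1, 0) -
            fderiv ℝ D (clip (a' + t * (b' - a')), Y) (1, 0))) (Icc 0 1) t := by
        intro t ht
        have hline : ∀ c d : ℝ, HasDerivAt (fun t : ℝ => c + t * d) d t := fun c d => by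
          simpa using ((hasDerivAt_id t).mul_const d).const_add c
        have h1 := (hcutd _ (hpt a b ha hb t ht) X hX).scomp t (hline a (b - a))
        have h2 := (hcutd _ (hpt a' b' ha' hb' t ht) Y hY).scomp t (hline a' (b' - a'))
        have h3 := (h1.sub h2).hasDerivWithinAt (s := Icc 0 1)
        refine h3.congr_deriv ?_
        rw [smul_sub, ← hab]
      have hbound : ∀ t ∈ Ico (0:ℝ) 1,
          ‖(b - a) • (fderiv ℝ D (clip (a + t * (b - a)), X) (1, 0) -
            fderiv ℝ D (clip (a' + t * (b' - a')), Y) (1, 0))‖ ≤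
            C₂ * (|b - a| * (|a - a'| + ‖X - Y‖)) := by
        intro t ht
        have ht' : t ∈ Icc (0:ℝ) 1 := ⟨ht.1, ht.2.le⟩
        have m1 := hmem _ (hclip' _ (hpt a b ha hb t ht')) X hX _ le2
        have m2 := hmem _ (hclip' _ (hpt a' b' ha' hb' t ht')) Y hY _ le2
        have e1 : ‖((1, 0) : ℝ × E)‖ = 1 := by simp [Prod.norm_def]
        have e2 := hL _ m1 _ m2
        have e3 : ‖((clip (a + t * (b - a)), X) - (clip (a' + t * (b' - a')), Y) : ℝ × E)‖ ≤
            |a - a'| + ‖X - Y‖ := by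
          have h1 := hclip (a + t * (b - a)) (a' + t * (b' - a'))
          have h2 : a + t * (b - a) - (a' + t * (b' - a')) = a - a' := by rw [hab]; ring
          rw [h2] at h1
          simp only [Prod.norm_def, Prod.fst_sub, Prod.snd_sub, Real.norm_eq_abs]
          exact max_le (by linarith [norm_nonneg (X - Y)]) (by linarith [abs_nonneg (a - a')])
        rw [norm_smul, Real.norm_eq_abs, ← sub_apply]
        have e4 := ContinuousLinearMap.le_opNorm (fderiv ℝ D (clip (a + t * (b - a)), X) -
          fderiv ℝ D (clip (a' + t * (b' - a')), Y)) (1, 0)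
        rw [e1, mul_one] at e4
        have e5 := e4.trans (e2.trans (mul_le_mul_of_nonneg_left e3 hC₂))
        calc _ ≤ |b - a| * (C₂ * (|a - a'| + ‖X - Y‖)) := by gcongr
          _ = _ := by ring
      have := norm_image_sub_le_of_norm_deriv_le_segment_01' hder hbound
      simp only [one_mul, zero_mul, add_zero, add_sub_cancel] at this
      convert this using 2
      abel
    rw [hG, hG, hG, hG]
    calc _ = ‖(R (b, X) - R (a, X) - (R (b', Y) - R (a', Y))) +
          (cut (b, X) - cut (a, X) - (cut (b', Y) - cut (a', Y)))‖ := by congr 1; abel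
      _ ≤ _ := (norm_add_le _ _).trans (by linarith)

end Abstract

end SteadyEuler
end

/-! ### Wave curves with Lipschitz derivative: strict differentiability and change of parameter. -/

noncomputable section
namespace SteadyEuler

open Set Filter Topology Metric

section Abstract

variable {E : Type*} [NormedAddCommGroup E] [NormedSpace ℝ E]
  {G : ℝ × E → E} {X₀ g₀ : E} {C ε : ℝ}

/-- `master` moves the increment from (σ', Y) to (0, X₀) at the cost C|σ - σ'|(|σ'| + ‖Y - X₀‖);
there differentiability at the single point 0 suffices. -/
lemma WaveCurve.strict (h : WaveCurve G X₀ g₀ C ε) {η : ℝ} (hη : 0 < η) :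
    ∃ ε' > 0, ε' ≤ ε ∧ ∀ σ σ' : ℝ, |σ| < ε' → |σ'| < ε' → ∀ Y ∈ ball X₀ ε',
      ‖G (σ, Y) - G (σ', Y) - (σ - σ') • g₀‖ ≤ η * |σ - σ'| := by
  have hC := h.nonneg
  have hε := h.pos
  have h1 := (hasDerivAt_iff_isLittleO.1 h.deriv).def (half_pos hη)
  obtain ⟨e, he, hb⟩ := Metric.eventually_nhds_iff_ball.1 h1
  have hz : G (0, X₀) = 0 := h.zero X₀ (mem_ball_self hε)
  refine ⟨min (min e ε / 2) (η / (4 * (C + 1))), by positivity, ?_, fun σ σ' hσ hσ' Y hY => ?_⟩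
  · exact (min_le_left _ _).trans (by linarith [min_le_right e ε])
  have l1 : min (min e ε / 2) (η / (4 * (C + 1))) ≤ min e ε / 2 := min_le_left _ _
  have l2 : min (min e ε / 2) (η / (4 * (C + 1))) ≤ η / (4 * (C + 1)) := min_le_right _ _
  have l3 := min_le_left e ε
  have l4 := min_le_right e ε
  have hd : |σ - σ'| < min e ε := by
    have := abs_sub σ σ'; linarith
  have hdb : σ - σ' ∈ ball (0:ℝ) e := by simpa using hd.trans_le l3
  have k1 := hb _ hdb
  simp only [hz, sub_zero, Real.norm_eq_abs] at k1
  have hY' : Y ∈ ball X₀ ε := ball_subset_ball (by linarith) hY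
  have k2 := h.master σ' σ 0 (σ - σ') (by linarith) (by linarith) (by simpa using hε)
    (by linarith) (by ring) Y hY' X₀ (mem_ball_self hε)
  rw [hz, sub_zero, sub_zero] at k2
  have hYn : ‖Y - X₀‖ < η / (4 * (C + 1)) := (mem_ball_iff_norm.1 hY).trans_le l2
  have hs : |σ'| < η / (4 * (C + 1)) := hσ'.trans_le l2
  have k3 : C * (|σ'| + ‖Y - X₀‖) ≤ η / 2 := by
    have : C * (|σ'| + ‖Y - X₀‖) ≤ (C + 1) * (η / (4 * (C + 1)) + η / (4 * (C + 1))) := by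
      gcongr; linarith
    refine this.trans (le_of_eq ?_)
    field_simp; ring
  have e1 : G (σ, Y) - G (σ', Y) - (σ - σ') • g₀ =
      (G (σ, Y) - G (σ', Y) - G (σ - σ', X₀)) + (G (σ - σ', X₀) - (σ - σ') • g₀) := by abel
  rw [e1]
  refine (norm_add_le _ _).trans ?_
  nlinarith [mul_le_mul_of_nonneg_right k3 (abs_nonneg (σ - σ'))]

/-- For the change of state, `master` is used from the common parameter zero, where G vanishes; for
the change of parameter, strict differentiability. The factor |σ| in front of ‖X - Y‖ is what makes
interaction errors quadratic. -/
lemma WaveCurve.lip (h : WaveCurve G X₀ g₀ C ε) :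
    ∃ C' ε' : ℝ, 0 < ε' ∧ ε' ≤ ε ∧ 0 ≤ C' ∧ ∀ σ σ' : ℝ, |σ| < ε' → |σ'| < ε' →
      ∀ X ∈ ball X₀ ε', ∀ Y ∈ ball X₀ ε',
      ‖G (σ, X) - G (σ', Y)‖ ≤ C' * (|σ - σ'| + |σ| * ‖X - Y‖) := by
  obtain ⟨ε', hε', hle, hs⟩ := h.strict one_pos
  refine ⟨C + (1 + ‖g₀‖), ε', hε', hle, by have := h.nonneg; positivity,
    fun σ σ' hσ hσ' X hX Y hY => ?_⟩
  have hX' := ball_subset_ball hle hX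
  have hY' := ball_subset_ball hle hY
  have k1 := h.master 0 σ 0 σ (by simpa using h.pos) (hσ.trans_le hle) (by simpa using h.pos)
    (hσ.trans_le hle) rfl X hX' Y hY'
  rw [h.zero X hX', h.zero Y hY'] at k1
  simp only [sub_zero, sub_self, abs_zero, zero_add] at k1
  have k2 := hs σ σ' hσ hσ' Y hY
  have k3 : ‖G (σ, Y) - G (σ', Y)‖ ≤ (1 + ‖g₀‖) * |σ - σ'| := by
    have : G (σ, Y) - G (σ', Y) =
      (G (σ, Y) - G (σ', Y) - (σ - σ') • g₀) + (σ - σ') • g₀ := by abel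
    rw [this]
    refine (norm_add_le _ _).trans ?_
    rw [norm_smul, Real.norm_eq_abs]; nlinarith
  have : G (σ, X) - G (σ', Y) = (G (σ, X) - G (σ, Y)) + (G (σ, Y) - G (σ', Y)) := by abel
  rw [this]
  refine (norm_add_le _ _).trans ?_
  have a1 := h.nonneg
  have a2 : 0 ≤ |σ| * ‖X - Y‖ := by positivity
  have a3 : 0 ≤ |σ - σ'| := abs_nonneg _
  nlinarith [norm_nonneg g₀, mul_nonneg (norm_nonneg g₀) a2, mul_nonneg a1 a3]

/-- The chain rule in strict form. It is needed for λ_j, to change the parameter, and for the flow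
angle, to separate the two acoustic families. -/
lemma WaveCurve.strict_comp (h : WaveCurve G X₀ g₀ C ε) {Λ : E → ℝ} {L : E →L[ℝ] ℝ}
    (hΛ : HasStrictFDerivAt Λ L X₀) {η : ℝ} (hη : 0 < η) :
    ∃ ε' > 0, ε' ≤ ε ∧ ∀ σ σ' : ℝ, |σ| < ε' → |σ'| < ε' → ∀ Y ∈ ball X₀ ε',
      |Λ (Y + G (σ, Y)) - Λ (Y + G (σ', Y)) - L g₀ * (σ - σ')| ≤ η * |σ - σ'| := by
  obtain ⟨C₁, ε₁, hε₁, hle₁, hC₁, hl⟩ := h.lip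
  set B := ‖g₀‖ + 1
  have hB : 0 < B := by positivity
  obtain ⟨e, he, hΛ'⟩ : ∃ e > 0, ∀ p ∈ ball X₀ e, ∀ q ∈ ball X₀ e,
      ‖Λ p - Λ q - L (p - q)‖ ≤ (η / (2 * B)) * ‖p - q‖ := by
    have := hΛ.isLittleO.def (by positivity : 0 < η / (2 * B))
    obtain ⟨e, he, hb⟩ := Metric.eventually_nhds_iff_ball.1 this
    refine ⟨e, he, fun p hp q hq => hb (p, q) ?_⟩
    rw [← ball_prod_same]; exact ⟨hp, hq⟩
  have hη' : 0 < min 1 (η / (2 * (‖L‖ + 1))) := by positivity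
  obtain ⟨ε₂, hε₂, hle₂, hs⟩ := h.strict hη'
  refine ⟨min (min ε₁ ε₂) (e / (2 * (C₁ + 1))), by positivity,
    (min_le_left _ _).trans ((min_le_left _ _).trans hle₁), fun σ σ' hσ hσ' Y hY => ?_⟩
  set ε' := min (min ε₁ ε₂) (e / (2 * (C₁ + 1)))
  have l1 : ε' ≤ ε₁ := (min_le_left _ _).trans (min_le_left _ _)
  have l2 : ε' ≤ ε₂ := (min_le_left _ _).trans (min_le_right _ _)
  have l3 : ε' ≤ e / (2 * (C₁ + 1)) := min_le_right _ _
  have hε'pos : 0 < ε' := (abs_nonneg σ).trans_lt hσ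
  have hmem : ∀ τ : ℝ, |τ| < ε' → Y + G (τ, Y) ∈ ball X₀ e := fun τ hτ => by
    have k := hl τ 0 (hτ.trans_le l1) (by simpa using hε'pos.trans_le l1) Y
      (ball_subset_ball l1 hY) Y (ball_subset_ball l1 hY)
    rw [h.zero Y (ball_subset_ball (l1.trans hle₁) hY)] at k
    simp only [sub_zero, sub_self, norm_zero, mul_zero, add_zero] at k
    rw [mem_ball_iff_norm]
    have e1 : Y + G (τ, Y) - X₀ = (Y - X₀) + G (τ, Y) := by abel
    rw [e1]
    refine (norm_add_le _ _).trans_lt ?_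
    have k2 := mem_ball_iff_norm.1 hY
    have k3 : ε' * (2 * (C₁ + 1)) ≤ e := (le_div_iff₀ (by positivity)).1 l3
    nlinarith [mul_le_mul_of_nonneg_left hτ.le hC₁]
  have k1 := hΛ' _ (hmem σ hσ) _ (hmem σ' hσ')
  have k2 := hs σ σ' (hσ.trans_le l2) (hσ'.trans_le l2) Y (ball_subset_ball l2 hY)
  rw [add_sub_add_left_eq_sub] at k1
  set Δ := G (σ, Y) - G (σ', Y)
  clear_value Δ
  have k3 : ‖Δ‖ ≤ B * |σ - σ'| := by
    have : Δ = (Δ - (σ - σ') • g₀) + (σ - σ') • g₀ := by abel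
    rw [this]
    refine (norm_add_le _ _).trans ?_
    rw [norm_smul, Real.norm_eq_abs]
    have : min 1 (η / (2 * (‖L‖ + 1))) * |σ - σ'| ≤ 1 * |σ - σ'| := by
      gcongr; exact min_le_left _ _
    simp only [B]
    linarith
  have k4 : |L Δ - L g₀ * (σ - σ')| ≤ η / 2 * |σ - σ'| := by
    have : L Δ - L g₀ * (σ - σ') = L (Δ - (σ - σ') • g₀) := by
      rw [map_sub, map_smul, smul_eq_mul, mul_comm]
    rw [this, ← Real.norm_eq_abs]
    refine (L.le_opNorm _).trans ?_
    calc ‖L‖ * ‖Δ - (σ - σ') • g₀‖ ≤ (‖L‖ + 1) * (η / (2 * (‖L‖ + 1)) * |σ - σ'|) := by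
          gcongr
          · linarith
          · exact k2.trans (by gcongr; exact min_le_right _ _)
      _ = _ := by field_simp
  have k5 : η / (2 * B) * ‖Δ‖ ≤ η / 2 * |σ - σ'| := by
    calc _ ≤ η / (2 * B) * (B * |σ - σ'|) := by gcongr
      _ = _ := by field_simp
  rw [Real.norm_eq_abs] at k1
  have e1 : Λ (Y + G (σ, Y)) - Λ (Y + G (σ', Y)) - L g₀ * (σ - σ') =
      (Λ (Y + G (σ, Y)) - Λ (Y + G (σ', Y)) - L Δ) + (L Δ - L g₀ * (σ - σ')) := by ring
  rw [e1]
  refine (abs_add_le _ _).trans ?_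
  linarith

/-- Lipschitz properties of a wave curve and of its parametrization by the increment of `Λ`. -/
structure RegularFamily (G : ℝ × E → E) (Λ : E → ℝ) (X₀ : E) (C ε : ℝ) : Prop where
  pos : 0 < ε
  one_le : 1 ≤ C
  zero : ∀ X ∈ ball X₀ ε, G (0, X) = 0
  lip : ∀ σ σ' : ℝ, |σ| < ε → |σ'| < ε → ∀ X ∈ ball X₀ ε, ∀ Y ∈ ball X₀ ε,
    ‖G (σ, X) - G (σ', Y)‖ ≤ C * (|σ - σ'| + |σ| * ‖X - Y‖)
  merge : ∀ σ τ : ℝ, |σ| < ε → |τ| < ε → |σ + τ| < ε → ∀ X ∈ ball X₀ ε,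
    X + G (σ, X) ∈ ball X₀ ε →
    ‖G (σ + τ, X) - G (σ, X) - G (τ, X + G (σ, X))‖ ≤ C * (|σ| * |τ|)
  param : ∀ σ σ' : ℝ, |σ| < ε → |σ'| < ε → ∀ X ∈ ball X₀ ε, ∀ Y ∈ ball X₀ ε,
    |σ - σ'| ≤ C * (|(Λ (X + G (σ, X)) - Λ X) - (Λ (Y + G (σ', Y)) - Λ Y)| + |σ| * ‖X - Y‖)
  param' : ∀ σ σ' : ℝ, |σ| < ε → |σ'| < ε → ∀ X ∈ ball X₀ ε, ∀ Y ∈ ball X₀ ε,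
    |(Λ (X + G (σ, X)) - Λ X) - (Λ (Y + G (σ', Y)) - Λ Y)| ≤ C * (|σ - σ'| + |σ| * ‖X - Y‖)

lemma RegularFamily.mono {Λ : E → ℝ} {C' ε' : ℝ} (h : RegularFamily G Λ X₀ C ε)
    (hC : C ≤ C') (hε' : 0 < ε') (hε : ε' ≤ ε) : RegularFamily G Λ X₀ C' ε' where
  pos := hε'
  one_le := h.one_le.trans hC
  zero X hX := h.zero X (ball_subset_ball hε hX)
  lip σ σ' h1 h2 X hX Y hY := (h.lip σ σ' (h1.trans_le hε) (h2.trans_le hε) X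
    (ball_subset_ball hε hX) Y (ball_subset_ball hε hY)).trans (by gcongr)
  merge σ τ h1 h2 h3 X hX hY := (h.merge σ τ (h1.trans_le hε) (h2.trans_le hε) (h3.trans_le hε) X
    (ball_subset_ball hε hX) (ball_subset_ball hε hY)).trans (by gcongr)
  param σ σ' h1 h2 X hX Y hY := (h.param σ σ' (h1.trans_le hε) (h2.trans_le hε) X
    (ball_subset_ball hε hX) Y (ball_subset_ball hε hY)).trans (by gcongr)
  param' σ σ' h1 h2 X hX Y hY := (h.param' σ σ' (h1.trans_le hε) (h2.trans_le hε) X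
    (ball_subset_ball hε hX) Y (ball_subset_ball hε hY)).trans (by gcongr)

/-- At a fixed state the increment of Λ is κσ up to half its size (`hpar`), and the second
difference of Λ bounds its dependence on the state by |σ|‖X - Y‖ (`hstate`). The two together allow
σ and the increment of Λ to be exchanged. -/
lemma WaveCurve.exists_regularFamily (h : WaveCurve G X₀ g₀ C ε) {Λ : E → ℝ}
    (hΛ : ContDiffAt ℝ 2 Λ X₀) (hκ : fderiv ℝ Λ X₀ g₀ ≠ 0) :
    ∃ C' ε' : ℝ, RegularFamily G Λ X₀ C' ε' := by
  set κ := fderiv ℝ Λ X₀ g₀ with hκdef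
  have hκ0 : 0 < |κ| := abs_pos.2 hκ
  obtain ⟨C₁, ε₁, hε₁, hle₁, hC₁, hl⟩ := h.lip
  obtain ⟨C₂, ε₂, hε₂, hC₂, hsd⟩ := second_difference hΛ
  obtain ⟨ε₃, hε₃, hle₃, hst⟩ := h.strict_comp (hΛ.hasStrictFDerivAt (by norm_num))
    (half_pos hκ0)
  set e := min (min ε₁ ε₃) (min 1 (ε₂ / (2 * (C₁ + 1)))) with he
  have he0 : 0 < e := by positivity
  have l1 : e ≤ ε₁ := (min_le_left _ _).trans (min_le_left _ _)
  have l3 : e ≤ ε₃ := (min_le_left _ _).trans (min_le_right _ _)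
  have l4 : e ≤ 1 := (min_le_right _ _).trans (min_le_left _ _)
  have l2 : e ≤ ε₂ / (2 * (C₁ + 1)) := (min_le_right _ _).trans (min_le_right _ _)
  have l2' : e * (2 * (C₁ + 1)) ≤ ε₂ := (le_div_iff₀ (by positivity)).1 l2
  have l2'' : e ≤ ε₂ := by nlinarith
  have l0 : e ≤ ε := l1.trans hle₁
  have hsmall : ∀ σ : ℝ, |σ| < e → ∀ X ∈ ball X₀ e, ‖G (σ, X)‖ ≤ C₁ * |σ| := fun σ hσ X hX => by
    have k := hl σ 0 (hσ.trans_le l1) (by simpa using he0.trans_le l1) X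
      (ball_subset_ball l1 hX) X (ball_subset_ball l1 hX)
    rw [h.zero X (ball_subset_ball l0 hX)] at k
    simpa using k
  have hmem : ∀ σ : ℝ, |σ| < e → ∀ X ∈ ball X₀ e, X + G (σ, X) ∈ ball X₀ ε₂ := fun σ hσ X hX => by
    rw [mem_ball_iff_norm]
    have e1 : X + G (σ, X) - X₀ = (X - X₀) + G (σ, X) := by abel
    rw [e1]
    refine (norm_add_le _ _).trans_lt ?_
    have k2 := mem_ball_iff_norm.1 hX
    have k3 := hsmall σ hσ X hX
    nlinarith [mul_le_mul_of_nonneg_left hσ.le hC₁]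
  set A : ℝ → E → ℝ := fun σ X => Λ (X + G (σ, X)) - Λ X with hA
  set M := C₂ * (C₁ + (1 + C₁) * C₁) with hM
  have hM0 : 0 ≤ M := by positivity
  -- dependence on the state
  have hstate : ∀ σ : ℝ, |σ| < e → ∀ X ∈ ball X₀ e, ∀ Y ∈ ball X₀ e,
      |A σ X - A σ Y| ≤ M * (|σ| * ‖X - Y‖) := fun σ hσ X hX Y hY => by
    have k := hsd _ (hmem σ hσ X hX) X (ball_subset_ball l2'' hX) _ (hmem σ hσ Y hY) Y
      (ball_subset_ball l2'' hY)
    have k1 := hl σ σ (hσ.trans_le l1) (hσ.trans_le l1) X (ball_subset_ball l1 hX) Y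
      (ball_subset_ball l1 hY)
    simp only [sub_self, abs_zero, zero_add] at k1
    simp only [add_sub_cancel_left, Real.norm_eq_abs] at k
    have k2 := hsmall σ hσ X hX
    have k3 : ‖X + G (σ, X) - (Y + G (σ, Y))‖ ≤ (1 + C₁) * ‖X - Y‖ := by
      have e1 : X + G (σ, X) - (Y + G (σ, Y)) = (X - Y) + (G (σ, X) - G (σ, Y)) := by abel
      rw [e1]
      refine (norm_add_le _ _).trans ?_
      have : |σ| * ‖X - Y‖ ≤ 1 * ‖X - Y‖ := by gcongr; linarith
      nlinarith
    calc |A σ X - A σ Y| ≤ _ := k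
      _ ≤ C₂ * (C₁ * (|σ| * ‖X - Y‖) + (1 + C₁) * ‖X - Y‖ * (C₁ * |σ|)) := by gcongr
      _ = _ := by simp only [hM]; ring
  have hpar : ∀ σ σ' : ℝ, |σ| < e → |σ'| < e → ∀ Y ∈ ball X₀ e,
      |A σ Y - A σ' Y - κ * (σ - σ')| ≤ |κ| / 2 * |σ - σ'| := fun σ σ' h1 h2 Y hY => by
    have := hst σ σ' (h1.trans_le l3) (h2.trans_le l3) Y (ball_subset_ball l3 hY)
    have e1 : A σ Y - A σ' Y = Λ (Y + G (σ, Y)) - Λ (Y + G (σ', Y)) := by simp only [hA]; ring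
    rwa [e1]
  refine ⟨max (max 1 C₁) (max (C * (1 + C₁)) (max ((2 / |κ|) * (1 + M)) (2 * |κ| + M))), e, he0,
    (le_max_left _ _).trans (le_max_left _ _), fun X hX => h.zero X (ball_subset_ball l0 hX),
    fun σ σ' h1 h2 X hX Y hY => ?_, fun σ τ h1 h2 h3 X hX hY => ?_,
    fun σ σ' h1 h2 X hX Y hY => ?_, fun σ σ' h1 h2 X hX Y hY => ?_⟩
  · refine (hl σ σ' (h1.trans_le l1) (h2.trans_le l1) X (ball_subset_ball l1 hX) Y
      (ball_subset_ball l1 hY)).trans ?_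
    gcongr
    exact (le_max_right _ _).trans (le_max_left _ _)
  · have hY' := ball_subset_ball l0 hY
    have k := h.master σ (σ + τ) 0 τ (h1.trans_le l0) (h3.trans_le l0) (by simpa using h.pos)
      (h2.trans_le l0) (by ring) X (ball_subset_ball l0 hX) _ hY'
    rw [h.zero _ hY'] at k
    simp only [sub_zero, add_sub_cancel_left, sub_add_cancel_left, norm_neg] at k
    have k1 := hsmall σ h1 X hX
    calc _ ≤ C * (|τ| * (|σ| + ‖G (σ, X)‖)) := k
      _ ≤ C * (|τ| * (|σ| + C₁ * |σ|)) := by have := h.nonneg; gcongr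
      _ = (C * (1 + C₁)) * (|σ| * |τ|) := by ring
      _ ≤ _ := by
        gcongr
        exact (le_max_left _ _).trans (le_max_right _ _)
  · have k1 := hpar σ σ' h1 h2 Y hY
    have k2 := hstate σ h1 X hX Y hY
    set q := |A σ X - A σ' Y| with hq
    have k3 : |κ| / 2 * |σ - σ'| ≤ q + M * (|σ| * ‖X - Y‖) := by
      have e1 : κ * (σ - σ') = -(A σ Y - A σ' Y - κ * (σ - σ')) +
        ((A σ X - A σ' Y) - (A σ X - A σ Y)) := by ring
      have e2 : |κ * (σ - σ')| ≤ |κ| / 2 * |σ - σ'| + (q + M * (|σ| * ‖X - Y‖)) := by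
        rw [e1]
        refine (abs_add_le _ _).trans ?_
        rw [abs_neg]
        have := abs_sub (A σ X - A σ' Y) (A σ X - A σ Y)
        linarith
      rw [abs_mul] at e2
      linarith
    have hq0 : 0 ≤ q := abs_nonneg _
    have hz : 0 ≤ |σ| * ‖X - Y‖ := by positivity
    calc |σ - σ'| = 2 / |κ| * (|κ| / 2 * |σ - σ'|) := by field_simp
      _ ≤ 2 / |κ| * ((1 + M) * (q + |σ| * ‖X - Y‖)) :=
        mul_le_mul_of_nonneg_left (by nlinarith) (by positivity)
      _ = ((2 / |κ|) * (1 + M)) * (q + |σ| * ‖X - Y‖) := by ring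
      _ ≤ _ := by
        gcongr
        exact ((le_max_left _ _).trans (le_max_right _ _)).trans (le_max_right _ _)
  · have k1 := hpar σ σ' h1 h2 Y hY
    have k2 := hstate σ h1 X hX Y hY
    have hz : 0 ≤ |σ| * ‖X - Y‖ := by positivity
    have hz' : 0 ≤ |σ - σ'| := abs_nonneg _
    have e1 : A σ X - A σ' Y = (A σ X - A σ Y) + ((A σ Y - A σ' Y - κ * (σ - σ')) + κ * (σ - σ')) := by
      ring
    calc |A σ X - A σ' Y| ≤ M * (|σ| * ‖X - Y‖) + (|κ| / 2 * |σ - σ'| + |κ| * |σ - σ'|) := by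
          rw [e1]
          refine (abs_add_le _ _).trans (add_le_add k2 ((abs_add_le _ _).trans ?_))
          rw [abs_mul κ]; linarith
      _ ≤ (2 * |κ| + M) * (|σ - σ'| + |σ| * ‖X - Y‖) := by
        nlinarith [mul_nonneg hκ0.le hz', mul_nonneg hM0 hz', mul_nonneg hκ0.le hz]
      _ ≤ _ := by
        gcongr
        exact ((le_max_right _ _).trans (le_max_right _ _)).trans (le_max_right _ _)

end Abstract

end SteadyEuler
end

noncomputable section
namespace SteadyEuler

open Set Filter Topology Metric

/-! ## Smoothness of the wave curves in logarithmic coordinates -/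

section Smooth

variable {γ : ℝ} {X₀ : LogState}

lemma contDiff_logMach (γ : ℝ) {n : WithTop ℕ∞} : ContDiff ℝ n (logMach γ) := by
  unfold logMach; fun_prop

lemma contDiffAt_prandtlMeyer {m : ℝ} (hm : 1 < m) {n : WithTop ℕ∞} :
    ContDiffAt ℝ n (prandtlMeyer γ) m := by
  have h : ContDiffAt ℝ n (fun m : ℝ => √(m - 1)) m :=
    (contDiffAt_id.sub contDiffAt_const).sqrt (by simp; linarith)
  exact (contDiffAt_const.mul (Real.contDiff_arctan.contDiffAt.comp m (h.div_const _))).sub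
    (Real.contDiff_arctan.contDiffAt.comp m h)

lemma contDiffAt_speedInc {n : WithTop ℕ∞} {E : Type*} [NormedAddCommGroup E] [NormedSpace ℝ E]
    {f g : E → ℝ} {x : E} (hf : ContDiffAt ℝ n f x) (hg : ContDiffAt ℝ n g x) (hγ : 1 < γ)
    (h1 : f x ≠ 0) (h2 : g x = 1) : ContDiffAt ℝ n (fun x => speedInc γ (f x) (g x)) x := by
  unfold speedInc
  refine ContDiffAt.div_const (ContDiffAt.log (contDiffAt_const.add
    ((contDiffAt_const.div (contDiffAt_const.mul hf) ?_).mul (contDiffAt_const.sub hg))) ?_) _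
  · exact mul_ne_zero (by linarith) h1
  · simp [h2]

lemma shockDens_one (hγ : 1 < γ) : shockDens γ 1 = 1 := by
  have : (γ + 1) * 1 + (γ - 1) = (γ - 1) * 1 + (γ + 1) := by ring
  rw [shockDens, this, div_self (by linarith)]

/-- At parameter zero the radicand in `shockTan` equals M² - 1, which is positive, so the root is
smooth there. -/
lemma contDiffAt_shockInc (hγ : 1 < γ) (sg : ℝ) (hm : 1 < logMach γ X₀) {n : WithTop ℕ∞} :
    ContDiffAt ℝ n (shockInc γ sg) (0, X₀) := by
  have cM : ContDiffAt ℝ n (fun w : ℝ × LogState => logMach γ w.2) (0, X₀) :=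
    ((contDiff_logMach γ).comp contDiff_snd).contDiffAt
  have cx : ContDiffAt ℝ n (fun w : ℝ × LogState => Real.exp w.1) (0, X₀) :=
    contDiff_fst.exp.contDiffAt
  have cN : ContDiffAt ℝ n (fun w : ℝ × LogState => shockDens γ (Real.exp w.1)) (0, X₀) := by
    unfold shockDens
    refine ((contDiffAt_const.mul cx).add contDiffAt_const).div
      ((contDiffAt_const.mul cx).add contDiffAt_const) ?_
    simp; linarith
  have clN : ContDiffAt ℝ n (fun w : ℝ × LogState => Real.log (shockDens γ (Real.exp w.1)))
      (0, X₀) := cN.log (by simp [shockDens_one hγ])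
  have ct : ContDiffAt ℝ n (fun w : ℝ × LogState => shockTan γ (logMach γ w.2) (Real.exp w.1))
      (0, X₀) := by
    unfold shockTan
    refine ((cx.sub contDiffAt_const).div ((contDiffAt_const.mul cM).sub
      (cx.sub contDiffAt_const)) ?_).mul (ContDiffAt.sqrt (ContDiffAt.div ?_
        ((contDiffAt_const.mul cx).add contDiffAt_const) ?_) ?_)
    · simp; exact ⟨by linarith, by linarith⟩
    · exact ((contDiffAt_const.mul cM).sub contDiffAt_const).sub (contDiffAt_const.mul cx)
    · simp; linarith
    · simp only [Real.exp_zero]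
      refine (div_pos ?_ (by linarith)).ne'
      nlinarith
  unfold shockInc
  refine contDiffAt_fst.prodMk (ContDiffAt.prodMk (contDiffAt_const.mul
    (Real.contDiff_arctan.contDiffAt.comp _ ct))
    (ContDiffAt.prodMk ?_ clN))
  exact contDiffAt_speedInc cM (contDiffAt_fst.sub clN).exp hγ (by simp; linarith)
    (by simp [shockDens_one hγ])

lemma contDiffAt_rarefInc (hγ : 1 < γ) (sg : ℝ) (hm : 1 < logMach γ X₀) {n : WithTop ℕ∞} :
    ContDiffAt ℝ n (rarefInc γ sg) (0, X₀) := by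
  have cM : ContDiffAt ℝ n (fun w : ℝ × LogState => logMach γ w.2) (0, X₀) :=
    ((contDiff_logMach γ).comp contDiff_snd).contDiffAt
  have cr : ContDiffAt ℝ n (fun w : ℝ × LogState => Real.exp (w.1 - w.1 / γ)) (0, X₀) :=
    (contDiff_fst.sub (contDiff_fst.div_const _)).exp.contDiffAt
  have cM' : ContDiffAt ℝ n (fun w : ℝ × LogState => logMach γ w.2 *
        (1 + 2 / ((γ - 1) * logMach γ w.2) * (1 - Real.exp (w.1 - w.1 / γ))) /
          Real.exp (w.1 - w.1 / γ)) (0, X₀) := by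
    refine (cM.mul (contDiffAt_const.add ((contDiffAt_const.div (contDiffAt_const.mul cM) ?_).mul
      (contDiffAt_const.sub cr)))).div cr (Real.exp_pos _).ne'
    exact mul_ne_zero (by linarith) (by simp; linarith)
  unfold rarefInc
  refine contDiffAt_fst.prodMk (ContDiffAt.prodMk (contDiffAt_const.mul
    (ContDiffAt.sub ?_ ?_)) (ContDiffAt.prodMk ?_ (contDiffAt_fst.div_const _)))
  · exact (contDiffAt_prandtlMeyer (γ := γ) hm).comp (0, X₀) cM
  · exact ContDiffAt.comp (g := prandtlMeyer γ) (0, X₀)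
      (contDiffAt_prandtlMeyer (by simpa using hm)) cM'
  · exact contDiffAt_speedInc cM cr hγ (by simp; linarith) (by simp)

lemma shockInc_zero (hγ : 1 < γ) (sg : ℝ) (X : LogState) : shockInc γ sg (0, X) = 0 := by
  simp [shockInc, shockDens_one hγ, shockTan, speedInc]

lemma rarefInc_zero (sg : ℝ) (X : LogState) : rarefInc γ sg (0, X) = 0 := by
  simp [rarefInc, speedInc]

/-- The derivative of the acoustic wave curves at wave parameter zero. -/
def acousticDir (γ sg : ℝ) (X : LogState) : LogState :=
  (1, sg * (√(logMach γ X - 1) / (γ * logMach γ X)), -(1 / (γ * logMach γ X)), 1 / γ)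

lemma hasDerivAt_speedInc {m : ℝ} {r : ℝ → ℝ} (hγ : 1 < γ) (hm : 1 < m) (h0 : r 0 = 1)
    (hr : HasDerivAt r (1 - 1 / γ) 0) :
    HasDerivAt (fun σ => speedInc γ m (r σ)) (-(1 / (γ * m))) 0 := by
  have h1 := ((((hr.const_sub 1).const_mul (2 / ((γ - 1) * m))).const_add 1).log
    (by simp [h0])).div_const 2
  refine h1.congr_deriv ?_
  have : γ - 1 ≠ 0 := by linarith
  simp only [h0, sub_self, mul_zero, add_zero, div_one]
  field_simp

/-- Together with `hasDerivAt_rarefInc`: both branches leave X in the direction `acousticDir`. This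
first-order contact is all that the gluing requires. -/
lemma hasDerivAt_shockInc (hγ : 1 < γ) (sg : ℝ) {X : LogState} (hm : 1 < logMach γ X) :
    HasDerivAt (fun σ => shockInc γ sg (σ, X)) (acousticDir γ sg X) 0 := by
  set m := logMach γ X
  have hγ0 : γ ≠ 0 := by linarith
  have hx : HasDerivAt (fun σ : ℝ => Real.exp σ) 1 0 := by simpa using Real.hasDerivAt_exp 0
  have hN : HasDerivAt (fun σ : ℝ => shockDens γ (Real.exp σ)) (1 / γ) 0 := by
    unfold shockDens
    refine (((hx.const_mul (γ + 1)).add_const (γ - 1)).div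
      ((hx.const_mul (γ - 1)).add_const (γ + 1)) (by simp; linarith)).congr_deriv ?_
    simp only [Real.exp_zero]
    have e : (γ - 1) * 1 + (γ + 1) = 2 * γ := by ring
    rw [e]
    field_simp
    ring
  have hlN : HasDerivAt (fun σ : ℝ => Real.log (shockDens γ (Real.exp σ))) (1 / γ) 0 := by
    refine (hN.log (by simp [shockDens_one hγ])).congr_deriv ?_
    simp [shockDens_one hγ]
  have ht : HasDerivAt (fun σ : ℝ => shockTan γ m (Real.exp σ)) (√(m - 1) / (γ * m)) 0 := by
    unfold shockTan
    -- The factor x - 1 vanishes at σ = 0, so the derivative of the root drops out of the product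
    -- rule and only its existence matters.
    have hB : DifferentiableAt ℝ (fun σ : ℝ => √((2 * γ * m - (γ - 1) - (γ + 1) * Real.exp σ) /
        ((γ + 1) * Real.exp σ + (γ - 1)))) 0 := by
      refine DifferentiableAt.sqrt (DifferentiableAt.div (by fun_prop) (by fun_prop) ?_) ?_
      · simp; linarith
      · simp only [Real.exp_zero]
        refine (div_pos ?_ (by linarith)).ne'
        nlinarith
    refine (((hx.sub_const 1).div ((hx.sub_const 1).const_sub (γ * m)) ?_).mul
      hB.hasDerivAt).congr_deriv ?_
    · simp; exact ⟨by linarith, by linarith⟩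
    · simp only [Pi.div_apply, Real.exp_zero, sub_self, zero_div, zero_mul, add_zero, sub_zero,
        one_mul]
      have e : (2 * γ * m - (γ - 1) - (γ + 1) * 1) / ((γ + 1) * 1 + (γ - 1)) = m - 1 := by
        have e : (γ + 1) * 1 + (γ - 1) = 2 * γ := by ring
        rw [e]
        field_simp; ring
      rw [e]
      field_simp
  have hr : HasDerivAt (fun σ : ℝ => Real.exp (σ - Real.log (shockDens γ (Real.exp σ))))
      (1 - 1 / γ) 0 := by
    refine ((hasDerivAt_id (0 : ℝ)).sub hlN).exp.congr_deriv ?_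
    simp [shockDens_one hγ]
  have hth := ht.arctan.const_mul sg
  simp only [Real.exp_zero] at hth
  have e0 : shockTan γ m 1 = 0 := by simp [shockTan]
  rw [e0] at hth
  have hth' : HasDerivAt (fun σ : ℝ => sg * Real.arctan (shockTan γ m (Real.exp σ)))
      (sg * (√(m - 1) / (γ * m))) 0 := hth.congr_deriv (by simp)
  exact (hasDerivAt_id (0 : ℝ)).prodMk (hth'.prodMk
    ((hasDerivAt_speedInc hγ hm (by simp [shockDens_one hγ]) hr).prodMk hlN))

lemma hasDerivAt_rarefInc (hγ : 1 < γ) (sg : ℝ) {X : LogState} (hm : 1 < logMach γ X) :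
    HasDerivAt (fun σ => rarefInc γ sg (σ, X)) (acousticDir γ sg X) 0 := by
  set m := logMach γ X with hmdef
  have hγ1 : γ - 1 ≠ 0 := by linarith
  have hr : HasDerivAt (fun σ : ℝ => Real.exp (σ - σ / γ)) (1 - 1 / γ) 0 := by
    refine ((hasDerivAt_id (0 : ℝ)).sub ((hasDerivAt_id (0 : ℝ)).div_const γ)).exp.congr_deriv ?_
    simp
  have hm' : HasDerivAt (fun σ : ℝ => m * (1 + 2 / ((γ - 1) * m) * (1 - Real.exp (σ - σ / γ))) /
      Real.exp (σ - σ / γ)) (-((γ - 1) * m + 2) / γ) 0 := by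
    refine (((((hr.const_sub 1).const_mul (2 / ((γ - 1) * m))).const_add 1).const_mul m).div hr
      (Real.exp_pos _).ne').congr_deriv ?_
    simp only [zero_div, Real.exp_zero, sub_self, mul_zero, add_zero, mul_one]
    field_simp
    ring
  have hval : (m * (1 + 2 / ((γ - 1) * m) * (1 - Real.exp ((0:ℝ) - 0 / γ))) /
      Real.exp ((0:ℝ) - 0 / γ)) = m := by simp
  have hp := (hasDerivAt_prandtlMeyer hγ (m := m * (1 + 2 / ((γ - 1) * m) *
    (1 - Real.exp ((0:ℝ) - 0 / γ))) / Real.exp ((0:ℝ) - 0 / γ)) (by rw [hval]; exact hm)).comp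
    (0 : ℝ) hm'
  rw [hval] at hp
  have hth := (hp.const_sub (prandtlMeyer γ m)).const_mul sg
  have hth' : HasDerivAt (fun σ : ℝ => sg * (prandtlMeyer γ m - prandtlMeyer γ (m *
      (1 + 2 / ((γ - 1) * m) * (1 - Real.exp (σ - σ / γ))) / Real.exp (σ - σ / γ))))
      (sg * (√(m - 1) / (γ * m))) 0 := by
    refine hth.congr_deriv ?_
    have : 2 + (γ - 1) * m ≠ 0 := by nlinarith
    have e : (γ - 1) * m + 2 = 2 + (γ - 1) * m := by ring
    rw [e]
    generalize 2 + (γ - 1) * m = D at *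
    field_simp
  exact (hasDerivAt_id (0 : ℝ)).prodMk (hth'.prodMk
    ((hasDerivAt_speedInc hγ hm (by simp) hr).prodMk ((hasDerivAt_id (0 : ℝ)).div_const γ)))

/-- The acoustic wave curve of the `j`-th family in logarithmic coordinates. -/
def acousticInc (γ : ℝ) (j : Acoustic) : ℝ × LogState → LogState :=
  glue j.sgn (rarefInc γ j.sgn) (shockInc γ j.sgn)

lemma Acoustic.sgn_ne_zero (j : Acoustic) : j.sgn ≠ 0 := by
  rcases j.sgn_cases with h | h <;> rw [h] <;> norm_num

lemma exists_waveCurve (hγ : 1 < γ) (j : Acoustic) (hm : 1 < logMach γ X₀) :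
    ∃ C ε : ℝ, WaveCurve (acousticInc γ j) X₀ (acousticDir γ j.sgn X₀) C ε := by
  have hev : ∀ᶠ X in 𝓝 X₀, 1 < logMach γ X :=
    (contDiff_logMach γ (n := 0)).continuous.continuousAt.eventually (lt_mem_nhds hm)
  exact exists_waveCurve_glue j.sgn_ne_zero (contDiffAt_rarefInc hγ _ hm)
    (contDiffAt_shockInc hγ _ hm) (Eventually.of_forall (rarefInc_zero _))
    (Eventually.of_forall (shockInc_zero hγ _))
    (hev.mono fun X hX => hasDerivAt_rarefInc hγ _ hX)
    (hev.mono fun X hX => hasDerivAt_shockInc hγ _ hX)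

end Smooth

/-! ## Coordinates and the characteristic speeds -/

lemma contDiff_ofLog {n : WithTop ℕ∞} : ContDiff ℝ n ofLog := by
  rw [contDiff_euclidean]
  intro i
  fin_cases i <;> simp [ofLog] <;> fun_prop

lemma continuous_velX : Continuous velX := by unfold velX; fun_prop
lemma continuous_pres : Continuous pres := by unfold pres; fun_prop
lemma continuous_dens : Continuous dens := by unfold dens; fun_prop

lemma Supersonic.eventually {γ : ℝ} {U : State} (h : Supersonic γ U) :
    ∀ᶠ V in 𝓝 U, Supersonic γ V := by
  have h1 := continuous_pres.continuousAt.eventually (lt_mem_nhds h.pres_pos)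
  have h2 := continuous_dens.continuousAt.eventually (lt_mem_nhds h.dens_pos)
  have h3 : ContinuousAt (fun V => velX V - sonic γ V) U := by
    unfold sonic
    exact continuous_velX.continuousAt.sub
      (((continuous_pres.continuousAt.const_mul γ).div continuous_dens.continuousAt
        h.dens_pos.ne').sqrt)
  have h4 := h3.eventually (lt_mem_nhds (sub_pos.2 h.2.2))
  filter_upwards [h1, h2, h4] with V a b c using ⟨a, b, by linarith⟩

lemma Supersonic.contDiffAt_toLog {γ : ℝ} {U : State} (h : Supersonic γ U) {n : WithTop ℕ∞} :
    ContDiffAt ℝ n toLog U := by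
  have c0 : ContDiffAt ℝ n velX U := (EuclideanSpace.proj (𝕜 := ℝ) (0 : Fin 4)).contDiff.contDiffAt
  have c1 : ContDiffAt ℝ n velY U := (EuclideanSpace.proj (𝕜 := ℝ) (1 : Fin 4)).contDiff.contDiffAt
  have c2 : ContDiffAt ℝ n pres U := (EuclideanSpace.proj (𝕜 := ℝ) (2 : Fin 4)).contDiff.contDiffAt
  have c3 : ContDiffAt ℝ n dens U := (EuclideanSpace.proj (𝕜 := ℝ) (3 : Fin 4)).contDiff.contDiffAt
  have hu := h.velX_pos
  have cs : ContDiffAt ℝ n speed U := ((c0.pow 2).add (c1.pow 2)).sqrt (by positivity)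
  exact (c2.log h.pres_pos.ne').prodMk ((Real.contDiff_arctan.contDiffAt.comp U
    (c1.div c0 hu.ne')).prodMk
    ((cs.log h.speed_pos.ne').prodMk (c3.log h.dens_pos.ne')))

/-- The characteristic speed in logarithmic coordinates. -/
def logLam (γ : ℝ) (j : Acoustic) (X : LogState) : ℝ := lam γ j (ofLog X)

lemma Supersonic.logLam_toLog {γ : ℝ} {U : State} (h : Supersonic γ U) (j : Acoustic) :
    logLam γ j (toLog U) = lam γ j U := by rw [logLam, h.ofLog_toLog]

lemma Supersonic.contDiffAt_logLam {γ : ℝ} (hγ : 1 < γ) {U : State} (h : Supersonic γ U)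
    (j : Acoustic) {n : WithTop ℕ∞} : ContDiffAt ℝ n (logLam γ j) (toLog U) := by
  have h1 : ContDiffAt ℝ n (lam γ j) (ofLog (toLog U)) := by
    rw [h.ofLog_toLog]; exact contDiffAt_lam hγ h n
  exact h1.comp (toLog U) contDiff_ofLog.contDiffAt

lemma Supersonic.one_lt_logMach {γ : ℝ} (hγ : 1 < γ) {U : State} (h : Supersonic γ U) :
    1 < logMach γ (toLog U) := by
  rw [h.logMach_toLog hγ]; exact h.one_lt_machSqOf hγ

/-- The eigenvector in logarithmic coordinates. -/
lemma Supersonic.hasDerivAt_ofLog {γ : ℝ} (hγ : 1 < γ) {U : State} (h : Supersonic γ U)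
    (j : Acoustic) :
    HasDerivAt (fun t : ℝ => ofLog (toLog U + t • ((γ * eigScale γ j U) •
      acousticDir γ j.sgn (toLog U)))) (eigvec γ j U) 0 := by
  set X := toLog U with hX
  set E := eigScale γ j U with hE
  have hc := h.sonic_pos hγ
  have hp := h.pres_pos
  have hr := h.dens_pos
  have hq := h.speed_pos
  have hq2 := speed_sq U
  have hroot : √(logMach γ X - 1) = machRoot γ U / sonic γ U := by
    rw [h.logMach_toLog hγ, machRoot, ← Real.sqrt_sq hc.le, ← Real.sqrt_div' _ (by positivity),
      Real.sqrt_sq hc.le]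
    congr 1
    rw [machSqOf]; field_simp
  have hM : logMach γ X = speed U ^ 2 / sonic γ U ^ 2 := by
    rw [h.logMach_toLog hγ, machSqOf, speed_sq]
  have hU := h.ofLog_toLog
  have eX : Real.exp X.2.2.1 * Real.cos X.2.1 = velX U :=
    congrArg (fun W : State => W 0) hU
  have eY : Real.exp X.2.2.1 * Real.sin X.2.1 = velY U :=
    congrArg (fun W : State => W 1) hU
  have eP : Real.exp X.1 = pres U := congrArg (fun W : State => W 2) hU
  have eR : Real.exp X.2.2.2 = dens U := congrArg (fun W : State => W 3) hU
  have e1 := h.lam_mul_sub j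
  have e2 := h.add_lam_mul j
  have hEv : E = kCoef γ j U * (j.sgn * charSec γ j U) / sonic γ U := by
    rw [hE, eigScale, e1]; field_simp
  have hcomp : ∀ i : Fin 4, HasDerivAt (fun t : ℝ => ofLog (X + t • ((γ * E) •
      acousticDir γ j.sgn X)) i) (eigvec γ j U i) 0 := by
    have hline : ∀ a b : ℝ, HasDerivAt (fun t : ℝ => a + t * b) b 0 := fun a b => by
      simpa using ((hasDerivAt_id (0:ℝ)).mul_const b).const_add a
    have z : ∀ a b : ℝ, a + 0 * b = a := by intros; ring
    intro i
    fin_cases i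
    · have := ((hline X.2.2.1 (γ * E * -(1 / (γ * logMach γ X)))).exp).mul
        ((hline X.2.1 (γ * E * (j.sgn * (√(logMach γ X - 1) / (γ * logMach γ X))))).cos)
      refine HasDerivAt.congr_deriv (f := fun t : ℝ => ofLog (X + t • ((γ * E) •
        acousticDir γ j.sgn X)) 0) this ?_
      simp only [z]
      simp only [eigvec, PiLp.smul_apply, smul_eq_mul, Fin.zero_eta,
        Matrix.cons_val_zero]
      trans (velX U * (γ * E * -(1 / (γ * logMach γ X))) - velY U *
        (γ * E * (j.sgn * (√(logMach γ X - 1) / (γ * logMach γ X)))))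
      · rw [← eX, ← eY]; ring
      · rw [hroot, hM, hEv]
        field_simp
        rw [hq2]
        linear_combination kCoef γ j U * (velX U * e1 + velY U * e2 -
          (velY U * machRoot γ U * charSec γ j U) * j.sgn_sq)
    · have := ((hline X.2.2.1 (γ * E * -(1 / (γ * logMach γ X)))).exp).mul
        ((hline X.2.1 (γ * E * (j.sgn * (√(logMach γ X - 1) / (γ * logMach γ X))))).sin)
      refine HasDerivAt.congr_deriv (f := fun t : ℝ => ofLog (X + t • ((γ * E) •
        acousticDir γ j.sgn X)) 1) this ?_
      simp only [z]
      simp only [eigvec, PiLp.smul_apply, smul_eq_mul, Fin.mk_one, Matrix.cons_val_one,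
        Matrix.cons_val_zero]
      trans (velY U * (γ * E * -(1 / (γ * logMach γ X))) + velX U *
        (γ * E * (j.sgn * (√(logMach γ X - 1) / (γ * logMach γ X)))))
      · rw [← eX, ← eY]; ring
      · rw [hroot, hM, hEv]
        field_simp
        rw [hq2]
        linear_combination kCoef γ j U * (velY U * e1 - velX U * e2 +
          (velX U * machRoot γ U * charSec γ j U) * j.sgn_sq)
    · have := (hline X.1 (γ * E * 1)).exp
      refine HasDerivAt.congr_deriv (f := fun t : ℝ => ofLog (X + t • ((γ * E) •
        acousticDir γ j.sgn X)) 2) this ?_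
      rw [z, eP, hE, eigScale, h.sonic_sq hγ]
      simp [eigvec]
      field_simp
    · have := (hline X.2.2.2 (γ * E * (1 / γ))).exp
      refine HasDerivAt.congr_deriv (f := fun t : ℝ => ofLog (X + t • ((γ * E) •
        acousticDir γ j.sgn X)) 3) this ?_
      rw [z, eR, hE, eigScale]
      simp [eigvec]
      field_simp
  have := hasDerivAt_pi.2 hcomp
  exact (PiLp.hasFDerivAt_toLp 2 _).comp_hasDerivAt 0 this

/-- Genuine nonlinearity in logarithmic coordinates. The image of the straight line in the direction
`acousticDir`, suitably scaled, is tangent to r_j at U, so `curve_lam` can be applied to it at t = 0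
although it is not an integral curve. -/
lemma Supersonic.fderiv_logLam {γ : ℝ} (hγ : 1 < γ) {U : State} (h : Supersonic γ U)
    (j : Acoustic) : γ * eigScale γ j U *
      fderiv ℝ (logLam γ j) (toLog U) (acousticDir γ j.sgn (toLog U)) = 1 := by
  set g := acousticDir γ j.sgn (toLog U)
  set c := γ * eigScale γ j U
  have hd := h.hasDerivAt_ofLog hγ j
  set ψ : ℝ → State := fun t => ofLog (toLog U + t • (c • g))
  have hψ0 : ψ 0 = U := by simp [ψ, h.ofLog_toLog]
  have hsup : ∀ᶠ t in 𝓝 (0:ℝ), Supersonic γ (ψ t) := by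
    have h1 := hd.continuousAt
    rw [ContinuousAt, hψ0] at h1
    exact h1.eventually h.eventually
  obtain ⟨e, he, hb⟩ := Metric.eventually_nhds_iff_ball.1 hsup
  have hs : ∀ r ∈ Icc 0 (e / 2), Supersonic γ (ψ r) := fun r hr => hb r (by
    rw [mem_ball_zero_iff, Real.norm_eq_abs, abs_of_nonneg hr.1]; linarith [hr.2])
  have h0 : (0:ℝ) ∈ Icc 0 (e / 2) := ⟨le_rfl, by positivity⟩
  have hu : UniqueDiffWithinAt ℝ (Icc 0 (e / 2)) 0 := uniqueDiffOn_Icc (by positivity) 0 h0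
  have k1 := curve_lam hγ hs h0 hu (by rw [hψ0]; exact hd.hasDerivWithinAt)
  have hline : HasDerivAt (fun t : ℝ => toLog U + t • (c • g)) (c • g) 0 := by
    simpa using ((hasDerivAt_id (0:ℝ)).smul_const (c • g)).const_add (toLog U)
  have k2 : HasFDerivAt (logLam γ j) (fderiv ℝ (logLam γ j) (toLog U))
      (toLog U + (0:ℝ) • (c • g)) := by
    rw [zero_smul, add_zero]
    exact ((h.contDiffAt_logLam hγ j (n := 1)).differentiableAt one_ne_zero).hasFDerivAt
  have k3 := (k2.comp_hasDerivAt 0 hline).hasDerivWithinAt (s := Icc 0 (e / 2))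
  have := hu.eq_deriv _ k3 k1
  simpa using this

/-- By `fderiv_logLam` the derivative of λ_j along the wave curve cannot vanish. -/
lemma Supersonic.exists_regularFamily {γ : ℝ} (hγ : 1 < γ) {U : State} (h : Supersonic γ U)
    (j : Acoustic) :
    ∃ C ε : ℝ, RegularFamily (acousticInc γ j) (logLam γ j) (toLog U) C ε := by
  obtain ⟨C, ε, hw⟩ := exists_waveCurve hγ j (h.one_lt_logMach hγ)
  refine hw.exists_regularFamily (h.contDiffAt_logLam hγ j) fun h0 => ?_
  have := h.fderiv_logLam hγ j
  rw [h0, mul_zero] at this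
  exact zero_ne_one this

/-- The flow angle along an acoustic wave curve. -/
lemma Supersonic.exists_angle_bound {γ : ℝ} (hγ : 1 < γ) {U : State} (h : Supersonic γ U)
    (j : Acoustic) : ∃ κ > 0, ∃ ε > 0, ∀ η > 0, ∃ ε' > 0, ε' ≤ ε ∧
      ∀ σ σ' : ℝ, |σ| < ε' → |σ'| < ε' → ∀ Y ∈ ball (toLog U) ε',
      |(acousticInc γ j (σ, Y)).2.1 - (acousticInc γ j (σ', Y)).2.1 - j.sgn * κ * (σ - σ')| ≤
        η * |σ - σ'| := by
  obtain ⟨C, ε, hw⟩ := exists_waveCurve hγ j (h.one_lt_logMach hγ)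
  have hm := h.one_lt_logMach hγ
  refine ⟨√(logMach γ (toLog U) - 1) / (γ * logMach γ (toLog U)), ?_, ε, hw.pos, fun η hη => ?_⟩
  · exact div_pos (Real.sqrt_pos.2 (by linarith)) (by nlinarith)
  · set L : LogState →L[ℝ] ℝ := (ContinuousLinearMap.fst ℝ ℝ (ℝ × ℝ)).comp
      (ContinuousLinearMap.snd ℝ ℝ (ℝ × ℝ × ℝ))
    obtain ⟨ε', h1, h2, h3⟩ := hw.strict_comp (Λ := fun X => X.2.1) (L := L)
      L.hasStrictFDerivAt hη
    refine ⟨ε', h1, h2, fun σ σ' a b Y hY => ?_⟩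
    have := h3 σ σ' a b Y hY
    simpa [L, acousticDir] using this

end SteadyEuler
end

noncomputable section
namespace SteadyEuler

open Set Filter Topology Metric

/-! ## Acoustic waves near a given state -/

/-- `V = Φ_j(a; U)`. -/
def AcJoin (γ : ℝ) (j : Acoustic) (a : ℝ) (U V : State) : Prop :=
  (0 ≤ a ∧ IsRarefaction γ j a U V) ∨ (a < 0 ∧ ∃ s, IsShock γ j a U V s)

/-- The logarithm of the pressure ratio. -/
def presInc (U V : State) : ℝ := Real.log (pres V) - Real.log (pres U)

/-- The flow angle. -/
def angle (U : State) : ℝ := Real.arctan (velY U / velX U)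

section Global

variable {γ : ℝ} {j : Acoustic} {a s : ℝ} {U V : State}

lemma AcJoin.left (hγ : 1 < γ) (h : AcJoin γ j a U V) : Supersonic γ U := by
  rcases h with ⟨h, h'⟩ | ⟨-, s, h⟩
  · exact (h'.rarefRel hγ h).left
  · exact h.1

lemma AcJoin.right (hγ : 1 < γ) (h : AcJoin γ j a U V) : Supersonic γ V := by
  rcases h with ⟨h, h'⟩ | ⟨-, s, h⟩
  · exact (h'.rarefRel hγ h).right
  · exact h.2.1

lemma AcJoin.lam_sub (hγ : 1 < γ) (h : AcJoin γ j a U V) : lam γ j V - lam γ j U = a := by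
  rcases h with ⟨h, h'⟩ | ⟨-, s, h⟩
  · exact h'.lam_sub hγ h
  · exact h.2.2.2.2.2.2.symm

lemma IsShock.sgn_mul_presInc (h : IsShock γ j a U V s) : j.sgn * presInc U V < 0 := by
  have hp := h.2.2.2.2.2.1
  have h1 := h.1.pres_pos
  have h2 := h.2.1.pres_pos
  rcases j.sgn_cases with e | e <;> rw [e] at hp ⊢ <;> unfold presInc
  · have := Real.log_lt_log h2 (by linarith : pres V < pres U); linarith
  · have := Real.log_lt_log h1 (by linarith : pres U < pres V); linarith

/-- The sign of σ selects the branch: upwards, the pressure rises in 3-rarefactions and 1-shocks and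
falls in 1-rarefactions and 3-shocks. -/
lemma AcJoin.toLog_eq (hγ : 1 < γ) (h : AcJoin γ j a U V) :
    toLog V = toLog U + acousticInc γ j (presInc U V, toLog U) := by
  rcases h with ⟨h, h'⟩ | ⟨-, s, h⟩
  · rw [acousticInc, glue_of_nonneg (show 0 ≤ j.sgn * presInc U V from (h'.monotone hγ h).1)]
    exact (h'.rarefRel hγ h).toLog_eq hγ
  · rw [acousticInc, glue_of_neg h.sgn_mul_presInc]
    exact (h.shockRel hγ).toLog_eq hγ

lemma presInc_swap (U V : State) : presInc V U = -presInc U V := by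
  unfold presInc; ring

/-- A wave read from above uses the same increment functions with -σ. The branch remains that of the
wave, so this is not the glued curve at -σ. -/
lemma AcJoin.toLog_eq_reverse (hγ : 1 < γ) (h : AcJoin γ j a U V) :
    toLog U = toLog V + rarefInc γ j.sgn (-presInc U V, toLog V) ∨
      toLog U = toLog V + shockInc γ j.sgn (-presInc U V, toLog V) := by
  rw [← presInc_swap]
  rcases h with ⟨h, h'⟩ | ⟨-, s, h⟩
  · exact Or.inl ((h'.rarefRel hγ h).symm.toLog_eq hγ)
  · exact Or.inr ((h.shockRel hγ).symm.toLog_eq hγ)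

lemma ShockRel.den_pos (hγ : 1 < γ) (h : ShockRel γ j s U V) :
    0 < γ * machSqOf γ U - (pres V / pres U - 1) := by
  have hU := h.left.dens_pos
  have hp := h.left.pres_pos
  have hm : machSqOf γ U = (velX U ^ 2 + velY U ^ 2) * dens U / (γ * pres U) := by
    rw [machSqOf, h.left.sonic_sq hγ]; field_simp
  have hden : γ * machSqOf γ U - (pres V / pres U - 1) =
      (dens U / pres U) * (velX U * velX V + velY U * velY V) := by
    rw [hm, h.rh.dot h.left h.ne]; field_simp
  rw [hden]
  have := h.dot_pos
  positivity

lemma ShockRel.angle_eq (hγ : 1 < γ) (h : ShockRel γ j s U V) :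
    angle V - angle U = j.sgn * Real.arctan (shockTan γ (machSqOf γ U) (pres V / pres U)) := by
  rw [angle, angle, arctan_sub_arctan h.left.velX_pos h.right.velX_pos h.dot_pos, h.tan_eq hγ,
    sgn_mul_arctan]

/-- From the lower to the upper state, a 3-wave turns the flow upwards when it raises the pressure,
whereas a 1-wave turns it downwards. This holds for waves of any size, which is what the smallness
of outgoing fans requires. -/
lemma AcJoin.sign (hγ : 1 < γ) (h : AcJoin γ j a U V) :
    0 ≤ j.sgn * presInc U V * (angle V - angle U) := by
  rcases h with ⟨h, h'⟩ | ⟨-, s, h⟩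
  · exact mul_nonneg (h'.monotone hγ h).1 (h'.monotone hγ h).2
  · have hs := h.shockRel hγ
    have hd := hs.den_pos hγ
    have h1 := h.1.pres_pos
    have h2 := h.2.1.pres_pos
    rw [hs.angle_eq hγ]
    have e : j.sgn * presInc U V * (j.sgn *
        Real.arctan (shockTan γ (machSqOf γ U) (pres V / pres U))) =
        presInc U V * Real.arctan (shockTan γ (machSqOf γ U) (pres V / pres U)) := by
      linear_combination (presInc U V *
        Real.arctan (shockTan γ (machSqOf γ U) (pres V / pres U))) * j.sgn_sq
    rw [e]
    rcases le_total (pres U) (pres V) with hp | hp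
    · refine mul_nonneg (sub_nonneg.2 (Real.log_le_log h1 hp)) (Real.arctan_nonneg.2 ?_)
      exact mul_nonneg (div_nonneg (sub_nonneg.2 ((one_le_div h1).2 hp)) hd.le) (Real.sqrt_nonneg _)
    · refine mul_nonneg_of_nonpos_of_nonpos (sub_nonpos.2 (Real.log_le_log h2 hp)) ?_
      rw [← Real.arctan_zero]
      refine Real.arctan_strictMono.monotone ?_
      exact mul_nonpos_of_nonpos_of_nonneg (div_nonpos_of_nonpos_of_nonneg
        (sub_nonpos.2 ((div_le_one h1).2 hp)) hd.le) (Real.sqrt_nonneg _)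

/-- The other acoustic family. -/
def Acoustic.other : Acoustic → Acoustic
  | .one => .three
  | .three => .one

lemma Acoustic.sgn_other (j : Acoustic) : j.other.sgn = -j.sgn := by
  cases j <;> simp [Acoustic.other, Acoustic.sgn]

/-- The normal velocity from `normal_eq` is inserted in the characteristic polynomial: the pressure
jump is proportional to (s - λ_j) times the distance of s from the other eigenvalue. The sign gives
the Lax condition, the size a bound of the jump by the parameter. -/
lemma ShockRel.charPoly_eq (hγ : 1 < γ) (h : ShockRel γ j s U V) :
    2 * dens U * (velX U ^ 2 - sonic γ U ^ 2) * ((s - lam γ j U) * (s - lam γ j.other U)) =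
      (1 + s ^ 2) * ((γ + 1) * (pres V - pres U)) := by
  have h1 := h.left.charPoly s
  have h2 := h.normal_eq hγ
  have hc := h.left.sonic_sq hγ
  have hr := h.left.dens_pos
  have e : (s - lam γ j U) * (s - lam γ j.other U) =
      (s - lam γ .one U) * (s - lam γ .three U) := by
    cases j <;> simp [Acoustic.other]; ring
  have hc' : dens U * sonic γ U ^ 2 = γ * pres U := by rw [hc]; field_simp
  rw [e]
  linear_combination 2 * dens U * h1 + h2 - 2 * (1 + s ^ 2) * hc'

lemma ShockRel.sgn_other (hγ : 1 < γ) (h : ShockRel γ j s U V) :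
    0 < j.sgn * (s - lam γ j.other U) := by
  have h1 := h.fam
  have h2 := h.left.sgn_mul_lam_sub hγ j.other
  rw [j.sgn_other] at h2
  linarith

/-- The Lax condition: the side of higher pressure difference determines the side of `s`. -/
lemma ShockRel.sgn_sub (hγ : 1 < γ) (h : ShockRel γ j s U V) :
    0 < (pres V - pres U) * (j.sgn * (s - lam γ j U)) := by
  have h1 := h.charPoly_eq hγ
  have h2 := h.sgn_other hγ
  have hr := h.left.dens_pos
  have hu := sub_pos.2 h.left.sonic_sq_lt
  have hp : pres V - pres U ≠ 0 := sub_ne_zero.2 h.ne.symm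
  have h3 : (2 * dens U * (velX U ^ 2 - sonic γ U ^ 2) * (j.sgn * (s - lam γ j.other U))) *
      ((pres V - pres U) * (j.sgn * (s - lam γ j U))) =
      (1 + s ^ 2) * (γ + 1) * (pres V - pres U) ^ 2 := by
    linear_combination (pres V - pres U) * h1 + (2 * dens U * (velX U ^ 2 - sonic γ U ^ 2) *
      (pres V - pres U) * (s - lam γ j.other U) * (s - lam γ j U)) * j.sgn_sq
  have h4 : 0 < (1 + s ^ 2) * (γ + 1) * (pres V - pres U) ^ 2 := by positivity
  rw [← h3] at h4
  exact pos_of_mul_pos_right h4 (by positivity)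

/-- A bound of the pressure jump in terms of the parameter of the shock. -/
lemma IsShock.pres_sub_le (hγ : 1 < γ) (h : IsShock γ j a U V s) {W : State}
    (hW : W = U ∨ W = V) : |pres V - pres U| ≤
      2 * dens W * velX W ^ 2 * (|lam γ .one W| + |lam γ .three W| + |a|) * |a| := by
  have hs := h.shockRel hγ
  have ha := h.2.2.2.2.2.2
  have hp := h.2.2.2.2.2.1
  have k1 := hs.sgn_sub hγ
  have k2 := hs.symm.sgn_sub hγ
  -- `s` lies between the two characteristic speeds
  have b1 : s < lam γ j U := by
    by_contra! hc
    nlinarith [mul_nonneg hp.le (sub_nonneg.2 hc), j.sgn_sq]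
  have b2 : lam γ j V < s := by
    by_contra! hc
    nlinarith [mul_nonneg hp.le (sub_nonneg.2 hc), j.sgn_sq]
  have hsub : ∀ W, W = U ∨ W = V → |s - lam γ j W| ≤ |a| := by
    rintro W (rfl | rfl)
    · rw [abs_of_neg (by linarith), abs_of_neg (by linarith)]; linarith
    · rw [abs_of_pos (by linarith), abs_of_neg (by linarith)]; linarith
  have main : ∀ W W' : State, ShockRel γ j s W W' → |s - lam γ j W| ≤ |a| →
      |pres W' - pres W| ≤
        2 * dens W * velX W ^ 2 * (|lam γ .one W| + |lam γ .three W| + |a|) * |a| := by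
    intro W W' hs hle
    have h1 := hs.charPoly_eq hγ
    have hr := hs.left.dens_pos
    have hu := sub_pos.2 hs.left.sonic_sq_lt
    have hd := hs.left.sonic_pos hγ
    have e1 : |s - lam γ j.other W| ≤ |lam γ .one W| + |lam γ .three W| + |a| := by
      have e2 : s - lam γ j.other W = (s - lam γ j W) + (lam γ j W - lam γ j.other W) := by ring
      rw [e2]
      refine (abs_add_le _ _).trans ?_
      have e3 := abs_sub (lam γ j W) (lam γ j.other W)
      have e4 : |lam γ j W| + |lam γ j.other W| = |lam γ .one W| + |lam γ .three W| := by
        cases j <;> simp [Acoustic.other]; ring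
      linarith
    have e5 : |pres W' - pres W| ≤ |(1 + s ^ 2) * ((γ + 1) * (pres W' - pres W))| := by
      rw [abs_mul, abs_mul, abs_of_pos (by positivity : 0 < 1 + s ^ 2),
        abs_of_pos (by linarith : 0 < γ + 1)]
      have := abs_nonneg (pres W' - pres W)
      nlinarith [mul_nonneg (sq_nonneg s) this, mul_nonneg (sq_nonneg s) (mul_nonneg (by linarith : 0 ≤ γ + 1) this), mul_nonneg (by linarith : 0 ≤ γ) this]
    refine e5.trans ?_
    rw [← h1, abs_mul, abs_mul (s - lam γ j W),
      abs_of_pos (mul_pos (by positivity) hu :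
        0 < 2 * dens W * (velX W ^ 2 - sonic γ W ^ 2))]
    calc _ ≤ 2 * dens W * velX W ^ 2 * (|a| * (|lam γ .one W| + |lam γ .three W| + |a|)) := by
          gcongr
          nlinarith
      _ = _ := by ring
  rcases hW with rfl | rfl
  · exact main _ _ hs (hsub _ (Or.inl rfl))
  · rw [abs_sub_comm]
    exact main _ _ hs.symm (hsub _ (Or.inr rfl))

end Global

/-! ### Smallness -/

lemma exists_inc_bound {X₀ : LogState} {f : ℝ × LogState → LogState}
    (hf : ContDiffAt ℝ 1 f (0, X₀)) (h0 : ∀ X, f (0, X) = 0) :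
    ∃ C ε : ℝ, 0 < ε ∧ 0 ≤ C ∧ ∀ σ : ℝ, |σ| < ε → ∀ X ∈ ball X₀ ε, ‖f (σ, X)‖ ≤ C * |σ| := by
  obtain ⟨K, t, ht, hK⟩ := hf.exists_lipschitzOnWith
  obtain ⟨ε, hε, hb⟩ := Metric.mem_nhds_iff.1 ht
  refine ⟨K, ε, hε, K.2, fun σ hσ X hX => ?_⟩
  have m1 : ((σ, X) : ℝ × LogState) ∈ t := hb (by
    rw [← ball_prod_same]; exact ⟨by simpa using hσ, hX⟩)
  have m2 : (((0:ℝ), X) : ℝ × LogState) ∈ t := hb (by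
    rw [← ball_prod_same]; exact ⟨mem_ball_self hε, hX⟩)
  have := hK.norm_sub_le m1 m2
  rw [h0, sub_zero] at this
  refine this.trans (le_of_eq ?_)
  simp [Prod.norm_def]

/-- Acoustic waves of small pressure ratio are small. -/
lemma exists_size_bound {γ : ℝ} (hγ : 1 < γ) {U₀ : State} (h₀ : Supersonic γ U₀) (j : Acoustic) :
    ∃ C ε : ℝ, 0 < ε ∧ 0 ≤ C ∧ ∀ (a : ℝ) (U V : State), AcJoin γ j a U V →
      (toLog U ∈ ball (toLog U₀) ε ∨ toLog V ∈ ball (toLog U₀) ε) → |presInc U V| < ε →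
      ‖toLog V - toLog U‖ ≤ C * |presInc U V| := by
  have hm := h₀.one_lt_logMach hγ
  obtain ⟨C₁, ε₁, hε₁, hC₁, h1⟩ := exists_inc_bound
    (contDiffAt_rarefInc hγ j.sgn hm) (rarefInc_zero j.sgn)
  obtain ⟨C₂, ε₂, hε₂, hC₂, h2⟩ := exists_inc_bound
    (contDiffAt_shockInc hγ j.sgn hm) (shockInc_zero hγ j.sgn)
  have l1 := min_le_left ε₁ ε₂
  have l2 := min_le_right ε₁ ε₂
  have m1 := le_max_left C₁ C₂
  have m2 := le_max_right C₁ C₂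
  refine ⟨max C₁ C₂, min ε₁ ε₂, by positivity, by positivity, fun a U V hj hUV hσ => ?_⟩
  have key : ∀ σ : ℝ, |σ| < min ε₁ ε₂ → ∀ X ∈ ball (toLog U₀) (min ε₁ ε₂),
      ‖rarefInc γ j.sgn (σ, X)‖ ≤ max C₁ C₂ * |σ| ∧
        ‖shockInc γ j.sgn (σ, X)‖ ≤ max C₁ C₂ * |σ| := fun σ hσ X hX =>
    ⟨(h1 σ (hσ.trans_le l1) X (ball_subset_ball l1 hX)).trans (by gcongr),
      (h2 σ (hσ.trans_le l2) X (ball_subset_ball l2 hX)).trans (by gcongr)⟩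
  rcases hUV with hU | hV
  · rw [hj.toLog_eq hγ, add_sub_cancel_left, acousticInc]
    unfold glue
    split_ifs
    · exact (key _ hσ _ hU).1
    · exact (key _ hσ _ hU).2
  -- If only the upper state is near U₀, the wave is read backwards.
  · have hσ' : |-presInc U V| < min ε₁ ε₂ := by rwa [abs_neg]
    rw [norm_sub_rev, ← abs_neg (presInc U V)]
    rcases hj.toLog_eq_reverse hγ with h | h <;> rw [h, add_sub_cancel_left]
    · exact (key _ hσ' _ hV).1
    · exact (key _ hσ' _ hV).2

/-- Along a rarefaction wave with large pressure ratio there is a point where the pressure ratio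
to a given end of the wave takes a prescribed value. -/
lemma IsRarefaction.exists_presInc {γ : ℝ} {j : Acoustic} {a : ℝ} (hγ : 1 < γ) (ha : 0 ≤ a)
    {U V : State} (h : IsRarefaction γ j a U V) {r : ℝ} (hr : 0 ≤ r) (hσ : r ≤ |presInc U V|) :
    (∃ t ∈ Icc 0 a, ∃ W, IsRarefaction γ j t U W ∧ IsRarefaction γ j (a - t) W V ∧
      |presInc U W| = r) ∧
    (∃ t ∈ Icc 0 a, ∃ W, IsRarefaction γ j t U W ∧ IsRarefaction γ j (a - t) W V ∧
      |presInc W V| = r) := by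
  obtain ⟨ψ, h0, h1, hc, hψ⟩ := h.exists_path
  have hcont : ContinuousOn (fun t => Real.log (pres (ψ t))) (Icc 0 a) := by
    refine ContinuousOn.log (continuous_pres.comp_continuousOn hc) fun t ht => ?_
    exact ((hψ t ht).1.rarefRel hγ ht.1).right.pres_pos.ne'
  constructor
  · have hf : ContinuousOn (fun t => |presInc U (ψ t)|) (Icc 0 a) :=
      (hcont.sub continuousOn_const).abs
    obtain ⟨t, ht, he⟩ := intermediate_value_Icc ha hf (show r ∈ _ from by
      rw [h0, h1]; exact ⟨by simpa [presInc] using hr, hσ⟩)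
    exact ⟨t, ht, ψ t, (hψ t ht).1, (hψ t ht).2, he⟩
  · have hf : ContinuousOn (fun t => |presInc (ψ t) V|) (Icc 0 a) :=
      (continuousOn_const.sub hcont).abs
    obtain ⟨t, ht, he⟩ := intermediate_value_Icc' ha hf (show r ∈ _ from by
      rw [h0, h1]; exact ⟨by simpa [presInc] using hr, hσ⟩)
    exact ⟨t, ht, ψ t, (hψ t ht).1, (hψ t ht).2, he⟩

/-- Local properties of the acoustic waves of a family. -/
structure LocalFamily (γ : ℝ) (j : Acoustic) (X₀ : LogState) (C ε : ℝ) : Prop where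
  reg : RegularFamily (acousticInc γ j) (logLam γ j) X₀ C ε
  size : ∀ (a : ℝ) (U V : State), AcJoin γ j a U V →
    (toLog U ∈ ball X₀ ε ∨ toLog V ∈ ball X₀ ε) → |presInc U V| < ε →
    ‖toLog V - toLog U‖ ≤ C * |presInc U V|

lemma LocalFamily.mono {γ : ℝ} {j : Acoustic} {X₀ : LogState} {C ε C' ε' : ℝ}
    (h : LocalFamily γ j X₀ C ε) (hC : C ≤ C') (hε' : 0 < ε') (hε : ε' ≤ ε) :
    LocalFamily γ j X₀ C' ε' where
  reg := h.reg.mono hC hε' hε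
  size a U V hj hUV hσ := (h.size a U V hj (hUV.imp (fun h => ball_subset_ball hε h)
    fun h => ball_subset_ball hε h) (hσ.trans_le hε)).trans (by gcongr)

lemma exists_localFamily {γ : ℝ} (hγ : 1 < γ) {U₀ : State} (h₀ : Supersonic γ U₀) :
    ∃ C ε : ℝ, ∀ j, LocalFamily γ j (toLog U₀) C ε := by
  have key : ∀ j, ∃ C ε : ℝ, LocalFamily γ j (toLog U₀) C ε := fun j => by
    obtain ⟨C₁, ε₁, h1⟩ := h₀.exists_regularFamily hγ j
    obtain ⟨C₂, ε₂, hε₂, hC₂, h2⟩ := exists_size_bound hγ h₀ j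
    have := h1.pos
    refine ⟨max C₁ C₂, min ε₁ ε₂, h1.mono (le_max_left _ _) (by positivity) (min_le_left _ _),
      fun a U V hj hUV hσ => ?_⟩
    have l2 := min_le_right ε₁ ε₂
    exact (h2 a U V hj (hUV.imp (fun h => ball_subset_ball l2 h) fun h => ball_subset_ball l2 h)
      (hσ.trans_le l2)).trans (by gcongr; exact le_max_right _ _)
  obtain ⟨C₁, ε₁, h1⟩ := key .one
  obtain ⟨C₂, ε₂, h2⟩ := key .three
  have := h1.reg.pos
  have := h2.reg.pos
  refine ⟨max C₁ C₂, min ε₁ ε₂, fun j => ?_⟩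
  cases j
  · exact h1.mono (le_max_left _ _) (by positivity) (min_le_left _ _)
  · exact h2.mono (le_max_right _ _) (by positivity) (min_le_right _ _)

section Local

variable {γ : ℝ} {j : Acoustic} {U₀ : State} {C ε : ℝ}

/-- The increment of `λ_j` dominates small pressure ratios. -/
lemma LocalFamily.presInc_le (hγ : 1 < γ) (h : LocalFamily γ j (toLog U₀) C ε) {a : ℝ}
    {U V : State} (hj : AcJoin γ j a U V) (hU : toLog U ∈ ball (toLog U₀) ε)
    (hσ : |presInc U V| < ε) : |presInc U V| ≤ C * |a| := by
  have k := h.reg.param (presInc U V) 0 hσ (by simpa using h.reg.pos) _ hU _ hU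
  rw [← hj.toLog_eq hγ, h.reg.zero _ hU, (hj.left hγ).logLam_toLog, (hj.right hγ).logLam_toLog,
    hj.lam_sub hγ] at k
  rw [add_zero, (hj.left hγ).logLam_toLog] at k
  simpa using k

lemma LocalFamily.abs_le (hγ : 1 < γ) (h : LocalFamily γ j (toLog U₀) C ε) {a : ℝ}
    {U V : State} (hj : AcJoin γ j a U V) (hU : toLog U ∈ ball (toLog U₀) ε)
    (hσ : |presInc U V| < ε) : |a| ≤ C * |presInc U V| := by
  have k := h.reg.param' (presInc U V) 0 hσ (by simpa using h.reg.pos) _ hU _ hU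
  rw [← hj.toLog_eq hγ, h.reg.zero _ hU, (hj.left hγ).logLam_toLog, (hj.right hγ).logLam_toLog,
    hj.lam_sub hγ] at k
  rw [add_zero, (hj.left hγ).logLam_toLog] at k
  simpa using k

lemma Supersonic.eventually_log {γ : ℝ} {U₀ : State} (h₀ : Supersonic γ U₀) {P : State → Prop}
    (hP : ∀ᶠ U in 𝓝 U₀, P U) :
    ∃ ε > 0, ∀ U, Supersonic γ U → toLog U ∈ ball (toLog U₀) ε → P U := by
  have h1 : ContinuousAt ofLog (toLog U₀) := (contDiff_ofLog (n := 0)).continuous.continuousAt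
  rw [ContinuousAt, h₀.ofLog_toLog] at h1
  obtain ⟨ε, hε, hb⟩ := Metric.eventually_nhds_iff_ball.1 (h1.eventually hP)
  exact ⟨ε, hε, fun U hU hm => by have := hb _ hm; rwa [hU.ofLog_toLog] at this⟩

/-- Waves with a small parameter have a small pressure ratio. -/
lemma exists_presInc_small (hγ : 1 < γ) (h₀ : Supersonic γ U₀)
    (h : LocalFamily γ j (toLog U₀) C ε) :
    ∀ r > 0, ∃ e > 0, ∀ (a : ℝ) (U V : State), AcJoin γ j a U V → |a| < e →
      (toLog U ∈ ball (toLog U₀) e ∨ toLog V ∈ ball (toLog U₀) e) → |presInc U V| < r := by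
  intro r hr
  have hC := h.reg.one_le
  have hε := h.reg.pos
  -- shocks
  obtain ⟨K, hK, e₁, he₁, hS⟩ : ∃ K > 0, ∃ e₁ > 0, ∀ W, Supersonic γ W →
      toLog W ∈ ball (toLog U₀) e₁ →
      2 * dens W * velX W ^ 2 * (|lam γ .one W| + |lam γ .three W| + 1) < K := by
    have hcont : ContinuousAt (fun W => 2 * dens W * velX W ^ 2 *
        (|lam γ .one W| + |lam γ .three W| + 1)) U₀ := by
      have c1 := (contDiffAt_lam (j := .one) hγ h₀ 1).continuousAt
      have c3 := (contDiffAt_lam (j := .three) hγ h₀ 1).continuousAt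
      have := continuous_dens.continuousAt (x := U₀)
      have := continuous_velX.continuousAt (x := U₀)
      fun_prop
    obtain ⟨e, he, hb⟩ := h₀.eventually_log (hcont.eventually (gt_mem_nhds
      (lt_add_of_pos_right _ one_pos)))
    refine ⟨_, ?_, e, he, hb⟩
    have := h₀.dens_pos
    positivity
  have hp0 := h₀.pres_pos
  obtain ⟨e₂, he₂, hP⟩ := h₀.eventually_log (continuous_pres.continuousAt.eventually
    (lt_mem_nhds (half_lt_self hp0)))
  set p := pres U₀ / 2
  have hp : 0 < p := by positivity
  set r' := min r (min (ε / 2) (ε / (4 * C)))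
  have hr' : 0 < r' := by positivity
  have r1 : r' ≤ r := min_le_left _ _
  have r2 : r' ≤ ε / 2 := (min_le_right _ _).trans (min_le_left _ _)
  have r3 : r' ≤ ε / (4 * C) := (min_le_right _ _).trans (min_le_right _ _)
  have r3' : C * r' ≤ ε / 4 := by
    have := (le_div_iff₀ (by positivity)).1 r3; linarith
  set e := min (min e₁ e₂) (min (min 1 (ε / 2)) (min (r' / (2 * C))
    (min (p / (2 * K)) (p * r / (2 * K) ))))
  have l1 : e ≤ e₁ := (min_le_left _ _).trans (min_le_left _ _)
  have l2 : e ≤ e₂ := (min_le_left _ _).trans (min_le_right _ _)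
  have l3 : e ≤ 1 := (min_le_right _ _).trans ((min_le_left _ _).trans (min_le_left _ _))
  have l4 : e ≤ ε / 2 := (min_le_right _ _).trans ((min_le_left _ _).trans (min_le_right _ _))
  have l5 : e ≤ r' / (2 * C) := (min_le_right _ _).trans ((min_le_right _ _).trans (min_le_left _ _))
  have l6 : e ≤ p / (2 * K) := (min_le_right _ _).trans ((min_le_right _ _).trans
    ((min_le_right _ _).trans (min_le_left _ _)))
  have l7 : e ≤ p * r / (2 * K) := (min_le_right _ _).trans ((min_le_right _ _).trans
    ((min_le_right _ _).trans (min_le_right _ _)))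
  refine ⟨e, by positivity, fun a U V hj ha hUV => ?_⟩
  rcases hj with ⟨ha0, hR⟩ | ⟨ha0, s, hSh⟩
  -- A rarefaction wave with too large a pressure ratio is cut where the ratio to its end near U₀ is
  -- exactly r'. The local estimates apply to this part and give it a parameter of at least r'/C,
  -- more than the whole wave has.
  · by_contra! hσ
    have hle : r' ≤ |presInc U V| := r1.trans hσ
    obtain ⟨⟨t, ht, W, hUW, hWV, hW⟩, ⟨t', ht', W', hUW', hWV', hW'⟩⟩ :=
      hR.exists_presInc hγ ha0 hr'.le hle
    have haC : C * a < r' := by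
      rw [abs_of_nonneg ha0] at ha
      have := (lt_div_iff₀ (by positivity)).1 (ha.trans_le l5)
      nlinarith
    rcases hUV with hU | hV
    · have hU' := ball_subset_ball (l4.trans (by linarith : ε / 2 ≤ ε)) hU
      have := h.presInc_le hγ (Or.inl ⟨ht.1, hUW⟩) hU' (by rw [hW]; linarith)
      rw [hW, abs_of_nonneg ht.1] at this
      nlinarith [ht.2]
    · have hV' := ball_subset_ball (l4.trans (by linarith : ε / 2 ≤ ε)) hV
      have hj' : AcJoin γ j (a - t') W' V := Or.inl ⟨by linarith [ht'.2], hWV'⟩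
      have hs := h.size _ W' V hj' (Or.inr hV') (by rw [hW']; linarith)
      rw [hW'] at hs
      have hWb : toLog W' ∈ ball (toLog U₀) ε := by
        rw [mem_ball_iff_norm] at hV ⊢
        have e1 : toLog W' - toLog U₀ = (toLog V - toLog U₀) - (toLog V - toLog W') := by abel
        rw [e1]
        refine (norm_sub_le _ _).trans_lt ?_
        linarith
      have := h.presInc_le hγ hj' hWb (by rw [hW']; linarith)
      rw [hW', abs_of_nonneg (by linarith [ht'.2])] at this
      nlinarith [ht'.1]
  -- For a shock, `pres_sub_le` at whichever end lies near U₀ bounds the pressure jump by K|a|. Both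
  -- pressures then stay above p/2, so their logarithms are close.
  · have hb : ∀ W, W = U ∨ W = V → toLog W ∈ ball (toLog U₀) e → |presInc U V| < r := by
      intro W hWUV hW
      have hWs : Supersonic γ W := by
        rcases hWUV with rfl | rfl
        · exact hSh.1
        · exact hSh.2.1
      have k1 := hSh.pres_sub_le hγ hWUV
      have k2 := hS W hWs (ball_subset_ball l1 hW)
      have k3 := hP W hWs (ball_subset_ball l2 hW)
      have k4 : |pres V - pres U| ≤ K * |a| := by
        refine k1.trans ?_
        gcongr
        refine le_trans ?_ k2.le
        have := hWs.dens_pos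
        gcongr
        linarith
      have k5 : K * |a| < p / 2 := by
        have := (lt_div_iff₀ (by positivity)).1 (ha.trans_le l6); linarith
      have k6 : K * |a| < p * r / 2 := by
        have := (lt_div_iff₀ (by positivity)).1 (ha.trans_le l7); linarith
      have hUp : p / 2 < pres U := by
        have := abs_lt.1 (k4.trans_lt k5)
        rcases hWUV with rfl | rfl <;> linarith
      have hVp : p / 2 < pres V := by
        have := abs_lt.1 (k4.trans_lt k5)
        rcases hWUV with rfl | rfl <;> linarith
      have hlog : ∀ x y : ℝ, p / 2 < x → p / 2 < y → |y - x| < p * r / 2 →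
          Real.log y - Real.log x < r := by
        intro x y hx hy hxy
        have hx0 : 0 < x := by linarith
        have hy0 : 0 < y := by linarith
        rw [← Real.log_div hy0.ne' hx0.ne']
        have := Real.log_le_sub_one_of_pos (div_pos hy0 hx0)
        have e1 : y / x - 1 = (y - x) / x := by field_simp
        rw [e1] at this
        refine this.trans_lt ?_
        rw [div_lt_iff₀ hx0]
        have := abs_lt.1 hxy
        nlinarith
      rw [presInc, abs_lt]
      have q := k4.trans_lt k6
      have q1 := hlog _ _ hUp hVp q
      have q2 := hlog _ _ hVp hUp (by rwa [abs_sub_comm])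
      constructor <;> linarith
    rcases hUV with hU | hV
    · exact hb U (Or.inl rfl) hU
    · exact hb V (Or.inr rfl) hV

/-- The state in front of (upstream of) a `j`-wave. -/
def upstream : Acoustic → State → State → State
  | .one, U, _ => U
  | .three, _, V => V

/-- Waves that turn the flow by a small angle have a small pressure ratio. -/
lemma exists_presInc_small_of_angle (hγ : 1 < γ) (h₀ : Supersonic γ U₀)
    (h : LocalFamily γ j (toLog U₀) C ε) :
    ∀ r > 0, ∃ e > 0, ∀ (a : ℝ) (U V : State), AcJoin γ j a U V →
      toLog (upstream j U V) ∈ ball (toLog U₀) e → |angle V - angle U| < e →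
      |presInc U V| < r := by
  intro r hr
  have hC := h.reg.one_le
  have hε := h.reg.pos
  obtain ⟨κ, hκ, ε₀, -, hang⟩ := h₀.exists_angle_bound hγ j
  obtain ⟨ε₁, hε₁, -, hang⟩ := hang (κ / 2) (by positivity)
  have hangle : ∀ (a : ℝ) (U V : State), AcJoin γ j a U V → toLog U ∈ ball (toLog U₀) ε →
      toLog U ∈ ball (toLog U₀) ε₁ → |presInc U V| < ε₁ →
      κ / 2 * |presInc U V| ≤ |angle V - angle U| := by
    intro a U V hj hU hU' hσ
    have k := hang (presInc U V) 0 hσ (by simpa using hε₁) _ hU'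
    have e1 : angle V - angle U = (acousticInc γ j (presInc U V, toLog U)).2.1 := by
      have := congrArg (fun X : LogState => X.2.1) (hj.toLog_eq hγ)
      simp only [Prod.snd_add, Prod.fst_add] at this
      have e2 : angle V = (toLog V).2.1 := rfl
      have e3 : angle U = (toLog U).2.1 := rfl
      rw [e2, e3, this]; ring
    rw [h.reg.zero _ hU, ← e1] at k
    simp only [Prod.snd_zero, Prod.fst_zero, sub_zero] at k
    have k2 : |j.sgn * κ * presInc U V| = κ * |presInc U V| := by
      rw [abs_mul, abs_mul, j.abs_sgn, abs_of_pos hκ, one_mul]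
    have := abs_sub_abs_le_abs_sub (j.sgn * κ * presInc U V) (angle V - angle U)
    rw [abs_sub_comm (j.sgn * κ * presInc U V) (angle V - angle U)] at this
    linarith
  obtain ⟨M, hM, e₁, he₁, hS⟩ : ∃ M > 0, ∃ e₁ > 0, ∀ W, Supersonic γ W →
      toLog W ∈ ball (toLog U₀) e₁ → machSqOf γ W < M := by
    have hcont : ContinuousAt (logMach γ) (toLog U₀) :=
      (contDiff_logMach γ (n := 0)).continuous.continuousAt
    obtain ⟨e, he, hb⟩ := Metric.eventually_nhds_iff_ball.1 (hcont.eventually (gt_mem_nhds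
      (lt_add_of_pos_right _ one_pos)))
    refine ⟨logMach γ (toLog U₀) + 1, ?_, e, he, fun W hW hWm => ?_⟩
    · have := h₀.one_lt_logMach hγ; linarith
    · rw [← hW.logMach_toLog hγ]; exact hb _ hWm
  -- T bounds `shockTan` from below for shocks whose logarithmic pressure ratio is at least r: then
  -- x - 1 ≥ r, the numerator of the radicand is at least (γ - 1)(x - 1) by `pressure_bound`, and M
  -- bounds the denominators.
  set T := r / (γ * M) * √((γ - 1) * r / (2 * γ * M)) with hT
  have hT0 : 0 < T := by
    have : 0 < γ - 1 := by linarith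
    positivity
  set r' := min r (min (min ε ε₁ / 2) (min ε ε₁ / (4 * C)))
  have hr' : 0 < r' := by positivity
  have r1 : r' ≤ r := min_le_left _ _
  have r2 : r' ≤ min ε ε₁ / 2 := (min_le_right _ _).trans (min_le_left _ _)
  have r3 : r' ≤ min ε ε₁ / (4 * C) := (min_le_right _ _).trans (min_le_right _ _)
  have r3' : C * r' ≤ min ε ε₁ / 4 := by
    have := (le_div_iff₀ (by positivity)).1 r3; linarith
  have m1 := min_le_left ε ε₁
  have m2 := min_le_right ε ε₁
  set e := min (min e₁ (min ε ε₁ / 2)) (min (κ / 2 * r') (Real.arctan T))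
  have l1 : e ≤ e₁ := (min_le_left _ _).trans (min_le_left _ _)
  have l2 : e ≤ min ε ε₁ / 2 := (min_le_left _ _).trans (min_le_right _ _)
  have l3 : e ≤ κ / 2 * r' := (min_le_right _ _).trans (min_le_left _ _)
  have l4 : e ≤ Real.arctan T := (min_le_right _ _).trans (min_le_right _ _)
  have hat : 0 < Real.arctan T := Real.arctan_pos.2 hT0
  refine ⟨e, by positivity, fun a U V hj hW hθ => ?_⟩
  by_contra! hσ
  have hle : r' ≤ |presInc U V| := r1.trans hσ
  rcases hj with ⟨ha0, hR⟩ | ⟨ha0, s, hSh⟩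
  · obtain ⟨⟨t, ht, W, hUW, hWV, hWr⟩, ⟨t', ht', W', hUW', hWV', hWr'⟩⟩ :=
      hR.exists_presInc hγ ha0 hr'.le hle
    have hVU := (hR.monotone hγ ha0).2
    change 0 ≤ angle V - angle U at hVU
    rw [abs_of_nonneg hVU] at hθ
    -- The flow angle increases along a rarefaction curve, so a part of the wave turns the flow by
    -- no more than the whole. The part with pressure ratio r' is within reach of the local bound
    -- `hangle`.
    have hmain : ∀ b A B, 0 ≤ b → IsRarefaction γ j b A B → |presInc A B| = r' →
        angle B - angle A ≤ angle V - angle U → toLog A ∈ ball (toLog U₀) (min ε ε₁) → False := by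
      intro b A B hb hAB hr hle hA
      have hn := (hAB.monotone hγ hb).2
      change 0 ≤ angle B - angle A at hn
      have k := hangle b A B (Or.inl ⟨hb, hAB⟩) (ball_subset_ball m1 hA)
        (ball_subset_ball m2 hA) (by rw [hr]; linarith)
      rw [hr, abs_of_nonneg hn] at k
      linarith
    cases j
    · refine hmain t U W ht.1 hUW hWr ?_ (ball_subset_ball (l2.trans (half_le_self (by positivity))) hW)
      have := (hWV.monotone hγ (by linarith [ht.2])).2
      change 0 ≤ angle V - angle W at this
      linarith
    · refine hmain (a - t') W' V (by linarith [ht'.2]) hWV' hWr' ?_ ?_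
      · have := (hUW'.monotone hγ ht'.1).2
        change 0 ≤ angle W' - angle U at this
        linarith
      · change toLog V ∈ _ at hW
        have hs := h.size _ W' V (Or.inl ⟨by linarith [ht'.2], hWV'⟩)
          (Or.inr (ball_subset_ball (by linarith) hW)) (by rw [hWr']; linarith)
        rw [hWr'] at hs
        rw [mem_ball_iff_norm] at hW ⊢
        have e1 : toLog W' - toLog U₀ = (toLog V - toLog U₀) - (toLog V - toLog W') := by abel
        rw [e1]
        refine (norm_sub_le _ _).trans_lt ?_
        linarith
  · -- a shock with upstream state `A`
    have hmain : ∀ A B, ShockRel γ j s A B → pres A < pres B → r ≤ presInc A B →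
        toLog A ∈ ball (toLog U₀) e → |angle B - angle A| < e → False := by
      intro A B hs hp hr hA hθ
      have hb := hs.pressure_bound hγ hp
      have hd := hs.den_pos hγ
      have hpA := hs.left.pres_pos
      have hpB := hs.right.pres_pos
      rw [hs.angle_eq hγ, abs_mul, j.abs_sgn, one_mul] at hθ
      have hm := hS A hs.left (ball_subset_ball l1 hA)
      have hm1 := hs.left.one_lt_machSqOf hγ
      set x := pres B / pres A
      set m := machSqOf γ A
      have hx1 : 1 < x := (one_lt_div hpA).2 hp
      have hx : r ≤ x - 1 := by
        have : Real.log x ≤ x - 1 := Real.log_le_sub_one_of_pos (by linarith)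
        have e1 : Real.log x = presInc A B := by
          rw [presInc]; exact Real.log_div hpB.ne' hpA.ne'
        linarith
      have hN : (γ - 1) * (x - 1) ≤ 2 * γ * m - (γ - 1) - (γ + 1) * x := by
        have : 0 < γ + 1 := by linarith
        have h1 : (γ + 1) * ((γ - 1) * (x - 1)) ≤
          (γ + 1) * (2 * γ * m - (γ - 1) - (γ + 1) * x) := by linarith
        exact le_of_mul_le_mul_left h1 this
      have hN0 : 0 ≤ (γ - 1) * (x - 1) := mul_nonneg (by linarith) (by linarith)
      have hden2 : (γ + 1) * x + (γ - 1) ≤ 2 * γ * M := by nlinarith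
      have hden1 : γ * m - (x - 1) ≤ γ * M := by nlinarith
      have hTle : T ≤ shockTan γ m x := by
        rw [hT, shockTan]
        have : 0 < (γ + 1) * x + (γ - 1) := by nlinarith
        have h0 : 0 ≤ γ - 1 := by linarith
        have h1 := (mul_le_mul_of_nonneg_left hx h0).trans hN
        have h2 := hN0.trans hN
        gcongr
      have := Real.arctan_strictMono.monotone hTle
      have h2 := le_abs_self (Real.arctan (shockTan γ m x))
      linarith
    have hp := hSh.2.2.2.2.2.1
    have hσs := hSh.sgn_mul_presInc
    have hs := hSh.shockRel hγ
    cases j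
    · simp only [Acoustic.sgn] at hp hσs
      refine hmain U V hs (by linarith) ?_ hW hθ
      rwa [abs_of_pos (by linarith)] at hσ
    · simp only [Acoustic.sgn] at hp hσs
      refine hmain V U hs.symm (by linarith) ?_ hW (by rwa [abs_sub_comm])
      rw [abs_of_neg (by linarith)] at hσ
      rwa [presInc_swap]

end Local

end SteadyEuler
end

noncomputable section
namespace SteadyEuler

open Set Filter Topology Metric

/-! ## Interaction estimates in logarithmic coordinates -/

/-- The physical wave `w` joins the lower state `U` to the upper state `V`; trivial waves are
allowed. -/
def WaveJoin (γ : ℝ) : Wave → State → State → Prop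
  | .acoustic j a, U, V => AcJoin γ j a U V
  | .contact a b, U, V =>
      Supersonic γ U ∧ Supersonic γ V ∧ toLog V = toLog U + ((0, 0, a, b) : LogState)
  | .nonphysical _, _, _ => False

lemma WaveJoin.left {γ : ℝ} (hγ : 1 < γ) {w : Wave} {U V : State} (h : WaveJoin γ w U V) :
    Supersonic γ U := by
  match w, h with
  | .acoustic j a, h => exact AcJoin.left hγ h
  | .contact a b, h => exact h.1

lemma WaveJoin.right {γ : ℝ} (hγ : 1 < γ) {w : Wave} {U V : State} (h : WaveJoin γ w U V) :
    Supersonic γ V := by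
  match w, h with
  | .acoustic j a, h => exact AcJoin.right hγ h
  | .contact a b, h => exact h.2.1

/-- A translation that leaves pressure and direction of the flow unchanged. -/
def slip (d : ℝ × ℝ) : LogState := (0, 0, d.1, d.2)

lemma norm_slip (d : ℝ × ℝ) : ‖slip d‖ = ‖d‖ := by
  simp [slip, Prod.norm_def]

lemma slip_sub (d f : ℝ × ℝ) : slip d - slip f = slip (d - f) := by
  ext <;> simp [slip]

lemma acousticInc_fst (γ : ℝ) (j : Acoustic) (σ : ℝ) (X : LogState) :
    (acousticInc γ j (σ, X)).1 = σ := by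
  rw [acousticInc, glue]; split_ifs <;> rfl

section Family

variable {γ : ℝ} {j : Acoustic} {U₀ : State} {C ε : ℝ}

lemma LocalFamily.norm_le (h : LocalFamily γ j (toLog U₀) C ε) {σ : ℝ} {X : LogState}
    (hσ : |σ| < ε) (hX : X ∈ ball (toLog U₀) ε) : ‖acousticInc γ j (σ, X)‖ ≤ C * |σ| := by
  have := h.reg.lip σ 0 hσ (by simpa using h.reg.pos) X hX X hX
  rwa [h.reg.zero X hX, sub_zero, sub_self, norm_zero, mul_zero, add_zero, sub_zero] at this

/-- Waves with small parameters are small. -/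
lemma exists_small (hγ : 1 < γ) (h₀ : Supersonic γ U₀) (h : LocalFamily γ j (toLog U₀) C ε) :
    ∀ r > 0, ∃ e > 0, ∀ (a : ℝ) (U V : State), AcJoin γ j a U V → |a| < e →
      (toLog U ∈ ball (toLog U₀) e ∨ toLog V ∈ ball (toLog U₀) e) →
      |presInc U V| < r ∧ toLog U ∈ ball (toLog U₀) r ∧ toLog V ∈ ball (toLog U₀) r ∧
        |presInc U V| ≤ C * |a| ∧ ‖toLog V - toLog U‖ ≤ C ^ 2 * |a| := by
  intro r hr
  have hC := h.reg.one_le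
  have hε := h.reg.pos
  set r₀ := min r ε
  have hr₀ : 0 < r₀ := by positivity
  have l1 : r₀ ≤ r := min_le_left _ _
  have l2 : r₀ ≤ ε := min_le_right _ _
  obtain ⟨e, he, hs⟩ := exists_presInc_small hγ h₀ h (r₀ / (2 * C)) (by positivity)
  have l3 : r₀ / (2 * C) ≤ r₀ / 2 := by gcongr; linarith
  have m1 := min_le_left e (r₀ / 2)
  have m2 := min_le_right e (r₀ / 2)
  refine ⟨min e (r₀ / 2), by positivity, fun a U V hj ha hUV => ?_⟩
  have hσ := hs a U V hj (ha.trans_le m1)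
    (hUV.imp (fun h => ball_subset_ball m1 h) fun h => ball_subset_ball m1 h)
  have hsz := h.size a U V hj (hUV.imp (fun h => ball_subset_ball (by linarith) h)
    fun h => ball_subset_ball (by linarith) h) (by linarith)
  have hd : ‖toLog V - toLog U‖ < r₀ / 2 := by
    refine hsz.trans_lt ?_
    have := (lt_div_iff₀ (by positivity)).1 hσ
    linarith
  have hUV' : toLog U ∈ ball (toLog U₀) r₀ ∧ toLog V ∈ ball (toLog U₀) r₀ := by
    simp only [mem_ball_iff_norm] at hUV ⊢
    have e1 : toLog U - toLog U₀ = (toLog V - toLog U₀) - (toLog V - toLog U) := by abel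
    have e2 : toLog V - toLog U₀ = (toLog U - toLog U₀) + (toLog V - toLog U) := by abel
    have k1 := norm_sub_le (toLog V - toLog U₀) (toLog V - toLog U)
    have k2 := norm_add_le (toLog U - toLog U₀) (toLog V - toLog U)
    rw [← e1] at k1
    rw [← e2] at k2
    rcases hUV with h | h <;> constructor <;> linarith
  have hp := h.presInc_le hγ hj (ball_subset_ball l2 hUV'.1) (by linarith)
  refine ⟨by linarith, ball_subset_ball l1 hUV'.1, ball_subset_ball l1 hUV'.2, hp, hsz.trans ?_⟩
  calc C * |presInc U V| ≤ C * (C * |a|) := by gcongr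
    _ = _ := by ring

/-- Equal waves that start from different states. -/
lemma LocalFamily.same (hγ : 1 < γ) (h : LocalFamily γ j (toLog U₀) C ε) {a : ℝ}
    {U V U' V' : State} (h1 : AcJoin γ j a U V) (h2 : AcJoin γ j a U' V')
    (hU : toLog U ∈ ball (toLog U₀) ε) (hU' : toLog U' ∈ ball (toLog U₀) ε)
    (hσ : |presInc U V| < ε) (hσ' : |presInc U' V'| < ε) :
    ‖toLog V - toLog U - (toLog V' - toLog U')‖ ≤
      2 * C ^ 2 * |presInc U V| * ‖toLog U - toLog U'‖ := by
  have hC := h.reg.one_le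
  have k := h.reg.param _ _ hσ hσ' _ hU _ hU'
  have l := h.reg.lip _ _ hσ hσ' _ hU _ hU'
  rw [← h1.toLog_eq hγ, ← h2.toLog_eq hγ, (h1.left hγ).logLam_toLog, (h1.right hγ).logLam_toLog,
    (h2.left hγ).logLam_toLog, (h2.right hγ).logLam_toLog, h1.lam_sub hγ, h2.lam_sub hγ, sub_self,
    abs_zero, zero_add] at k
  rw [h1.toLog_eq hγ, h2.toLog_eq hγ, add_sub_cancel_left, add_sub_cancel_left]
  refine l.trans ?_
  calc _ ≤ C * (C * (|presInc U V| * ‖toLog U - toLog U'‖) +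
        C * (|presInc U V| * ‖toLog U - toLog U'‖)) := by
        exact mul_le_mul_of_nonneg_left
          (add_le_add k (le_mul_of_one_le_left (by positivity) hC)) (by positivity)
    _ = _ := by ring

/-- The parameters of two waves of the same family. -/
lemma LocalFamily.param_sub (hγ : 1 < γ) (h : LocalFamily γ j (toLog U₀) C ε) {a a' : ℝ}
    {U V U' V' : State} (h1 : AcJoin γ j a U V) (h2 : AcJoin γ j a' U' V')
    (hU : toLog U ∈ ball (toLog U₀) ε) (hU' : toLog U' ∈ ball (toLog U₀) ε)
    (hσ : |presInc U V| < ε) (hσ' : |presInc U' V'| < ε) :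
    |a - a'| ≤ C * (|presInc U V - presInc U' V'| +
      |presInc U V| * ‖toLog U - toLog U'‖) := by
  have k := h.reg.param' _ _ hσ hσ' _ hU _ hU'
  rwa [← h1.toLog_eq hγ, ← h2.toLog_eq hγ, (h1.left hγ).logLam_toLog, (h1.right hγ).logLam_toLog,
    (h2.left hγ).logLam_toLog, (h2.right hγ).logLam_toLog, h1.lam_sub hγ, h2.lam_sub hγ] at k

/-- Two consecutive waves of the same family compared with a wave of the added parameters. -/
lemma LocalFamily.merge_sub (hγ : 1 < γ) (h : LocalFamily γ j (toLog U₀) C ε)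
    (hΛ : ∀ X ∈ ball (toLog U₀) ε, ∀ Y ∈ ball (toLog U₀) ε,
      |logLam γ j X - logLam γ j Y| ≤ C * ‖X - Y‖) {a b : ℝ}
    {U M V W : State} (h1 : AcJoin γ j a U M) (h2 : AcJoin γ j b M V)
    (h3 : AcJoin γ j (a + b) U W) (hU : toLog U ∈ ball (toLog U₀) (ε / 2))
    (hM : toLog M ∈ ball (toLog U₀) ε) (hV : toLog V ∈ ball (toLog U₀) ε)
    (hσ : |presInc U M| < ε / (4 * C)) (hτ : |presInc M V| < ε / (4 * C))
    (hω : |presInc U W| < ε) :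
    ‖toLog W - toLog V‖ ≤ 2 * C ^ 4 * (|presInc U M| * |presInc M V|) := by
  have hC := h.reg.one_le
  have hε := h.reg.pos
  set σ := presInc U M
  set τ := presInc M V
  set X := toLog U
  have hX : X ∈ ball (toLog U₀) ε := ball_subset_ball (half_le_self hε.le) hU
  have hst : |σ + τ| < ε / (2 * C) := by
    refine (abs_add_le _ _).trans_lt ?_
    have : ε / (2 * C) = ε / (4 * C) + ε / (4 * C) := by field_simp; norm_num
    linarith
  have q1 : ε / (4 * C) ≤ ε := div_le_self hε.le (by linarith)
  have q2 : ε / (2 * C) ≤ ε := div_le_self hε.le (by linarith)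
  have eM : toLog M = X + acousticInc γ j (σ, X) := h1.toLog_eq hγ
  have eV : toLog V = toLog M + acousticInc γ j (τ, toLog M) := h2.toLog_eq hγ
  have eW : toLog W = X + acousticInc γ j (presInc U W, X) := h3.toLog_eq hγ
  have k := h.reg.merge σ τ (by linarith) (by linarith) (by linarith) X hX (by rwa [← eM])
  rw [← eM] at k
  set Y := X + acousticInc γ j (σ + τ, X) with hY
  have hYb : Y ∈ ball (toLog U₀) ε := by
    have := h.norm_le (lt_of_lt_of_le hst q2) hX
    rw [mem_ball_iff_norm] at hU ⊢
    have e1 : Y - toLog U₀ = (X - toLog U₀) + acousticInc γ j (σ + τ, X) := by rw [hY]; abel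
    rw [e1]
    refine (norm_add_le _ _).trans_lt ?_
    have := (lt_div_iff₀ (by positivity)).1 hst
    linarith
  have k' : ‖Y - toLog V‖ ≤ C * (|σ| * |τ|) := by
    refine le_trans (le_of_eq ?_) k
    congr 1
    rw [hY, eV, eM]; abel
  -- W and Y lie on the same curve through X. The increment of λ_j is a + b at W, and nearly so at
  -- Y, because Y is close to V, where it is a + b exactly. Hence their curve parameters are close.
  have p := h.reg.param (presInc U W) (σ + τ) hω (by linarith) X hX X hX
  have l := h.reg.lip (presInc U W) (σ + τ) hω (by linarith) X hX X hX
  rw [sub_self, norm_zero, mul_zero, add_zero] at p l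
  have e2 : logLam γ j (toLog V) - logLam γ j X = a + b := by
    rw [(h2.right hγ).logLam_toLog, (h1.left hγ).logLam_toLog]
    have := h1.lam_sub hγ
    have := h2.lam_sub hγ
    linarith
  have e3 : logLam γ j (toLog W) - logLam γ j X = a + b := by
    rw [(h3.right hγ).logLam_toLog, (h1.left hγ).logLam_toLog, h3.lam_sub hγ]
  have hp : |presInc U W - (σ + τ)| ≤ C * (C * (C * (|σ| * |τ|))) := by
    refine p.trans ?_
    gcongr
    rw [← eW, e3, ← e2, ← hY]
    refine le_trans (le_of_eq ?_) ((hΛ _ hV _ hYb).trans ?_)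
    · congr 1; ring
    · rw [norm_sub_rev]; gcongr
  have e4 : toLog W - toLog V = (acousticInc γ j (presInc U W, X) -
      acousticInc γ j (σ + τ, X)) + (Y - toLog V) := by rw [eW, hY]; abel
  rw [e4]
  refine (norm_add_le _ _).trans ((add_le_add l k').trans ?_)
  have h0 : 0 ≤ |σ| * |τ| := by positivity
  have h4 : C ≤ C ^ 4 := le_self_pow₀ hC (by norm_num)
  calc C * |presInc U W - (σ + τ)| + C * (|σ| * |τ|)
      ≤ C * (C * (C * (C * (|σ| * |τ|)))) + C ^ 4 * (|σ| * |τ|) := by gcongr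
    _ = _ := by ring

end Family

/-! ### The accurate Riemann solver -/

/-- The upper state of a fan with the given increments of the pressure logarithm over the acoustic
waves and the given slip. -/
def fanEnd (γ σ₁ : ℝ) (d : ℝ × ℝ) (σ₃ : ℝ) (X : LogState) : LogState :=
  X + acousticInc γ .one (σ₁, X) + slip d +
    acousticInc γ .three (σ₃, X + acousticInc γ .one (σ₁, X) + slip d)

/-- The unknowns are the differences s and t of the two acoustic increments and the size D of the
difference of the slips. `h1` is the pressure component, `h2` the angle and `h3` the remaining
components. The linear part in s and t has determinant κ₁ + κ₃ > 0, and the terms with κ/16 and μ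
are small enough to be absorbed. -/
lemma linear_transversality {κ κ₁ κ₃ C μ s t D E : ℝ} (hκ₁ : 0 < κ₁) (hκ₃ : 0 < κ₃)
    (hκ : κ = κ₁ + κ₃) (hC : 1 ≤ C) (hE : 0 ≤ E) (hμ0 : 0 ≤ μ) (hμ : μ ≤ 1 / 2)
    (hμ' : μ * (48 * C) ≤ κ) (hD0 : 0 ≤ D)
    (h1 : |s + t| ≤ E)
    (h2 : |κ₃ * t - κ₁ * s| ≤ E + κ / 16 * (|s| + |t|) + μ * (C * |s| + D))
    (h3 : D ≤ E + C * |s| + C * |t| + μ * (C * |s| + D)) :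
    ∃ M, M = 2 / κ * (κ₃ + 2 + C + κ) ∧ |s| ≤ M * E ∧ |t| ≤ (1 + M) * E ∧
      D ≤ (2 + 2 * C + 5 * C * M) * E := by
  have hκ0 : 0 < κ := by linarith
  have ht : |t| ≤ E + |s| := by
    have : t = (s + t) - s := by ring
    rw [this]
    exact (abs_sub _ _).trans (by linarith)
  have hs0 := abs_nonneg s
  have ht0 := abs_nonneg t
  have hD : D ≤ 2 * E + 3 * C * |s| + 2 * C * |t| := by
    have := mul_le_mul_of_nonneg_right hμ (by positivity : 0 ≤ C * |s| + D)
    linarith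
  have hμD : μ * (C * |s| + D) ≤ (1 + C) * E + κ / 8 * |s| := by
    have a1 : C * |s| + D ≤ (2 + 2 * C) * E + 6 * C * |s| := by nlinarith
    have a2 := mul_le_mul_of_nonneg_left a1 hμ0
    have a3 := mul_le_mul_of_nonneg_right hμ (by positivity : 0 ≤ (2 + 2 * C) * E)
    have a4 := mul_le_mul_of_nonneg_right hμ' hs0
    nlinarith
  have hs : κ * |s| ≤ κ₃ * E + |κ₃ * t - κ₁ * s| := by
    rw [← abs_of_pos hκ0, ← abs_mul]
    have : κ * s = κ₃ * (s + t) - (κ₃ * t - κ₁ * s) := by rw [hκ]; ring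
    rw [this]
    refine (abs_sub _ _).trans ?_
    rw [abs_mul, abs_of_pos hκ₃]
    gcongr
  have hs' : |s| ≤ 2 / κ * (κ₃ + 2 + C + κ) * E := by
    rw [div_mul_eq_mul_div, div_mul_eq_mul_div, le_div_iff₀ hκ0]
    nlinarith
  refine ⟨_, rfl, hs', by linarith, ?_⟩
  nlinarith [mul_le_mul_of_nonneg_left hs' (by linarith : 0 ≤ C), mul_le_mul_of_nonneg_left ht (by linarith : 0 ≤ C)]

set_option maxHeartbeats 1000000 in
/-- The fan is determined by its end states, with Lipschitz dependence. -/
lemma exists_fanEnd_bound {γ : ℝ} (hγ : 1 < γ) {U₀ : State} (h₀ : Supersonic γ U₀) {C ε : ℝ}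
    (h : ∀ j, LocalFamily γ j (toLog U₀) C ε) :
    ∃ M, 0 ≤ M ∧ ∃ e > 0, ∀ (σ₁ τ₁ σ₃ τ₃ : ℝ) (d f : ℝ × ℝ), ∀ X ∈ ball (toLog U₀) e,
      |σ₁| < e → |τ₁| < e → |σ₃| < e → |τ₃| < e → ‖d‖ < e → ‖f‖ < e →
      |σ₁ - τ₁| ≤ M * ‖fanEnd γ σ₁ d σ₃ X - fanEnd γ τ₁ f τ₃ X‖ ∧
      ‖d - f‖ ≤ M * ‖fanEnd γ σ₁ d σ₃ X - fanEnd γ τ₁ f τ₃ X‖ ∧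
      |σ₃ - τ₃| ≤ M * ‖fanEnd γ σ₁ d σ₃ X - fanEnd γ τ₁ f τ₃ X‖ := by
  have hC := (h .one).reg.one_le
  have hε := (h .one).reg.pos
  obtain ⟨κ₁, hκ₁, ε₀, -, hang₁⟩ := h₀.exists_angle_bound hγ .one
  obtain ⟨κ₃, hκ₃, ε₀', -, hang₃⟩ := h₀.exists_angle_bound hγ .three
  set κ := κ₁ + κ₃ with hκ
  have hκ0 : 0 < κ := by positivity
  obtain ⟨ε₁, hε₁, -, hang₁⟩ := hang₁ (κ / 16) (by positivity)
  obtain ⟨ε₃, hε₃, -, hang₃⟩ := hang₃ (κ / 16) (by positivity)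
  set r := min ε (min ε₁ ε₃) with hr
  have hr0 : 0 < r := by positivity
  have r1 : r ≤ ε := min_le_left _ _
  have r2 : r ≤ ε₁ := (min_le_right _ _).trans (min_le_left _ _)
  have r3 : r ≤ ε₃ := (min_le_right _ _).trans (min_le_right _ _)
  set e := min (r / (4 * C)) (min (1 / (2 * C)) (κ / (48 * C ^ 2)))
  have e1 : e * (4 * C) ≤ r := (le_div_iff₀ (by positivity)).1 (min_le_left _ _)
  have e2 : e * (2 * C) ≤ 1 :=
    (le_div_iff₀ (by positivity)).1 ((min_le_right _ _).trans (min_le_left _ _))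
  have e3 : e * (48 * C ^ 2) ≤ κ :=
    (le_div_iff₀ (by positivity)).1 ((min_le_right _ _).trans (min_le_right _ _))
  have he : 0 < e := by positivity
  have e4 : e ≤ r / 4 := by nlinarith
  set M := 2 / κ * (κ₃ + 2 + C + κ) with hM
  have hM0 : 0 ≤ M := by positivity
  refine ⟨2 + 2 * C + 5 * C * M, by positivity, e, he, ?_⟩
  intro σ₁ τ₁ σ₃ τ₃ d f X hX hσ₁ hτ₁ hσ₃ hτ₃ hd hf
  set E := ‖fanEnd γ σ₁ d σ₃ X - fanEnd γ τ₁ f τ₃ X‖ with hE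
  have hXr : X ∈ ball (toLog U₀) r := ball_subset_ball (by linarith) hX
  have hXε := ball_subset_ball r1 hXr
  set A := acousticInc γ .one (σ₁, X) with hA
  set A' := acousticInc γ .one (τ₁, X) with hA'
  set Y := X + A + slip d with hY
  set Y' := X + A' + slip f with hY'
  set B := acousticInc γ .three (σ₃, Y) with hB
  set B' := acousticInc γ .three (τ₃, Y') with hB'
  have hfan : fanEnd γ σ₁ d σ₃ X - fanEnd γ τ₁ f τ₃ X = (A - A') + slip (d - f) + (B - B') := by
    rw [← slip_sub]
    change Y + B - (Y' + B') = _
    rw [hY, hY']; abel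
  have hYr : Y ∈ ball (toLog U₀) r := by
    rw [mem_ball_iff_norm] at hX ⊢
    have q1 : Y - toLog U₀ = (X - toLog U₀) + A + slip d := by rw [hY]; abel
    have q2 := (h .one).norm_le (show |σ₁| < ε by linarith) hXε
    rw [q1]
    refine (norm_add₃_le).trans_lt ?_
    rw [norm_slip]
    nlinarith
  have hYr' : Y' ∈ ball (toLog U₀) r := by
    rw [mem_ball_iff_norm] at hX ⊢
    have q1 : Y' - toLog U₀ = (X - toLog U₀) + A' + slip f := by rw [hY']; abel
    have q2 := (h .one).norm_le (show |τ₁| < ε by linarith) hXε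
    rw [q1]
    refine (norm_add₃_le).trans_lt ?_
    rw [norm_slip]
    nlinarith
  have hYε := ball_subset_ball r1 hYr
  have hYε' := ball_subset_ball r1 hYr'
  have hAA : ‖A - A'‖ ≤ C * |σ₁ - τ₁| := by
    have := (h .one).reg.lip σ₁ τ₁ (by linarith) (by linarith) X hXε X hXε
    rwa [sub_self, norm_zero, mul_zero, add_zero] at this
  have hYY : ‖Y - Y'‖ ≤ C * |σ₁ - τ₁| + ‖d - f‖ := by
    have q : Y - Y' = (A - A') + slip (d - f) := by rw [← slip_sub, hY, hY']; abel
    rw [q]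
    refine (norm_add_le _ _).trans ?_
    rw [norm_slip]
    gcongr
  have hBB : ‖B - B'‖ ≤ C * |σ₃ - τ₃| + C * |τ₃| * ‖Y - Y'‖ := by
    have := (h .three).reg.lip τ₃ σ₃ (by linarith) (by linarith) Y' hYε' Y hYε
    rw [norm_sub_rev, abs_sub_comm, norm_sub_rev Y' Y] at this
    refine this.trans (le_of_eq (by ring))
  have hμ0 : 0 ≤ C * |τ₃| := by positivity
  have hμle : C * |τ₃| ≤ C * e := by gcongr
  -- The pressure component is exactly linear, since σ is the first coordinate of every acoustic
  -- increment and slips do not change it.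
  have hfst : |(σ₁ - τ₁) + (σ₃ - τ₃)| ≤ E := by
    have := norm_fst_le (fanEnd γ σ₁ d σ₃ X - fanEnd γ τ₁ f τ₃ X)
    rw [hfan] at this
    simp only [Prod.fst_add, Prod.fst_sub, hA, hA', hB, hB', acousticInc_fst, slip, add_zero,
      Real.norm_eq_abs] at this
    rw [hE, hfan]
    exact this
  -- The angle is linear up to κ/16, apart from the shift of the state from which the 3-wave starts.
  have hsnd : |κ₃ * (σ₃ - τ₃) - κ₁ * (σ₁ - τ₁)| ≤
      E + κ / 16 * (|σ₁ - τ₁| + |σ₃ - τ₃|) + C * |τ₃| * (C * |σ₁ - τ₁| + ‖d - f‖) := by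
    have b1 := hang₁ σ₁ τ₁ (by linarith) (by linarith) X (ball_subset_ball r2 hXr)
    have b3 := hang₃ σ₃ τ₃ (by linarith) (by linarith) Y (ball_subset_ball r3 hYr)
    have b4 : |(acousticInc γ .three (τ₃, Y)).2.1 - (acousticInc γ .three (τ₃, Y')).2.1| ≤
        C * |τ₃| * ‖Y - Y'‖ := by
      have q := (h .three).reg.lip τ₃ τ₃ (by linarith) (by linarith) Y hYε Y' hYε'
      rw [sub_self, abs_zero, zero_add, ← mul_assoc] at q
      refine le_trans ?_ q
      exact (norm_fst_le (acousticInc γ .three (τ₃, Y) - acousticInc γ .three (τ₃, Y')).2).trans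
        (norm_snd_le _)
    have b5 : |(A - A' + slip (d - f) + (B - B')).2.1| ≤ E := by
      rw [hE, hfan]
      exact (norm_fst_le (A - A' + slip (d - f) + (B - B')).2).trans (norm_snd_le _)
    have b6 := mul_le_mul_of_nonneg_left hYY hμ0
    simp only [Prod.snd_add, Prod.fst_add, Prod.snd_sub, Prod.fst_sub, hA, hA', hB, hB', slip,
      add_zero] at b5
    simp only [Acoustic.sgn] at b1 b3
    have : κ₃ * (σ₃ - τ₃) - κ₁ * (σ₁ - τ₁) =
      ((acousticInc γ .one (σ₁, X)).2.1 - (acousticInc γ .one (τ₁, X)).2.1 +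
        ((acousticInc γ .three (σ₃, Y)).2.1 - (acousticInc γ .three (τ₃, Y')).2.1)) -
      ((acousticInc γ .one (σ₁, X)).2.1 - (acousticInc γ .one (τ₁, X)).2.1 - -1 * κ₁ * (σ₁ - τ₁)) -
      ((acousticInc γ .three (σ₃, Y)).2.1 - (acousticInc γ .three (τ₃, Y)).2.1 -
        1 * κ₃ * (σ₃ - τ₃)) -
      ((acousticInc γ .three (τ₃, Y)).2.1 - (acousticInc γ .three (τ₃, Y')).2.1) := by ring
    rw [this]
    refine (abs_sub _ _).trans ?_
    have c1 := abs_sub ((acousticInc γ .one (σ₁, X)).2.1 - (acousticInc γ .one (τ₁, X)).2.1 +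
        ((acousticInc γ .three (σ₃, Y)).2.1 - (acousticInc γ .three (τ₃, Y')).2.1) -
      ((acousticInc γ .one (σ₁, X)).2.1 - (acousticInc γ .one (τ₁, X)).2.1 - -1 * κ₁ * (σ₁ - τ₁)))
      ((acousticInc γ .three (σ₃, Y)).2.1 - (acousticInc γ .three (τ₃, Y)).2.1 -
        1 * κ₃ * (σ₃ - τ₃))
    have c2 := abs_sub ((acousticInc γ .one (σ₁, X)).2.1 - (acousticInc γ .one (τ₁, X)).2.1 +
        ((acousticInc γ .three (σ₃, Y)).2.1 - (acousticInc γ .three (τ₃, Y')).2.1))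
      ((acousticInc γ .one (σ₁, X)).2.1 - (acousticInc γ .one (τ₁, X)).2.1 - -1 * κ₁ * (σ₁ - τ₁))
    linarith
  have hthird : ‖d - f‖ ≤ E + C * |σ₁ - τ₁| + C * |σ₃ - τ₃| +
      C * |τ₃| * (C * |σ₁ - τ₁| + ‖d - f‖) := by
    have q : ‖d - f‖ = ‖fanEnd γ σ₁ d σ₃ X - fanEnd γ τ₁ f τ₃ X - (A - A') - (B - B')‖ := by
      rw [← norm_slip, hfan]; congr 1; abel
    refine (q.le.trans (norm_sub_le _ _)).trans ?_
    have q1 := norm_sub_le (fanEnd γ σ₁ d σ₃ X - fanEnd γ τ₁ f τ₃ X) (A - A')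
    have b6 := mul_le_mul_of_nonneg_left hYY hμ0
    linarith
  obtain ⟨M', hM', g1, g2, g3⟩ := linear_transversality hκ₁ hκ₃ hκ hC (norm_nonneg _) hμ0
    (by linarith) (by
      have := mul_le_mul_of_nonneg_right hμle (by positivity : 0 ≤ 48 * C)
      linarith) (norm_nonneg _) hfst hsnd hthird
  rw [← hM] at hM'
  subst hM'
  have hE0 : 0 ≤ E := norm_nonneg _
  have hCM : M ≤ C * M := le_mul_of_one_le_left hM0 hC
  exact ⟨g1.trans (mul_le_mul_of_nonneg_right (by linarith) hE0), g3,
    g2.trans (mul_le_mul_of_nonneg_right (by linarith) hE0)⟩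

/-- The waves of a fan whose end states are close to each other are small. -/
lemma exists_fan_small {γ : ℝ} (hγ : 1 < γ) {U₀ : State} (h₀ : Supersonic γ U₀) {C ε : ℝ}
    (h : ∀ j, LocalFamily γ j (toLog U₀) C ε) :
    ∀ r > 0, ∃ e > 0, ∀ (a₁ a₂₁ a₂₂ a₃ : ℝ) (U M₁ M₂ V : State), AcJoin γ .one a₁ U M₁ →
      WaveJoin γ (.contact a₂₁ a₂₂) M₁ M₂ → AcJoin γ .three a₃ M₂ V →
      toLog U ∈ ball (toLog U₀) e → toLog V ∈ ball (toLog U₀) e →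
      |presInc U M₁| < r ∧ |presInc M₂ V| < r ∧ toLog M₁ ∈ ball (toLog U₀) r ∧
        toLog M₂ ∈ ball (toLog U₀) r ∧ ‖(a₂₁, a₂₂)‖ < r := by
  intro r hr
  have hC := (h .one).reg.one_le
  have hε := (h .one).reg.pos
  set r' := min (r / (8 * C)) (ε / (8 * C))
  have hr' : 0 < r' := by positivity
  have k1 : r' * (8 * C) ≤ r := (le_div_iff₀ (by positivity)).1 (min_le_left _ _)
  have k2 : r' * (8 * C) ≤ ε := (le_div_iff₀ (by positivity)).1 (min_le_right _ _)
  have k3 : r' ≤ r / 8 := by nlinarith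
  have k4 : r' ≤ ε / 8 := by nlinarith
  obtain ⟨e₁, he₁, h1⟩ := exists_presInc_small_of_angle hγ h₀ (h .one) r' hr'
  obtain ⟨e₃, he₃, h3⟩ := exists_presInc_small_of_angle hγ h₀ (h .three) r' hr'
  set e := min (r' / 4) (min (e₁ / 4) (e₃ / 4))
  have l1 : e ≤ r' / 4 := min_le_left _ _
  have l2 : e ≤ e₁ / 4 := (min_le_right _ _).trans (min_le_left _ _)
  have l3 : e ≤ e₃ / 4 := (min_le_right _ _).trans (min_le_right _ _)
  refine ⟨e, by positivity, fun a₁ a₂₁ a₂₂ a₃ U M₁ M₂ V j1 j2 j3 hU hV => ?_⟩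
  obtain ⟨s1, s2, j2⟩ := j2
  have p12 : presInc M₁ M₂ = 0 := by
    have := congrArg Prod.fst j2
    simp only [Prod.fst_add, add_zero] at this
    exact sub_eq_zero.2 this
  have t12 : angle M₂ = angle M₁ := by
    have := congrArg (fun X : LogState => X.2.1) j2
    simp only [Prod.snd_add, Prod.fst_add, add_zero] at this
    exact this
  have hUV : ‖toLog V - toLog U‖ < 2 * e := by
    have := dist_triangle_right (toLog V) (toLog U) (toLog U₀)
    rw [dist_eq_norm] at this
    rw [mem_ball] at hU hV
    linarith
  have hp : |presInc U M₁ + presInc M₂ V| < 2 * e := by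
    have q : presInc U M₁ + presInc M₂ V = (toLog V - toLog U).1 := by
      change _ = presInc U V
      unfold presInc at p12 ⊢
      linarith
    rw [q]
    exact (norm_fst_le _).trans_lt hUV
  have ht : |(angle M₁ - angle U) + (angle V - angle M₂)| < 2 * e := by
    have q : (angle M₁ - angle U) + (angle V - angle M₂) = (toLog V - toLog U).2.1 := by
      change _ = angle V - angle U
      linarith
    rw [q]
    exact ((norm_fst_le _).trans (norm_snd_le _)).trans_lt hUV
  have g1 := j1.sign hγ
  have g3 := j3.sign hγ
  simp only [Acoustic.sgn] at g1 g3
  set σ₁ := presInc U M₁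
  set σ₃ := presInc M₂ V
  set x := angle M₁ - angle U
  set y := angle V - angle M₂
  -- If σ₁ and σ₃ do not have opposite signs, their small sum bounds both. Otherwise `AcJoin.sign`
  -- prevents the two turning angles from cancelling, so both are small and bound the pressure
  -- ratios.
  have hσ : |σ₁| < r' ∧ |σ₃| < r' := by
    have hsame : ∀ x y : ℝ, 0 ≤ x * y → |x + y| < 2 * e → |x| < 2 * e ∧ |y| < 2 * e := by
      intro x y hxy hs
      have := abs_nonneg x
      have := abs_nonneg y
      rcases mul_nonneg_iff.1 hxy with ⟨hx, hy⟩ | ⟨hx, hy⟩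
      · rw [abs_of_nonneg (by linarith)] at hs
        rw [abs_of_nonneg hx, abs_of_nonneg hy]
        constructor <;> linarith
      · rw [abs_of_nonpos (by linarith)] at hs
        rw [abs_of_nonpos hx, abs_of_nonpos hy]
        constructor <;> linarith
    rcases le_or_gt 0 (σ₁ * σ₃) with hs | hs
    · obtain ⟨a, b⟩ := hsame _ _ hs hp
      constructor <;> linarith
    · have hxy : 0 ≤ x * y := by
        by_contra! hc
        nlinarith [mul_pos_of_neg_of_neg hs hc, mul_nonneg g1 g3]
      obtain ⟨a, b⟩ := hsame _ _ hxy ht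
      exact ⟨h1 a₁ U M₁ j1 (ball_subset_ball (by linarith) hU) (by linarith),
        h3 a₃ M₂ V j3 (ball_subset_ball (by linarith) hV) (by linarith)⟩
  have z1 := (h .one).size a₁ U M₁ j1 (Or.inl (ball_subset_ball (by linarith) hU))
    (by linarith [hσ.1])
  have z3 := (h .three).size a₃ M₂ V j3 (Or.inr (ball_subset_ball (by linarith) hV))
    (by linarith [hσ.2])
  have w1 : ‖toLog M₁ - toLog U‖ < r / 8 := by nlinarith [hσ.1]
  have w3 : ‖toLog V - toLog M₂‖ < r / 8 := by nlinarith [hσ.2]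
  rw [mem_ball_iff_norm] at hU hV ⊢
  rw [mem_ball_iff_norm]
  have q1 : toLog M₁ - toLog U₀ = (toLog M₁ - toLog U) + (toLog U - toLog U₀) := by abel
  have q2 : toLog M₂ - toLog U₀ = (toLog V - toLog U₀) - (toLog V - toLog M₂) := by abel
  have q3 : slip (a₂₁, a₂₂) = (toLog M₂ - toLog U₀) - (toLog M₁ - toLog U₀) := by
    rw [j2, slip]; abel
  have b1 : ‖toLog M₁ - toLog U₀‖ < r / 4 := by
    rw [q1]; exact (norm_add_le _ _).trans_lt (by linarith)
  have b2 : ‖toLog M₂ - toLog U₀‖ < r / 4 := by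
    rw [q2]; exact (norm_sub_le _ _).trans_lt (by linarith)
  refine ⟨by linarith [hσ.1], by linarith [hσ.2], by linarith, by linarith, ?_⟩
  rw [← norm_slip, q3]
  exact (norm_sub_le _ _).trans_lt (by linarith)

end SteadyEuler
end

/-! ### Outgoing fans compared with the incoming waves. -/

noncomputable section
namespace SteadyEuler

open Set Filter Topology Metric

/-- The acoustic parameter of the family `j`. -/
def Wave.acParam (j : Acoustic) : Wave → ℝ
  | .acoustic i a => if i = j then a else 0
  | _ => 0

/-- The parameters of the second family. -/
def Wave.slipParam : Wave → ℝ × ℝ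
  | .contact a b => (a, b)
  | _ => 0

/-- The pairs of waves (lower, upper) of the physical families that may interact. -/
def Wave.Crosses (w w' : Wave) : Prop :=
  w'.family < w.family ∨ ∃ j a b, w = .acoustic j a ∧ w' = .acoustic j b

/-- A fan of a 1-wave, a 2-wave and a 3-wave. -/
structure FanJoin (γ a₁ a₂₁ a₂₂ a₃ : ℝ) (U M₁ M₂ V : State) : Prop where
  one : AcJoin γ .one a₁ U M₁
  two : WaveJoin γ (.contact a₂₁ a₂₂) M₁ M₂
  three : AcJoin γ .three a₃ M₂ V

lemma FanJoin.toLog_eq {γ a₁ a₂₁ a₂₂ a₃ : ℝ} {U M₁ M₂ V : State} (hγ : 1 < γ)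
    (h : FanJoin γ a₁ a₂₁ a₂₂ a₃ U M₁ M₂ V) :
    toLog V = fanEnd γ (presInc U M₁) (a₂₁, a₂₂) (presInc M₂ V) (toLog U) := by
  have h1 := h.one.toLog_eq hγ
  have h2 := h.two.2.2
  have h3 := h.three.toLog_eq hγ
  have e : toLog M₂ = toLog U + acousticInc γ .one (presInc U M₁, toLog U) + slip (a₂₁, a₂₂) := by
    rw [h2, h1]; rfl
  rw [fanEnd, ← e, h3]

/-- The outgoing fan compared with a fan that ends close to its upper state. -/
structure FanCompare (γ C ε : ℝ) (X₀ : LogState) (a₁ a₂₁ a₂₂ a₃ : ℝ) (U M₁ M₂ V : State)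
    (τ₁ : ℝ) (f : ℝ × ℝ) (τ₃ T : ℝ) : Prop where
  one : |τ₁ - presInc U M₁| ≤ T
  two : ‖f - (a₂₁, a₂₂)‖ ≤ T
  three : |τ₃ - presInc M₂ V| ≤ T
  one_lt : |presInc U M₁| < ε
  three_lt : |presInc M₂ V| < ε
  mem_one : toLog M₁ ∈ ball X₀ ε
  mem_two : toLog M₂ ∈ ball X₀ ε
  sub_one : ‖toLog M₂ - toLog U‖ ≤ C * (|τ₁| + T) + (‖f‖ + T)
  sub_two : ‖toLog M₁ - toLog V‖ ≤ (‖f‖ + T) + C * (|τ₃| + T)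

section

variable {γ : ℝ} {U₀ : State} {C ε : ℝ}

/-- Any candidate fan from U that ends within δ of V agrees with the actual one up to Mδ. The waves
of the actual fan are not assumed to be small; `exists_fan_small` supplies this. -/
lemma exists_fanCompare (hγ : 1 < γ) (h₀ : Supersonic γ U₀)
    (h : ∀ j, LocalFamily γ j (toLog U₀) C ε) :
    ∃ M, 0 ≤ M ∧ ∃ e > 0, ∀ (a₁ a₂₁ a₂₂ a₃ : ℝ) (U M₁ M₂ V : State),
      FanJoin γ a₁ a₂₁ a₂₂ a₃ U M₁ M₂ V →
      toLog U ∈ ball (toLog U₀) e → toLog V ∈ ball (toLog U₀) e →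
      ∀ (τ₁ : ℝ) (f : ℝ × ℝ) (τ₃ δ : ℝ), |τ₁| < e → ‖f‖ < e → |τ₃| < e →
      ‖fanEnd γ τ₁ f τ₃ (toLog U) - toLog V‖ ≤ δ →
      FanCompare γ C ε (toLog U₀) a₁ a₂₁ a₂₂ a₃ U M₁ M₂ V τ₁ f τ₃ (M * δ) := by
  have hC := (h .one).reg.one_le
  have hε := (h .one).reg.pos
  obtain ⟨M, hM, e₁, he₁, h1⟩ := exists_fanEnd_bound hγ h₀ h
  obtain ⟨e₂, he₂, h2⟩ := exists_fan_small hγ h₀ h (min e₁ ε) (by positivity)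
  have l1 := min_le_left e₁ ε
  have l2 := min_le_right e₁ ε
  refine ⟨M, hM, min e₁ (min e₂ ε), by positivity, ?_⟩
  have m1 : min e₁ (min e₂ ε) ≤ e₁ := min_le_left _ _
  have m2 : min e₁ (min e₂ ε) ≤ e₂ := (min_le_right _ _).trans (min_le_left _ _)
  have m3 : min e₁ (min e₂ ε) ≤ ε := (min_le_right _ _).trans (min_le_right _ _)
  intro a₁ a₂₁ a₂₂ a₃ U M₁ M₂ V hF hU hV τ₁ f τ₃ δ hτ₁ hf hτ₃ hδ
  obtain ⟨s1, s2, b1, b2, s3⟩ := h2 a₁ a₂₁ a₂₂ a₃ U M₁ M₂ V hF.one hF.two hF.three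
    (ball_subset_ball m2 hU) (ball_subset_ball m2 hV)
  rw [hF.toLog_eq hγ] at hδ
  obtain ⟨c1, c2, c3⟩ := h1 τ₁ (presInc U M₁) τ₃ (presInc M₂ V) f (a₂₁, a₂₂) (toLog U)
    (ball_subset_ball m1 hU) (by linarith) (by linarith) (by linarith) (by linarith) (by linarith)
    (by linarith)
  have hle := mul_le_mul_of_nonneg_left hδ hM
  have c1' := c1.trans hle
  have c2' := c2.trans hle
  have c3' := c3.trans hle
  have z1 := (h .one).norm_le (show |presInc U M₁| < ε by linarith) (ball_subset_ball m3 hU)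
  have z3 := (h .three).norm_le (show |presInc M₂ V| < ε by linarith) (ball_subset_ball l2 b2)
  have d1 : |presInc U M₁| ≤ |τ₁| + M * δ := by
    have := abs_sub_abs_le_abs_sub (presInc U M₁) τ₁
    rw [abs_sub_comm] at this; linarith
  have d3 : |presInc M₂ V| ≤ |τ₃| + M * δ := by
    have := abs_sub_abs_le_abs_sub (presInc M₂ V) τ₃
    rw [abs_sub_comm] at this; linarith
  have d2 : ‖(a₂₁, a₂₂)‖ ≤ ‖f‖ + M * δ := by
    have := norm_sub_norm_le (a₂₁, a₂₂) f
    rw [norm_sub_rev] at this; linarith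
  refine ⟨c1', c2', c3', by linarith, by linarith, ball_subset_ball l2 b1,
    ball_subset_ball l2 b2, ?_, ?_⟩
  · have e : toLog M₂ - toLog U = acousticInc γ .one (presInc U M₁, toLog U) +
        slip (a₂₁, a₂₂) := by
      rw [hF.two.2.2, hF.one.toLog_eq hγ, slip]; abel
    rw [e]
    refine (norm_add_le _ _).trans ?_
    rw [norm_slip]
    exact add_le_add (z1.trans (by gcongr)) d2
  · have e : toLog M₁ - toLog V = -slip (a₂₁, a₂₂) -
        acousticInc γ .three (presInc M₂ V, toLog M₂) := by
      rw [hF.three.toLog_eq hγ, hF.two.2.2, slip]; abel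
    rw [e]
    refine (norm_sub_le _ _).trans ?_
    rw [norm_neg, norm_slip]
    exact add_le_add d2 (z3.trans (by gcongr))

/-- The bound of the outgoing parameters in terms of the incoming ones. -/
def OutBound (K a₁ a₂₁ a₂₂ a₃ b₁ : ℝ) (f : ℝ × ℝ) (b₃ : ℝ) : Prop :=
  |a₁ - b₁| ≤ K ∧ ‖(a₂₁, a₂₂) - f‖ ≤ K ∧ |a₃ - b₃| ≤ K

lemma OutBound.mono {K K' a₁ a₂₁ a₂₂ a₃ b₁ b₃ : ℝ} {f : ℝ × ℝ}
    (h : OutBound K a₁ a₂₁ a₂₂ a₃ b₁ f b₃) (hK : K ≤ K') :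
    OutBound K' a₁ a₂₁ a₂₂ a₃ b₁ f b₃ :=
  ⟨h.1.trans hK, h.2.1.trans hK, h.2.2.trans hK⟩

variable {a₁ a₂₁ a₂₂ a₃ : ℝ} {U M₁ M₂ V M : State}

/-- The candidate keeps both pressure increments and exchanges the waves. Its end misses V because
each wave now starts from a different state, an error of at most C²|σ||τ| for either wave.
`param_sub` finally turns pressure increments at different states into parameters. -/
lemma outBound_three_one (hγ : 1 < γ) (h : ∀ j, LocalFamily γ j (toLog U₀) C ε) {N : ℝ}
    (hN : 0 ≤ N) {a b : ℝ} (hF : FanJoin γ a₁ a₂₁ a₂₂ a₃ U M₁ M₂ V)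
    (h3 : AcJoin γ .three a U M) (h1 : AcJoin γ .one b M V)
    (hU : toLog U ∈ ball (toLog U₀) ε) (hM : toLog M ∈ ball (toLog U₀) ε)
    (hU' : toLog U + acousticInc γ .one (presInc M V, toLog U) ∈ ball (toLog U₀) ε)
    (hσ : |presInc U M| < ε) (hτ : |presInc M V| < ε) (hσ1 : |presInc U M| ≤ 1)
    (hcomp : ∀ δ, ‖fanEnd γ (presInc M V) 0 (presInc U M) (toLog U) - toLog V‖ ≤ δ →
      FanCompare γ C ε (toLog U₀) a₁ a₂₁ a₂₂ a₃ U M₁ M₂ V (presInc M V) 0 (presInc U M) (N * δ)) :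
    OutBound (4 * C ^ 2 * (2 * C ^ 2 * N + 1) * (|presInc U M| * |presInc M V|))
      a₁ a₂₁ a₂₂ a₃ b 0 a := by
  have hC := (h .one).reg.one_le
  have hε := (h .one).reg.pos
  set σ := presInc U M
  set τ := presInc M V
  set X := toLog U
  have eM : toLog M = X + acousticInc γ .three (σ, X) := h3.toLog_eq hγ
  have eV : toLog V = toLog M + acousticInc γ .one (τ, toLog M) := h1.toLog_eq hγ
  have n1 := (h .one).norm_le hτ hU
  have n3 := (h .three).norm_le hσ hU
  have hMX : ‖X - toLog M‖ ≤ C * |σ| := by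
    rw [norm_sub_rev, eM, add_sub_cancel_left]; exact n3
  have k := hcomp (2 * C ^ 2 * (|σ| * |τ|)) (by
    have e : fanEnd γ τ 0 σ X - toLog V =
        (acousticInc γ .one (τ, X) - acousticInc γ .one (τ, toLog M)) +
        (acousticInc γ .three (σ, X + acousticInc γ .one (τ, X)) -
          acousticInc γ .three (σ, X)) := by
      have s0 : slip (0 : ℝ × ℝ) = 0 := rfl
      rw [fanEnd, eV, s0, add_zero]
      nth_rewrite 1 [eM]
      abel
    rw [e]
    refine (norm_add_le _ _).trans ?_
    have l1 := (h .one).reg.lip τ τ hτ hτ X hU (toLog M) hM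
    have l3 := (h .three).reg.lip σ σ hσ hσ _ hU' X hU
    rw [sub_self, abs_zero, zero_add] at l1 l3
    rw [add_sub_cancel_left] at l3
    calc _ ≤ C * (|τ| * (C * |σ|)) + C * (|σ| * (C * |τ|)) :=
          add_le_add (l1.trans (by gcongr)) (l3.trans (by gcongr))
      _ = _ := by ring)
  set R := |σ| * |τ| with hR
  set T := N * (2 * C ^ 2 * R) with hT
  have hR0 : 0 ≤ R := by positivity
  have hT0 : 0 ≤ T := by positivity
  have hT1 : T ≤ C ^ 2 * T := le_mul_of_one_le_left hT0 (one_le_pow₀ hC)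
  have hT2 : C * T ≤ C ^ 2 * T := by gcongr; exact le_self_pow₀ hC (by norm_num)
  have hR2 : 0 ≤ C ^ 2 * R := by positivity
  have eK : 4 * C ^ 2 * (2 * C ^ 2 * N + 1) * R = 4 * (C ^ 2 * T) + 4 * (C ^ 2 * R) := by
    rw [hT]; ring
  rw [eK]
  refine ⟨?_, ?_, ?_⟩
  · have := (h .one).param_sub hγ h1 hF.one hM hU hτ k.one_lt
    rw [abs_sub_comm]
    have c : C * (|τ - presInc U M₁| + |τ| * ‖toLog M - X‖) ≤ C * (T + |τ| * (C * |σ|)) := by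
      gcongr
      · exact k.one
      · rwa [norm_sub_rev]
    have : C * (T + |τ| * (C * |σ|)) = C * T + C ^ 2 * R := by rw [hR]; ring
    linarith
  · rw [norm_sub_rev]
    linarith [k.two]
  · have := (h .three).param_sub hγ h3 hF.three hU k.mem_two hσ k.three_lt
    rw [abs_sub_comm]
    have q : |σ| * ‖X - toLog M₂‖ ≤ C * R + (C + 1) * T := by
      have := k.sub_one
      rw [norm_zero, zero_add] at this
      calc |σ| * ‖X - toLog M₂‖ ≤ |σ| * (C * (|τ| + T) + T) := by
            rw [norm_sub_rev]; gcongr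
        _ = C * R + |σ| * ((C + 1) * T) := by rw [hR]; ring
        _ ≤ C * R + 1 * ((C + 1) * T) := by gcongr
        _ = _ := by ring
    have c : C * (|σ - presInc M₂ V| + |σ| * ‖X - toLog M₂‖) ≤
        C * (T + (C * R + (C + 1) * T)) := by
      gcongr
      exact k.three
    have : C * (T + (C * R + (C + 1) * T)) = 2 * (C * T) + C ^ 2 * T + C ^ 2 * R := by ring
    linarith

/-- A slip commutes with the 1-wave except that the start of the latter moves by ‖d‖; the candidate
contains no 3-wave. -/
lemma outBound_two_one (hγ : 1 < γ) (h : ∀ j, LocalFamily γ j (toLog U₀) C ε) {N : ℝ}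
    (hN : 0 ≤ N) {b : ℝ} {d : ℝ × ℝ} (hF : FanJoin γ a₁ a₂₁ a₂₂ a₃ U M₁ M₂ V)
    (h2 : toLog M = toLog U + slip d) (h1 : AcJoin γ .one b M V)
    (hU : toLog U ∈ ball (toLog U₀) ε) (hM : toLog M ∈ ball (toLog U₀) ε)
    (hU' : toLog U + acousticInc γ .one (presInc M V, toLog U) + slip d ∈ ball (toLog U₀) ε)
    (hτ : |presInc M V| < ε)
    (hcomp : ∀ δ, ‖fanEnd γ (presInc M V) d 0 (toLog U) - toLog V‖ ≤ δ →
      FanCompare γ C ε (toLog U₀) a₁ a₂₁ a₂₂ a₃ U M₁ M₂ V (presInc M V) d 0 (N * δ)) :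
    OutBound (4 * C ^ 2 * (2 * C ^ 2 * N + 1) * (‖d‖ * |presInc M V|))
      a₁ a₂₁ a₂₂ a₃ b d 0 := by
  have hC := (h .one).reg.one_le
  have hε := (h .one).reg.pos
  set τ := presInc M V
  set X := toLog U
  have eV : toLog V = toLog M + acousticInc γ .one (τ, toLog M) := h1.toLog_eq hγ
  have hMX : ‖X - toLog M‖ = ‖d‖ := by
    rw [norm_sub_rev, h2, add_sub_cancel_left, norm_slip]
  set R := ‖d‖ * |τ| with hR
  have hR0 : 0 ≤ R := by positivity
  have k := hcomp (2 * C ^ 2 * R) (by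
    have e : fanEnd γ τ d 0 X - toLog V =
        acousticInc γ .one (τ, X) - acousticInc γ .one (τ, toLog M) := by
      rw [fanEnd, (h .three).reg.zero _ hU', eV]
      nth_rewrite 1 [h2]
      abel
    rw [e]
    have l1 := (h .one).reg.lip τ τ hτ hτ X hU (toLog M) hM
    rw [sub_self, abs_zero, zero_add, hMX] at l1
    refine l1.trans ?_
    have : C ≤ C ^ 2 := le_self_pow₀ hC (by norm_num)
    calc C * (|τ| * ‖d‖) = C * R := by rw [hR]; ring
      _ ≤ 2 * C ^ 2 * R := by gcongr; linarith)
  set T := N * (2 * C ^ 2 * R) with hT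
  have hT0 : 0 ≤ T := by positivity
  have hT1 : T ≤ C ^ 2 * T := le_mul_of_one_le_left hT0 (one_le_pow₀ hC)
  have hT2 : C * T ≤ C ^ 2 * T := by gcongr; exact le_self_pow₀ hC (by norm_num)
  have hR1 : C * R ≤ C ^ 2 * R := by gcongr; exact le_self_pow₀ hC (by norm_num)
  have hR2 : 0 ≤ C ^ 2 * R := by positivity
  have eK : 4 * C ^ 2 * (2 * C ^ 2 * N + 1) * R = 4 * (C ^ 2 * T) + 4 * (C ^ 2 * R) := by
    rw [hT]; ring
  rw [eK]
  refine ⟨?_, ?_, ?_⟩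
  · have := (h .one).param_sub hγ h1 hF.one hM hU hτ k.one_lt
    rw [abs_sub_comm]
    have c : C * (|τ - presInc U M₁| + |τ| * ‖toLog M - X‖) ≤ C * (T + |τ| * ‖d‖) := by
      rw [norm_sub_rev, hMX]
      gcongr
      exact k.one
    have : C * (T + |τ| * ‖d‖) = C * T + C * R := by rw [hR]; ring
    linarith
  · rw [norm_sub_rev]
    linarith [k.two]
  · have := (h .three).abs_le hγ hF.three k.mem_two k.three_lt
    have k3 := k.three
    rw [zero_sub, abs_neg] at k3
    rw [sub_zero]
    have := mul_le_mul_of_nonneg_left k3 (by linarith : 0 ≤ C)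
    linarith

/-- The candidate carries out the slip first, so only the start of the 3-wave moves, by ‖d‖; it
contains no 1-wave. -/
lemma outBound_three_two (hγ : 1 < γ) (h : ∀ j, LocalFamily γ j (toLog U₀) C ε) {N : ℝ}
    (hN : 0 ≤ N) {a : ℝ} {d : ℝ × ℝ} (hF : FanJoin γ a₁ a₂₁ a₂₂ a₃ U M₁ M₂ V)
    (h3 : AcJoin γ .three a U M) (h2 : toLog V = toLog M + slip d)
    (hU : toLog U ∈ ball (toLog U₀) ε)
    (hU' : toLog U + slip d ∈ ball (toLog U₀) ε)
    (hσ : |presInc U M| < ε) (hσ1 : |presInc U M| ≤ 1)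
    (hcomp : ∀ δ, ‖fanEnd γ 0 d (presInc U M) (toLog U) - toLog V‖ ≤ δ →
      FanCompare γ C ε (toLog U₀) a₁ a₂₁ a₂₂ a₃ U M₁ M₂ V 0 d (presInc U M) (N * δ)) :
    OutBound (4 * C ^ 2 * (2 * C ^ 2 * N + 1) * (|presInc U M| * ‖d‖))
      a₁ a₂₁ a₂₂ a₃ 0 d a := by
  have hC := (h .one).reg.one_le
  have hε := (h .one).reg.pos
  set σ := presInc U M
  set X := toLog U
  have eM : toLog M = X + acousticInc γ .three (σ, X) := h3.toLog_eq hγ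
  set R := |σ| * ‖d‖ with hR
  have hR0 : 0 ≤ R := by positivity
  have k := hcomp (2 * C ^ 2 * R) (by
    have e : fanEnd γ 0 d σ X - toLog V =
        acousticInc γ .three (σ, X + slip d) - acousticInc γ .three (σ, X) := by
      rw [fanEnd, (h .one).reg.zero _ hU, h2, eM, add_zero]
      abel
    rw [e]
    have l1 := (h .three).reg.lip σ σ hσ hσ _ hU' X hU
    rw [sub_self, abs_zero, zero_add, add_sub_cancel_left, norm_slip] at l1
    refine l1.trans ?_
    have : C ≤ C ^ 2 := le_self_pow₀ hC (by norm_num)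
    gcongr
    linarith)
  set T := N * (2 * C ^ 2 * R) with hT
  have hT0 : 0 ≤ T := by positivity
  have hT1 : T ≤ C ^ 2 * T := le_mul_of_one_le_left hT0 (one_le_pow₀ hC)
  have hT2 : C * T ≤ C ^ 2 * T := by gcongr; exact le_self_pow₀ hC (by norm_num)
  have hR1 : C * R ≤ C ^ 2 * R := by gcongr; exact le_self_pow₀ hC (by norm_num)
  have hR2 : 0 ≤ C ^ 2 * R := by positivity
  have eK : 4 * C ^ 2 * (2 * C ^ 2 * N + 1) * R = 4 * (C ^ 2 * T) + 4 * (C ^ 2 * R) := by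
    rw [hT]; ring
  rw [eK]
  refine ⟨?_, ?_, ?_⟩
  · have := (h .one).abs_le hγ hF.one hU k.one_lt
    have k3 := k.one
    rw [zero_sub, abs_neg] at k3
    rw [sub_zero]
    have := mul_le_mul_of_nonneg_left k3 (by linarith : 0 ≤ C)
    linarith
  · rw [norm_sub_rev]
    linarith [k.two]
  · have := (h .three).param_sub hγ h3 hF.three hU k.mem_two hσ k.three_lt
    rw [abs_sub_comm]
    have q : |σ| * ‖X - toLog M₂‖ ≤ R + (C + 1) * T := by
      have := k.sub_one
      rw [abs_zero, zero_add] at this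
      calc |σ| * ‖X - toLog M₂‖ ≤ |σ| * (C * T + (‖d‖ + T)) := by
            rw [norm_sub_rev]; gcongr
        _ = R + |σ| * ((C + 1) * T) := by rw [hR]; ring
        _ ≤ R + 1 * ((C + 1) * T) := by gcongr
        _ = _ := by ring
    have c : C * (|σ - presInc M₂ V| + |σ| * ‖X - toLog M₂‖) ≤
        C * (T + (R + (C + 1) * T)) := by
      gcongr
      exact k.three
    have : C * (T + (R + (C + 1) * T)) = 2 * (C * T) + C ^ 2 * T + C * R := by ring
    linarith

/-- The candidate is one wave with the added pressure increments. Since a + b is exactly the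
increment of λ_j from U to V, the outgoing parameter of this family is compared through values of
λ_j at the middle states, not through pressure increments. -/
lemma outBound_same (hγ : 1 < γ) (h : ∀ j, LocalFamily γ j (toLog U₀) C ε)
    (hΛ : ∀ j, ∀ X ∈ ball (toLog U₀) ε, ∀ Y ∈ ball (toLog U₀) ε,
      |logLam γ j X - logLam γ j Y| ≤ C * ‖X - Y‖) {N : ℝ}
    (hN : 0 ≤ N) {a b : ℝ} {j : Acoustic} (hF : FanJoin γ a₁ a₂₁ a₂₂ a₃ U M₁ M₂ V)
    (h1 : AcJoin γ j a U M) (h2 : AcJoin γ j b M V)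
    (hU : toLog U ∈ ball (toLog U₀) ε) (hM : toLog M ∈ ball (toLog U₀) ε)
    (hV : toLog V ∈ ball (toLog U₀) ε)
    (hU' : toLog U + acousticInc γ .one (presInc U M + presInc M V, toLog U) ∈
      ball (toLog U₀) ε)
    (hσ : |presInc U M| < ε) (hτ : |presInc M V| < ε)
    (hστ : |presInc U M + presInc M V| < ε)
    (hcomp : ∀ τ₁ τ₃ δ, (τ₁, τ₃) = (presInc U M + presInc M V, (0 : ℝ)) ∨
        (τ₁, τ₃) = ((0 : ℝ), presInc U M + presInc M V) →
        ‖fanEnd γ τ₁ 0 τ₃ (toLog U) - toLog V‖ ≤ δ →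
      FanCompare γ C ε (toLog U₀) a₁ a₂₁ a₂₂ a₃ U M₁ M₂ V τ₁ 0 τ₃ (N * δ)) :
    OutBound (4 * C ^ 2 * (2 * C ^ 2 * N + 1) * (|presInc U M| * |presInc M V|))
      a₁ a₂₁ a₂₂ a₃ ((Wave.acoustic j (a + b)).acParam .one) 0
        ((Wave.acoustic j (a + b)).acParam .three) := by
  have hC := (h .one).reg.one_le
  have hε := (h .one).reg.pos
  set σ := presInc U M
  set τ := presInc M V
  set X := toLog U
  have eM : toLog M = X + acousticInc γ j (σ, X) := h1.toLog_eq hγ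
  have eV : toLog V = toLog M + acousticInc γ j (τ, toLog M) := h2.toLog_eq hγ
  have hm := (h j).reg.merge σ τ hσ hτ hστ X hU (by rwa [← eM])
  rw [← eM] at hm
  set R := |σ| * |τ| with hR
  have hR0 : 0 ≤ R := by positivity
  have hCR : C * R ≤ 2 * C ^ 2 * R := by
    have : C ≤ C ^ 2 := le_self_pow₀ hC (by norm_num)
    gcongr; linarith
  have hm' : ‖X + acousticInc γ j (σ + τ, X) - toLog V‖ ≤ 2 * C ^ 2 * R := by
    refine le_trans (le_of_eq ?_) (hm.trans hCR)
    congr 1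
    rw [eV]
    nth_rewrite 1 [eM]
    abel
  set T := N * (2 * C ^ 2 * R) with hT
  have hT0 : 0 ≤ T := by positivity
  have hT1 : T ≤ C ^ 2 * T := le_mul_of_one_le_left hT0 (one_le_pow₀ hC)
  have hT2 : C * T ≤ C ^ 2 * T := by gcongr; exact le_self_pow₀ hC (by norm_num)
  have hR2 : 0 ≤ C ^ 2 * R := by positivity
  have eK : 4 * C ^ 2 * (2 * C ^ 2 * N + 1) * R = 4 * (C ^ 2 * T) + 4 * (C ^ 2 * R) := by
    rw [hT]; ring
  have hab : logLam γ j (toLog V) - logLam γ j X = a + b := by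
    rw [(h2.right hγ).logLam_toLog, (h1.left hγ).logLam_toLog]
    have := h1.lam_sub hγ
    have := h2.lam_sub hγ
    linarith
  have s0 : slip (0 : ℝ × ℝ) = 0 := rfl
  rw [eK]
  cases j
  · have k := hcomp (σ + τ) 0 (2 * C ^ 2 * R) (Or.inl rfl) (by
      rw [fanEnd, s0, add_zero, (h .three).reg.zero _ hU', add_zero]
      exact hm')
    simp only [Wave.acParam, if_true, reduceCtorEq, if_false]
    refine ⟨?_, ?_, ?_⟩
    · have e : a₁ - (a + b) = logLam γ .one (toLog M₁) - logLam γ .one (toLog V) := by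
        rw [← hab, (hF.one.right hγ).logLam_toLog, (h1.left hγ).logLam_toLog,
          ← hF.one.lam_sub hγ]
        ring
      rw [e]
      refine (hΛ _ _ k.mem_one _ hV).trans ?_
      have := k.sub_two
      simp only [norm_zero, abs_zero, zero_add] at this
      have := mul_le_mul_of_nonneg_left this (by linarith : 0 ≤ C)
      have e2 : C * (T + C * T) = C * T + C ^ 2 * T := by ring
      linarith
    · rw [norm_sub_rev]
      linarith [k.two]
    · have := (h .three).abs_le hγ hF.three k.mem_two k.three_lt
      have k3 := k.three
      rw [zero_sub, abs_neg] at k3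
      rw [sub_zero]
      have := mul_le_mul_of_nonneg_left k3 (by linarith : 0 ≤ C)
      linarith
  · have k := hcomp 0 (σ + τ) (2 * C ^ 2 * R) (Or.inr rfl) (by
      rw [fanEnd, s0, add_zero, (h .one).reg.zero _ hU, add_zero]
      exact hm')
    simp only [Wave.acParam, if_true, reduceCtorEq, if_false]
    refine ⟨?_, ?_, ?_⟩
    · have := (h .one).abs_le hγ hF.one hU k.one_lt
      have k3 := k.one
      rw [zero_sub, abs_neg] at k3
      rw [sub_zero]
      have := mul_le_mul_of_nonneg_left k3 (by linarith : 0 ≤ C)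
      linarith
    · rw [norm_sub_rev]
      linarith [k.two]
    · have e : a₃ - (a + b) = logLam γ .three X - logLam γ .three (toLog M₂) := by
        rw [← hab, (hF.three.left hγ).logLam_toLog, (h2.right hγ).logLam_toLog,
          ← hF.three.lam_sub hγ]
        ring
      rw [e]
      refine (hΛ _ _ hU _ k.mem_two).trans ?_
      have := k.sub_one
      simp only [norm_zero, abs_zero, zero_add] at this
      rw [norm_sub_rev]
      have := mul_le_mul_of_nonneg_left this (by linarith : 0 ≤ C)
      have e2 : C * (C * T + T) = C * T + C ^ 2 * T := by ring
      linarith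

end

end SteadyEuler
end

noncomputable section
namespace SteadyEuler

open Set Filter Topology Metric

/-! ## Local interaction estimates -/

section Log

variable {γ : ℝ} {U₀ : State} {C ε : ℝ}

lemma exists_small_all (hγ : 1 < γ) (h₀ : Supersonic γ U₀)
    (h : ∀ j, LocalFamily γ j (toLog U₀) C ε) :
    ∀ r > 0, ∃ e > 0, e ≤ r ∧ ∀ (j : Acoustic) (a : ℝ) (U V : State), AcJoin γ j a U V → |a| < e →
      (toLog U ∈ ball (toLog U₀) e ∨ toLog V ∈ ball (toLog U₀) e) →
      |presInc U V| < r ∧ toLog U ∈ ball (toLog U₀) r ∧ toLog V ∈ ball (toLog U₀) r ∧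
        |presInc U V| ≤ C * |a| ∧ ‖toLog V - toLog U‖ ≤ C ^ 2 * |a| := by
  intro r hr
  obtain ⟨e₁, he₁, h1⟩ := exists_small hγ h₀ (h .one) r hr
  obtain ⟨e₃, he₃, h3⟩ := exists_small hγ h₀ (h .three) r hr
  have l1 : min r (min e₁ e₃) ≤ e₁ := (min_le_right _ _).trans (min_le_left _ _)
  have l3 : min r (min e₁ e₃) ≤ e₃ := (min_le_right _ _).trans (min_le_right _ _)
  refine ⟨min r (min e₁ e₃), by positivity, min_le_left _ _, fun j a U V hj ha hUV => ?_⟩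
  cases j
  · exact h1 a U V hj (ha.trans_le l1)
      (hUV.imp (fun h => ball_subset_ball l1 h) fun h => ball_subset_ball l1 h)
  · exact h3 a U V hj (ha.trans_le l3)
      (hUV.imp (fun h => ball_subset_ball l3 h) fun h => ball_subset_ball l3 h)

lemma exists_wave_small (hγ : 1 < γ) (h₀ : Supersonic γ U₀)
    (h : ∀ j, LocalFamily γ j (toLog U₀) C ε) :
    ∀ r > 0, ∃ e > 0, e ≤ r ∧ ∀ (w : Wave) (U V : State), WaveJoin γ w U V → w.strength < e →
      (toLog U ∈ ball (toLog U₀) e ∨ toLog V ∈ ball (toLog U₀) e) →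
      toLog U ∈ ball (toLog U₀) r ∧ toLog V ∈ ball (toLog U₀) r ∧
        ‖toLog V - toLog U‖ ≤ C ^ 2 * w.strength := by
  intro r hr
  have hC := (h .one).reg.one_le
  obtain ⟨e, he, her, h1⟩ := exists_small_all hγ h₀ h r hr
  have l1 : min e (r / 2) ≤ e := min_le_left _ _
  have l2 : min e (r / 2) ≤ r / 2 := min_le_right _ _
  refine ⟨min e (r / 2), by positivity, by linarith, fun w U V hj hw hUV => ?_⟩
  match w, hj, hw with
  | .acoustic j a, hj, hw =>
    obtain ⟨-, b, c, -, d⟩ := h1 j a U V hj (lt_of_lt_of_le hw l1)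
      (hUV.imp (fun h => ball_subset_ball l1 h) fun h => ball_subset_ball l1 h)
    exact ⟨b, c, d⟩
  | .contact a b, ⟨_, _, e⟩, hw =>
    have e : toLog V = toLog U + slip (a, b) := e
    have hn : ‖toLog V - toLog U‖ ≤ |a| + |b| := by
      rw [e, add_sub_cancel_left, norm_slip, Prod.norm_def]
      exact max_le (by simp) (by simp)
    change |a| + |b| < _ at hw
    change _ ∧ _ ∧ _ ≤ C ^ 2 * (|a| + |b|)
    have hUV' : toLog U ∈ ball (toLog U₀) r ∧ toLog V ∈ ball (toLog U₀) r := by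
      simp only [mem_ball_iff_norm] at hUV ⊢
      have e1 : toLog U - toLog U₀ = (toLog V - toLog U₀) - (toLog V - toLog U) := by abel
      have e2 : toLog V - toLog U₀ = (toLog U - toLog U₀) + (toLog V - toLog U) := by abel
      have k1 := norm_sub_le (toLog V - toLog U₀) (toLog V - toLog U)
      have k2 := norm_add_le (toLog U - toLog U₀) (toLog V - toLog U)
      rw [← e1] at k1
      rw [← e2] at k2
      rcases hUV with h | h <;> constructor <;> linarith
    exact ⟨hUV'.1, hUV'.2, hn.trans (le_mul_of_one_le_left (by positivity) (one_le_pow₀ hC))⟩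

lemma norm_slip_le (a b : ℝ) : ‖(a, b)‖ ≤ |a| + |b| := by
  rw [Prod.norm_def]
  exact max_le (by simp) (by simp)

/-- The outgoing waves of the accurate Riemann solver. -/
lemma exists_interact_log (hγ : 1 < γ) (h₀ : Supersonic γ U₀)
    (h : ∀ j, LocalFamily γ j (toLog U₀) C ε)
    (hΛ : ∀ j, ∀ X ∈ ball (toLog U₀) ε, ∀ Y ∈ ball (toLog U₀) ε,
      |logLam γ j X - logLam γ j Y| ≤ C * ‖X - Y‖) :
    ∃ K, ∃ e > 0, ∀ (w w' : Wave) (U M V M₁ M₂ : State) (a₁ a₂₁ a₂₂ a₃ : ℝ), w.Crosses w' →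
      WaveJoin γ w U M → WaveJoin γ w' M V → w.strength < e → w'.strength < e →
      toLog U ∈ ball (toLog U₀) e → FanJoin γ a₁ a₂₁ a₂₂ a₃ U M₁ M₂ V →
      OutBound (K * (w.strength * w'.strength)) a₁ a₂₁ a₂₂ a₃
        (w.acParam .one + w'.acParam .one) (w.slipParam + w'.slipParam)
        (w.acParam .three + w'.acParam .three) := by
  have hC := (h .one).reg.one_le
  have hε := (h .one).reg.pos
  obtain ⟨N, hN, e₀, he₀, hcomp⟩ := exists_fanCompare hγ h₀ h
  set r := min (min (e₀ / 2) (ε / (4 * C))) 1 with hr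
  have hr0 : 0 < r := by positivity
  have r1 : r ≤ e₀ / 2 := (min_le_left _ _).trans (min_le_left _ _)
  have r2 : r * (4 * C) ≤ ε :=
    (le_div_iff₀ (by positivity)).1 ((min_le_left _ _).trans (min_le_right _ _))
  have r3 : r ≤ 1 := min_le_right _ _
  have r4 : r ≤ r * C := le_mul_of_one_le_right hr0.le hC
  obtain ⟨e₁, he₁, l1, hs₁⟩ := exists_small_all hγ h₀ h r hr0
  obtain ⟨e₁', he₁', l1', ht₁⟩ := exists_wave_small hγ h₀ h r hr0
  -- A second, smaller radius: it puts the state M between the two waves into the ball in which the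
  -- upper wave is controlled.
  obtain ⟨e₂, he₂, l2, ht₂⟩ := exists_wave_small hγ h₀ h (min e₁ e₁') (by positivity)
  have l3 := min_le_left e₁ e₁'
  have l4 := min_le_right e₁ e₁'
  refine ⟨4 * C ^ 2 * (2 * C ^ 2 * N + 1) * C ^ 2, e₂, he₂, ?_⟩
  intro w w' U M V M₁ M₂ a₁ a₂₁ a₂₂ a₃ hc hw hw' hsw hsw' hU hF
  obtain ⟨hU₁, hM₁, -⟩ := ht₂ w U M hw hsw (Or.inl hU)
  obtain ⟨hM₂, hV₂, -⟩ := ht₁ w' M V hw' (by linarith) (Or.inl (ball_subset_ball l4 hM₁))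
  have hUε : toLog U ∈ ball (toLog U₀) ε := ball_subset_ball (by linarith) hU₁
  have hMε : toLog M ∈ ball (toLog U₀) ε := ball_subset_ball (by linarith) hM₂
  have hVε : toLog V ∈ ball (toLog U₀) ε := ball_subset_ball (by linarith) hV₂
  have hUe : toLog U ∈ ball (toLog U₀) e₀ := ball_subset_ball (by linarith) hU₁
  have hVe : toLog V ∈ ball (toLog U₀) e₀ := ball_subset_ball (by linarith) hV₂
  have hK : 0 ≤ 4 * C ^ 2 * (2 * C ^ 2 * N + 1) := by positivity
  have hac : ∀ j a, AcJoin γ j a U M → |a| < e₂ → |presInc U M| < r ∧ |presInc U M| ≤ C * |a| := by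
    intro j a hj ha
    obtain ⟨q, -, -, q', -⟩ := hs₁ j a U M hj (by linarith) (Or.inl (ball_subset_ball l3 hU₁))
    exact ⟨q, q'⟩
  have hac' : ∀ j a, AcJoin γ j a M V → |a| < e₂ →
      |presInc M V| < r ∧ |presInc M V| ≤ C * |a| := by
    intro j a hj ha
    obtain ⟨q, -, -, q', -⟩ := hs₁ j a M V hj (by linarith) (Or.inl (ball_subset_ball l3 hM₁))
    exact ⟨q, q'⟩
  have hmem : ∀ (σ : ℝ) (d : ℝ × ℝ), |σ| ≤ 2 * r → ‖d‖ ≤ r →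
      toLog U + acousticInc γ .one (σ, toLog U) + slip d ∈ ball (toLog U₀) ε := by
    intro σ d hσ hd
    have n1 := (h .one).norm_le (show |σ| < ε by nlinarith) hUε
    have : C * |σ| ≤ C * (2 * r) := by gcongr
    have hU1 : toLog U ∈ ball (toLog U₀) r := ball_subset_ball (by linarith) hU₁
    rw [mem_ball_iff_norm] at hU1 ⊢
    have e1 : toLog U + acousticInc γ .one (σ, toLog U) + slip d - toLog U₀ =
      (toLog U - toLog U₀) + acousticInc γ .one (σ, toLog U) + slip d := by abel
    rw [e1]
    refine norm_add₃_le.trans_lt ?_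
    rw [norm_slip]
    linarith
  have hmem0 : ∀ σ : ℝ, |σ| ≤ 2 * r →
      toLog U + acousticInc γ .one (σ, toLog U) ∈ ball (toLog U₀) ε := by
    intro σ hσ
    have := hmem σ 0 hσ (by simpa using hr0.le)
    have s0 : slip (0 : ℝ × ℝ) = 0 := rfl
    rwa [s0, add_zero] at this
  match w, w', hc, hw, hw', hsw, hsw' with
  | .contact a b, .acoustic .one b', _, hw, hw', hsw, hsw' =>
    obtain ⟨q1, q2⟩ := hac' _ _ hw' hsw'
    change |a| + |b| < _ at hsw
    have hd := norm_slip_le a b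
    have := outBound_two_one hγ h hN hF hw.2.2 hw' hUε hMε
      (hmem (presInc M V) (a, b) (by linarith) (by linarith)) (by linarith)
      (fun δ hδ => hcomp _ _ _ _ _ _ _ _ hF hUe hVe _ _ _ δ (by linarith) (by linarith)
        (by simpa using he₀) hδ)
    simp only [Wave.acParam, Wave.slipParam, Wave.strength, if_true, reduceCtorEq, if_false,
      add_zero, zero_add]
    refine this.mono ?_
    have hC2 : C ≤ C ^ 2 := le_self_pow₀ hC (by norm_num)
    calc _ ≤ 4 * C ^ 2 * (2 * C ^ 2 * N + 1) * ((|a| + |b|) * (C ^ 2 * |b'|)) := by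
          gcongr
          exact q2.trans (by gcongr)
      _ = _ := by ring
  | .acoustic .three a, .contact b b', _, hw, hw', hsw, hsw' =>
    obtain ⟨q1, q2⟩ := hac _ _ hw hsw
    change |b| + |b'| < _ at hsw'
    have hd := norm_slip_le b b'
    have := outBound_three_two (d := (b, b')) hγ h hN hF hw hw'.2.2 hUε
      (by
        have := hmem 0 (b, b') (by simpa using hr0.le) (by linarith)
        rwa [(h .one).reg.zero _ hUε, add_zero] at this) (by linarith) (by linarith)
      (fun δ hδ => hcomp _ _ _ _ _ _ _ _ hF hUe hVe _ _ _ δ (by simpa using he₀) (by linarith)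
        (by linarith) hδ)
    simp only [Wave.acParam, Wave.slipParam, Wave.strength, if_true, reduceCtorEq, if_false,
      add_zero, zero_add]
    refine this.mono ?_
    have hC2 : C ≤ C ^ 2 := le_self_pow₀ hC (by norm_num)
    calc _ ≤ 4 * C ^ 2 * (2 * C ^ 2 * N + 1) * ((C ^ 2 * |a|) * (|b| + |b'|)) := by
          gcongr
          exact q2.trans (by gcongr)
      _ = _ := by ring
  | .acoustic i a, .acoustic j b, hc, hw, hw', hsw, hsw' =>
    by_cases hij : i = j
    · subst hij
      obtain ⟨p1, p2⟩ := hac _ _ hw hsw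
      obtain ⟨q1, q2⟩ := hac' _ _ hw' hsw'
      have hst : |presInc U M + presInc M V| < 2 * r :=
        (abs_add_le _ _).trans_lt (by linarith)
      have := outBound_same hγ h hΛ hN hF hw hw' hUε hMε hVε
        (hmem0 _ hst.le)
        (by linarith) (by linarith) (by linarith)
        (fun τ₁ τ₃ δ hτ hδ => hcomp _ _ _ _ _ _ _ _ hF hUe hVe _ _ _ δ
          (by rcases hτ with hτ | hτ <;> obtain ⟨rfl, rfl⟩ := Prod.mk.inj hτ
              · linarith
              · simpa using he₀)
          (by simpa using he₀)
          (by rcases hτ with hτ | hτ <;> obtain ⟨rfl, rfl⟩ := Prod.mk.inj hτ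
              · simpa using he₀
              · linarith) hδ)
      have e : ∀ k, (Wave.acoustic i a).acParam k + (Wave.acoustic i b).acParam k =
          (Wave.acoustic i (a + b)).acParam k := by
        intro k
        simp only [Wave.acParam]
        split_ifs <;> simp
      rw [e, e]
      simp only [Wave.slipParam, Wave.strength, add_zero]
      refine this.mono ?_
      calc _ ≤ 4 * C ^ 2 * (2 * C ^ 2 * N + 1) * ((C * |a|) * (C * |b|)) := by gcongr
        _ = _ := by ring
    · cases i <;> cases j
      · exact absurd rfl hij
      · exfalso
        rcases hc with hc | ⟨k, x, y, e1, e2⟩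
        · simp [Wave.family] at hc
        · injection e1 with e1; injection e2 with e2
          exact hij (e1.trans e2.symm)
      · obtain ⟨p1, p2⟩ := hac _ _ hw hsw
        obtain ⟨q1, q2⟩ := hac' _ _ hw' hsw'
        have := outBound_three_one hγ h hN hF hw hw' hUε hMε
          (hmem0 _ (by linarith))
          (by linarith) (by linarith) (by linarith)
          (fun δ hδ => hcomp _ _ _ _ _ _ _ _ hF hUe hVe _ _ _ δ (by linarith) (by simpa using he₀)
            (by linarith) hδ)
        simp only [Wave.acParam, Wave.slipParam, Wave.strength, if_true, reduceCtorEq, if_false,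
          add_zero, zero_add]
        refine this.mono ?_
        calc _ ≤ 4 * C ^ 2 * (2 * C ^ 2 * N + 1) * ((C * |a|) * (C * |b|)) := by gcongr
          _ = _ := by ring
      · exact absurd rfl hij
  | .acoustic .one a, .contact b b', hc, _, _, _, _ =>
    exfalso
    rcases hc with hc | ⟨k, x, y, e1, e2⟩
    · simp [Wave.family] at hc
    · cases e2
  | .contact a b, .acoustic .three b', hc, _, _, _, _ =>
    exfalso
    rcases hc with hc | ⟨k, x, y, e1, e2⟩
    · simp [Wave.family] at hc
    · cases e1
  | .contact a b, .contact a' b', hc, _, _, _, _ =>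
    exfalso
    rcases hc with hc | ⟨k, x, y, e1, e2⟩
    · simp [Wave.family] at hc
    · cases e1

end Log

end SteadyEuler
end

/-! ### Interaction estimates in the original variables, uniform on compact sets. -/

noncomputable section
namespace SteadyEuler

open Set Filter Topology Metric

/-- Interaction estimates for small waves between states near `U₀`. -/
structure LocalEstimates (γ : ℝ) (U₀ : State) (C ε : ℝ) : Prop where
  pos : 0 < ε
  one_le : 1 ≤ C
  size : ∀ (w : Wave) (U V : State), WaveJoin γ w U V → w.strength < ε →
    (U ∈ ball U₀ ε ∨ V ∈ ball U₀ ε) → ‖V - U‖ ≤ C * w.strength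
  same : ∀ (w : Wave) (U V U' V' : State), WaveJoin γ w U V → WaveJoin γ w U' V' →
    w.strength < ε → U ∈ ball U₀ ε → U' ∈ ball U₀ ε →
    ‖V - U - (V' - U')‖ ≤ C * w.strength * ‖U - U'‖
  merge : ∀ (j : Acoustic) (a b : ℝ) (U M V W : State), AcJoin γ j a U M → AcJoin γ j b M V →
    AcJoin γ j (a + b) U W → |a| < ε → |b| < ε → U ∈ ball U₀ ε → ‖V - W‖ ≤ C * (|a| * |b|)
  interact : ∀ (w w' : Wave) (U M V M₁ M₂ : State) (a₁ a₂₁ a₂₂ a₃ : ℝ), w.Crosses w' →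
    WaveJoin γ w U M → WaveJoin γ w' M V → w.strength < ε → w'.strength < ε →
    U ∈ ball U₀ ε → FanJoin γ a₁ a₂₁ a₂₂ a₃ U M₁ M₂ V →
    OutBound (C * (w.strength * w'.strength)) a₁ a₂₁ a₂₂ a₃
      (w.acParam .one + w'.acParam .one) (w.slipParam + w'.slipParam)
      (w.acParam .three + w'.acParam .three)
  reflect : ∀ (a b : ℝ) (U V M : State), AcJoin γ .one a U V → AcJoin γ .three b M V →
    pres M = pres U → |a| < ε → U ∈ ball U₀ ε → |b| ≤ C * |a| ∧ ‖V - M‖ ≤ C * |a|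

lemma Wave.strength_nonneg (w : Wave) : 0 ≤ w.strength := by
  cases w <;> simp only [Wave.strength] <;> positivity

lemma LocalEstimates.mono {γ : ℝ} {U₀ U₁ : State} {C C' ε ε' : ℝ} (h : LocalEstimates γ U₀ C ε)
    (hC : C ≤ C') (hε : 0 < ε') (hle : ε' ≤ ε) (hb : ball U₁ ε' ⊆ ball U₀ ε) :
    LocalEstimates γ U₁ C' ε' where
  pos := hε
  one_le := h.one_le.trans hC
  size w U V hw hs hUV := (h.size w U V hw (hs.trans_le hle) (hUV.imp (fun h => hb h)
    fun h => hb h)).trans (mul_le_mul_of_nonneg_right hC w.strength_nonneg)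
  same w U V U' V' hw hw' hs hU hU' := (h.same w U V U' V' hw hw' (hs.trans_le hle) (hb hU)
    (hb hU')).trans (mul_le_mul_of_nonneg_right
      (mul_le_mul_of_nonneg_right hC w.strength_nonneg) (norm_nonneg _))
  merge j a b U M V W h1 h2 h3 ha hb' hU := (h.merge j a b U M V W h1 h2 h3 (ha.trans_le hle)
    (hb'.trans_le hle) (hb hU)).trans (mul_le_mul_of_nonneg_right hC (by positivity))
  interact w w' U M V M₁ M₂ a₁ a₂₁ a₂₂ a₃ hc hw hw' hs hs' hU hF :=
    (h.interact w w' U M V M₁ M₂ a₁ a₂₁ a₂₂ a₃ hc hw hw' (hs.trans_le hle) (hs'.trans_le hle)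
      (hb hU) hF).mono (mul_le_mul_of_nonneg_right hC
        (mul_nonneg w.strength_nonneg w'.strength_nonneg))
  reflect a b U V M h1 h3 hp ha hU := by
    obtain ⟨q1, q2⟩ := h.reflect a b U V M h1 h3 hp (ha.trans_le hle) (hb hU)
    exact ⟨q1.trans (mul_le_mul_of_nonneg_right hC (abs_nonneg a)),
      q2.trans (mul_le_mul_of_nonneg_right hC (abs_nonneg a))⟩

section

variable {γ : ℝ} {U₀ : State} {C ε : ℝ}

lemma Supersonic.exists_ball_toLog (h₀ : Supersonic γ U₀) {r : ℝ} (hr : 0 < r) :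
    ∃ e > 0, ∀ U ∈ ball U₀ e, toLog U ∈ ball (toLog U₀) r := by
  have h1 : ContinuousAt toLog U₀ := (h₀.contDiffAt_toLog (n := 1)).continuousAt
  exact Metric.eventually_nhds_iff_ball.1 (h1.eventually (ball_mem_nhds _ hr))

lemma exists_ofLog_lipschitz (γ : ℝ) (U₀ : State) :
    ∃ L, 0 ≤ L ∧ ∃ r > 0, ∀ U V, Supersonic γ U → Supersonic γ V → toLog U ∈ ball (toLog U₀) r →
      toLog V ∈ ball (toLog U₀) r → ‖U - V‖ ≤ L * ‖toLog U - toLog V‖ := by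
  obtain ⟨K, t, ht, hK⟩ :=
    ((contDiff_ofLog (n := 1)).contDiffAt (x := toLog U₀)).exists_lipschitzOnWith
  obtain ⟨r, hr, hb⟩ := Metric.mem_nhds_iff.1 ht
  refine ⟨K, K.2, r, hr, fun U V hU hV hUr hVr => ?_⟩
  have := hK.norm_sub_le (hb hUr) (hb hVr)
  rwa [hU.ofLog_toLog, hV.ofLog_toLog] at this

lemma Supersonic.exists_toLog_lipschitz (h₀ : Supersonic γ U₀) :
    ∃ L, 0 ≤ L ∧ ∃ r > 0, ∀ U ∈ ball U₀ r, ∀ V ∈ ball U₀ r,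
      ‖toLog U - toLog V‖ ≤ L * ‖U - V‖ := by
  obtain ⟨K, t, ht, hK⟩ := (h₀.contDiffAt_toLog (n := 1)).exists_lipschitzOnWith
  obtain ⟨r, hr, hb⟩ := Metric.mem_nhds_iff.1 ht
  exact ⟨K, K.2, r, hr, fun U hU V hV => hK.norm_sub_le (hb hU) (hb hV)⟩

/-- For a 2-wave the difference vanishes, since it is the same translation from every state; for
acoustic waves this is `LocalFamily.same`. -/
lemma exists_same_log (hγ : 1 < γ) (h₀ : Supersonic γ U₀)
    (h : ∀ j, LocalFamily γ j (toLog U₀) C ε) :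
    ∃ e > 0, ∀ (w : Wave) (U V U' V' : State), WaveJoin γ w U V → WaveJoin γ w U' V' →
    w.strength < e → toLog U ∈ ball (toLog U₀) e → toLog U' ∈ ball (toLog U₀) e →
    ‖toLog V - toLog U - (toLog V' - toLog U')‖ ≤
      2 * C ^ 3 * w.strength * ‖toLog U - toLog U'‖ := by
  have hC := (h .one).reg.one_le
  obtain ⟨e, he, -, hs⟩ := exists_small_all hγ h₀ h ε (h .one).reg.pos
  refine ⟨e, he, fun w U V U' V' hw hw' hsw hU hU' => ?_⟩
  match w, hw, hw', hsw with
  | .acoustic j a, hw, hw', hsw =>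
    obtain ⟨s1, s2, -, s3, -⟩ := hs j a U V hw hsw (Or.inl hU)
    obtain ⟨t1, t2, -, -, -⟩ := hs j a U' V' hw' hsw (Or.inl hU')
    refine ((h j).same hγ hw hw' s2 t2 s1 t1).trans ?_
    calc _ ≤ 2 * C ^ 2 * (C * |a|) * ‖toLog U - toLog U'‖ := by gcongr
      _ = 2 * C ^ 3 * |a| * ‖toLog U - toLog U'‖ := by ring
  | .contact a b, hw, hw', _ =>
    rw [hw.2.2, hw'.2.2, add_sub_cancel_left, add_sub_cancel_left, sub_self, norm_zero]
    have := (Wave.contact a b).strength_nonneg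
    positivity

lemma exists_merge_log (hγ : 1 < γ) (h₀ : Supersonic γ U₀)
    (h : ∀ j, LocalFamily γ j (toLog U₀) C ε)
    (hΛ : ∀ j, ∀ X ∈ ball (toLog U₀) ε, ∀ Y ∈ ball (toLog U₀) ε,
      |logLam γ j X - logLam γ j Y| ≤ C * ‖X - Y‖) {r : ℝ} (hr : 0 < r) :
    ∃ e > 0, ∀ (j : Acoustic) (a b : ℝ) (U M V W : State), AcJoin γ j a U M → AcJoin γ j b M V →
    AcJoin γ j (a + b) U W → |a| < e → |b| < e → toLog U ∈ ball (toLog U₀) e →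
    toLog V ∈ ball (toLog U₀) r ∧ toLog W ∈ ball (toLog U₀) r ∧
    ‖toLog V - toLog W‖ ≤ 2 * C ^ 6 * (|a| * |b|) := by
  have hC := (h .one).reg.one_le
  have hε := (h .one).reg.pos
  obtain ⟨e₁, he₁, l1, h1⟩ := exists_small_all hγ h₀ h (min r (ε / (4 * C))) (by positivity)
  obtain ⟨e₂, he₂, l2, h2⟩ := exists_small_all hγ h₀ h e₁ he₁
  have q1 : min r (ε / (4 * C)) ≤ r := min_le_left _ _
  have q2 : min r (ε / (4 * C)) ≤ ε / (4 * C) := min_le_right _ _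
  have q3 : ε / (4 * C) ≤ ε / 4 := by gcongr; linarith
  refine ⟨e₂ / 2, by positivity, fun j a b U M V W j1 j2 j3 ha hb hU => ?_⟩
  have hU2 := ball_subset_ball (half_le_self he₂.le) hU
  obtain ⟨-, u1, m1, -, -⟩ := h2 j a U M j1 (by linarith) (Or.inl hU2)
  obtain ⟨s1, u1, -, s2, -⟩ := h1 j a U M j1 (by linarith) (Or.inl u1)
  obtain ⟨t1, m2, v2, t2, -⟩ := h1 j b M V j2 (by linarith) (Or.inl m1)
  obtain ⟨w1, -, w3, -, -⟩ := h1 j (a + b) U W j3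
    (lt_of_le_of_lt (abs_add_le _ _) (by linarith)) (Or.inl (ball_subset_ball l2 hU2))
  refine ⟨ball_subset_ball q1 v2, ball_subset_ball q1 w3, ?_⟩
  have := (h j).merge_sub hγ (hΛ j) j1 j2 j3 (ball_subset_ball (by linarith) u1)
    (ball_subset_ball (by linarith) m2) (ball_subset_ball (by linarith) v2) (by linarith)
    (by linarith) (by linarith)
  rw [norm_sub_rev]
  refine this.trans ?_
  calc _ ≤ 2 * C ^ 4 * ((C * |a|) * (C * |b|)) := by gcongr
    _ = _ := by ring

/-- Equal pressures below both waves give the reflected wave exactly the logarithmic pressure ratio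
of the incoming one, and this ratio bounds its size and its parameter. No smallness of b has to be
known beforehand. -/
lemma exists_reflect_log (hγ : 1 < γ) (h₀ : Supersonic γ U₀)
    (h : ∀ j, LocalFamily γ j (toLog U₀) C ε) {r : ℝ} (hr : 0 < r) :
    ∃ e > 0, ∀ (a b : ℝ) (U V M : State), AcJoin γ .one a U V → AcJoin γ .three b M V →
    pres M = pres U → |a| < e → toLog U ∈ ball (toLog U₀) e →
    toLog V ∈ ball (toLog U₀) r ∧ toLog M ∈ ball (toLog U₀) r ∧ |b| ≤ C ^ 2 * |a| ∧
      ‖toLog V - toLog M‖ ≤ C ^ 2 * |a| := by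
  have hC := (h .one).reg.one_le
  have hε := (h .one).reg.pos
  set r' := min (r / (4 * C)) (ε / (4 * C))
  have hr' : 0 < r' := by positivity
  have k1 : r' * (4 * C) ≤ r := (le_div_iff₀ (by positivity)).1 (min_le_left _ _)
  have k2 : r' * (4 * C) ≤ ε := (le_div_iff₀ (by positivity)).1 (min_le_right _ _)
  have k3 : r' ≤ r' * C := le_mul_of_one_le_right hr'.le hC
  obtain ⟨e, he, l1, h1⟩ := exists_small_all hγ h₀ h r' hr'
  refine ⟨e, he, fun a b U V M j1 j3 hp ha hU => ?_⟩
  obtain ⟨s1, u1, v1, s2, -⟩ := h1 _ a U V j1 ha (Or.inl hU)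
  have hpi : presInc M V = presInc U V := by rw [presInc, presInc, hp]
  have hs := (h .three).size b M V j3 (Or.inr (ball_subset_ball (by linarith) v1))
    (by rw [hpi]; linarith)
  rw [hpi] at hs
  have hs' : C * |presInc U V| ≤ C * r' := by gcongr
  have hM : toLog M ∈ ball (toLog U₀) (min r ε) := by
    rw [mem_ball_iff_norm] at v1 ⊢
    have e1 : toLog M - toLog U₀ = (toLog V - toLog U₀) - (toLog V - toLog M) := by abel
    rw [e1]
    refine (norm_sub_le _ _).trans_lt (lt_min ?_ ?_) <;> linarith
  have hb := (h .three).abs_le hγ j3 (ball_subset_ball (min_le_right _ _) hM)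
    (by rw [hpi]; linarith)
  rw [hpi] at hb
  have hfin : C * |presInc U V| ≤ C ^ 2 * |a| := by
    calc _ ≤ C * (C * |a|) := by gcongr
      _ = _ := by ring
  exact ⟨ball_subset_ball (by linarith) v1, ball_subset_ball (min_le_left _ _) hM,
    hb.trans hfin, hs.trans hfin⟩

/-- The interaction estimates hold near every supersonic state. -/
lemma Supersonic.exists_localEstimates (hγ : 1 < γ) (h₀ : Supersonic γ U₀) :
    ∃ C ε : ℝ, LocalEstimates γ U₀ C ε := by
  obtain ⟨C, ε, h, hΛ⟩ : ∃ C ε : ℝ, (∀ j, LocalFamily γ j (toLog U₀) C ε) ∧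
      ∀ j, ∀ X ∈ ball (toLog U₀) ε, ∀ Y ∈ ball (toLog U₀) ε,
        |logLam γ j X - logLam γ j Y| ≤ C * ‖X - Y‖ := by
    obtain ⟨C, ε, h⟩ := exists_localFamily hγ h₀
    have hε := (h .one).reg.pos
    have key : ∀ j, ∃ K : ℝ, ∃ r > 0, ∀ X ∈ ball (toLog U₀) r, ∀ Y ∈ ball (toLog U₀) r,
        |logLam γ j X - logLam γ j Y| ≤ K * ‖X - Y‖ := fun j => by
      obtain ⟨K, t, ht, hK⟩ := (h₀.contDiffAt_logLam hγ j (n := 1)).exists_lipschitzOnWith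
      obtain ⟨r, hr, hb⟩ := Metric.mem_nhds_iff.1 ht
      exact ⟨K, r, hr, fun X hX Y hY => hK.norm_sub_le (hb hX) (hb hY)⟩
    obtain ⟨K₁, r₁, hr₁, q1⟩ := key .one
    obtain ⟨K₃, r₃, hr₃, q3⟩ := key .three
    refine ⟨max C (max K₁ K₃), min ε (min r₁ r₃), fun j => (h j).mono (le_max_left _ _)
      (by positivity) (min_le_left _ _), fun j X hX Y hY => ?_⟩
    have l1 : min ε (min r₁ r₃) ≤ r₁ := (min_le_right _ _).trans (min_le_left _ _)
    have l3 : min ε (min r₁ r₃) ≤ r₃ := (min_le_right _ _).trans (min_le_right _ _)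
    cases j
    · exact (q1 X (ball_subset_ball l1 hX) Y (ball_subset_ball l1 hY)).trans (by
        gcongr; exact (le_max_left _ _).trans (le_max_right _ _))
    · exact (q3 X (ball_subset_ball l3 hX) Y (ball_subset_ball l3 hY)).trans (by
        gcongr; exact (le_max_right _ _).trans (le_max_right _ _))
  have hC := (h .one).reg.one_le
  obtain ⟨L, hL, r₁, hr₁, hof⟩ := exists_ofLog_lipschitz γ U₀
  obtain ⟨L', hL', r₂, hr₂, hto⟩ := h₀.exists_toLog_lipschitz
  -- The comparison of equal waves involves four states, so a Lipschitz bound of `ofLog` would not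
  -- transfer it to the original variables; its second difference does.
  obtain ⟨D, r₃, hr₃, hD, hsd⟩ := second_difference
    ((contDiff_ofLog (n := 2)).contDiffAt (x := toLog U₀))
  obtain ⟨K, e₁, he₁, hint⟩ := exists_interact_log hγ h₀ h hΛ
  obtain ⟨e₂, he₂, hsame⟩ := exists_same_log hγ h₀ h
  obtain ⟨e₃, he₃, hmerge⟩ := exists_merge_log hγ h₀ h hΛ hr₁
  obtain ⟨e₄, he₄, hrefl⟩ := exists_reflect_log hγ h₀ h hr₁
  obtain ⟨e₅, he₅, -, hsmall⟩ := exists_wave_small hγ h₀ h (min r₁ r₃) (by positivity)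
  set e := min (min e₁ e₂) (min (min e₃ e₄) (min e₅ (min r₁ r₃)))
  have he : 0 < e := by positivity
  have l1 : e ≤ e₁ := (min_le_left _ _).trans (min_le_left _ _)
  have l2 : e ≤ e₂ := (min_le_left _ _).trans (min_le_right _ _)
  have l3 : e ≤ e₃ := (min_le_right _ _).trans ((min_le_left _ _).trans (min_le_left _ _))
  have l4 : e ≤ e₄ := (min_le_right _ _).trans ((min_le_left _ _).trans (min_le_right _ _))
  have l5 : e ≤ e₅ := (min_le_right _ _).trans ((min_le_right _ _).trans (min_le_left _ _))
  have l6 : e ≤ min r₁ r₃ := (min_le_right _ _).trans ((min_le_right _ _).trans (min_le_right _ _))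
  have q1 := min_le_left r₁ r₃
  have q3 := min_le_right r₁ r₃
  obtain ⟨ε', hε', hball⟩ := h₀.exists_ball_toLog he
  set ρ := min (min ε' r₂) (min e 1)
  have hρ : 0 < ρ := by positivity
  have p1 : ρ ≤ ε' := (min_le_left _ _).trans (min_le_left _ _)
  have p2 : ρ ≤ r₂ := (min_le_left _ _).trans (min_le_right _ _)
  have p3 : ρ ≤ e := (min_le_right _ _).trans (min_le_left _ _)
  have p4 : ρ ≤ 1 := (min_le_right _ _).trans (min_le_right _ _)
  have hb : ∀ U ∈ ball U₀ ρ, toLog U ∈ ball (toLog U₀) e := fun U hU =>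
    hball U (ball_subset_ball p1 hU)
  set S := D * (2 * C ^ 3 + (1 + 2 * C ^ 3) * C ^ 2) * L'
  have hS : 0 ≤ S := by positivity
  set A := 1 + L * C ^ 2 + S + L * (2 * C ^ 6) + |K| + C ^ 2
  have hLC : 0 ≤ L * C ^ 2 := by positivity
  have hLC6 : 0 ≤ L * (2 * C ^ 6) := by positivity
  have hC2 : 0 ≤ C ^ 2 := by positivity
  have hK := abs_nonneg K
  refine ⟨A, ρ, hρ, by simp only [A]; linarith, ?_, ?_, ?_, ?_, ?_⟩
  · intro w U V hw hs hUV
    obtain ⟨u1, v1, n⟩ := hsmall w U V hw (by linarith)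
      (hUV.imp (fun h => ball_subset_ball l5 (hb _ h)) fun h => ball_subset_ball l5 (hb _ h))
    refine (hof V U (hw.right hγ) (hw.left hγ) (ball_subset_ball q1 v1)
      (ball_subset_ball q1 u1)).trans ?_
    calc _ ≤ L * (C ^ 2 * w.strength) := by gcongr
      _ = L * C ^ 2 * w.strength := by ring
      _ ≤ _ := mul_le_mul_of_nonneg_right (by simp only [A]; linarith) w.strength_nonneg
  · intro w U V U' V' hw hw' hs hU hU'
    have hs0 := w.strength_nonneg
    obtain ⟨u1, v1, n⟩ := hsmall w U V hw (by linarith) (Or.inl (ball_subset_ball l5 (hb _ hU)))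
    obtain ⟨u1', v1', -⟩ := hsmall w U' V' hw' (by linarith)
      (Or.inl (ball_subset_ball l5 (hb _ hU')))
    have k := hsame w U V U' V' hw hw' (by linarith) (ball_subset_ball l2 (hb _ hU))
      (ball_subset_ball l2 (hb _ hU'))
    have d := hto U (ball_subset_ball p2 hU) U' (ball_subset_ball p2 hU')
    have z := hsd (toLog V) (ball_subset_ball q3 v1) (toLog U) (ball_subset_ball q3 u1)
      (toLog V') (ball_subset_ball q3 v1') (toLog U') (ball_subset_ball q3 u1')
    rw [(hw.left hγ).ofLog_toLog, (hw.right hγ).ofLog_toLog, (hw'.left hγ).ofLog_toLog,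
      (hw'.right hγ).ofLog_toLog] at z
    refine z.trans ?_
    set Δ := ‖toLog U - toLog U'‖
    have hΔ : 0 ≤ Δ := norm_nonneg _
    have hVV : ‖toLog V - toLog V'‖ ≤ (1 + 2 * C ^ 3) * Δ := by
      have e1 : toLog V - toLog V' = (toLog U - toLog U') +
        (toLog V - toLog U - (toLog V' - toLog U')) := by abel
      rw [e1]
      refine (norm_add_le _ _).trans ?_
      calc _ ≤ Δ + 2 * C ^ 3 * w.strength * Δ := add_le_add le_rfl k
        _ ≤ Δ + 2 * C ^ 3 * 1 * Δ := by gcongr; linarith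
        _ = _ := by ring
    calc _ ≤ D * (2 * C ^ 3 * w.strength * Δ + (1 + 2 * C ^ 3) * Δ * (C ^ 2 * w.strength)) := by
          gcongr
      _ = D * (2 * C ^ 3 + (1 + 2 * C ^ 3) * C ^ 2) * w.strength * Δ := by ring
      _ ≤ D * (2 * C ^ 3 + (1 + 2 * C ^ 3) * C ^ 2) * w.strength * (L' * ‖U - U'‖) := by gcongr
      _ = S * w.strength * ‖U - U'‖ := by simp only [S]; ring
      _ ≤ A * w.strength * ‖U - U'‖ := by gcongr; simp only [A]; linarith
  · intro j a b U M V W j1 j2 j3 ha hb' hU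
    obtain ⟨v1, w1, n⟩ := hmerge j a b U M V W j1 j2 j3 (by linarith) (by linarith)
      (ball_subset_ball l3 (hb _ hU))
    refine (hof V W (j2.right hγ) (j3.right hγ) v1 w1).trans ?_
    calc _ ≤ L * (2 * C ^ 6 * (|a| * |b|)) := by gcongr
      _ = L * (2 * C ^ 6) * (|a| * |b|) := by ring
      _ ≤ _ := by gcongr; simp only [A]; linarith
  · intro w w' U M V M₁ M₂ a₁ a₂₁ a₂₂ a₃ hc hw hw' hs hs' hU hF
    refine (hint w w' U M V M₁ M₂ a₁ a₂₁ a₂₂ a₃ hc hw hw' (by linarith) (by linarith)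
      (ball_subset_ball l1 (hb _ hU)) hF).mono (mul_le_mul_of_nonneg_right ?_
        (mul_nonneg w.strength_nonneg w'.strength_nonneg))
    have := le_abs_self K
    simp only [A]; linarith
  · intro a b U V M j1 j3 hp ha hU
    obtain ⟨v1, m1, n1, n2⟩ := hrefl a b U V M j1 j3 hp (by linarith)
      (ball_subset_ball l4 (hb _ hU))
    constructor
    · exact n1.trans (by gcongr; simp only [A]; linarith)
    · refine (hof V M (j3.right hγ) (j3.left hγ) v1 m1).trans ?_
      calc _ ≤ L * (C ^ 2 * |a|) := by gcongr
        _ = L * C ^ 2 * |a| := by ring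
        _ ≤ _ := by gcongr; simp only [A]; linarith

end

/-- The interaction estimates hold uniformly near a compact set of supersonic states. -/
lemma exists_localEstimates_of_isCompact {γ : ℝ} (hγ : 1 < γ) {s : Set State} (hs : IsCompact s)
    (h : ∀ U ∈ s, Supersonic γ U) : ∃ C ε : ℝ, 1 ≤ C ∧ 0 < ε ∧ ∀ U ∈ s, LocalEstimates γ U C ε := by
  refine hs.induction_on (p := fun t => ∃ C ε : ℝ, 1 ≤ C ∧ 0 < ε ∧
    ∀ U ∈ t, LocalEstimates γ U C ε) ⟨1, 1, le_rfl, one_pos, by simp⟩ ?_ ?_ ?_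
  · rintro t t' htt ⟨C, ε, hC, hε, h⟩
    exact ⟨C, ε, hC, hε, fun U hU => h U (htt hU)⟩
  · rintro t t' ⟨C, ε, hC, hε, h⟩ ⟨C', ε', hC', hε', h'⟩
    refine ⟨max C C', min ε ε', hC.trans (le_max_left _ _), by positivity, ?_⟩
    rintro U (hU | hU)
    · exact (h U hU).mono (le_max_left _ _) (by positivity) (min_le_left _ _)
        (ball_subset_ball (min_le_left _ _))
    · exact (h' U hU).mono (le_max_right _ _) (by positivity) (min_le_right _ _)
        (ball_subset_ball (min_le_right _ _))
  · intro U hU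
    obtain ⟨C, ε, hL⟩ := (h U hU).exists_localEstimates hγ
    have hε := hL.pos
    -- With half the radius, the ball about any point of this neighbourhood stays inside the ball
    -- about U.
    refine ⟨ball U (ε / 2), mem_nhdsWithin_of_mem_nhds (ball_mem_nhds U (by positivity)),
      C, ε / 2, hL.one_le, by positivity, fun V hV => ?_⟩
    refine hL.mono le_rfl (by positivity) (by linarith) (ball_subset_ball' ?_)
    rw [mem_ball] at hV
    linarith

end SteadyEuler
end

noncomputable section
namespace SteadyEuler

open Set Filter Topology Metric

/-! ## Chains of fronts -/

lemma IsRarefaction.refl {γ : ℝ} {U : State} (h : Supersonic γ U) (j : Acoustic) :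
    IsRarefaction γ j 0 U U := by
  refine ⟨fun _ => U, rfl, rfl, fun t ht => ⟨h, ?_⟩⟩
  rw [Icc_self] at ht ⊢
  rw [mem_singleton_iff] at ht
  subst ht
  exact hasDerivWithinAt_iff_hasFDerivWithinAt.2 HasFDerivWithinAt.singleton

/-- Consecutive rarefaction waves of the same family form a rarefaction wave. -/
lemma IsRarefaction.append {γ : ℝ} {j : Acoustic} {a b : ℝ} {U M V : State} (ha : 0 ≤ a)
    (hb : 0 ≤ b) (h1 : IsRarefaction γ j a U M) (h2 : IsRarefaction γ j b M V) :
    IsRarefaction γ j (a + b) U V := by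
  obtain ⟨ψ, h0, h1', hψ⟩ := h1
  obtain ⟨χ, k0, k1, hχ⟩ := h2
  set ω : ℝ → State := fun t => if t ≤ a then ψ t else χ (t - a) with hω
  have hl : ∀ t ≤ a, ω t = ψ t := fun t ht => if_pos ht
  have hr : ∀ t, a ≤ t → ω t = χ (t - a) := by
    intro t ht
    rcases ht.eq_or_lt with rfl | ht
    · rw [hl _ le_rfl, h1', sub_self, k0]
    · exact if_neg ht.not_ge
  refine ⟨ω, by rw [hl 0 ha, h0], by rw [hr _ (by linarith)]; simpa using k1, fun t ht => ?_⟩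
  have hleft : t ≤ a → HasDerivWithinAt ω (eigvec γ j (ω t)) (Icc 0 a) t := by
    intro h
    have := (hψ t ⟨ht.1, h⟩).2
    rw [hl t h]
    exact this.congr (fun s hs => hl s hs.2) (hl t h)
  have hright : a ≤ t → HasDerivWithinAt ω (eigvec γ j (ω t)) (Icc a (a + b)) t := by
    intro h
    have hm : t - a ∈ Icc 0 b := ⟨by linarith, by linarith [ht.2]⟩
    have := (hχ (t - a) hm).2
    rw [hr t h]
    have hc : HasDerivWithinAt (fun s => χ (s - a)) (eigvec γ j (χ (t - a))) (Icc a (a + b)) t := by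
      have hs : HasDerivWithinAt (fun s : ℝ => s - a) 1 (Icc a (a + b)) t :=
        (hasDerivWithinAt_id t _).sub_const a
      have h2 := this.scomp t hs (fun s hs => (⟨by linarith [hs.1], by linarith [hs.2]⟩ :
        s - a ∈ Icc 0 b))
      rwa [one_smul] at h2
    exact hc.congr (fun s hs => hr s hs.1) (hr t h)
  have hunion : Icc 0 (a + b) = Icc 0 a ∪ Icc a (a + b) :=
    (Icc_union_Icc_eq_Icc ha (by linarith)).symm
  rcases lt_trichotomy t a with h | h | h
  · refine ⟨by rw [hl t h.le]; exact (hψ t ⟨ht.1, h.le⟩).1, (hleft h.le).mono_of_mem_nhdsWithin ?_⟩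
    rw [mem_nhdsWithin]
    exact ⟨Iio a, isOpen_Iio, h, fun s hs => ⟨hs.2.1, hs.1.le⟩⟩
  · refine ⟨by rw [hl t h.le]; exact (hψ t ⟨ht.1, h.le⟩).1, ?_⟩
    rw [hunion]
    exact (hleft h.le).union (hright h.ge)
  · refine ⟨by rw [hr t h.le]; exact (hχ _ ⟨by linarith, by linarith [ht.2]⟩).1,
      (hright h.le).mono_of_mem_nhdsWithin ?_⟩
    rw [mem_nhdsWithin]
    exact ⟨Ioi a, isOpen_Ioi, h, fun s hs => ⟨hs.1.le, hs.2.2⟩⟩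

/-- A rarefaction wave as a curve of states, any two of which are joined by a rarefaction wave. -/
lemma IsRarefaction.exists_curve {γ : ℝ} {j : Acoustic} {a : ℝ} {U V : State}
    (h : IsRarefaction γ j a U V) : ∃ ψ : ℝ → State, ψ 0 = U ∧ ψ a = V ∧
      ContinuousOn ψ (Icc 0 a) ∧ (∀ t ∈ Icc 0 a, Supersonic γ (ψ t)) ∧
      ∀ s t, 0 ≤ s → s ≤ t → t ≤ a → IsRarefaction γ j (t - s) (ψ s) (ψ t) := by
  obtain ⟨ψ, h0, h1, hψ⟩ := h
  refine ⟨ψ, h0, h1, fun t ht => (hψ t ht).2.continuousWithinAt, fun t ht => (hψ t ht).1, ?_⟩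
  intro s t hs hst hta
  refine ⟨fun τ => ψ (s + τ), by simp, by simp, fun τ hτ => ?_⟩
  have hm : s + τ ∈ Icc 0 a := ⟨by linarith [hτ.1], by linarith [hτ.2]⟩
  refine ⟨(hψ _ hm).1, ?_⟩
  have hs' : HasDerivWithinAt (fun τ : ℝ => s + τ) 1 (Icc 0 (t - s)) τ :=
    (hasDerivWithinAt_id τ _).const_add s
  have := (hψ _ hm).2.scomp τ hs' (fun r hr => (⟨by linarith [hr.1], by linarith [hr.2]⟩ :
    s + r ∈ Icc 0 a))
  rwa [one_smul] at this

lemma Connects.append_iff {P : Params} {l₁ l₂ : List Front} {U V : State} :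
    Connects P U (l₁ ++ l₂) V ↔ ∃ M, Connects P U l₁ M ∧ Connects P M l₂ V := by
  induction l₁ generalizing U with
  | nil => simp [Connects]
  | cons f l ih =>
    simp only [List.cons_append, Connects, ih]
    constructor
    · rintro ⟨h1, h2, M, h3, h4⟩
      exact ⟨M, ⟨h1, h2, h3⟩, h4⟩
    · rintro ⟨M, ⟨h1, h2, h3⟩, h4⟩
      exact ⟨h1, h2, M, h3, h4⟩

/-- The wave of a front together with its generation order. -/
def Front.tag (f : Front) : Wave × ℕ := (f.wave, f.order)

lemma Connects.split {P : Params} {out : List Front} {U V : State} (h : Connects P U out V)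
    {t₁ t₂ : List (Wave × ℕ)} (ht : out.map Front.tag = t₁ ++ t₂) :
    ∃ M o₁ o₂, Connects P U o₁ M ∧ o₁.map Front.tag = t₁ ∧ Connects P M o₂ V ∧
      o₂.map Front.tag = t₂ := by
  obtain ⟨o₁, o₂, rfl, h1, h2⟩ := List.map_eq_append_iff.1 ht
  obtain ⟨M, hM1, hM2⟩ := Connects.append_iff.1 h
  exact ⟨M, o₁, o₂, hM1, h1, hM2, h2⟩

lemma Connects.supersonic_right {P : Params} {fs : List Front} {U V : State}
    (h : Connects P U fs V) (hU : Supersonic P.γ U) : Supersonic P.γ V := by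
  induction fs generalizing U with
  | nil => exact (show U = V from h) ▸ hU
  | cons f fs ih => exact ih h.2.2 h.2.1.2.1

lemma Joins.waveJoin {γ lamHat : ℝ} {w : Wave} {U V : State} {s : ℝ} (hU : Supersonic γ U)
    (hV : Supersonic γ V) (h : Joins γ lamHat w U V s) (hw : w.family ≠ 4) : WaveJoin γ w U V := by
  match w, h with
  | .acoustic j a, h =>
    rcases h with ⟨ha, h, -⟩ | ⟨ha, h⟩
    · exact Or.inl ⟨ha.le, h⟩
    · exact Or.inr ⟨ha, s, h⟩
  | .contact a b, ⟨_, hx, hy, hp, hr, _⟩ =>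
    refine ⟨hU, hV, ?_⟩
    have hs : speed V = Real.exp a * speed U := by
      rw [speed, hx, hy, speed, ← Real.sqrt_sq (Real.exp_pos a).le, ← Real.sqrt_mul (sq_nonneg _),
        Real.sqrt_sq (Real.exp_pos a).le]
      congr 1
      ring
    have hq : velY V / velX V = velY U / velX U := by
      rw [hx, hy, mul_div_mul_right _ _ (Real.exp_pos a).ne']
    ext
    · simp [toLog, hp]
    · simp [toLog, hq]
    · simp only [toLog, hs, Prod.snd_add, Prod.fst_add]
      rw [Real.log_mul (Real.exp_pos a).ne' hU.speed_pos.ne', Real.log_exp, add_comm]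
    · simp only [toLog, hr, Prod.snd_add]
      rw [Real.log_mul hU.dens_pos.ne' (Real.exp_pos b).ne', Real.log_exp]
  | .nonphysical e, _ => exact absurd rfl hw

lemma Front.Admissible.waveJoin {P : Params} {f : Front} (h : f.Admissible P) (hf : ¬ f.IsNP) :
    WaveJoin P.γ f.wave f.below f.above := by
  obtain ⟨h1, h2, s, h3, -⟩ := h
  exact h3.waveJoin h1 h2 hf

/-- The fronts of a divided rarefaction wave join up to one rarefaction wave, so the division is
invisible to the interaction estimates. -/
lemma connects_replicate {P : Params} {j : Acoustic} {b : ℝ} (hb : 0 < b) {k : ℕ} :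
    ∀ {n : ℕ} {out : List Front} {U V : State}, Connects P U out V → Supersonic P.γ U →
      out.map Front.tag = List.replicate n (.acoustic j b, k) →
      IsRarefaction P.γ j (n * b) U V := by
  intro n
  induction n with
  | zero =>
    intro out U V h hU ht
    simp only [List.replicate_zero, List.map_eq_nil_iff] at ht
    subst ht
    have : U = V := h
    subst this
    simpa using IsRarefaction.refl hU j
  | succ n ih =>
    intro out U V h hU ht
    match out, h, ht with
    | f :: fs, ⟨hf, ha, hc⟩, ht =>
      rw [List.replicate_succ, List.map_cons, List.cons.injEq] at ht
      have h1 := ih hc ha.2.1 ht.2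
      obtain ⟨-, -, s, hj, -⟩ := ha
      have hw : f.wave = .acoustic j b := congrArg Prod.fst ht.1
      rw [hw, hf] at hj
      rcases hj with ⟨-, hj, -⟩ | ⟨hneg, -⟩
      · have := IsRarefaction.append hb.le (by positivity) hj h1
        convert this using 1
        push_cast; ring
      · exact absurd hb hneg.not_gt
    | [], _, ht => simp [List.replicate_succ] at ht

lemma ceil_pos_of_pos {a δ : ℝ} (ha : 0 < a) (hδ : 0 < δ) : 0 < (⌈a / δ⌉₊ : ℝ) := by
  exact_mod_cast Nat.ceil_pos.2 (div_pos ha hδ)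

/-- The fronts into which a wave is divided join the same states as the wave. -/
lemma Connects.waveJoin {P : Params} (hδ : 0 < P.δ) {w : Wave} (hw : w.family ≠ 4) {k : ℕ}
    {out : List Front} {U V : State} (h : Connects P U out V) (hU : Supersonic P.γ U)
    (ht : out.map Front.tag = (pieces P.δ w).map fun w' => (w', k)) : WaveJoin P.γ w U V := by
  have hnil : out = [] → U = V := by rintro rfl; exact h
  have hsing : ∀ w', w'.family ≠ 4 → out.map Front.tag = [(w', k)] → WaveJoin P.γ w' U V := by
    intro w' hw' ht
    obtain ⟨f, rfl, hft⟩ := List.map_eq_singleton_iff.1 ht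
    obtain ⟨hf, ha, hc⟩ := h
    have hfw : f.wave = w' := congrArg Prod.fst hft
    subst hfw
    have := ha.waveJoin hw'
    rwa [hf, show f.above = V from hc] at this
  match w, ht with
  | .acoustic j a, ht =>
    simp only [pieces] at ht
    split_ifs at ht with h1 h2
    · have hn := ceil_pos_of_pos h1 hδ
      rw [List.map_replicate] at ht
      have := connects_replicate (div_pos h1 hn) h hU ht
      rw [mul_div_cancel₀ _ hn.ne'] at this
      exact Or.inl ⟨h1.le, this⟩
    · rw [List.map_nil, List.map_eq_nil_iff] at ht
      rw [← hnil ht, h2]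
      exact Or.inl ⟨le_rfl, IsRarefaction.refl hU j⟩
    · exact hsing _ hw ht
  | .contact a b, ht =>
    simp only [pieces] at ht
    split_ifs at ht with h1
    · rw [List.map_nil, List.map_eq_nil_iff] at ht
      rw [← hnil ht, h1.1, h1.2]
      exact ⟨hU, hU, by simp⟩
    · exact hsing _ hw ht
  | .nonphysical e, _ => exact absurd rfl hw

lemma Connects.nonphysical {P : Params} {e : ℝ} {k : ℕ} {out : List Front} {U V : State}
    (h : Connects P U out V)
    (ht : out.map Front.tag = (pieces P.δ (.nonphysical e)).map fun w' => (w', k)) :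
    e = ‖V - U‖ := by
  simp only [pieces] at ht
  split_ifs at ht with h1
  · rw [List.map_nil, List.map_eq_nil_iff] at ht
    subst ht
    have : U = V := h
    simp [h1, this]
  · obtain ⟨f, rfl, hft⟩ := List.map_eq_singleton_iff.1 ht
    obtain ⟨hf, ⟨-, -, s, hj, -⟩, hc⟩ := h
    have hfw : f.wave = .nonphysical e := congrArg Prod.fst hft
    rw [hfw, hf, show f.above = V from hc] at hj
    exact hj.2.1

/-! ## Invariants of approximate solutions -/

/-- The invariants of the slabs of an approximate solution. -/
structure Slab.Good (P : Params) (c : Slab) : Prop where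
  connects : Connects P c.bottom c.fronts P.Up
  pres_bottom : pres c.bottom = P.pbar
  small : ∀ f ∈ c.fronts, ∀ j a, f.wave = .acoustic j a → a ≤ P.δ

/-- The bound also covers strong fronts: each of them is small although their total strength is not.
-/
lemma pieces_le {δ : ℝ} (hδ : 0 < δ) {w : Wave} {j : Acoustic} {a : ℝ}
    (h : Wave.acoustic j a ∈ pieces δ w) : a ≤ δ := by
  match w, h with
  | .acoustic i b, h =>
    simp only [pieces] at h
    split_ifs at h with h1 h2
    · obtain ⟨-, h⟩ := List.mem_replicate.1 h
      injection h with _ h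
      rw [h, div_le_iff₀ (ceil_pos_of_pos h1 hδ), mul_comm, ← div_le_iff₀ hδ]
      exact Nat.le_ceil _
    · simp at h
    · rw [List.mem_singleton] at h
      injection h with _ h
      linarith
  | .contact a b, h =>
    simp only [pieces] at h
    split_ifs at h <;> simp at h
  | .nonphysical e, h =>
    simp only [pieces] at h
    split_ifs at h <;> simp at h

lemma IsFan.small {P : Params} (hδ : 0 < P.δ) {ord : ℕ → ℕ} {ws : List Wave} {x y : ℝ} {U V : State}
    {out : List Front} (h : IsFan P ord ws x y U out V) :
    ∀ f ∈ out, ∀ j a, f.wave = .acoustic j a → a ≤ P.δ := by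
  intro f hf j a hw
  have hm : (f.wave, f.order) ∈ out.map fun f => (f.wave, f.order) :=
    List.mem_map.2 ⟨f, hf, rfl⟩
  rw [h.2.2, List.mem_flatMap] at hm
  obtain ⟨w, -, hm⟩ := hm
  obtain ⟨w', hw', he⟩ := List.mem_map.1 hm
  have : w' = .acoustic j a := by rw [← hw]; exact congrArg Prod.fst he
  exact pieces_le hδ (this ▸ hw')

lemma InitialFronts.connects {P : Params} (hδ : 0 < P.δ) {U : State} {y : ℝ} {fs : List Front}
    (h : InitialFronts P U y fs) : Connects P U fs P.Up ∧
      ∀ f ∈ fs, ∀ j a, f.wave = .acoustic j a → a ≤ P.δ := by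
  induction h with
  | nil y => exact ⟨rfl, by simp⟩
  | jump U V y y' out rest hy hout hrest ih =>
    obtain ⟨a₁, a₂₁, a₂₂, a₃, hfan⟩ := hout
    refine ⟨Connects.append_iff.2 ⟨V, hfan.2.1, ih.1⟩, fun f hf => ?_⟩
    rcases List.mem_append.1 hf with hf | hf
    · exact hfan.small hδ f hf
    · exact ih.2 f hf

lemma IsInitial.good {P : Params} (hδ : 0 < P.δ) {c : Slab} (h : IsInitial P c) : c.Good P := by
  obtain ⟨-, -, hp, U₀, S₀, fan, rest, -, hfan, hrest, hc⟩ := h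
  obtain ⟨h1, h2⟩ := hrest.connects hδ
  refine ⟨hc ▸ Connects.append_iff.2 ⟨U₀, hfan.2.1, h1⟩, hp, fun f hf => ?_⟩
  rw [hc] at hf
  rcases List.mem_append.1 hf with hf | hf
  · exact hfan.small hδ f hf
  · exact h2 f hf

/-- A collision keeps the outer states of the replaced block, and a reflection changes only the
lowest state, to one with the static pressure. The uppermost state therefore remains U₊. -/
lemma Interaction.good {P : Params} (hδ : 0 < P.δ) {c c' : Slab} {x E : ℝ}
    (h : Interaction P c x c' E) (hc : c.Good P) : c'.Good P := by
  obtain ⟨h1, h2, h3⟩ := hc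
  cases h with
  | collide lo hi out f g E hfronts hmeet honly hcase hsolver =>
    rw [hfronts] at h1 h3
    obtain ⟨M, hlo, rfl, -, hg, -, hhi⟩ := Connects.append_iff.1 h1
    have key : Connects P f.below out g.above ∧
        ∀ f ∈ out, ∀ j a, f.wave = .acoustic j a → a ≤ P.δ := by
      rcases hsolver with ⟨-, -, a₁, a₂₁, a₂₂, a₃, hf⟩ | ⟨-, e, hf⟩
      · exact ⟨hf.2.1, hf.small hδ⟩
      · exact ⟨hf.2.1, hf.small hδ⟩
    refine ⟨Connects.append_iff.2 ⟨_, Connects.append_iff.2 ⟨_, hlo, key.1⟩, hhi⟩, h2, ?_⟩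
    intro h hh
    rcases List.mem_append.1 hh with hh | hh
    · rcases List.mem_append.1 hh with hh | hh
      · exact h3 h (by simp [hh])
      · exact key.2 h hh
    · exact h3 h (by simp [hh])
  | reflect hi out f a b s Um hfronts hwave hmeet honly hpres hjoin hsolver =>
    rw [hfronts] at h1 h3
    obtain ⟨-, -, hhi⟩ := h1
    have key : Connects P Um out f.above ∧
        ∀ f ∈ out, ∀ j a, f.wave = .acoustic j a → a ≤ P.δ := by
      rcases hsolver with ⟨-, hf⟩ | ⟨-, e, hf⟩
      · exact ⟨hf.2.1, hf.small hδ⟩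
      · exact ⟨hf.2.1, hf.small hδ⟩
    refine ⟨Connects.append_iff.2 ⟨_, key.1, hhi⟩, hpres, fun h hh => ?_⟩
    rcases List.mem_append.1 hh with hh | hh
    · exact key.2 h hh
    · exact h3 h (by simp [hh])

lemma ApproxSolution.good {P : Params} (hδ : 0 < P.δ) (A : ApproxSolution P) :
    ∀ n ≤ A.N, (A.slab n).Good P := by
  intro n
  induction n with
  | zero => exact fun _ => A.initial.good hδ
  | succ n ih => exact fun hn => (A.interaction n hn).good hδ (ih (by omega))

end SteadyEuler
end

noncomputable section
namespace SteadyEuler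

open Set Filter Topology Metric

/-! ## Additivity of the functionals -/

/-- Total strengths of the fronts of each kind: 1-shocks, 1-rarefactions, 2-waves, 3-shocks, weak
and strong 3-rarefactions, non-physical fronts. -/
@[ext]
structure Load where
  oneS : ℝ
  oneR : ℝ
  slip : ℝ
  threeS : ℝ
  threeR : ℝ
  strong : ℝ
  np : ℝ

namespace Load

instance : Zero Load := ⟨⟨0, 0, 0, 0, 0, 0, 0⟩⟩

instance : Add Load := ⟨fun L M => ⟨L.oneS + M.oneS, L.oneR + M.oneR, L.slip + M.slip,
  L.threeS + M.threeS, L.threeR + M.threeR, L.strong + M.strong, L.np + M.np⟩⟩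

@[simp] lemma zero_def : (0 : Load) = ⟨0, 0, 0, 0, 0, 0, 0⟩ := rfl

@[simp] lemma add_def (L M : Load) : L + M = ⟨L.oneS + M.oneS, L.oneR + M.oneR, L.slip + M.slip,
  L.threeS + M.threeS, L.threeR + M.threeR, L.strong + M.strong, L.np + M.np⟩ := rfl

/-- All entries are nonnegative. -/
structure Nonneg (L : Load) : Prop where
  oneS : 0 ≤ L.oneS
  oneR : 0 ≤ L.oneR
  slip : 0 ≤ L.slip
  threeS : 0 ≤ L.threeS
  threeR : 0 ≤ L.threeR
  strong : 0 ≤ L.strong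
  np : 0 ≤ L.np

/-- The interaction potential of two groups of fronts, the first one lying below the second. -/
def cross (L M : Load) : ℝ :=
  L.oneS * (M.oneS + M.oneR) + L.oneR * M.oneS + L.slip * (M.oneS + M.oneR) +
    (L.threeS + L.threeR) * (M.oneS + M.oneR + M.slip) +
    L.threeS * (M.threeS + M.threeR) + L.threeR * M.threeS +
    L.np * (M.oneS + M.oneR + M.slip + M.threeS + M.threeR)

end Load

/-- The strength of a non-physical front. -/
def Wave.npParam : Wave → ℝ
  | .nonphysical e => |e|
  | _ => 0

/-- The load of a wave with a generation order. -/
def Load.ofTag (t : Wave × ℕ) : Load where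
  oneS := max (-t.1.acParam .one) 0
  oneR := max (t.1.acParam .one) 0
  slip := |t.1.slipParam.1| + |t.1.slipParam.2|
  threeS := max (-t.1.acParam .three) 0
  threeR := if t.2 = 0 then 0 else max (t.1.acParam .three) 0
  strong := if t.2 = 0 then max (t.1.acParam .three) 0 else 0
  np := t.1.npParam

lemma Load.ofTag_nonneg (t : Wave × ℕ) : (Load.ofTag t).Nonneg where
  oneS := le_max_right _ _
  oneR := le_max_right _ _
  slip := by simp only [Load.ofTag]; positivity
  threeS := le_max_right _ _
  threeR := by simp only [Load.ofTag]; split_ifs <;> simp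
  strong := by simp only [Load.ofTag]; split_ifs <;> simp
  np := by obtain ⟨w, k⟩ := t; cases w <;> simp [Load.ofTag, Wave.npParam]

def loadOfTags : List (Wave × ℕ) → Load
  | [] => 0
  | t :: ts => Load.ofTag t + loadOfTags ts

/-- The load of a list of fronts. -/
def load (fs : List Front) : Load := loadOfTags (fs.map Front.tag)

lemma load_cons (f : Front) (fs : List Front) : load (f :: fs) = Load.ofTag f.tag + load fs := rfl

lemma load_nil : load [] = 0 := rfl

lemma loadOfTags_append (l₁ l₂ : List (Wave × ℕ)) :
    loadOfTags (l₁ ++ l₂) = loadOfTags l₁ + loadOfTags l₂ := by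
  induction l₁ with
  | nil => ext <;> simp [loadOfTags]
  | cons t l ih =>
    rw [List.cons_append, loadOfTags, ih, loadOfTags]
    ext <;> simp <;> ring

lemma load_append (l₁ l₂ : List Front) : load (l₁ ++ l₂) = load l₁ + load l₂ := by
  rw [load, List.map_append, loadOfTags_append]; rfl

lemma loadOfTags_nonneg (l : List (Wave × ℕ)) : (loadOfTags l).Nonneg := by
  induction l with
  | nil => constructor <;> simp [loadOfTags]
  | cons t l ih =>
    have h := Load.ofTag_nonneg t
    exact ⟨add_nonneg h.1 ih.1, add_nonneg h.2 ih.2, add_nonneg h.3 ih.3, add_nonneg h.4 ih.4,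
      add_nonneg h.5 ih.5, add_nonneg h.6 ih.6, add_nonneg h.7 ih.7⟩

lemma load_nonneg (l : List Front) : (load l).Nonneg := loadOfTags_nonneg _

/-- The kinds of fronts. -/
lemma Front.kind (f : Front) :
    (f.wave.family = 1 ∧ ¬ f.IsStrong ∧ f.wave.IsShock ∧
      Load.ofTag f.tag = ⟨f.strength, 0, 0, 0, 0, 0, 0⟩) ∨
    (f.wave.family = 1 ∧ ¬ f.IsStrong ∧ ¬ f.wave.IsShock ∧
      Load.ofTag f.tag = ⟨0, f.strength, 0, 0, 0, 0, 0⟩) ∨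
    (f.wave.family = 2 ∧ ¬ f.IsStrong ∧ ¬ f.wave.IsShock ∧
      Load.ofTag f.tag = ⟨0, 0, f.strength, 0, 0, 0, 0⟩) ∨
    (f.wave.family = 3 ∧ ¬ f.IsStrong ∧ f.wave.IsShock ∧
      Load.ofTag f.tag = ⟨0, 0, 0, f.strength, 0, 0, 0⟩) ∨
    (f.wave.family = 3 ∧ ¬ f.IsStrong ∧ ¬ f.wave.IsShock ∧
      Load.ofTag f.tag = ⟨0, 0, 0, 0, f.strength, 0, 0⟩) ∨
    (f.wave.family = 3 ∧ f.IsStrong ∧ ¬ f.wave.IsShock ∧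
      Load.ofTag f.tag = ⟨0, 0, 0, 0, 0, f.strength, 0⟩) ∨
    (f.wave.family = 4 ∧ ¬ f.IsStrong ∧ ¬ f.wave.IsShock ∧
      Load.ofTag f.tag = ⟨0, 0, 0, 0, 0, 0, f.strength⟩) := by
  obtain ⟨w, k, U, V, x, y, v⟩ := f
  cases w with
  | acoustic j a =>
    cases j
    · rcases lt_or_ge a 0 with h | h
      · left
        simp [Wave.family, Front.IsStrong, Wave.IsShock, Load.ofTag, Front.tag, Wave.acParam,
          Wave.slipParam, Wave.npParam, Front.strength, Wave.strength, h, h.le, abs_of_neg]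
      · right; left
        simp [Wave.family, Front.IsStrong, Wave.IsShock, Load.ofTag, Front.tag, Wave.acParam,
          Wave.slipParam, Wave.npParam, Front.strength, Wave.strength, h, abs_of_nonneg]
    · rcases lt_or_ge a 0 with h | h
      · right; right; right; left
        simp [Wave.family, Front.IsStrong, Wave.IsShock, Load.ofTag, Front.tag, Wave.acParam,
          Wave.slipParam, Wave.npParam, Front.strength, Wave.strength, h, h.le, abs_of_neg,
          h.not_gt]
      · by_cases hs : k = 0 ∧ 0 < a
        · right; right; right; right; right; left
          simp [Wave.family, Front.IsStrong, Wave.IsShock, Load.ofTag, Front.tag, Wave.acParam,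
            Wave.slipParam, Wave.npParam, Front.strength, Wave.strength, h, hs, abs_of_nonneg]
        · right; right; right; right; left
          have h0 : k = 0 → a = 0 := fun hk => by
            by_contra hne
            exact hs ⟨hk, lt_of_le_of_ne h (Ne.symm hne)⟩
          have h1 : k = 0 → ¬ 0 < a := fun hk ha => hs ⟨hk, ha⟩
          by_cases hk : k = 0
          · simp [Wave.family, Front.IsStrong, Wave.IsShock, Load.ofTag, Front.tag, Wave.acParam,
              Wave.slipParam, Wave.npParam, Front.strength, Wave.strength, hk, h0 hk]
          · simp [Wave.family, Front.IsStrong, Wave.IsShock, Load.ofTag, Front.tag, Wave.acParam,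
              Wave.slipParam, Wave.npParam, Front.strength, Wave.strength, h, hk, abs_of_nonneg]
  | contact a b =>
    right; right; left
    simp [Wave.family, Front.IsStrong, Wave.IsShock, Load.ofTag, Front.tag, Wave.acParam,
      Wave.slipParam, Wave.npParam, Front.strength, Wave.strength]
  | nonphysical e =>
    right; right; right; right; right; right
    simp [Wave.family, Front.IsStrong, Wave.IsShock, Load.ofTag, Front.tag, Wave.acParam,
      Wave.slipParam, Wave.npParam, Front.strength, Wave.strength]

/-- Whether two fronts interact depends only on their kinds, of which there are seven; the pair
potential is therefore a bilinear form in the loads. -/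
lemma pairPotential_eq (f g : Front) :
    pairPotential f g = (Load.ofTag f.tag).cross (Load.ofTag g.tag) := by
  rcases f.kind with ⟨h1, h2, h3, h4⟩ | ⟨h1, h2, h3, h4⟩ | ⟨h1, h2, h3, h4⟩ | ⟨h1, h2, h3, h4⟩ |
    ⟨h1, h2, h3, h4⟩ | ⟨h1, h2, h3, h4⟩ | ⟨h1, h2, h3, h4⟩ <;>
  rcases g.kind with ⟨k1, k2, k3, k4⟩ | ⟨k1, k2, k3, k4⟩ | ⟨k1, k2, k3, k4⟩ | ⟨k1, k2, k3, k4⟩ |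
    ⟨k1, k2, k3, k4⟩ | ⟨k1, k2, k3, k4⟩ | ⟨k1, k2, k3, k4⟩ <;>
  simp [pairPotential, Front.Approach, Front.IsWeak, Front.IsNP, Load.cross, h1, h2, h3, h4,
    k1, k2, k3, k4]

open Classical in
lemma ite_isWeakOf_eq (f : Front) :
    (if f.IsWeakOf 1 then f.strength else 0) =
        (Load.ofTag f.tag).oneS + (Load.ofTag f.tag).oneR ∧
      (if f.IsWeakOf 2 then f.strength else 0) = (Load.ofTag f.tag).slip ∧
      (if f.IsWeakOf 3 then f.strength else 0) =
        (Load.ofTag f.tag).threeS + (Load.ofTag f.tag).threeR ∧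
      (if f.IsStrong then f.strength else 0) = (Load.ofTag f.tag).strong ∧
      (if f.IsNP then f.strength else 0) = (Load.ofTag f.tag).np := by
  rcases f.kind with ⟨h1, h2, h3, h4⟩ | ⟨h1, h2, h3, h4⟩ | ⟨h1, h2, h3, h4⟩ | ⟨h1, h2, h3, h4⟩ |
    ⟨h1, h2, h3, h4⟩ | ⟨h1, h2, h3, h4⟩ | ⟨h1, h2, h3, h4⟩ <;>
  simp [Front.IsWeakOf, Front.IsNP, h1, h2, h4]

lemma weakSum_one (fs : List Front) : weakSum 1 fs = (load fs).oneS + (load fs).oneR := by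
  induction fs with
  | nil => simp [weakSum, load_nil]
  | cons f fs ih =>
    unfold weakSum at ih ⊢
    rw [List.map_cons, List.sum_cons, ih, (ite_isWeakOf_eq f).1, load_cons]
    simp only [Load.add_def]; ring

lemma weakSum_two (fs : List Front) : weakSum 2 fs = (load fs).slip := by
  induction fs with
  | nil => simp [weakSum, load_nil]
  | cons f fs ih =>
    unfold weakSum at ih ⊢
    rw [List.map_cons, List.sum_cons, ih, (ite_isWeakOf_eq f).2.1, load_cons]
    simp only [Load.add_def]

lemma weakSum_three (fs : List Front) : weakSum 3 fs = (load fs).threeS + (load fs).threeR := by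
  induction fs with
  | nil => simp [weakSum, load_nil]
  | cons f fs ih =>
    unfold weakSum at ih ⊢
    rw [List.map_cons, List.sum_cons, ih, (ite_isWeakOf_eq f).2.2.1, load_cons]
    simp only [Load.add_def]; ring

lemma strongSum_eq (fs : List Front) : strongSum fs = (load fs).strong := by
  induction fs with
  | nil => simp [strongSum, load_nil]
  | cons f fs ih =>
    unfold strongSum at ih ⊢
    rw [List.map_cons, List.sum_cons, ih, (ite_isWeakOf_eq f).2.2.2.1, load_cons]
    simp only [Load.add_def]

lemma npSum_eq (fs : List Front) : npSum fs = (load fs).np := by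
  induction fs with
  | nil => simp [npSum, load_nil]
  | cons f fs ih =>
    unfold npSum at ih ⊢
    rw [List.map_cons, List.sum_cons, ih, (ite_isWeakOf_eq f).2.2.2.2, load_cons]
    simp only [Load.add_def]

lemma sum_pairPotential (f : Front) (fs : List Front) :
    (fs.map (pairPotential f)).sum = (Load.ofTag f.tag).cross (load fs) := by
  induction fs with
  | nil => simp [load_nil, Load.cross]
  | cons g fs ih =>
    rw [List.map_cons, List.sum_cons, ih, pairPotential_eq, load_cons]
    simp only [Load.cross, Load.add_def]; ring

/-- By bilinearity a block of fronts interacts with the others only through its total load, so a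
replaced block is described by seven numbers and its own potential. -/
lemma potentialQ₀_append (l₁ l₂ : List Front) : potentialQ₀ (l₁ ++ l₂) =
    potentialQ₀ l₁ + potentialQ₀ l₂ + (load l₁).cross (load l₂) := by
  induction l₁ with
  | nil => simp [potentialQ₀, load_nil, Load.cross]
  | cons f l ih =>
    rw [List.cons_append, potentialQ₀, potentialQ₀, ih, sum_pairPotential, sum_pairPotential,
      load_append, load_cons]
    simp only [Load.cross, Load.add_def]; ring

open Classical in
lemma potentialBelow_cons (Kω : ℝ) (i : ℕ) (f : Front) (fs : List Front) :
    potentialBelow Kω i (f :: fs) = (if f.IsWeakOf i then f.strength else 0) +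
      Real.exp (Kω * (Load.ofTag f.tag).strong) * potentialBelow Kω i fs := by
  unfold potentialBelow
  rw [show (∑ n : Fin (f :: fs).length, _) = (∑ n : Fin (fs.length + 1), _) from rfl,
    Fin.sum_univ_succ, Finset.mul_sum]
  congr 1
  · simp [strongSum]
  · refine Finset.sum_congr rfl fun n _ => ?_
    change (if (fs.get n).IsWeakOf i then
      (fs.get n).strength * Real.exp (Kω * strongSum (f :: fs.take n)) else 0) = _
    split_ifs
    · rw [strongSum_eq, strongSum_eq, load_cons, Load.add_def, mul_add, Real.exp_add]
      ring
    · simp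

lemma potentialBelow_nil (Kω : ℝ) (i : ℕ) : potentialBelow Kω i [] = 0 := by
  simp [potentialBelow]

/-- The weight is the exponential of an additive quantity: a block multiplies the contribution of
everything above it by one factor. -/
lemma potentialBelow_append (Kω : ℝ) (i : ℕ) (l₁ l₂ : List Front) :
    potentialBelow Kω i (l₁ ++ l₂) = potentialBelow Kω i l₁ +
      Real.exp (Kω * (load l₁).strong) * potentialBelow Kω i l₂ := by
  induction l₁ with
  | nil => simp [potentialBelow_nil, load_nil]
  | cons f l ih =>
    rw [List.cons_append, potentialBelow_cons, potentialBelow_cons, ih, load_cons, Load.add_def]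
    simp only [mul_add, Real.exp_add]
    ring

open Classical in
lemma potentialAbove_cons (Knp : ℝ) (f : Front) (fs : List Front) :
    potentialAbove Knp (f :: fs) =
      (Load.ofTag f.tag).np * Real.exp (Knp * (load fs).strong) + potentialAbove Knp fs := by
  unfold potentialAbove
  rw [show (∑ n : Fin (f :: fs).length, _) = (∑ n : Fin (fs.length + 1), _) from rfl,
    Fin.sum_univ_succ]
  congr 1
  rw [← (ite_isWeakOf_eq f).2.2.2.2, ← strongSum_eq]
  simp

lemma potentialAbove_nil (Knp : ℝ) : potentialAbove Knp [] = 0 := by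
  simp [potentialAbove]

/-- For non-physical fronts the strong fronts above count, so here the upper block supplies the
factor for the lower one. -/
lemma potentialAbove_append (Knp : ℝ) (l₁ l₂ : List Front) :
    potentialAbove Knp (l₁ ++ l₂) =
      Real.exp (Knp * (load l₂).strong) * potentialAbove Knp l₁ + potentialAbove Knp l₂ := by
  induction l₁ with
  | nil => simp [potentialAbove_nil]
  | cons f l ih =>
    rw [List.cons_append, potentialAbove_cons, potentialAbove_cons, ih, load_append, Load.add_def]
    simp only [mul_add, Real.exp_add]
    ring

lemma potentialBelow_nonneg (Kω : ℝ) (i : ℕ) (fs : List Front) : 0 ≤ potentialBelow Kω i fs := by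
  refine Finset.sum_nonneg fun n _ => ?_
  split_ifs
  · exact mul_nonneg (Wave.strength_nonneg _) (Real.exp_pos _).le
  · exact le_rfl

lemma potentialAbove_nonneg (Knp : ℝ) (fs : List Front) : 0 ≤ potentialAbove Knp fs := by
  refine Finset.sum_nonneg fun n _ => ?_
  split_ifs
  · exact mul_nonneg (Wave.strength_nonneg _) (Real.exp_pos _).le
  · exact le_rfl

lemma Load.cross_nonneg {L M : Load} (hL : L.Nonneg) (hM : M.Nonneg) : 0 ≤ L.cross M := by
  obtain ⟨a1, a2, a3, a4, a5, a6, a7⟩ := hL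
  obtain ⟨b1, b2, b3, b4, b5, b6, b7⟩ := hM
  unfold Load.cross
  positivity

lemma potentialQ₀_nonneg (fs : List Front) : 0 ≤ potentialQ₀ fs := by
  induction fs with
  | nil => simp [potentialQ₀]
  | cons f fs ih =>
    rw [potentialQ₀, sum_pairPotential]
    exact add_nonneg (Load.cross_nonneg (Load.ofTag_nonneg _) (load_nonneg _)) ih

/-! ### Lists of outgoing fronts -/

lemma loadOfTags_replicate (t : Wave × ℕ) (n : ℕ) : loadOfTags (List.replicate n t) =
    ⟨n * (Load.ofTag t).oneS, n * (Load.ofTag t).oneR, n * (Load.ofTag t).slip,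
      n * (Load.ofTag t).threeS, n * (Load.ofTag t).threeR, n * (Load.ofTag t).strong,
      n * (Load.ofTag t).np⟩ := by
  induction n with
  | zero => ext <;> simp [loadOfTags]
  | succ n ih =>
    rw [List.replicate_succ, loadOfTags, ih]
    ext <;> simp <;> ring

/-- The division of a wave into fronts does not change the load. -/
lemma loadOfTags_pieces {δ : ℝ} (hδ : 0 < δ) (w : Wave) (k : ℕ) :
    loadOfTags ((pieces δ w).map fun w' => (w', k)) = Load.ofTag (w, k) := by
  have hz : ∀ L : Load, L + 0 = L := fun L => by ext <;> simp
  cases w with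
  | acoustic j a =>
    simp only [pieces]
    split_ifs with h1 h2
    · have hn := ceil_pos_of_pos h1 hδ
      have h3 : 0 < a / ⌈a / δ⌉₊ := div_pos h1 hn
      have h4 : (⌈a / δ⌉₊ : ℝ) * (a / ⌈a / δ⌉₊) = a := mul_div_cancel₀ _ hn.ne'
      rw [List.map_replicate, loadOfTags_replicate]
      cases j <;> by_cases hk : k = 0 <;>
        simp [Load.ofTag, Wave.acParam, Wave.slipParam, Wave.npParam, hk, h1.le, h3.le, h4]
    · subst h2
      simp [loadOfTags, Load.ofTag, Wave.acParam, Wave.slipParam, Wave.npParam]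
    · exact hz _
  | contact a b =>
    simp only [pieces]
    split_ifs with h1
    · simp [loadOfTags, Load.ofTag, Wave.acParam, Wave.slipParam, Wave.npParam, h1]
    · exact hz _
  | nonphysical e =>
    simp only [pieces]
    split_ifs with h1
    · simp [loadOfTags, Load.ofTag, Wave.acParam, Wave.slipParam, Wave.npParam, h1]
    · exact hz _

/-- This serves for the equal fronts of a divided rarefaction wave, which do not approach one
another. -/
lemma potentialQ₀_eq_zero {t : Wave × ℕ} (ht : (Load.ofTag t).cross (Load.ofTag t) = 0)
    {fs : List Front} (h : ∀ f ∈ fs, f.tag = t) : potentialQ₀ fs = 0 := by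
  induction fs with
  | nil => rfl
  | cons f fs ih =>
    have hz : (fs.map (pairPotential f)).sum = 0 := by
      refine List.sum_eq_zero fun x hx => ?_
      obtain ⟨g, hg, rfl⟩ := List.mem_map.1 hx
      rw [pairPotential_eq, h f (by simp), h g (by simp [hg]), ht]
    rw [potentialQ₀, hz, ih fun g hg => h g (by simp [hg]), add_zero]

/-- Only rarefaction waves are divided; any other wave gives at most one front and hence no pair. -/
lemma potentialQ₀_pieces {δ : ℝ} (hδ : 0 < δ) {w : Wave} {k : ℕ} {fs : List Front}
    (h : fs.map Front.tag = (pieces δ w).map fun w' => (w', k)) : potentialQ₀ fs = 0 := by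
  have hnil : fs.map Front.tag = [] → potentialQ₀ fs = 0 := fun h => by
    rw [List.map_eq_nil_iff.1 h]; rfl
  have hsing : ∀ t, fs.map Front.tag = [t] → potentialQ₀ fs = 0 := fun t h => by
    obtain ⟨f, rfl, -⟩ := List.map_eq_singleton_iff.1 h
    simp [potentialQ₀]
  cases w with
  | acoustic j a =>
    simp only [pieces] at h
    split_ifs at h with h1 h2
    · have hn := ceil_pos_of_pos h1 hδ
      have h3 : 0 < a / ⌈a / δ⌉₊ := div_pos h1 hn
      rw [List.map_replicate] at h
      refine potentialQ₀_eq_zero (t := (.acoustic j (a / ⌈a / δ⌉₊), k)) ?_ fun f hf => ?_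
      · cases j <;> by_cases hk : k = 0 <;>
          simp [Load.cross, Load.ofTag, Wave.acParam, Wave.slipParam, Wave.npParam, hk, h3.le]
      · have : f.tag ∈ fs.map Front.tag := List.mem_map_of_mem hf
        rw [h] at this
        exact (List.mem_replicate.1 this).2
    · exact hnil h
    · exact hsing _ h
  | contact a b =>
    simp only [pieces] at h
    split_ifs at h with h1
    · exact hnil h
    · exact hsing _ h
  | nonphysical e =>
    simp only [pieces] at h
    split_ifs at h with h1
    · exact hnil h
    · exact hsing _ h

lemma potentialBelow_of_strong_eq_zero (Kω : ℝ) (i : ℕ) {fs : List Front}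
    (h : (load fs).strong = 0) : potentialBelow Kω i fs = weakSum i fs := by
  induction fs with
  | nil => simp [potentialBelow_nil, weakSum]
  | cons f fs ih =>
    rw [load_cons, Load.add_def] at h
    have h1 := (Load.ofTag_nonneg f.tag).strong
    have h2 := (load_nonneg fs).strong
    simp only at h
    have h3 : (Load.ofTag f.tag).strong = 0 := by linarith
    rw [potentialBelow_cons, ih (by linarith), h3, mul_zero, Real.exp_zero, one_mul]
    simp [weakSum]

lemma potentialBelow_of_weakSum_eq_zero (Kω : ℝ) (i : ℕ) {fs : List Front}
    (h : weakSum i fs = 0) : potentialBelow Kω i fs = 0 := by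
  classical
  have hn : ∀ f : Front, 0 ≤ if f.IsWeakOf i then f.strength else 0 := fun f => by
    split_ifs
    · exact Wave.strength_nonneg _
    · exact le_rfl
  induction fs with
  | nil => exact potentialBelow_nil _ _
  | cons f fs ih =>
    have hs : 0 ≤ weakSum i fs := List.sum_nonneg fun x hx => by
      obtain ⟨g, -, rfl⟩ := List.mem_map.1 hx
      exact hn g
    have h0 : weakSum i (f :: fs) = (if f.IsWeakOf i then f.strength else 0) + weakSum i fs := by
      simp [weakSum]
    have := hn f
    rw [h0] at h
    rw [potentialBelow_cons, ih (by linarith), mul_zero, add_zero]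
    linarith

lemma potentialAbove_of_np_eq_zero (Knp : ℝ) {fs : List Front} (h : (load fs).np = 0) :
    potentialAbove Knp fs = 0 := by
  induction fs with
  | nil => exact potentialAbove_nil _
  | cons f fs ih =>
    rw [load_cons, Load.add_def] at h
    have h1 := (Load.ofTag_nonneg f.tag).np
    have h2 := (load_nonneg fs).np
    simp only at h
    have h3 : (Load.ofTag f.tag).np = 0 := by linarith
    rw [potentialAbove_cons, ih (by linarith), h3, zero_mul, add_zero]

lemma potentialAbove_of_strong_eq_zero (Knp : ℝ) {fs : List Front} (h : (load fs).strong = 0) :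
    potentialAbove Knp fs = (load fs).np := by
  induction fs with
  | nil => simp [potentialAbove_nil, load_nil]
  | cons f fs ih =>
    rw [load_cons, Load.add_def] at h ⊢
    have h1 := (Load.ofTag_nonneg f.tag).strong
    have h2 := (load_nonneg fs).strong
    simp only at h ⊢
    have h3 : (load fs).strong = 0 := by linarith
    rw [potentialAbove_cons, ih h3, h3, mul_zero, Real.exp_zero, mul_one]

/-- The fronts that carry, from below to above, a 1-wave, a 2-wave, a 3-wave and a non-physical
wave. -/
def fanTags (δ : ℝ) (ord : ℕ → ℕ) (a₁ : ℝ) (d : ℝ × ℝ) (a₃ e : ℝ) : List (Wave × ℕ) :=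
  [.acoustic .one a₁, .contact d.1 d.2, .acoustic .three a₃, .nonphysical e].flatMap fun w =>
    (pieces δ w).map fun w' => (w', ord w.family)

/-- The functionals of the outgoing fronts. -/
lemma functionals_of_fanTags {δ : ℝ} (hδ : 0 < δ) {ord : ℕ → ℕ} {a₁ : ℝ} {d : ℝ × ℝ} {a₃ e : ℝ}
    {out : List Front} (h : out.map Front.tag = fanTags δ ord a₁ d a₃ e) (Kω Knp : ℝ) :
    load out = ⟨max (-a₁) 0, max a₁ 0, |d.1| + |d.2|, max (-a₃) 0,
      if ord 3 = 0 then 0 else max a₃ 0, if ord 3 = 0 then max a₃ 0 else 0, |e|⟩ ∧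
    potentialQ₀ out = 0 ∧ potentialBelow Kω 1 out = |a₁| ∧
    potentialBelow Kω 2 out = |d.1| + |d.2| ∧ potentialAbove Knp out = |e| := by
  simp only [fanTags, List.flatMap_cons, List.flatMap_nil, List.append_nil] at h
  obtain ⟨o₁, o', rfl, h1, h'⟩ := List.map_eq_append_iff.1 h
  obtain ⟨o₂, o'', rfl, h2, h''⟩ := List.map_eq_append_iff.1 h'
  obtain ⟨o₃, o₄, rfl, h3, h4⟩ := List.map_eq_append_iff.1 h''
  have l1 : load o₁ = ⟨max (-a₁) 0, max a₁ 0, 0, 0, 0, 0, 0⟩ := by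
    rw [load, h1, loadOfTags_pieces hδ]
    simp [Load.ofTag, Wave.acParam, Wave.slipParam, Wave.npParam]
  have l2 : load o₂ = ⟨0, 0, |d.1| + |d.2|, 0, 0, 0, 0⟩ := by
    rw [load, h2, loadOfTags_pieces hδ]
    simp [Load.ofTag, Wave.acParam, Wave.slipParam, Wave.npParam]
  have l3 : load o₃ = ⟨0, 0, 0, max (-a₃) 0, if ord 3 = 0 then 0 else max a₃ 0,
      if ord 3 = 0 then max a₃ 0 else 0, 0⟩ := by
    rw [load, h3, loadOfTags_pieces hδ]
    simp [Load.ofTag, Wave.acParam, Wave.slipParam, Wave.npParam, Wave.family]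
  have l4 : load o₄ = ⟨0, 0, 0, 0, 0, 0, |e|⟩ := by
    rw [load, h4, loadOfTags_pieces hδ]
    simp [Load.ofTag, Wave.acParam, Wave.slipParam, Wave.npParam]
  have habs : max (-a₁) 0 + max a₁ 0 = |a₁| := by
    rcases le_total 0 a₁ with h | h
    · simp [h, abs_of_nonneg]
    · simp [h, abs_of_nonpos]
  have q1 : potentialBelow Kω 1 o₁ = |a₁| := by
    rw [potentialBelow_of_strong_eq_zero _ _ (by rw [l1]), weakSum_one, l1, ← habs]
  have q2 : potentialBelow Kω 2 o₁ = 0 :=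
    potentialBelow_of_weakSum_eq_zero _ _ (by rw [weakSum_two, l1])
  have q3 : potentialBelow Kω 1 (o₂ ++ (o₃ ++ o₄)) = 0 :=
    potentialBelow_of_weakSum_eq_zero _ _ (by
      rw [weakSum_one, load_append, load_append, l2, l3, l4]; simp)
  have q4 : potentialBelow Kω 2 o₂ = |d.1| + |d.2| := by
    rw [potentialBelow_of_strong_eq_zero _ _ (by rw [l2]), weakSum_two, l2]
  have q5 : potentialBelow Kω 2 (o₃ ++ o₄) = 0 :=
    potentialBelow_of_weakSum_eq_zero _ _ (by
      rw [weakSum_two, load_append, l3, l4]; simp)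
  have q6 : potentialAbove Knp o₄ = |e| := by
    rw [potentialAbove_of_strong_eq_zero _ (by rw [l4]), l4]
  have q7 : potentialAbove Knp o₁ = 0 := potentialAbove_of_np_eq_zero _ (by rw [l1])
  have q8 : potentialAbove Knp o₂ = 0 := potentialAbove_of_np_eq_zero _ (by rw [l2])
  have q9 : potentialAbove Knp o₃ = 0 := potentialAbove_of_np_eq_zero _ (by rw [l3])
  refine ⟨?_, ?_, ?_, ?_, ?_⟩
  · rw [load_append, load_append, load_append, l1, l2, l3, l4]
    ext <;> simp
  · rw [potentialQ₀_append, potentialQ₀_append, potentialQ₀_append, potentialQ₀_pieces hδ h1,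
      potentialQ₀_pieces hδ h2, potentialQ₀_pieces hδ h3, potentialQ₀_pieces hδ h4,
      load_append o₂, load_append o₃, l1, l2, l3, l4]
    simp [Load.cross]
  · rw [potentialBelow_append, q1, q3, mul_zero, add_zero]
  · rw [potentialBelow_append, potentialBelow_append, q2, q4, q5, l1]
    simp
  · rw [potentialAbove_append, potentialAbove_append, potentialAbove_append, q6, q7, q8, q9]
    simp

end SteadyEuler
end

noncomputable section
namespace SteadyEuler

open Set Filter Topology Metric

/-! ## All states lie near the background curve -/

/-- The total strength of all fronts that are not strong. -/
def Load.weak (L : Load) : ℝ := L.oneS + L.oneR + L.slip + L.threeS + L.threeR + L.np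

lemma Load.Nonneg.weak {L : Load} (h : L.Nonneg) : 0 ≤ L.weak := by
  obtain ⟨a1, a2, a3, a4, a5, a6, a7⟩ := h
  unfold Load.weak
  positivity

lemma Load.weak_add (L M : Load) : (L + M).weak = L.weak + M.weak := by
  simp only [Load.weak, Load.add_def]; ring

lemma Load.strong_add (L M : Load) : (L + M).strong = L.strong + M.strong := rfl

lemma Front.load_cases (f : Front) :
    (f.IsStrong ∧ (Load.ofTag f.tag).strong = f.strength ∧ (Load.ofTag f.tag).weak = 0) ∨
    (¬ f.IsStrong ∧ (Load.ofTag f.tag).strong = 0 ∧ (Load.ofTag f.tag).weak = f.strength) := by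
  rcases f.kind with ⟨-, h2, -, h4⟩ | ⟨-, h2, -, h4⟩ | ⟨-, h2, -, h4⟩ | ⟨-, h2, -, h4⟩ |
    ⟨-, h2, -, h4⟩ | ⟨-, h2, -, h4⟩ | ⟨-, h2, -, h4⟩ <;>
  simp [h2, h4, Load.weak]

/-- The background rarefaction curve `ψ` on `[0, S]`, with the local estimates at its points. -/
structure IsTube (γ : ℝ) (ψ : ℝ → State) (S C ε : ℝ) : Prop where
  pos : 0 < S
  eps_pos : 0 < ε
  one_le : 1 ≤ C
  curve : ∀ s t, 0 ≤ s → s ≤ t → t ≤ S → IsRarefaction γ .three (t - s) (ψ s) (ψ t)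
  est : ∀ t ∈ Icc 0 S, LocalEstimates γ (ψ t) C ε

lemma IsBackground.exists_tube {γ : ℝ} (hγ : 1 < γ) {Up Um : State} {S : ℝ}
    (h : IsBackground γ Up Um S) : ∃ (ψ : ℝ → State) (C ε : ℝ), IsTube γ ψ S C ε ∧ ψ S = Up := by
  obtain ⟨ψ, -, h1, hc, hs, hψ⟩ := h.joined.exists_curve
  obtain ⟨C, ε, hC, hε, hest⟩ := exists_localEstimates_of_isCompact hγ
    (isCompact_Icc.image_of_continuousOn hc) (by rintro _ ⟨t, ht, rfl⟩; exact hs t ht)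
  exact ⟨ψ, C, ε, ⟨h.strength_pos, hε, hC, hψ, fun t ht => hest _ ⟨t, ht, rfl⟩⟩, h1⟩

variable {P : Params} {ψ : ℝ → State} {S C ε : ℝ}

/-- The jump across a front is bounded by its strength. -/
lemma Front.Admissible.norm_sub_le {f : Front} {U₀ : State} (hE : LocalEstimates P.γ U₀ C ε)
    (h : f.Admissible P) (hf : f.strength < ε)
    (hU : f.below ∈ ball U₀ ε ∨ f.above ∈ ball U₀ ε) :
    ‖f.above - f.below‖ ≤ C * f.strength := by
  by_cases hnp : f.IsNP
  · obtain ⟨-, -, s, hj, -⟩ := h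
    have hle : f.strength ≤ C * f.strength :=
      le_mul_of_one_le_left (Wave.strength_nonneg _) hE.one_le
    rw [Front.IsNP] at hnp
    rcases hw : f.wave with ⟨_ | _, a⟩ | ⟨a, b⟩ | e
    · simp [hw, Wave.family] at hnp
    · simp [hw, Wave.family] at hnp
    · simp [hw, Wave.family] at hnp
    · rw [hw] at hj
      rw [← hj.2.1]
      refine le_trans ?_ hle
      rw [Front.strength, hw]
      exact le_abs_self e
  · exact hE.size _ _ _ (h.waveJoin hnp) hf hU

/-- The distance of the lowest state of a chain of fronts from the background curve. -/
lemma Connects.norm_bottom_sub_le (hT : IsTube P.γ ψ S C ε) (hδ : 0 < P.δ) (hδε : 4 * C * P.δ < ε)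
    (hδ1 : 2 * C * P.δ ≤ 1) {fs : List Front} {U : State} (h : Connects P U fs (ψ S))
    (hsmall : ∀ f ∈ fs, ∀ j a, f.wave = .acoustic j a → a ≤ P.δ)
    (hB : Real.exp (2 * C * (load fs).strong) * (C * (load fs).weak +
      2 * C * max 0 ((load fs).strong - S + P.δ)) ≤ ε / 2) :
    ‖U - ψ (max 0 (S - (load fs).strong))‖ ≤ Real.exp (2 * C * (load fs).strong) *
      (C * (load fs).weak + 2 * C * max 0 ((load fs).strong - S + P.δ)) := by
  have hC := hT.one_le
  have hC0 : 0 < C := by linarith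
  have hε := hT.eps_pos
  induction fs generalizing U with
  | nil =>
    have hU : U = ψ S := h
    have : max 0 (S - 0) = S := by rw [sub_zero, max_eq_right hT.pos.le]
    simp only [load_nil, Load.zero_def, Load.weak, this, hU, sub_self, norm_zero]
    positivity
  | cons f fs ih =>
    obtain ⟨rfl, hadm, hc⟩ := h
    have hn := load_nonneg fs
    set σ := (load fs).strong with hσ
    set w := (load fs).weak with hw
    have hσ0 : 0 ≤ σ := hn.strong
    have hw0 : 0 ≤ w := hn.weak
    rw [load_cons, Load.weak_add, Load.strong_add] at hB ⊢
    rw [← hσ, ← hw] at hB ⊢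
    have hmem : ∀ σ : ℝ, 0 ≤ σ → max 0 (S - σ) ∈ Icc 0 S := fun σ hσ =>
      ⟨le_max_left _ _, max_le hT.pos.le (by linarith)⟩
    have hsmall' : ∀ g ∈ fs, ∀ j a, g.wave = .acoustic j a → a ≤ P.δ := fun g hg =>
      hsmall g (by simp [hg])
    set m := max 0 (σ - S + P.δ) with hm
    have hm0 : 0 ≤ m := le_max_left _ _
    have hexp1 : 1 ≤ Real.exp (2 * C * σ) := Real.one_le_exp (by positivity)
    -- The induction descends from U₊. A strong front is compared with the piece of the background
    -- curve that has the same parameter; any other front simply adds C times its strength.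
    rcases f.load_cases with ⟨hs, h1, h2⟩ | ⟨hs, h1, h2⟩
    · obtain ⟨-, a, ha, hwave⟩ := hs
      have hstr : f.strength = a := by
        rw [Front.strength, hwave, Wave.strength, abs_of_pos ha]
      have haδ := hsmall f (by simp) _ _ hwave
      rw [h1, h2, hstr, zero_add] at hB ⊢
      have hWJ : WaveJoin P.γ f.wave f.below f.above :=
        hadm.waveJoin (by simp [Front.IsNP, hwave, Wave.family])
      rw [hwave] at hWJ
      have hsa : (Wave.acoustic .three a).strength = a := abs_of_pos ha
      have hCa : 4 * C * a < ε := lt_of_le_of_lt (by gcongr) hδε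
      have haε : a < ε := by nlinarith
      have hCa1 : 2 * C * a ≤ 1 := le_trans (by gcongr) hδ1
      have hmm : m ≤ max 0 (a + σ - S + P.δ) := max_le_max_left _ (by linarith)
      have hmono : Real.exp (2 * C * σ) * (C * w + 2 * C * m) ≤
          Real.exp (2 * C * (a + σ)) * (C * w + 2 * C * max 0 (a + σ - S + P.δ)) := by
        gcongr
        linarith
      have hd := ih hc hsmall' (hmono.trans hB)
      have hd2 : ‖f.above - ψ (max 0 (S - σ))‖ ≤ ε / 2 := hd.trans (hmono.trans hB)
      have hsize : ‖f.above - f.below‖ ≤ C * a := by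
        have := (hT.est _ (hmem σ hσ0)).size _ _ _ hWJ (by rw [hsa]; exact haε)
          (Or.inr (by rw [mem_ball, dist_eq_norm]; linarith))
        rwa [hsa] at this
      -- While the strong strength fits into S, the front has a counterpart on the curve. Beyond
      -- that the reference state stops at ψ 0 and the front costs 2Ca. The shift by δ in the
      -- maximum makes this term grow by exactly a, also for the front that straddles S.
      rcases le_or_gt (a + σ) S with hle | hgt
      · have e1 : max 0 (S - σ) = S - σ := max_eq_right (by linarith)
        have e2 : max 0 (S - (a + σ)) = S - (a + σ) := max_eq_right (by linarith)
        rw [e1] at hd hd2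
        rw [e2]
        have hr := hT.curve (S - (a + σ)) (S - σ) (by linarith) (by linarith) (by linarith)
        rw [show S - σ - (S - (a + σ)) = a by ring] at hr
        have hWJ' : WaveJoin P.γ (.acoustic .three a) (ψ (S - (a + σ))) (ψ (S - σ)) :=
          Or.inl ⟨ha.le, hr⟩
        have hE := hT.est (S - (a + σ)) ⟨by linarith, by linarith⟩
        have hb0 : ψ (S - (a + σ)) ∈ ball (ψ (S - (a + σ))) ε := mem_ball_self hε
        have hsize' := hE.size _ _ _ hWJ' (by rw [hsa]; exact haε) (Or.inl hb0)
        rw [hsa] at hsize'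
        have htri : ‖f.below - ψ (S - (a + σ))‖ ≤ ‖f.above - f.below‖ +
            ‖f.above - ψ (S - σ)‖ + ‖ψ (S - σ) - ψ (S - (a + σ))‖ := by
          rw [show f.below - ψ (S - (a + σ)) = -(f.above - f.below) + (f.above - ψ (S - σ)) +
            (ψ (S - σ) - ψ (S - (a + σ))) by abel]
          refine (norm_add_le _ _).trans (add_le_add_left ((norm_add_le _ _).trans ?_) _)
          rw [norm_neg]
        have hb1 : f.below ∈ ball (ψ (S - (a + σ))) ε := by
          rw [mem_ball, dist_eq_norm]; linarith
        have hsame := hE.same _ _ _ _ _ hWJ hWJ' (by rw [hsa]; exact haε) hb1 hb0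
        rw [hsa] at hsame
        set x := ‖f.below - ψ (S - (a + σ))‖ with hx
        have hx0 : 0 ≤ x := norm_nonneg _
        have hkey : x ≤ ‖f.above - ψ (S - σ)‖ + C * a * x := by
          have : f.below - ψ (S - (a + σ)) = (f.above - ψ (S - σ)) -
            (f.above - f.below - (ψ (S - σ) - ψ (S - (a + σ)))) := by abel
          rw [hx, this]
          refine (norm_sub_le _ _).trans (add_le_add_right ?_ _)
          rw [← this]
          exact hsame
        -- From x ≤ y + Cax and 2Ca ≤ 1 one gets x ≤ (1 + 2Ca)y, which is one factor of the
        -- exponential in a discrete Gronwall argument.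
        have hx2 : x ≤ ‖f.above - ψ (S - σ)‖ * (1 + 2 * C * a) := by
          have h0 : 0 ≤ C * a := by positivity
          have hq : 0 ≤ 1 - 2 * (C * a) := by linarith
          nlinarith [mul_nonneg (mul_nonneg hx0 h0) hq]
        have hexp : 1 + 2 * C * a ≤ Real.exp (2 * C * a) := by
          have := Real.add_one_le_exp (2 * C * a); linarith
        calc x ≤ ‖f.above - ψ (S - σ)‖ * (1 + 2 * C * a) := hx2
          _ ≤ (Real.exp (2 * C * σ) * (C * w + 2 * C * m)) * Real.exp (2 * C * a) := by
            gcongr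
          _ = Real.exp (2 * C * (a + σ)) * (C * w + 2 * C * m) := by
            rw [mul_add (2 * C), Real.exp_add]; ring
          _ ≤ _ := by gcongr
      · have e2 : max 0 (S - (a + σ)) = 0 := max_eq_left (by linarith)
        have e3 : max 0 (a + σ - S + P.δ) = a + m := by
          rw [hm, max_eq_right (by linarith), max_eq_right (by linarith)]; ring
        rw [e2, e3]
        have hcurve : ‖ψ (max 0 (S - σ)) - ψ 0‖ ≤ C * a := by
          set t := max 0 (S - σ) with ht
          have ht0 : 0 ≤ t := le_max_left _ _
          have hta : t ≤ a := max_le ha.le (by linarith)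
          have hr := hT.curve 0 t le_rfl ht0 (hmem σ hσ0).2
          rw [sub_zero] at hr
          have hst : (Wave.acoustic .three t).strength = t := abs_of_nonneg ht0
          have := (hT.est 0 ⟨le_rfl, hT.pos.le⟩).size (.acoustic .three t) _ _
            (Or.inl ⟨ht0, hr⟩) (by rw [hst]; linarith) (Or.inl (mem_ball_self hε))
          rw [hst] at this
          exact this.trans (by gcongr)
        have htri : ‖f.below - ψ 0‖ ≤ ‖f.above - f.below‖ +
            ‖f.above - ψ (max 0 (S - σ))‖ + ‖ψ (max 0 (S - σ)) - ψ 0‖ := by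
          rw [show f.below - ψ 0 = -(f.above - f.below) + (f.above - ψ (max 0 (S - σ))) +
            (ψ (max 0 (S - σ)) - ψ 0) by abel]
          refine (norm_add_le _ _).trans (add_le_add_left ((norm_add_le _ _).trans ?_) _)
          rw [norm_neg]
        calc ‖f.below - ψ 0‖ ≤ Real.exp (2 * C * σ) * (C * w + 2 * C * m) + 1 * (2 * C * a) := by
              linarith
          _ ≤ Real.exp (2 * C * σ) * (C * w + 2 * C * m) + Real.exp (2 * C * σ) * (2 * C * a) := by
              gcongr
          _ = Real.exp (2 * C * σ) * (C * w + 2 * C * (a + m)) := by ring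
          _ ≤ _ := by
            gcongr
            linarith
    · rw [h1, h2, zero_add] at hB ⊢
      rw [← hm] at hB ⊢
      have hstr0 : 0 ≤ f.strength := Wave.strength_nonneg _
      have hmono : Real.exp (2 * C * σ) * (C * w + 2 * C * m) + C * f.strength ≤
          Real.exp (2 * C * σ) * (C * (f.strength + w) + 2 * C * m) := by
        have := mul_le_mul_of_nonneg_right hexp1 (show 0 ≤ C * f.strength by positivity)
        linarith
      have hCs : 0 ≤ C * f.strength := by positivity
      have hd0 : 0 ≤ Real.exp (2 * C * σ) * (C * w + 2 * C * m) := by positivity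
      have hd := ih hc hsmall' (by linarith)
      have hle : f.strength ≤ C * f.strength := le_mul_of_one_le_left hstr0 hC
      have hsize := hadm.norm_sub_le (hT.est _ (hmem σ hσ0)) (by linarith)
        (Or.inr (by rw [mem_ball, dist_eq_norm]; linarith))
      calc ‖f.below - ψ (max 0 (S - σ))‖ ≤ ‖f.above - f.below‖ + ‖f.above - ψ (max 0 (S - σ))‖ := by
            rw [show f.below - ψ (max 0 (S - σ)) = -(f.above - f.below) +
              (f.above - ψ (max 0 (S - σ))) by abel]
            refine (norm_add_le _ _).trans ?_
            rw [norm_neg]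
        _ ≤ _ := by linarith

/-- If the strong fronts have nearly the strength of the background wave and all other fronts are
small, then all states lie near the background curve. -/
lemma IsTube.exists_near {γ : ℝ} (hT : IsTube γ ψ S C ε) {r : ℝ} (hr : 0 < r) (hrε : r ≤ ε / 2) :
    ∃ d > 0, ∀ P : Params, P.γ = γ → 0 < P.δ → P.δ < d → ∀ (fs : List Front) (U : State),
      Connects P U fs (ψ S) → (∀ f ∈ fs, ∀ j a, f.wave = .acoustic j a → a ≤ P.δ) →
      (load fs).strong < S + d → (load fs).weak < d →
      ∃ t ∈ Icc 0 S, ‖U - ψ t‖ ≤ r := by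
  have hC := hT.one_le
  have hC0 : 0 < C := by linarith
  have hε := hT.eps_pos
  -- The factor 5C consists of C from the weak fronts and 2C · 2 from the excess of the strong
  -- strength, which together with δ is below 2d.
  set B := Real.exp (2 * C * (S + 1)) * (5 * C) with hBdef
  have hB0 : 0 < B := by positivity
  refine ⟨min 1 (min (r / B) (min (ε / (4 * C)) (1 / (2 * C)))), by positivity, ?_⟩
  set d := min 1 (min (r / B) (min (ε / (4 * C)) (1 / (2 * C)))) with hd
  have hd0 : 0 < d := by positivity
  have hd1 : d ≤ 1 := min_le_left _ _
  have hd2 : d * B ≤ r := by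
    rw [← le_div_iff₀ hB0]
    exact (min_le_right _ _).trans (min_le_left _ _)
  have hd3 : d ≤ ε / (4 * C) :=
    (min_le_right _ _).trans ((min_le_right _ _).trans (min_le_left _ _))
  have hd4 : d ≤ 1 / (2 * C) :=
    (min_le_right _ _).trans ((min_le_right _ _).trans (min_le_right _ _))
  intro P hP hδ hδd fs U h hsmall hs hw
  have hn := load_nonneg fs
  have hbound : Real.exp (2 * C * (load fs).strong) * (C * (load fs).weak +
      2 * C * max 0 ((load fs).strong - S + P.δ)) ≤ r := by
    calc _ ≤ Real.exp (2 * C * (S + 1)) * (C * d + 2 * C * (2 * d)) := by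
          have hn' := hn.weak
          have hmax : max 0 ((load fs).strong - S + P.δ) ≤ 2 * d := max_le (by linarith)
            (by linarith)
          gcongr
          · linarith
      _ = d * B := by rw [hBdef]; ring
      _ ≤ r := hd2
  have h1 : 4 * C * P.δ < ε := by
    have := hδd.trans_le hd3
    rw [lt_div_iff₀ (by positivity)] at this
    linarith
  have h2 : 2 * C * P.δ ≤ 1 := by
    have := hδd.le.trans hd4
    rw [le_div_iff₀ (by positivity)] at this
    linarith
  refine ⟨max 0 (S - (load fs).strong), ⟨le_max_left _ _, max_le hT.pos.le ?_⟩, ?_⟩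
  · linarith [hn.strong]
  · exact (h.norm_bottom_sub_le (hP ▸ hT) hδ h1 h2 hsmall (hbound.trans hrε)).trans hbound

end SteadyEuler
end

noncomputable section
namespace SteadyEuler

open Set Filter Topology Metric

/-! ## The fronts that leave an interaction -/

variable {P : Params} {f g : Front} {out : List Front} {E : ℝ}

lemma Wave.IsShock.acoustic {w : Wave} (h : w.IsShock) : ∃ j a, w = .acoustic j a ∧ a < 0 := by
  match w, h with
  | .acoustic j a, h => exact ⟨j, a, rfl, h⟩

/-- Without a non-physical front, either the lower front belongs to the faster family or both belong
to the same acoustic family, since a shock or a strong rarefaction takes part. These are the cases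
covered by the interaction estimates. -/
lemma Collision.crosses (h : Collision f g E) (hf : ¬ f.IsNP) : f.wave.Crosses g.wave := by
  have key : f.wave.family = g.wave.family → (∃ j a, f.wave = .acoustic j a) →
      f.wave.Crosses g.wave := by
    rintro hfam ⟨j, a, hw⟩
    right
    rcases hg : g.wave with ⟨i, b⟩ | ⟨b, b'⟩ | b
    · rw [hw, hg] at hfam
      refine ⟨j, a, b, hw, ?_⟩
      cases i <;> cases j <;> simp_all [Wave.family]
    · rw [hw, hg] at hfam
      cases j <;> simp [Wave.family] at hfam
    · rw [hw, hg] at hfam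
      cases j <;> simp [Wave.family] at hfam
  have key' : f.wave.family = g.wave.family → (∃ j a, g.wave = .acoustic j a) →
      f.wave.Crosses g.wave := by
    rintro hfam ⟨j, a, hw⟩
    refine key hfam ?_
    rcases hg : f.wave with ⟨i, b⟩ | ⟨b, b'⟩ | b
    · exact ⟨i, b, rfl⟩
    · rw [hw, hg] at hfam
      cases j <;> simp [Wave.family] at hfam
    · rw [hw, hg] at hfam
      cases j <;> simp [Wave.family] at hfam
  cases h with
  | weak h =>
    obtain ⟨-, -, h | ⟨h, h' | h'⟩⟩ := h
    · exact Or.inl h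
    · obtain ⟨j, a, h', -⟩ := h'.acoustic
      exact key h ⟨j, a, h'⟩
    · obtain ⟨j, a, h', -⟩ := h'.acoustic
      exact key' h ⟨j, a, h'⟩
  | strong_weak hf hg =>
    obtain ⟨-, a, -, hf⟩ := hf
    left
    rw [hf]
    rcases hg with hg | hg <;> rw [hg.1] <;> simp [Wave.family]
  | strong_shock hf hg hs =>
    obtain ⟨-, a, -, hf⟩ := hf
    exact key (by rw [hg.1, hf]; rfl) ⟨_, _, hf⟩
  | shock_strong hf hs hg =>
    obtain ⟨-, a, -, hg⟩ := hg
    exact key' (by rw [hf.1, hg]; rfl) ⟨_, _, hg⟩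
  | np_strong hf' hg => exact absurd hf' hf
  | np_weak hf' hg => exact absurd hf' hf

lemma Collision.not_isNP (h : Collision f g E) : ¬ g.IsNP := by
  have hs : g.IsStrong → ¬ g.IsNP := by
    rintro ⟨-, a, -, h⟩
    simp [Front.IsNP, h, Wave.family]
  cases h with
  | weak h => exact h.2.1.1
  | strong_weak hf hg => exact hg.elim (fun h => h.2.1) fun h => h.2.1
  | strong_shock hf hg _ => exact hg.2.1
  | shock_strong hf _ hg => exact hs hg
  | np_strong hf hg => exact hs hg
  | np_weak hf hg => exact hg.1

lemma pieces_acoustic_zero (δ : ℝ) (j : Acoustic) : pieces δ (.acoustic j 0) = [] := by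
  simp [pieces]

lemma pieces_contact_zero (δ : ℝ) : pieces δ (.contact 0 0) = [] := by
  simp [pieces]

lemma pieces_nonphysical_zero (δ : ℝ) : pieces δ (.nonphysical 0) = [] := by
  simp [pieces]

/-- Crossing waves, listed as a fan. -/
lemma flatMap_crossing {w w' : Wave} (h : w.Crosses w' ∨ w.family = 4) (hw' : w'.family ≠ 4)
    (δ e : ℝ) (ord : ℕ → ℕ) :
    ((crossing w w' ++ [Wave.nonphysical e]).flatMap fun w =>
        (pieces δ w).map fun w' => (w', ord w.family)) =
      fanTags δ ord (w.acParam .one + w'.acParam .one) (w.slipParam + w'.slipParam)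
        (w.acParam .three + w'.acParam .three) e := by
  rcases w with ⟨_ | _, a⟩ | ⟨a, b⟩ | a <;> rcases w' with ⟨_ | _, a'⟩ | ⟨a', b'⟩ | a' <;>
  simp_all [Wave.Crosses, Wave.family, crossing, fanTags, Wave.acParam, Wave.slipParam,
    pieces_acoustic_zero, pieces_contact_zero]

/-- The fronts `out` are a 1-wave, a 2-wave, a 3-wave and a non-physical front, whose parameters
differ by at most `D` from those of `f` and `g` together, the strength of the non-physical one
exceeding that of `f` by at most `D'`. -/
def OutEstimate (P : Params) (ord : ℕ → ℕ) (f g : Front) (out : List Front) (D D' : ℝ) : Prop :=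
  ∃ (a₁ : ℝ) (d : ℝ × ℝ) (a₃ e : ℝ), out.map Front.tag = fanTags P.δ ord a₁ d a₃ e ∧
    |a₁ - (f.wave.acParam .one + g.wave.acParam .one)| ≤ D ∧
    |d.1 - (f.wave.slipParam + g.wave.slipParam).1| +
      |d.2 - (f.wave.slipParam + g.wave.slipParam).2| ≤ D ∧
    |a₃ - (f.wave.acParam .three + g.wave.acParam .three)| ≤ D ∧
    |e| ≤ f.wave.npParam + D'

/-- The factor 2 arises because `OutBound` measures the slip in the maximum norm, while the strength
of a 2-wave is the sum of both components. There is no non-physical front, that is, e = 0. -/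
lemma AccurateFan.outEstimate (hδ : 0 < P.δ) {U₀ : State} {C ε : ℝ} {ord : ℕ → ℕ} {x y : ℝ}
    (hE : LocalEstimates P.γ U₀ C ε) (hf : f.Admissible P) (hg : g.Admissible P)
    (hfg : g.below = f.above) (hcross : f.wave.Crosses g.wave) (hfn : ¬ f.IsNP) (hgn : ¬ g.IsNP)
    (hU : f.below ∈ ball U₀ ε) (hfε : f.strength < ε) (hgε : g.strength < ε)
    (h : AccurateFan P ord x y f.below out g.above) :
    OutEstimate P ord f g out (2 * C * (f.strength * g.strength)) 0 := by
  obtain ⟨a₁, a₂₁, a₂₂, a₃, -, hc, ht⟩ := h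
  have htags : out.map Front.tag = fanTags P.δ ord a₁ (a₂₁, a₂₂) a₃ 0 := by
    rw [show out.map Front.tag = out.map fun f => (f.wave, f.order) from rfl, ht]
    simp [fanTags, pieces_nonphysical_zero]
  have hJ := hg.waveJoin hgn
  rw [hfg] at hJ
  simp only [List.flatMap_cons, List.flatMap_nil, List.append_nil] at ht
  obtain ⟨M₁, o₁, o', hc1, ht1, hc', ht'⟩ := hc.split ht
  obtain ⟨M₂, o₂, o₃, hc2, ht2, hc3, ht3⟩ := hc'.split ht'
  have hs1 := hc1.supersonic_right hf.1
  have hs2 := hc2.supersonic_right hs1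
  have hfan : FanJoin P.γ a₁ a₂₁ a₂₂ a₃ f.below M₁ M₂ g.above :=
    ⟨hc1.waveJoin hδ (by simp [Wave.family]) hf.1 ht1,
      hc2.waveJoin hδ (by simp [Wave.family]) hs1 ht2,
      hc3.waveJoin hδ (by simp [Wave.family]) hs2 ht3⟩
  obtain ⟨h1, h2, h3⟩ := hE.interact _ _ _ _ _ _ _ _ _ _ _ hcross (hf.waveJoin hfn) hJ hfε hgε hU
    hfan
  have hP : 0 ≤ C * (f.strength * g.strength) := (abs_nonneg _).trans h1
  change _ ≤ C * (f.strength * g.strength) at h1 h2 h3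
  rw [Prod.norm_def, max_le_iff] at h2
  simp only [Real.norm_eq_abs, Prod.fst_sub, Prod.snd_sub] at h2
  exact ⟨a₁, (a₂₁, a₂₂), a₃, 0, htags, by linarith, by linarith [h2.1, h2.2], by linarith, by
    rcases f.wave with ⟨_, _⟩ | ⟨_, _⟩ | _ <;> simp [Wave.npParam]⟩

/-- All physical parameters are passed on unchanged, so the whole error sits in the non-physical
front. It is the failure of two waves to commute (two uses of `same`), the error of `merge`, or the
distortion of an incoming non-physical jump by the wave above it. -/
lemma SimplifiedFan.outEstimate (hδ : 0 < P.δ) {U₀ : State} {C ε : ℝ} {ord : ℕ → ℕ} {x y : ℝ}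
    (hγ : 1 < P.γ) (hE : LocalEstimates P.γ U₀ C ε) (hf : f.Admissible P) (hg : g.Admissible P)
    (hfg : g.below = f.above) (hcross : f.wave.Crosses g.wave ∨ f.IsNP) (hgn : ¬ g.IsNP)
    (hU : f.below ∈ ball U₀ (ε / 2)) (hM : f.above ∈ ball U₀ ε) (hfε : f.strength < ε)
    (hgε : C * g.strength < ε / 2) (h : SimplifiedFan P ord x y f g out) :
    OutEstimate P ord f g out 0 (2 * C ^ 2 * (f.strength * g.strength)) := by
  obtain ⟨e, -, hc, ht⟩ := h
  have hC := hE.one_le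
  have hε := hE.pos
  have hf0 : 0 ≤ f.strength := Wave.strength_nonneg _
  have hg0 : 0 ≤ g.strength := Wave.strength_nonneg _
  have hgε' : g.strength < ε := by nlinarith
  have hU' : f.below ∈ ball U₀ ε := ball_subset_ball (by linarith) hU
  have hJ := hg.waveJoin hgn
  rw [hfg] at hJ
  have hP : 0 ≤ f.strength * g.strength := by positivity
  refine ⟨_, _, _, e, ht.trans (flatMap_crossing hcross hgn _ _ _), by simp, by simp, by simp, ?_⟩
  rw [List.flatMap_append] at ht
  obtain ⟨V₂, o₁, o₂, hc1, ht1, hc2, ht2⟩ := hc.split ht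
  rw [List.flatMap_cons, List.flatMap_nil, List.append_nil] at ht2
  have he := hc2.nonphysical ht2
  rw [he, abs_norm]
  by_cases hnp : f.IsNP
  · obtain ⟨e₀, hw⟩ : ∃ e₀, f.wave = .nonphysical e₀ := by
      rw [Front.IsNP] at hnp
      rcases hw : f.wave with ⟨_ | _, _⟩ | ⟨_, _⟩ | e₀
      · simp [hw, Wave.family] at hnp
      · simp [hw, Wave.family] at hnp
      · simp [hw, Wave.family] at hnp
      · exact ⟨e₀, rfl⟩
    have hcr : crossing f.wave g.wave = [g.wave] := by rw [hw]; rfl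
    rw [hcr, List.flatMap_cons, List.flatMap_nil, List.append_nil] at ht1
    have hJ1 := hc1.waveJoin hδ hgn hf.1 ht1
    have hsame := hE.same _ _ _ _ _ hJ hJ1 hgε' hM hU'
    obtain ⟨-, -, s, hj, -⟩ := hf
    rw [hw] at hj
    have hstr : f.strength = ‖f.above - f.below‖ := by
      rw [Front.strength, hw, Wave.strength, abs_of_pos hj.1, hj.2.1]
    have hnpp : f.wave.npParam = f.strength := by rw [hw, Front.strength, hw]; rfl
    rw [hnpp]
    change _ ≤ C * g.strength * ‖f.above - f.below‖ at hsame
    rw [← hstr] at hsame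
    -- The new jump is the old one plus the difference of two equal waves that start on the two
    -- sides of the old jump.
    have hdec : g.above - V₂ = (f.above - f.below) + (g.above - f.above - (V₂ - f.below)) := by abel
    have hCC : C ≤ 2 * C ^ 2 := by nlinarith
    calc ‖g.above - V₂‖ ≤ f.strength + C * g.strength * f.strength := by
          rw [hdec, hstr]
          rw [hstr] at hsame
          exact (norm_add_le _ _).trans (add_le_add_right hsame _)
      _ = f.strength + C * (f.strength * g.strength) := by ring
      _ ≤ _ := by gcongr
  · have hcross := hcross.resolve_right hnp
    have hnpp : 0 ≤ f.wave.npParam := by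
      rcases f.wave with ⟨_, _⟩ | ⟨_, _⟩ | _ <;> simp [Wave.npParam]
    refine le_trans ?_ (le_add_of_nonneg_left hnpp)
    have hI := hf.waveJoin hnp
    rcases hcross with hlt | ⟨j, a, b, hwf, hwg⟩
    · have hcr : crossing f.wave g.wave = [g.wave, f.wave] := by
        revert hlt hnp
        rw [Front.IsNP]
        rcases f.wave with ⟨_ | _, a⟩ | ⟨a, b⟩ | a <;>
        rcases g.wave with ⟨_ | _, a'⟩ | ⟨a', b'⟩ | a' <;> simp [Wave.family, crossing]
      rw [hcr, List.flatMap_cons, List.flatMap_cons, List.flatMap_nil, List.append_nil] at ht1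
      obtain ⟨M₁, q₁, q₂, hd1, hu1, hd2, hu2⟩ := hc1.split ht1
      have hJ1 := hd1.waveJoin hδ hgn hf.1 hu1
      have hI1 := hd2.waveJoin hδ hnp (hJ1.right hγ) hu2
      have hs1 : ‖M₁ - f.below‖ ≤ C * g.strength := hE.size _ _ _ hJ1 hgε' (Or.inl hU')
      have hs2 : ‖f.above - f.below‖ ≤ C * f.strength := hE.size _ _ _ hI hfε (Or.inl hU')
      have hM1 : M₁ ∈ ball U₀ ε := by
        rw [mem_ball, dist_eq_norm] at hU ⊢
        calc ‖M₁ - U₀‖ = ‖(M₁ - f.below) + (f.below - U₀)‖ := by congr 1; abel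
          _ ≤ _ := norm_add_le _ _
          _ < ε := by linarith
      have h1 : ‖g.above - f.above - (M₁ - f.below)‖ ≤ C * g.strength * ‖f.above - f.below‖ :=
        hE.same _ _ _ _ _ hJ hJ1 hgε' hM hU'
      have h2 : ‖f.above - f.below - (V₂ - M₁)‖ ≤ C * f.strength * ‖f.below - M₁‖ :=
        hE.same _ _ _ _ _ hI hI1 hfε hU' hM1
      rw [norm_sub_rev f.below M₁] at h2
      calc ‖g.above - V₂‖ = ‖(g.above - f.above - (M₁ - f.below)) +
            (f.above - f.below - (V₂ - M₁))‖ := by congr 1; abel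
        _ ≤ _ := norm_add_le _ _
        _ ≤ C * g.strength * (C * f.strength) + C * f.strength * (C * g.strength) := by
          refine add_le_add (h1.trans ?_) (h2.trans ?_) <;> gcongr
        _ = _ := by ring
    · have hcr : crossing f.wave g.wave = [.acoustic j (a + b)] := by
        rw [hwf, hwg]; simp [crossing]
      rw [hcr, List.flatMap_cons, List.flatMap_nil, List.append_nil] at ht1
      have hK := hc1.waveJoin hδ (by cases j <;> simp [Wave.family]) hf.1 ht1
      have hsf : f.strength = |a| := by rw [Front.strength, hwf]; rfl
      have hsg : g.strength = |b| := by rw [Front.strength, hwg]; rfl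
      rw [hwf] at hI
      rw [hwg] at hJ
      have := hE.merge j a b _ _ _ _ hI hJ hK (hsf ▸ hfε) (hsg ▸ hgε') hU'
      rw [← hsf, ← hsg] at this
      exact this.trans (mul_le_mul_of_nonneg_right (by nlinarith) hP)

end SteadyEuler
end

noncomputable section
namespace SteadyEuler

open Set Filter Topology Metric

/-! ## The change of the functional -/

/-- `M'` exceeds `M` by at most `D` in each physical family and by at most `D'` in the
non-physical fronts. -/
structure Load.Exceeds (M M' : Load) (D D' : ℝ) : Prop where
  oneS : M'.oneS ≤ M.oneS + D
  one : M'.oneS + M'.oneR ≤ M.oneS + M.oneR + D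
  slip : M'.slip ≤ M.slip + D
  threeS : M'.threeS ≤ M.threeS + D
  three : M'.threeS + M'.threeR ≤ M.threeS + M.threeR + D
  np : M'.np ≤ M.np + D'

/-- Every entry of L meets a combination of loads of M that is bounded in `Exceeds`; a rarefaction,
for instance, meets only the shocks of its own family. The difference is thus a sum of products of
nonnegative terms, and rarefactions need no separate bound. -/
lemma Load.Exceeds.cross_left {L M M' : Load} {D D' : ℝ} (h : M.Exceeds M' D D') (hD : 0 ≤ D)
    (hL : L.Nonneg) : L.cross M' ≤ L.cross M + 3 * D * L.weak := by
  obtain ⟨h1, h2, h3, h4, h5, -⟩ := h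
  obtain ⟨a1, a2, a3, a4, a5, a6, a7⟩ := hL
  have e : L.cross M + 3 * D * L.weak - L.cross M' =
      L.oneR * (M.oneS + D - M'.oneS) +
      (L.oneS + L.slip + L.threeS + L.threeR + L.np) *
        (M.oneS + M.oneR + D - (M'.oneS + M'.oneR)) +
      (L.threeS + L.threeR + L.np) * (M.slip + D - M'.slip) +
      L.threeR * (M.threeS + D - M'.threeS) +
      (L.threeS + L.np) * (M.threeS + M.threeR + D - (M'.threeS + M'.threeR)) +
      D * (2 * L.oneS + 2 * L.oneR + 2 * L.slip) := by
    unfold Load.cross Load.weak; ring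
  rw [← sub_nonneg] at h1 h2 h3 h4 h5 ⊢
  rw [e]
  positivity

lemma Load.Exceeds.cross_right {M M' H : Load} {D D' : ℝ} (h : M.Exceeds M' D D') (hD : 0 ≤ D)
    (hD' : 0 ≤ D') (hH : H.Nonneg) : M'.cross H ≤ M.cross H + (3 * D + D') * H.weak := by
  obtain ⟨h1, h2, h3, h4, h5, h6⟩ := h
  obtain ⟨a1, a2, a3, a4, a5, a6, a7⟩ := hH
  have e : M.cross H + (3 * D + D') * H.weak - M'.cross H =
      H.oneR * (M.oneS + D - M'.oneS) +
      H.oneS * (M.oneS + M.oneR + D - (M'.oneS + M'.oneR)) +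
      (H.oneS + H.oneR) * (M.slip + D - M'.slip) +
      H.threeR * (M.threeS + D - M'.threeS) +
      (H.oneS + H.oneR + H.slip + H.threeS) *
        (M.threeS + M.threeR + D - (M'.threeS + M'.threeR)) +
      (H.oneS + H.oneR + H.slip + H.threeS + H.threeR) * (M.np + D' - M'.np) +
      D * (2 * H.slip + 2 * H.threeS + 2 * H.threeR + 3 * H.np) + D' * H.np := by
    unfold Load.cross Load.weak; ring
  rw [← sub_nonneg] at h1 h2 h3 h4 h5 h6 ⊢
  rw [e]
  positivity

/-- The increment of an exponential weight. -/
lemma exp_sub_exp_le {k s t : ℝ} (hk : 0 ≤ k) (ht : t ≤ s + 1) :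
    Real.exp (k * t) - Real.exp (k * s) ≤
      Real.exp (k * s) * (k * Real.exp k * max (t - s) 0) := by
  rcases le_or_gt t s with h | h
  · rw [max_eq_right (by linarith), mul_zero, mul_zero, sub_nonpos]
    gcongr
  · rw [max_eq_left (by linarith), show k * t = k * s + k * (t - s) by ring, Real.exp_add]
    have h1 : Real.exp (k * (t - s)) - 1 ≤ k * (t - s) * Real.exp (k * (t - s)) := by
      have h2 := Real.add_one_le_exp (-(k * (t - s)))
      have h3 := mul_le_mul_of_nonneg_left h2 (Real.exp_pos (k * (t - s))).le
      rw [← Real.exp_add, add_neg_cancel, Real.exp_zero] at h3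
      linarith
    have h4 : Real.exp (k * (t - s)) ≤ Real.exp k := by
      gcongr
      nlinarith
    have h5 : k * (t - s) * Real.exp (k * (t - s)) ≤ k * (t - s) * Real.exp k :=
      mul_le_mul_of_nonneg_left h4 (mul_nonneg hk (by linarith))
    have h6 := mul_le_mul_of_nonneg_left (h1.trans h5) (Real.exp_pos (k * s)).le
    linarith

/-- The weights, four of which have to be chosen. -/
def weightsOf (K K₀ Kω Knp : ℝ) : Weights := ⟨K, K₀, 1, 1, 2, 1, Kω, Knp, 1⟩

lemma glimm_weightsOf (K K₀ Kω Knp S : ℝ) (c : Slab) :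
    glimm (weightsOf K K₀ Kω Knp) S c =
      K * ((load c.fronts).oneS + (load c.fronts).oneR) + (load c.fronts).slip +
      2 * ((load c.fronts).threeS + (load c.fronts).threeR) + (load c.fronts).np +
      K₀ * potentialQ₀ c.fronts + potentialBelow Kω 1 c.fronts + potentialBelow Kω 2 c.fronts +
      potentialAbove Knp c.fronts + |(load c.fronts).strong - S| := by
  simp only [glimm, weightsOf, weakSum_one, weakSum_two, weakSum_three, npSum_eq, strongSum_eq]
  ring

variable {K K₀ Kω Knp S φ : ℝ} {c : Slab}

lemma load_weak_le_glimm (hK : 1 ≤ K) (hK₀ : 0 ≤ K₀) (c : Slab) :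
    (load c.fronts).weak ≤ glimm (weightsOf K K₀ Kω Knp) S c := by
  rw [glimm_weightsOf]
  have hn := load_nonneg c.fronts
  have h1 := potentialQ₀_nonneg c.fronts
  have h2 := potentialBelow_nonneg Kω 1 c.fronts
  have h3 := potentialBelow_nonneg Kω 2 c.fronts
  have h4 := potentialAbove_nonneg Knp c.fronts
  have h5 := abs_nonneg ((load c.fronts).strong - S)
  have h6 := hn.threeS
  have h7 := hn.threeR
  have h8 := mul_nonneg (sub_nonneg.2 hK) (add_nonneg hn.oneS hn.oneR)
  have h9 := mul_nonneg hK₀ h1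
  unfold Load.weak
  linarith

lemma abs_strong_sub_le_glimm (hK : 1 ≤ K) (hK₀ : 0 ≤ K₀) (c : Slab) :
    |(load c.fronts).strong - S| ≤ glimm (weightsOf K K₀ Kω Knp) S c := by
  rw [glimm_weightsOf]
  obtain ⟨n1, n2, n3, n4, n5, n6, n7⟩ := load_nonneg c.fronts
  have h1 := potentialQ₀_nonneg c.fronts
  have h2 := potentialBelow_nonneg Kω 1 c.fronts
  have h3 := potentialBelow_nonneg Kω 2 c.fronts
  have h4 := potentialAbove_nonneg Knp c.fronts
  have : 0 ≤ K := by linarith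
  have h9 := mul_nonneg hK₀ h1
  have h8 := mul_nonneg this (add_nonneg n1 n2)
  linarith

/-- The change of the functional when some neighbouring fronts are replaced by others. -/
lemma glimm_sub_glimm_le (hK : 1 ≤ K) (hK₀ : 0 ≤ K₀) (hKω : 0 ≤ Kω) (hKnp : 0 ≤ Knp)
    {lo mid out hi : List Front} {c' : Slab} {D D' : ℝ} (hD : 0 ≤ D) (hD' : 0 ≤ D')
    (hc : c.fronts = lo ++ mid ++ hi) (hc' : c'.fronts = lo ++ out ++ hi)
    (hex : (load mid).Exceeds (load out) D D')
    (hs : (load out).strong ≤ (load mid).strong + 1)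
    (hF : glimm (weightsOf K K₀ Kω Knp) S c ≤ φ) (h₀ : 3 * K₀ * φ ≤ 1)
    (h₁ : (Kω * Real.exp Kω + Knp * Real.exp Knp) * φ ≤ 1) :
    glimm (weightsOf K K₀ Kω Knp) S c' - glimm (weightsOf K K₀ Kω Knp) S c ≤
      K * ((load out).oneS + (load out).oneR - ((load mid).oneS + (load mid).oneR)) +
      ((load out).slip - (load mid).slip) +
      2 * ((load out).threeS + (load out).threeR - ((load mid).threeS + (load mid).threeR)) +
      ((load out).np - (load mid).np) +
      |(load out).strong - (load mid).strong| + max ((load out).strong - (load mid).strong) 0 +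
      D + D' + K₀ * (potentialQ₀ out - potentialQ₀ mid) +
      Real.exp (Kω * (load lo).strong) *
        (potentialBelow Kω 1 out - potentialBelow Kω 1 mid +
          (potentialBelow Kω 2 out - potentialBelow Kω 2 mid)) +
      Real.exp (Knp * (load hi).strong) * (potentialAbove Knp out - potentialAbove Knp mid) := by
  have hW := (load_weak_le_glimm (Kω := Kω) (Knp := Knp) (S := S) hK hK₀ c).trans hF
  have hF' := hF
  rw [glimm_weightsOf] at hF'
  rw [glimm_weightsOf, glimm_weightsOf]
  simp only [hc, hc', load_append, potentialQ₀_append, potentialBelow_append,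
    potentialAbove_append] at hW hF' ⊢
  have nL := load_nonneg lo
  have nM := load_nonneg mid
  have nH := load_nonneg hi
  have x1 := hex.cross_left hD nL
  have x2 := hex.cross_right hD hD' nH
  have q1 := potentialQ₀_nonneg lo
  have q2 := potentialQ₀_nonneg mid
  have q3 := potentialQ₀_nonneg hi
  have q4 := Load.cross_nonneg nL nM
  have q5 := Load.cross_nonneg nL nH
  have q6 := Load.cross_nonneg nM nH
  have hcl : ∀ L M N : Load, (L + M).cross N = L.cross N + M.cross N := fun L M N => by
    simp only [Load.cross, Load.add_def]; ring
  simp only [hcl] at hF' ⊢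
  rw [Load.weak_add, Load.weak_add] at hW
  simp only [Load.add_def] at hF' ⊢
  set L := load lo
  set M := load mid
  set M' := load out
  set H := load hi
  set b1l := potentialBelow Kω 1 lo
  set b1m := potentialBelow Kω 1 mid
  set b1o := potentialBelow Kω 1 out
  set b1h := potentialBelow Kω 1 hi
  set b2l := potentialBelow Kω 2 lo
  set b2m := potentialBelow Kω 2 mid
  set b2o := potentialBelow Kω 2 out
  set b2h := potentialBelow Kω 2 hi
  set pl := potentialAbove Knp lo
  set pm := potentialAbove Knp mid
  set po := potentialAbove Knp out
  set ph := potentialAbove Knp hi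
  have p1 : 0 ≤ b1l := potentialBelow_nonneg _ _ _
  have p2 : 0 ≤ b1m := potentialBelow_nonneg _ _ _
  have p4 : 0 ≤ b1h := potentialBelow_nonneg _ _ _
  have p5 : 0 ≤ b2l := potentialBelow_nonneg _ _ _
  have p6 : 0 ≤ b2m := potentialBelow_nonneg _ _ _
  have p8 : 0 ≤ b2h := potentialBelow_nonneg _ _ _
  have r1 : 0 ≤ pl := potentialAbove_nonneg _ _
  have r2 : 0 ≤ pm := potentialAbove_nonneg _ _
  have r4 : 0 ≤ ph := potentialAbove_nonneg _ _
  set z := max (M'.strong - M.strong) 0 with hz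
  have hz0 : 0 ≤ z := le_max_right _ _
  obtain ⟨l1, l2, l3, l4, l5, l6, l7⟩ := nL
  obtain ⟨m1, m2, m3, m4, m5, m6, m7⟩ := nM
  obtain ⟨h1, h2, h3, h4, h5, h6, h7⟩ := nH
  set eL := Real.exp (Kω * L.strong)
  set eH := Real.exp (Knp * H.strong)
  set eM := Real.exp (Knp * M.strong)
  set eM' := Real.exp (Knp * M'.strong)
  set e := Real.exp (Kω * (L.strong + M.strong))
  set e' := Real.exp (Kω * (L.strong + M'.strong))
  have eL0 : 0 < eL := Real.exp_pos _
  have eH0 : 0 < eH := Real.exp_pos _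
  have eM0 : 0 < eM := Real.exp_pos _
  have e0 : 0 < e := Real.exp_pos _
  have n1 : 0 ≤ K * (L.oneS + M.oneS + H.oneS + (L.oneR + M.oneR + H.oneR)) :=
    mul_nonneg (by linarith) (by positivity)
  have n2 : 0 ≤ K₀ * (potentialQ₀ lo + potentialQ₀ mid + L.cross M + potentialQ₀ hi +
      (L.cross H + M.cross H)) := by positivity
  have n3 : 0 ≤ eL * b1m := by positivity
  have n4 : 0 ≤ eL * b2m := by positivity
  have n5 : 0 ≤ e * b1h := by positivity
  have n6 : 0 ≤ e * b2h := by positivity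
  have n7 : 0 ≤ eH * (eM * pl) := by positivity
  have n8 : 0 ≤ eH * pm := by positivity
  have n9 := abs_nonneg (L.strong + M.strong + H.strong - S)
  rw [mul_add eH] at hF'
  have hb : e * b1h + e * b2h ≤ φ := by linarith
  have hp : eH * (eM * pl) ≤ φ := by linarith
  have hφ : 0 ≤ φ := by linarith
  -- If the strong strength grows by z, the fronts above gain exponential weight. Their weighted
  -- total is at most φ, so by `h₁` this gain and the corresponding one in `t2` together do not
  -- exceed z.
  have t1 : (e' - e) * (b1h + b2h) ≤ φ * (Kω * Real.exp Kω * z) := by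
    have hle : e' - e ≤ e * (Kω * Real.exp Kω * z) := by
      have := exp_sub_exp_le (s := L.strong + M.strong) (t := L.strong + M'.strong) hKω
        (by linarith)
      rwa [show L.strong + M'.strong - (L.strong + M.strong) = M'.strong - M.strong by ring] at this
    calc (e' - e) * (b1h + b2h) ≤ e * (Kω * Real.exp Kω * z) * (b1h + b2h) := by gcongr
      _ = (e * b1h + e * b2h) * (Kω * Real.exp Kω * z) := by ring
      _ ≤ _ := by gcongr
  have t2 : eH * ((eM' - eM) * pl) ≤ φ * (Knp * Real.exp Knp * z) := by
    have hle : eM' - eM ≤ eM * (Knp * Real.exp Knp * z) := exp_sub_exp_le hKnp hs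
    calc eH * ((eM' - eM) * pl) ≤ eH * (eM * (Knp * Real.exp Knp * z) * pl) := by gcongr
      _ = eH * (eM * pl) * (Knp * Real.exp Knp * z) := by ring
      _ ≤ _ := by gcongr
  have t3 : φ * (Kω * Real.exp Kω * z) + φ * (Knp * Real.exp Knp * z) ≤ z := by
    have := mul_le_mul_of_nonneg_right h₁ hz0
    linarith
  have wL : 0 ≤ L.weak := by unfold Load.weak; positivity
  have wM : 0 ≤ M.weak := by unfold Load.weak; positivity
  have wH : 0 ≤ H.weak := by unfold Load.weak; positivity
  -- Additional interaction potential with the uninvolved fronts is D or D' times their total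
  -- strength, which is at most φ; `h₀` compensates the factor K₀.
  have t4 : K₀ * (L.cross M' + M'.cross H - (L.cross M + M.cross H)) ≤ D + D' := by
    calc K₀ * (L.cross M' + M'.cross H - (L.cross M + M.cross H)) ≤
          K₀ * ((3 * D + 3 * D') * φ) := by
          gcongr
          have a1 : (3 * D + 3 * D') * (L.weak + H.weak) ≤ (3 * D + 3 * D') * φ := by
            gcongr
            linarith
          have a2 : 0 ≤ D' * (3 * L.weak + 2 * H.weak) := by positivity
          linarith
      _ = (3 * K₀ * φ) * (D + D') := by ring
      _ ≤ 1 * (D + D') := by gcongr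
      _ = D + D' := one_mul _
  have t5 : |L.strong + M'.strong + H.strong - S| ≤
      |L.strong + M.strong + H.strong - S| + |M'.strong - M.strong| := by
    have := abs_add_le (L.strong + M.strong + H.strong - S) (M'.strong - M.strong)
    rwa [show L.strong + M.strong + H.strong - S + (M'.strong - M.strong) =
      L.strong + M'.strong + H.strong - S by ring] at this
  linarith

end SteadyEuler
end

noncomputable section
namespace SteadyEuler

open Set Filter Topology Metric

/-! ## The interactions -/

variable {P : Params} {f g : Front} {out : List Front} {ord : ℕ → ℕ} {D D' : ℝ}

lemma OutEstimate.mono {D₁ D₁' : ℝ} (h : OutEstimate P ord f g out D D') (h1 : D ≤ D₁)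
    (h2 : D' ≤ D₁') : OutEstimate P ord f g out D₁ D₁' := by
  obtain ⟨a₁, d, a₃, e, ht, q1, q2, q3, q4⟩ := h
  exact ⟨a₁, d, a₃, e, ht, q1.trans h1, q2.trans h1, q3.trans h1, by linarith⟩

lemma Load.ofTag_one (t : Wave × ℕ) :
    (Load.ofTag t).oneS + (Load.ofTag t).oneR = |t.1.acParam .one| := by
  simp only [Load.ofTag]
  rcases le_total 0 (t.1.acParam .one) with h | h
  · simp [h, abs_of_nonneg]
  · simp [h, abs_of_nonpos]

lemma Load.ofTag_three (t : Wave × ℕ) :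
    (Load.ofTag t).threeS + (Load.ofTag t).threeR + (Load.ofTag t).strong =
      |t.1.acParam .three| := by
  simp only [Load.ofTag]
  rcases le_total 0 (t.1.acParam .three) with h | h
  · split_ifs <;> simp [h, abs_of_nonneg]
  · split_ifs <;> simp [h, abs_of_nonpos]

lemma load_pair (f g : Front) : load [f, g] = Load.ofTag f.tag + Load.ofTag g.tag := by
  rw [load_cons, load_cons, load_nil]
  ext <;> simp

lemma max_neg_add_max (a : ℝ) : max (-a) 0 + max a 0 = |a| := by
  rcases le_total 0 a with h | h
  · simp [h, abs_of_nonneg]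
  · simp [h, abs_of_nonpos]

/-- The functionals of the outgoing fronts, compared with those of the incoming fronts. -/
lemma OutEstimate.functionals (h : OutEstimate P ord f g out D D') (hδ : 0 < P.δ)
    (hord : f.IsStrong ∨ g.IsStrong → ord 3 = 0) (Kω Knp : ℝ) :
    (load [f, g]).Exceeds (load out) D D' ∧ potentialQ₀ out = 0 ∧
      potentialBelow Kω 1 out = (load out).oneS + (load out).oneR ∧
      potentialBelow Kω 2 out = (load out).slip ∧ potentialAbove Knp out = (load out).np ∧
      (load out).threeS + (load out).threeR + (load out).strong ≤
        (load [f, g]).threeS + (load [f, g]).threeR + (load [f, g]).strong + D ∧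
      (f.IsStrong ∨ g.IsStrong →
        ∃ a, |a - (f.wave.acParam .three + g.wave.acParam .three)| ≤ D ∧
          (load out).threeS = max (-a) 0 ∧ (load out).threeR = 0 ∧ (load out).strong = max a 0) := by
  obtain ⟨a₁, d, a₃, e, ht, q1, q2, q3, q4⟩ := h
  obtain ⟨f1, f2, f3, f4, f5⟩ := functionals_of_fanTags hδ ht Kω Knp
  rw [load_pair]
  have o1 := Load.ofTag_one f.tag
  have o2 := Load.ofTag_one g.tag
  have o3 := Load.ofTag_three f.tag
  have o4 := Load.ofTag_three g.tag
  have nf := Load.ofTag_nonneg f.tag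
  have ng := Load.ofTag_nonneg g.tag
  have hthree : (load out).threeS + (load out).threeR + (load out).strong = |a₃| := by
    rw [f1, ← max_neg_add_max a₃]
    simp only
    split_ifs <;> ring
  have hthree' : (load out).threeS + (load out).threeR + (load out).strong ≤
      (Load.ofTag f.tag).threeS + (Load.ofTag f.tag).threeR + (Load.ofTag f.tag).strong +
      ((Load.ofTag g.tag).threeS + (Load.ofTag g.tag).threeR + (Load.ofTag g.tag).strong) + D := by
    rw [hthree, o3, o4]
    have := abs_sub_abs_le_abs_sub a₃ (f.wave.acParam .three + g.wave.acParam .three)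
    have := abs_add_le (f.wave.acParam .three) (g.wave.acParam .three)
    change |a₃| ≤ |f.wave.acParam .three| + |g.wave.acParam .three| + D
    linarith
  have hneg : ∀ {a x y : ℝ}, |a - (x + y)| ≤ D → max (-a) 0 ≤ max (-x) 0 + max (-y) 0 + D := by
    intro a x y h
    have h1 := (abs_le.1 h).1
    have h2 := (abs_nonneg _).trans h
    refine max_le ?_ (by positivity)
    linarith [le_max_left (-x) 0, le_max_left (-y) 0]
  have h3S : (load out).threeS ≤ (Load.ofTag f.tag).threeS + (Load.ofTag g.tag).threeS + D := by
    rw [f1]; exact hneg q3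
  refine ⟨⟨?_, ?_, ?_, h3S, ?_, ?_⟩, f2, ?_, ?_, ?_, ?_, fun hs => ⟨a₃, q3, ?_⟩⟩
  · rw [f1]; exact hneg q1
  · rw [f1]
    simp only [Load.add_def]
    rw [max_neg_add_max, add_add_add_comm, o1, o2]
    have := abs_sub_abs_le_abs_sub a₁ (f.wave.acParam .one + g.wave.acParam .one)
    have := abs_add_le (f.wave.acParam .one) (g.wave.acParam .one)
    change |a₁| ≤ |f.wave.acParam .one| + |g.wave.acParam .one| + D
    linarith
  · rw [f1]
    change |d.1| + |d.2| ≤ |f.wave.slipParam.1| + |f.wave.slipParam.2| +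
      (|g.wave.slipParam.1| + |g.wave.slipParam.2|) + D
    rw [Prod.fst_add, Prod.snd_add] at q2
    have := abs_sub_abs_le_abs_sub d.1 (f.wave.slipParam.1 + g.wave.slipParam.1)
    have := abs_sub_abs_le_abs_sub d.2 (f.wave.slipParam.2 + g.wave.slipParam.2)
    have := abs_add_le f.wave.slipParam.1 g.wave.slipParam.1
    have := abs_add_le f.wave.slipParam.2 g.wave.slipParam.2
    linarith
  · simp only [Load.add_def]
    by_cases hs : f.IsStrong ∨ g.IsStrong
    · have : (load out).threeR = 0 := by rw [f1]; simp [hord hs]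
      linarith [nf.threeR, ng.threeR]
    · rw [not_or] at hs
      have s1 : (Load.ofTag f.tag).strong = 0 := by
        rcases f.load_cases with h | h
        · exact absurd h.1 hs.1
        · exact h.2.1
      have s2 : (Load.ofTag g.tag).strong = 0 := by
        rcases g.load_cases with h | h
        · exact absurd h.1 hs.2
        · exact h.2.1
      have := (load_nonneg out).strong
      linarith
  · rw [f1]
    have := ng.np
    change |e| ≤ f.wave.npParam + (Load.ofTag g.tag).np + D'
    linarith
  · rw [f3, f1, max_neg_add_max]
  · rw [f4, f1]
  · rw [f5, f1]
  · simp only [Load.add_def]; linarith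
  · simp [f1, hord hs]

/-- The relations between the weights that make the functional decrease; `φ` bounds the functional
itself. -/
structure GoodWeights (S C K K₀ Kω Knp φ : ℝ) : Prop where
  one_le_C : 1 ≤ C
  Knp_ge : 3 * C + 1 ≤ Knp
  K_ge : C * (5 + Real.exp (Knp * (S + 1))) + 1 ≤ K
  Kω_ge : C * (K + 10 + Real.exp (Knp * (S + 1))) + 1 ≤ Kω
  K₀_ge : C * (K + 6 + 2 * Real.exp (Kω * (S + 1)) + Real.exp (Knp * (S + 1))) + 1 ≤ K₀
  pos : 0 < φ
  le_one : φ ≤ 1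
  quad : 3 * K₀ * φ ≤ 1
  exp : (Kω * Real.exp Kω + Knp * Real.exp Knp) * φ ≤ 1
  small : 2 * C * (K + 8 + 2 * Real.exp (Kω * (S + 1)) + Real.exp (Knp * (S + 1))) * φ ≤ 1

/-- Each constant depends only on those chosen before it. K must outweigh a non-physical front
emitted below all strong fronts, Kω the K-weighted 1-fronts created at a strong front, and K₀ the
errors of all exponential weights; φ is chosen last. The number S + 1 bounds the total strength of
the strong fronts. -/
lemma exists_goodWeights (S : ℝ) {C : ℝ} (hC : 1 ≤ C) {d : ℝ} (hd : 0 < d) :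
    ∃ K K₀ Kω Knp φ, GoodWeights S C K K₀ Kω Knp φ ∧ φ ≤ d := by
  set Knp := 3 * C + 1
  set N := Real.exp (Knp * (S + 1))
  have hN : 0 < N := Real.exp_pos _
  set K := C * (5 + N) + 1
  have hK : 0 < K := by positivity
  set Kω := C * (K + 10 + N) + 1
  have hKω : 0 < Kω := by positivity
  set Ω := Real.exp (Kω * (S + 1))
  have hΩ : 0 < Ω := Real.exp_pos _
  set K₀ := C * (K + 6 + 2 * Ω + N) + 1
  have hK₀ : 0 < K₀ := by positivity
  have hKnp : 0 < Knp := by positivity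
  set a := Kω * Real.exp Kω + Knp * Real.exp Knp
  have ha : 0 < a := by positivity
  set b := 2 * C * (K + 8 + 2 * Ω + N)
  have hb : 0 < b := by positivity
  set φ := min (min d 1) (min (1 / (3 * K₀)) (min (1 / a) (1 / b)))
  have h1 : φ ≤ 1 / (3 * K₀) := (min_le_right _ _).trans (min_le_left _ _)
  have h2 : φ ≤ 1 / a := (min_le_right _ _).trans ((min_le_right _ _).trans (min_le_left _ _))
  have h3 : φ ≤ 1 / b := (min_le_right _ _).trans ((min_le_right _ _).trans (min_le_right _ _))
  rw [le_div_iff₀ (by positivity), mul_comm] at h1 h2 h3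
  exact ⟨K, K₀, Kω, Knp, φ, ⟨hC, le_rfl, le_rfl, le_rfl, le_rfl, by positivity,
    (min_le_left _ _).trans (min_le_right _ _), h1, h2, h3⟩,
    (min_le_left _ _).trans (min_le_left _ _)⟩

variable {S C K K₀ Kω Knp φ : ℝ} {c c' : Slab} {lo hi : List Front}

namespace GoodWeights

lemma Knp_pos (h : GoodWeights S C K K₀ Kω Knp φ) : 0 < Knp := by linarith [h.Knp_ge, h.one_le_C]

lemma one_le_K (h : GoodWeights S C K K₀ Kω Knp φ) : 1 ≤ K := by
  have := h.one_le_C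
  have : 0 ≤ C * (5 + Real.exp (Knp * (S + 1))) := by positivity
  linarith [h.K_ge]

lemma Kω_pos (h : GoodWeights S C K K₀ Kω Knp φ) : 0 < Kω := by
  have := h.one_le_C
  have := h.one_le_K
  have : 0 ≤ C * (K + 10 + Real.exp (Knp * (S + 1))) := by positivity
  linarith [h.Kω_ge]

lemma K₀_pos (h : GoodWeights S C K K₀ Kω Knp φ) : 0 < K₀ := by
  have := h.one_le_C
  have := h.one_le_K
  have : 0 ≤ C * (K + 6 + 2 * Real.exp (Kω * (S + 1)) + Real.exp (Knp * (S + 1))) := by positivity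
  linarith [h.K₀_ge]

lemma C_mul_le (h : GoodWeights S C K K₀ Kω Knp φ) : C * φ ≤ 1 / 2 := by
  have h1 := h.small
  have h2 := h.one_le_K
  have h3 := h.pos
  have h4 := h.one_le_C
  have h5 : 0 ≤ 2 * C * φ * (K + 7 + 2 * Real.exp (Kω * (S + 1)) + Real.exp (Knp * (S + 1))) := by
    positivity
  linarith

lemma le_half (h : GoodWeights S C K K₀ Kω Knp φ) : φ ≤ 1 / 2 := by
  have := mul_le_mul_of_nonneg_right h.one_le_C h.pos.le
  linarith [h.C_mul_le]

/-- The change of the functional in a collision. -/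
lemma collide_le (h : GoodWeights S C K K₀ Kω Knp φ) (hδ : 0 < P.δ)
    (hc : c.fronts = lo ++ f :: g :: hi) (hc' : c'.fronts = lo ++ out ++ hi)
    (hout : OutEstimate P ord f g out D D') (hord : f.IsStrong ∨ g.IsStrong → ord 3 = 0)
    (hD : 0 ≤ D) (hD' : 0 ≤ D') (hD1 : D ≤ 1 / 2)
    (hF : glimm (weightsOf K K₀ Kω Knp) S c ≤ φ) :
    ∃ eL eH : ℝ, 1 ≤ eL ∧ eL ≤ Real.exp (Kω * (S + 1)) ∧ 1 ≤ eH ∧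
      eH ≤ Real.exp (Knp * (S + 1)) ∧
    glimm (weightsOf K K₀ Kω Knp) S c' - glimm (weightsOf K K₀ Kω Knp) S c ≤
      (K + 2) * D + 2 * D' +
      (2 * ((load out).threeS + (load out).threeR -
        ((load [f, g]).threeS + (load [f, g]).threeR)) +
      |(load out).strong - (load [f, g]).strong| +
        max ((load out).strong - (load [f, g]).strong) 0) -
      K₀ * (Load.ofTag f.tag).cross (Load.ofTag g.tag) +
      eL * (2 * D - Kω * ((Load.ofTag f.tag).strong *
        ((Load.ofTag g.tag).oneS + (Load.ofTag g.tag).oneR + (Load.ofTag g.tag).slip))) +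
      eH * (D' - Knp * ((Load.ofTag g.tag).strong * (Load.ofTag f.tag).np)) := by
  classical
  have hK := h.one_le_K
  have hK₀ := h.K₀_pos.le
  have hKω := h.Kω_pos.le
  have hKnp := h.Knp_pos.le
  obtain ⟨hex, z1, z2, z3, z4, z5, -⟩ := hout.functionals hδ hord Kω Knp
  have hc1 : c.fronts = lo ++ [f, g] ++ hi := by rw [hc]; simp
  have hW := (load_weak_le_glimm (Kω := Kω) (Knp := Knp) (S := S) hK hK₀ c).trans hF
  have hS := (abs_strong_sub_le_glimm (Kω := Kω) (Knp := Knp) (S := S) hK hK₀ c).trans hF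
  rw [hc1, load_append, load_append, Load.weak_add, Load.weak_add] at hW
  rw [hc1, load_append, load_append, Load.strong_add, Load.strong_add] at hS
  have nL := load_nonneg lo
  have nM := load_nonneg [f, g]
  have nH := load_nonneg hi
  have hS' := (abs_le.1 hS).2
  have hφ := h.le_half
  have hWM : (load [f, g]).threeS + (load [f, g]).threeR ≤ φ := by
    have h1 := nL.weak
    have h2 := nH.weak
    have h3 : (load [f, g]).threeS + (load [f, g]).threeR ≤ (load [f, g]).weak := by
      obtain ⟨m1, m2, m3, m4, m5, m6, m7⟩ := nM
      unfold Load.weak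
      linarith
    linarith
  have nO := load_nonneg out
  -- The strong strength can gain at most the weak incoming 3-strength, which is at most φ ≤ 1/2,
  -- and the error D ≤ 1/2. This is the unit step that the exponential estimate allows.
  have hs : (load out).strong ≤ (load [f, g]).strong + 1 := by
    linarith [nO.threeS, nO.threeR]
  have key := glimm_sub_glimm_le hK hK₀ hKω hKnp hD hD' hc1 hc' hex hs hF h.quad h.exp
  refine ⟨Real.exp (Kω * (load lo).strong), Real.exp (Knp * (load hi).strong),
    Real.one_le_exp (mul_nonneg hKω nL.strong), ?_,
    Real.one_le_exp (mul_nonneg hKnp nH.strong), ?_, key.trans ?_⟩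
  · gcongr
    linarith [nM.strong, nH.strong]
  · gcongr
    linarith [nM.strong, nL.strong]
  · have b1 : potentialBelow Kω 1 [f, g] = (Load.ofTag f.tag).oneS + (Load.ofTag f.tag).oneR +
        Real.exp (Kω * (Load.ofTag f.tag).strong) *
          ((Load.ofTag g.tag).oneS + (Load.ofTag g.tag).oneR) := by
      rw [potentialBelow_cons, potentialBelow_cons, potentialBelow_nil, (ite_isWeakOf_eq f).1,
        (ite_isWeakOf_eq g).1, mul_zero, add_zero]
    have b2 : potentialBelow Kω 2 [f, g] = (Load.ofTag f.tag).slip +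
        Real.exp (Kω * (Load.ofTag f.tag).strong) * (Load.ofTag g.tag).slip := by
      rw [potentialBelow_cons, potentialBelow_cons, potentialBelow_nil, (ite_isWeakOf_eq f).2.1,
        (ite_isWeakOf_eq g).2.1, mul_zero, add_zero]
    have b3 : potentialAbove Knp [f, g] = (Load.ofTag f.tag).np *
        Real.exp (Knp * (Load.ofTag g.tag).strong) + (Load.ofTag g.tag).np := by
      rw [potentialAbove_cons, potentialAbove_cons, potentialAbove_nil, load_cons, load_nil]
      simp
    have b4 : potentialQ₀ [f, g] = (Load.ofTag f.tag).cross (Load.ofTag g.tag) := by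
      simp [potentialQ₀, pairPotential_eq]
    rw [z1, z2, z3, z4, b1, b2, b3, b4]
    obtain ⟨x1, x2, x3, x4, x5, x6⟩ := hex
    rw [load_pair] at x2 x3 x6 ⊢
    simp only [Load.add_def] at x2 x3 x6 ⊢
    obtain ⟨g1, g2, g3, g4, g5, g6, g7⟩ := Load.ofTag_nonneg g.tag
    obtain ⟨f1, f2, f3, f4, f5, f6, f7⟩ := Load.ofTag_nonneg f.tag
    set F := Load.ofTag f.tag
    set G := Load.ofTag g.tag
    -- Only the linear part of the loss of exponential weight is used.
    have e1 := Real.add_one_le_exp (Kω * F.strong)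
    have e2 := Real.add_one_le_exp (Knp * G.strong)
    have y1 := mul_le_mul_of_nonneg_left
      (show (load out).oneS + (load out).oneR - (F.oneS + G.oneS + (F.oneR + G.oneR)) ≤ D by
        linarith) (show 0 ≤ K by linarith)
    have y2 : (load out).oneS + (load out).oneR - (F.oneS + F.oneR +
        Real.exp (Kω * F.strong) * (G.oneS + G.oneR)) +
        ((load out).slip - (F.slip + Real.exp (Kω * F.strong) * G.slip)) ≤
        2 * D - Kω * (F.strong * (G.oneS + G.oneR + G.slip)) := by
      have := mul_le_mul_of_nonneg_right e1 (show 0 ≤ G.oneS + G.oneR + G.slip by positivity)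
      linarith
    have y3 : (load out).np - (F.np * Real.exp (Knp * G.strong) + G.np) ≤
        D' - Knp * (G.strong * F.np) := by
      have := mul_le_mul_of_nonneg_right e2 f7
      linarith
    have y4 := mul_le_mul_of_nonneg_left y2 (Real.exp_pos (Kω * (load lo).strong)).le
    have y5 := mul_le_mul_of_nonneg_left y3 (Real.exp_pos (Knp * (load hi).strong)).le
    linarith

/-- Weak fronts, or a non-physical and a weak front. -/
lemma weak_le (h : GoodWeights S C K K₀ Kω Knp φ) (hδ : 0 < P.δ)
    (hc : c.fronts = lo ++ f :: g :: hi) (hc' : c'.fronts = lo ++ out ++ hi)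
    (hfs : ¬ f.IsStrong) (hgs : ¬ g.IsStrong)
    (hpair : pairPotential f g = f.strength * g.strength)
    (hout : OutEstimate P ord f g out (C * (f.strength * g.strength))
      (C * (f.strength * g.strength)))
    (hP : f.strength * g.strength ≤ φ) (hF : glimm (weightsOf K K₀ Kω Knp) S c ≤ φ) :
    glimm (weightsOf K K₀ Kω Knp) S c' - glimm (weightsOf K K₀ Kω Knp) S c ≤
      -(1 / 4) * (f.strength * g.strength) := by
  have hC := h.one_le_C
  have hP0 : 0 ≤ f.strength * g.strength :=
    mul_nonneg (Wave.strength_nonneg _) (Wave.strength_nonneg _)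
  set E := f.strength * g.strength
  have hD : 0 ≤ C * E := by positivity
  have hD1 : C * E ≤ 1 / 2 := (mul_le_mul_of_nonneg_left hP (by linarith)).trans h.C_mul_le
  have hord : f.IsStrong ∨ g.IsStrong → ord 3 = 0 := fun hs => absurd hs (by simp [hfs, hgs])
  obtain ⟨eL, eH, l1, l2, r1, r2, key⟩ := h.collide_le hδ hc hc' hout hord hD hD hD1 hF
  obtain ⟨hex, -, -, -, -, z5, -⟩ := hout.functionals hδ hord Kω Knp
  have s1 : (Load.ofTag f.tag).strong = 0 := by
    rcases f.load_cases with h | h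
    · exact absurd h.1 hfs
    · exact h.2.1
  have s2 : (Load.ofTag g.tag).strong = 0 := by
    rcases g.load_cases with h | h
    · exact absurd h.1 hgs
    · exact h.2.1
  have s3 : (load [f, g]).strong = 0 := by rw [load_pair, Load.strong_add, s1, s2, add_zero]
  have nO := (load_nonneg out).strong
  -- Should the outgoing 3-wave have order zero, its rarefaction strength enters twice, through
  -- |S(x) - S| and through the exponential weights; the weight 2 of L₃ gives the same bound in
  -- either case.
  rw [← pairPotential_eq, hpair, s1, s2, s3, sub_zero, abs_of_nonneg nO, max_eq_left nO] at key
  rw [s3] at z5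
  refine key.trans ?_
  have t1 : eL * (2 * (C * E)) ≤ Real.exp (Kω * (S + 1)) * (2 * (C * E)) := by gcongr
  have t2 : eH * (C * E) ≤ Real.exp (Knp * (S + 1)) * (C * E) := by gcongr
  -- The pair disappears from Q₀, and K₀ times its product outweighs all errors, each of which is a
  -- multiple of C times that product.
  have t3 := mul_le_mul_of_nonneg_right h.K₀_ge hP0
  linarith

/-- A strong front below a weak front of the first or second family. -/
lemma strong_weak_le (h : GoodWeights S C K K₀ Kω Knp φ) (hδ : 0 < P.δ)
    (hc : c.fronts = lo ++ f :: g :: hi) (hc' : c'.fronts = lo ++ out ++ hi)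
    (hf : f.IsStrong) (hg : g.IsWeakOf 1 ∨ g.IsWeakOf 2) (hord : ord 3 = 0)
    (hout : OutEstimate P ord f g out (C * (f.strength * g.strength))
      (C * (f.strength * g.strength)))
    (hP : f.strength * g.strength ≤ φ) (hF : glimm (weightsOf K K₀ Kω Knp) S c ≤ φ) :
    glimm (weightsOf K K₀ Kω Knp) S c' - glimm (weightsOf K K₀ Kω Knp) S c ≤
      -(1 / 4) * (f.strength * g.strength) := by
  classical
  have hC := h.one_le_C
  have hP0 : 0 ≤ f.strength * g.strength :=
    mul_nonneg (Wave.strength_nonneg _) (Wave.strength_nonneg _)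
  set E := f.strength * g.strength with hE
  have hD : 0 ≤ C * E := by positivity
  have hD1 : C * E ≤ 1 / 2 := (mul_le_mul_of_nonneg_left hP (by linarith)).trans h.C_mul_le
  obtain ⟨eL, eH, l1, l2, r1, r2, key⟩ := h.collide_le hδ hc hc' hout (fun _ => hord) hD hD hD1 hF
  obtain ⟨hex, -, -, -, -, z5, z6⟩ := hout.functionals hδ (fun _ => hord) Kω Knp
  obtain ⟨a, ha, q1, q2, q3⟩ := z6 (Or.inl hf)
  have sf : (Load.ofTag f.tag).strong = f.strength := by
    rcases f.load_cases with h | h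
    · exact h.2.1
    · exact absurd hf h.1
  obtain ⟨b, hb, hfw⟩ := hf.2
  have hfb : f.strength = b := by rw [Front.strength, hfw]; exact abs_of_pos hb
  have hg3 : g.wave.acParam .three = 0 := by
    rcases hw : g.wave with ⟨_ | _, _⟩ | ⟨_, _⟩ | _ <;> try rfl
    rcases hg with hg | hg <;> simp [Front.IsWeakOf, hw, Wave.family] at hg
  have hf3 : f.wave.acParam .three = b := by rw [hfw]; rfl
  rw [hg3, hf3, add_zero] at ha
  have tg := Load.ofTag_three g.tag
  rw [show g.tag.1 = g.wave from rfl, hg3, abs_zero] at tg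
  have ng := Load.ofTag_nonneg g.tag
  have g1 := ng.threeS
  have g2 := ng.threeR
  have g3 := ng.strong
  have hgsum : (Load.ofTag g.tag).oneS + (Load.ofTag g.tag).oneR + (Load.ofTag g.tag).slip =
      g.strength := by
    rcases hg with hg | hg
    · have h1 := (ite_isWeakOf_eq g).1
      rw [if_pos hg] at h1
      have h2 := (ite_isWeakOf_eq g).2.1
      rw [if_neg (fun hh => absurd (hg.1.symm.trans hh.1) (by norm_num))] at h2
      linarith
    · have h1 := (ite_isWeakOf_eq g).2.1
      rw [if_pos hg] at h1
      have h2 := (ite_isWeakOf_eq g).1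
      rw [if_neg (fun hh => absurd (hg.1.symm.trans hh.1) (by norm_num))] at h2
      linarith
  have hs : (load [f, g]).strong = b := by
    rw [load_pair, Load.strong_add, sf, hfb]; linarith
  have hdiff : |(load out).strong - b| ≤ C * E := by
    rw [q3, ← max_eq_left hb.le]
    exact (abs_max_sub_max_le_abs _ _ _).trans ha
  have hmax : max ((load out).strong - b) 0 ≤ C * E := max_le ((le_abs_self _).trans hdiff) hD
  have h3S : (load out).threeS ≤ C * E := by
    rw [q1]
    exact max_le (by linarith [(abs_le.1 ha).1]) hD
  have nM := load_nonneg [f, g]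
  have m1 := nM.threeS
  have m2 := nM.threeR
  rw [hs, hgsum, sf, ← hE] at key
  refine key.trans ?_
  have hcross := mul_nonneg h.K₀_pos.le
    (Load.cross_nonneg (Load.ofTag_nonneg f.tag) ng)
  -- Once g has passed below the strong front, its exponent no longer contains the strength of that
  -- front. The loss, at least Kω times the product, exceeds the created 1- and 2-fronts.
  have t0 : 2 * (C * E) - Kω * E ≤ -((C * (K + 8 + Real.exp (Knp * (S + 1))) + 1) * E) := by
    have := mul_le_mul_of_nonneg_right h.Kω_ge hP0
    linarith
  have hK := h.one_le_K
  have hneg : 0 ≤ (C * (K + 8 + Real.exp (Knp * (S + 1))) + 1) * E := by positivity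
  have t1 : eL * (2 * (C * E) - Kω * E) ≤
      -((C * (K + 8 + Real.exp (Knp * (S + 1))) + 1) * E) := by
    have := mul_le_mul_of_nonneg_left t0 (show 0 ≤ eL by linarith)
    have := mul_le_mul_of_nonneg_right l1 hneg
    linarith
  have t2 : eH * (C * E - Knp * ((Load.ofTag g.tag).strong * (Load.ofTag f.tag).np)) ≤
      Real.exp (Knp * (S + 1)) * (C * E) := by
    rw [show (Load.ofTag g.tag).strong = 0 by linarith, zero_mul, mul_zero, sub_zero]
    gcongr
  rw [q2] at *
  linarith

/-- A strong front and a weak shock of the third family. -/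
lemma shock_le (h : GoodWeights S C K K₀ Kω Knp φ) (hδ : 0 < P.δ)
    (hc : c.fronts = lo ++ f :: g :: hi) (hc' : c'.fronts = lo ++ out ++ hi)
    {x y : ℝ} (hx : 0 < x) (hy : 0 < y) (hs : f.IsStrong ∨ g.IsStrong)
    (hload : load [f, g] = ⟨0, 0, 0, y, 0, x, 0⟩)
    (hthree : f.wave.acParam .three + g.wave.acParam .three = x - y)
    (hprod : f.strength * g.strength = x * y) (hord : ord 3 = 0)
    (hout : OutEstimate P ord f g out (C * (f.strength * g.strength))
      (C * (f.strength * g.strength)))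
    (hxφ : x ≤ φ) (hyφ : y ≤ φ) (hF : glimm (weightsOf K K₀ Kω Knp) S c ≤ φ) :
    glimm (weightsOf K K₀ Kω Knp) S c' - glimm (weightsOf K K₀ Kω Knp) S c ≤
      -(1 / 4) * min x y := by
  have hC := h.one_le_C
  have hK := h.one_le_K
  have hφ1 := h.le_one
  have hφ := h.pos
  rw [hprod] at hout
  have hm : 0 < min x y := lt_min hx hy
  have hxy : x * y ≤ φ * min x y := by
    rcases le_total x y with hle | hle
    · rw [min_eq_left hle, mul_comm]; gcongr
    · rw [min_eq_right hle]; gcongr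
  have hD : 0 ≤ C * (x * y) := by positivity
  have hP : x * y ≤ φ := by nlinarith
  have hD1 : C * (x * y) ≤ 1 / 2 :=
    (mul_le_mul_of_nonneg_left hP (by linarith)).trans h.C_mul_le
  obtain ⟨eL, eH, l1, l2, r1, r2, key⟩ := h.collide_le hδ hc hc' hout (fun _ => hord) hD hD hD1 hF
  obtain ⟨hex, -, -, -, -, z5, z6⟩ := hout.functionals hδ (fun _ => hord) Kω Knp
  obtain ⟨a, ha, q1, q2, q3⟩ := z6 hs
  rw [hthree] at ha
  rw [hload] at key
  simp only at key
  have ng := Load.ofTag_nonneg g.tag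
  have nf := Load.ofTag_nonneg f.tag
  set D := C * (x * y) with hDdef
  have hcross := mul_nonneg h.K₀_pos.le (Load.cross_nonneg nf ng)
  have t1 : eL * (2 * D - Kω * ((Load.ofTag f.tag).strong *
      ((Load.ofTag g.tag).oneS + (Load.ofTag g.tag).oneR + (Load.ofTag g.tag).slip))) ≤
      Real.exp (Kω * (S + 1)) * (2 * D) := by
    have : 0 ≤ Kω * ((Load.ofTag f.tag).strong *
      ((Load.ofTag g.tag).oneS + (Load.ofTag g.tag).oneR + (Load.ofTag g.tag).slip)) :=
      mul_nonneg h.Kω_pos.le (mul_nonneg nf.strong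
        (add_nonneg (add_nonneg ng.oneS ng.oneR) ng.slip))
    calc _ ≤ eL * (2 * D) := mul_le_mul_of_nonneg_left (by linarith) (by linarith)
      _ ≤ _ := by gcongr
  have t2 : eH * (D - Knp * ((Load.ofTag g.tag).strong * (Load.ofTag f.tag).np)) ≤
      Real.exp (Knp * (S + 1)) * D := by
    have : 0 ≤ Knp * ((Load.ofTag g.tag).strong * (Load.ofTag f.tag).np) :=
      mul_nonneg h.Knp_pos.le (mul_nonneg ng.strong nf.np)
    calc _ ≤ eH * D := mul_le_mul_of_nonneg_left (by linarith) (by linarith)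
      _ ≤ _ := by gcongr
  -- The product xy is at most φ min(x, y), so by the choice of φ all quadratic errors together cost
  -- at most half of the minimum.
  have t3 : D * (K + 8 + 2 * Real.exp (Kω * (S + 1)) + Real.exp (Knp * (S + 1))) ≤
      1 / 2 * min x y := by
    have h1 := mul_le_mul_of_nonneg_right h.small hm.le
    have h2 : D ≤ C * (φ * min x y) := by rw [hDdef]; gcongr
    have h3 := mul_le_mul_of_nonneg_right h2
      (show 0 ≤ K + 8 + 2 * Real.exp (Kω * (S + 1)) + Real.exp (Knp * (S + 1)) by positivity)
    linarith
  obtain ⟨a1, a2⟩ := abs_le.1 ha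
  -- Cancellation: up to D, the shock loses min(x, y), counted twice in the functional, while the
  -- strong strength changes by no more than min(x, y), counted once.
  have t4 : 2 * ((load out).threeS + (load out).threeR - (y + 0)) + |(load out).strong - x| +
      max ((load out).strong - x) 0 ≤ 4 * D - min x y := by
    have u1 : max ((load out).strong - x) 0 ≤ D := by
      rw [q3]
      refine max_le ?_ hD
      have : max a 0 ≤ x + D := max_le (by linarith) (by linarith)
      linarith
    have u2 : (load out).threeS ≤ y - min x y + D := by
      rw [q1]
      refine max_le ?_ ?_
      · linarith [min_le_left x y]
      · linarith [min_le_right x y]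
    have u3 : |(load out).strong - x| ≤ min x y + D := by
      rw [q3, abs_le]
      constructor
      · rcases le_total x y with hle | hle
        · rw [min_eq_left hle]
          linarith [le_max_right a 0]
        · rw [min_eq_right hle]
          linarith [le_max_left a 0]
      · have : max a 0 ≤ x + D := max_le (by linarith) (by linarith)
        linarith
    rw [q2]
    linarith
  linarith

/-- A non-physical front below a strong front. -/
lemma np_strong_le (h : GoodWeights S C K K₀ Kω Knp φ) (hδ : 0 < P.δ)
    (hc : c.fronts = lo ++ f :: g :: hi) (hc' : c'.fronts = lo ++ out ++ hi)
    (hf : f.IsNP) (hg : g.IsStrong) (hord : ord 3 = 0)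
    (hout : OutEstimate P ord f g out 0 (C * (f.strength * g.strength)))
    (hF : glimm (weightsOf K K₀ Kω Knp) S c ≤ φ) :
    glimm (weightsOf K K₀ Kω Knp) S c' - glimm (weightsOf K K₀ Kω Knp) S c ≤
      -(1 / 4) * (f.strength * g.strength) := by
  classical
  have hC := h.one_le_C
  have hP0 : 0 ≤ f.strength * g.strength :=
    mul_nonneg (Wave.strength_nonneg _) (Wave.strength_nonneg _)
  have hD : 0 ≤ C * (f.strength * g.strength) := by positivity
  obtain ⟨eL, eH, l1, l2, r1, r2, key⟩ := h.collide_le hδ hc hc' hout (fun _ => hord) le_rfl hD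
    (by norm_num) hF
  obtain ⟨hex, -, -, -, -, z5, z6⟩ := hout.functionals hδ (fun _ => hord) Kω Knp
  obtain ⟨a, ha, q1, q2, q3⟩ := z6 (Or.inr hg)
  have sg : (Load.ofTag g.tag).strong = g.strength := by
    rcases g.load_cases with h | h
    · exact h.2.1
    · exact absurd hg h.1
  have nf : (Load.ofTag f.tag).np = f.strength := by
    rw [← (ite_isWeakOf_eq f).2.2.2.2, if_pos hf]
  have hfs : ¬ f.IsStrong := by
    rintro ⟨-, b, -, hb⟩
    simp [Front.IsNP, hb, Wave.family] at hf
  have sf : (Load.ofTag f.tag).strong = 0 := by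
    rcases f.load_cases with h | h
    · exact absurd h.1 hfs
    · exact h.2.1
  obtain ⟨b, hb, hgw⟩ := hg.2
  have hgb : g.strength = b := by rw [Front.strength, hgw]; exact abs_of_pos hb
  have hg3 : g.wave.acParam .three = b := by rw [hgw]; rfl
  have hf3 : f.wave.acParam .three = 0 := by
    rcases hw : f.wave with ⟨_ | _, _⟩ | ⟨_, _⟩ | _ <;> try rfl
    simp [Front.IsNP, hw, Wave.family] at hf
  have hab : a = b := by
    rw [hg3, hf3, zero_add] at ha
    exact sub_eq_zero.1 (abs_nonpos_iff.1 ha)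
  have hs : (load out).strong - (load [f, g]).strong = 0 := by
    rw [load_pair, Load.strong_add, sf, sg, hgb, q3, hab, max_eq_left hb.le]; ring
  have h3 := hex.three
  rw [hs, sg, nf, sf, mul_comm g.strength f.strength] at key
  set E := f.strength * g.strength
  have hcross := mul_nonneg h.K₀_pos.le
    (Load.cross_nonneg (Load.ofTag_nonneg f.tag) (Load.ofTag_nonneg g.tag))
  -- Of 3C + 1, one C covers the growth of the non-physical front inside its exponential weight. The
  -- remaining 2C pay for L₄ and for the new terms in Q₀.
  have t0 : C * E - Knp * E ≤ -((2 * C + 1) * E) := by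
    have := mul_le_mul_of_nonneg_right h.Knp_ge hP0
    linarith
  have t1 : eH * (C * E - Knp * E) ≤ -((2 * C + 1) * E) := by
    have h1 := mul_le_mul_of_nonneg_left t0 (show 0 ≤ eH by linarith)
    have h2 := mul_le_mul_of_nonneg_right r1 (show 0 ≤ (2 * C + 1) * E by positivity)
    linarith
  simp only [abs_zero, max_self, mul_zero, zero_mul, sub_zero, zero_add, add_zero] at key h3
  linarith

end GoodWeights

end SteadyEuler
end

/-! ### Reflection at the free boundary and conclusion. -/

noncomputable section
namespace SteadyEuler

open Set Filter Topology Metric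

variable {P : Params} {f g : Front} {out : List Front} {ord : ℕ → ℕ}
  {S C K K₀ Kω Knp φ : ℝ} {c c' : Slab} {lo hi : List Front}

/-- A 1-front is reflected at the free boundary. -/
lemma GoodWeights.reflect_le (h : GoodWeights S C K K₀ Kω Knp φ) (hδ : 0 < P.δ)
    (hc : c.fronts = f :: hi) (hc' : c'.fronts = out ++ hi) {a b e : ℝ}
    (hf : f.wave = .acoustic .one a) (hout : out.map Front.tag = fanTags P.δ ord 0 0 b e)
    (hb : |b| ≤ C * |a|) (he : |e| ≤ C * |a|)
    (hF : glimm (weightsOf K K₀ Kω Knp) S c ≤ φ) :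
    glimm (weightsOf K K₀ Kω Knp) S c' - glimm (weightsOf K K₀ Kω Knp) S c ≤ -(1 / 4) * |a| := by
  classical
  have hC := h.one_le_C
  have hK := h.one_le_K
  have hK₀ := h.K₀_pos.le
  have hKω := h.Kω_pos.le
  have hKnp := h.Knp_pos.le
  have ha := abs_nonneg a
  have hD : 0 ≤ C * |a| := by positivity
  have hc1 : c.fronts = [] ++ [f] ++ hi := by rw [hc]; simp
  have hc1' : c'.fronts = [] ++ out ++ hi := by rw [hc']; simp
  have hW := (load_weak_le_glimm (Kω := Kω) (Knp := Knp) (S := S) hK hK₀ c).trans hF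
  have hS := (abs_strong_sub_le_glimm (Kω := Kω) (Knp := Knp) (S := S) hK hK₀ c).trans hF
  have hl : load [f] = Load.ofTag f.tag := by
    rw [load_cons, load_nil]; ext <;> simp
  have l1 : Load.ofTag f.tag = ⟨max (-a) 0, max a 0, 0, 0, 0, 0, 0⟩ := by
    simp [Load.ofTag, Front.tag, hf, Wave.acParam, Wave.slipParam, Wave.npParam]
  have hmax := max_neg_add_max a
  obtain ⟨f1, f2, f3, f4, f5⟩ := functionals_of_fanTags hδ hout Kω Knp
  rw [hc, load_cons, Load.weak_add] at hW
  rw [hc, load_cons, Load.strong_add] at hS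
  have nH := load_nonneg hi
  have hwf : (Load.ofTag f.tag).weak = |a| := by
    rw [l1, ← hmax]; simp [Load.weak]
  have haφ : |a| ≤ φ := by linarith [nH.weak]
  have hsH : (load hi).strong ≤ S + 1 := by
    have : (Load.ofTag f.tag).strong = 0 := by rw [l1]
    linarith [(abs_le.1 hS).2, h.le_one]
  have hD1 : C * |a| ≤ 1 := by
    have := mul_le_mul_of_nonneg_left haφ (show 0 ≤ C by linarith)
    linarith [h.C_mul_le]
  have hm1 : max (-b) 0 ≤ C * |a| := max_le ((neg_le_abs b).trans hb) hD
  have hm2 : max b 0 ≤ C * |a| := max_le ((le_abs_self b).trans hb) hD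
  have h0 : 0 ≤ max (-a) 0 := le_max_right _ _
  have h0' : 0 ≤ max a 0 := le_max_right _ _
  have habs := max_neg_add_max b
  have h3 : (load out).threeS + (load out).threeR + (load out).strong = |b| := by
    rw [f1, ← habs]
    simp only
    split_ifs <;> ring
  have nO := load_nonneg out
  have hex : (load [f]).Exceeds (load out) (C * |a|) (C * |a|) := by
    rw [hl, l1]
    have := nO.strong
    have := nO.threeR
    constructor
    · rw [f1]; simp only [neg_zero, max_self]; linarith
    · rw [f1]; simp only [neg_zero, max_self]; linarith
    · rw [f1]; simp only [Prod.fst_zero, Prod.snd_zero, abs_zero]; linarith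
    · simp only; linarith
    · simp only; linarith
    · rw [f1]; simpa using he
  have hs : (load out).strong ≤ (load [f]).strong + 1 := by
    rw [hl, l1]
    simp only
    linarith [nO.threeS, nO.threeR]
  have key := glimm_sub_glimm_le hK hK₀ hKω hKnp hD hD hc1 hc1' hex hs hF h.quad h.exp
  have b1 : potentialBelow Kω 1 [f] = |a| := by
    rw [potentialBelow_cons, potentialBelow_nil, (ite_isWeakOf_eq f).1, l1, ← hmax]; simp
  have b2 : potentialBelow Kω 2 [f] = 0 := by
    rw [potentialBelow_cons, potentialBelow_nil, (ite_isWeakOf_eq f).2.1, l1]; simp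
  have b3 : potentialAbove Knp [f] = 0 := by
    rw [potentialAbove_cons, potentialAbove_nil, l1]; simp
  have b4 : potentialQ₀ [f] = 0 := by simp [potentialQ₀]
  have o1 : (load out).oneS + (load out).oneR = 0 := by rw [f1]; simp
  have o2 : (load out).slip = 0 := by rw [f1]; simp
  have o3 : (load out).np = |e| := by rw [f1]
  rw [f2, f3, f4, f5, b1, b2, b3, b4, hl, l1, o1, o2, o3, hmax] at key
  simp only [load_nil, Load.zero_def, mul_zero, Real.exp_zero, sub_zero, zero_sub, abs_zero,
    Prod.fst_zero, Prod.snd_zero, add_zero, one_mul] at key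
  rw [abs_of_nonneg nO.strong, max_eq_left nO.strong] at key
  have t1 : Real.exp (Knp * (load hi).strong) * |e| ≤ Real.exp (Knp * (S + 1)) * (C * |a|) := by
    gcongr
  -- K times the vanished 1-front pays for the reflected 3-wave or for a non-physical front that
  -- starts below all strong fronts and thus carries the exponential factor of their total strength.
  have t2 := mul_le_mul_of_nonneg_right h.K_ge ha
  linarith

lemma load_weak_le_of_mem {fs : List Front} (hf : f ∈ fs) :
    (Load.ofTag f.tag).weak ≤ (load fs).weak := by
  obtain ⟨l₁, l₂, rfl⟩ := List.append_of_mem hf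
  rw [load_append, load_cons, Load.weak_add, Load.weak_add]
  linarith [(load_nonneg l₁).weak, (load_nonneg l₂).weak]

/-- The strength of every front is small. -/
lemma Slab.Good.strength_lt (hc : c.Good P) (hδ : P.δ < φ) (hW : (load c.fronts).weak < φ)
    (hf : f ∈ c.fronts) : f.strength < φ := by
  rcases f.load_cases with ⟨⟨-, a, ha, hw⟩, -, -⟩ | ⟨-, -, h⟩
  · rw [Front.strength, hw, Wave.strength, abs_of_pos ha]
    exact (hc.small f hf _ _ hw).trans_lt hδ
  · rw [← h]
    exact (load_weak_le_of_mem hf).trans_lt hW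

lemma Front.IsStrong.load (h : f.IsStrong) : ∃ b, 0 < b ∧ f.wave = .acoustic .three b ∧
    f.strength = b ∧ Load.ofTag f.tag = ⟨0, 0, 0, 0, 0, b, 0⟩ := by
  obtain ⟨h0, b, hb, hw⟩ := h
  refine ⟨b, hb, hw, by rw [Front.strength, hw]; exact abs_of_pos hb, ?_⟩
  simp [Load.ofTag, Front.tag, hw, h0, Wave.acParam, Wave.slipParam, Wave.npParam, hb.le]

lemma Front.IsWeakOf.load_of_isShock (h : f.IsWeakOf 3) (hs : f.wave.IsShock) :
    ∃ b, 0 < b ∧ f.wave = .acoustic .three (-b) ∧ f.strength = b ∧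
      Load.ofTag f.tag = ⟨0, 0, 0, b, 0, 0, 0⟩ := by
  obtain ⟨j, a, hw, ha⟩ := hs.acoustic
  have h3 := h.1
  rw [hw] at h3
  cases j with
  | one => simp [Wave.family] at h3
  | three =>
    refine ⟨-a, by linarith, by rw [hw, neg_neg], by rw [Front.strength, hw]; exact abs_of_neg ha,
      ?_⟩
    simp [Load.ofTag, Front.tag, hw, Wave.acParam, Wave.slipParam, Wave.npParam, ha.le]

/-- Every interaction decreases the functional. -/
lemma Interaction.glimm_sub_le {ψ : ℝ → State} {C ε x E : ℝ} (hγ : 1 < P.γ)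
    (hT : IsTube P.γ ψ S C ε) (hw : GoodWeights S (2 * C ^ 2) K K₀ Kω Knp φ) (hδ : 0 < P.δ)
    (hδφ : P.δ < φ) (hCφ : 4 * C * φ ≤ ε)
    (hnear : ∀ (fs : List Front) (U : State), Connects P U fs P.Up →
      (∀ f ∈ fs, ∀ j a, f.wave = .acoustic j a → a ≤ P.δ) → (load fs).strong < S + φ →
      (load fs).weak < φ → ∃ t ∈ Icc 0 S, ‖U - ψ t‖ ≤ ε / 4)
    (hc : c.Good P) (hF : glimm (weightsOf K K₀ Kω Knp) S c < φ) (h : Interaction P c x c' E) :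
    glimm (weightsOf K K₀ Kω Knp) S c' - glimm (weightsOf K K₀ Kω Knp) S c ≤ -(1 / 4) * E := by
  classical
  have hC := hT.one_le
  have hε := hT.eps_pos
  have hφ := hw.pos
  have hφ1 := hw.le_one
  have hCφ0 : φ ≤ C * φ := le_mul_of_one_le_left hφ.le hC
  have hCC : 2 * C ≤ 2 * C ^ 2 := by nlinarith
  have hW := (load_weak_le_glimm (Kω := Kω) (Knp := Knp) (S := S) hw.one_le_K hw.K₀_pos.le
    c).trans_lt hF
  have hS := (abs_strong_sub_le_glimm (Kω := Kω) (Knp := Knp) (S := S) hw.one_le_K hw.K₀_pos.le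
    c).trans_lt hF
  have hS' := (abs_lt.1 hS).2
  cases h with
  | collide lo hi out f g E hfronts hmeet honly hcase hsolver =>
    have hcon := hc.connects
    rw [hfronts] at hcon
    obtain ⟨M, hlo, rfl, haf, hfg, hag, hhi⟩ := Connects.append_iff.1 hcon
    -- The fronts from f upwards form a chain that ends at U₊, which places the state below f near
    -- the background curve.
    have hrest : Connects P f.below (f :: g :: hi) P.Up := ⟨rfl, haf, hfg, hag, hhi⟩
    have hfs : f.strength < φ := hc.strength_lt hδφ hW (by rw [hfronts]; simp)
    have hgs : g.strength < φ := hc.strength_lt hδφ hW (by rw [hfronts]; simp)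
    have hf0 : 0 ≤ f.strength := Wave.strength_nonneg _
    have hg0 : 0 ≤ g.strength := Wave.strength_nonneg _
    rw [hfronts, load_append, Load.weak_add] at hW
    rw [hfronts, load_append, Load.strong_add] at hS'
    obtain ⟨t, ht, hU⟩ := hnear _ _ hrest
      (fun h hh => hc.small h (by rw [hfronts]; exact List.mem_append_right _ hh))
      (by linarith [(load_nonneg lo).strong]) (by linarith [(load_nonneg lo).weak])
    have hE := hT.est t ht
    have hgn := hcase.not_isNP
    have hcf : C * f.strength < ε / 4 + ε / 4 := by
      have := mul_le_mul_of_nonneg_left hfs.le (show 0 ≤ C by linarith)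
      linarith
    have hcg : C * g.strength < ε / 2 := by
      have := mul_le_mul_of_nonneg_left hgs.le (show 0 ≤ C by linarith)
      linarith
    have hU1 : f.below ∈ ball (ψ t) (ε / 2) := by
      rw [mem_ball, dist_eq_norm]; linarith
    have hU2 : f.below ∈ ball (ψ t) ε := ball_subset_ball (by linarith) hU1
    have hP : 0 ≤ f.strength * g.strength := by positivity
    have hPφ : f.strength * g.strength ≤ φ := by nlinarith
    have hM : f.above ∈ ball (ψ t) ε := by
      have hsize := haf.norm_sub_le hE (hfs.trans_le (by linarith)) (Or.inl hU2)
      rw [mem_ball, dist_eq_norm]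
      calc ‖f.above - ψ t‖ = ‖(f.above - f.below) + (f.below - ψ t)‖ := by congr 1; abel
        _ ≤ _ := norm_add_le _ _
        _ < ε := by linarith
    -- An incoming non-physical front leaves the physical parameters exactly unchanged;
    -- `np_strong_le` relies on this value 0.
    have hout' : OutEstimate P (genOrder f.wave.family f.order g.wave.family g.order) f g out
        (if f.IsNP then 0 else 2 * C ^ 2 * (f.strength * g.strength))
        (2 * C ^ 2 * (f.strength * g.strength)) := by
      rcases hsolver with ⟨hnp, -, hsol⟩ | ⟨-, hsol⟩
      · rw [if_neg hnp]
        refine (hsol.outEstimate hδ hE haf hag hfg (hcase.crosses hnp) hnp hgn hU2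
          (hfs.trans_le (by linarith)) (hgs.trans_le (by linarith))).mono ?_ (by positivity)
        gcongr
      · refine (hsol.outEstimate hδ hγ hE haf hag hfg ?_ hgn hU1 hM
          (hfs.trans_le (by linarith)) hcg).mono ?_ le_rfl
        · by_cases hnp : f.IsNP
          · exact Or.inr hnp
          · exact Or.inl (hcase.crosses hnp)
        · split_ifs
          · exact le_rfl
          · positivity
    have hout : OutEstimate P (genOrder f.wave.family f.order g.wave.family g.order) f g out
        (2 * C ^ 2 * (f.strength * g.strength)) (2 * C ^ 2 * (f.strength * g.strength)) := by
      refine hout'.mono ?_ le_rfl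
      split_ifs
      · positivity
      · exact le_rfl
    cases hcase with
    | weak ha =>
      exact hw.weak_le hδ hfronts rfl ha.1.2 ha.2.1.2 (if_pos (Or.inl ha)) hout hPφ hF.le
    | strong_weak hf hg =>
      refine hw.strong_weak_le hδ hfronts rfl hf hg ?_ hout hPφ hF.le
      obtain ⟨h0, b, hb, hfw⟩ := hf
      simp [genOrder, hfw, h0, Wave.family]
    | strong_shock hf hg hs =>
      have h0 := hf.1
      have hg3 := hg.1
      obtain ⟨a, ha, hfw, hfa, hfl⟩ := hf.load
      obtain ⟨b, hb, hgw, hgb, hgl⟩ := hg.load_of_isShock hs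
      rw [hfa, hgb]
      refine hw.shock_le hδ hfronts rfl ha hb (Or.inl hf) ?_ ?_ (by rw [hfa, hgb]) ?_ hout
        (hfa ▸ hfs.le) (hgb ▸ hgs.le) hF.le
      · rw [load_pair, hfl, hgl]; simp
      · rw [hfw, hgw]; simp [Wave.acParam, sub_eq_add_neg]
      · simp [genOrder, hfw, h0, hgw, Wave.family]
    | shock_strong hf hs hg =>
      have h0 := hg.1
      obtain ⟨a, ha, hgw, hga, hgl⟩ := hg.load
      obtain ⟨b, hb, hfw, hfb, hfl⟩ := hf.load_of_isShock hs
      rw [hga, hfb, min_comm]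
      refine hw.shock_le hδ hfronts rfl ha hb (Or.inr hg) ?_ ?_ (by rw [hga, hfb, mul_comm]) ?_ hout
        (hga ▸ hgs.le) (hfb ▸ hfs.le) hF.le
      · rw [load_pair, hfl, hgl]; simp
      · rw [hfw, hgw]; simp only [Wave.acParam, if_true]; ring
      · simp [genOrder, hfw, h0, hgw, Wave.family]
    | np_strong hf hg =>
      rw [if_pos hf] at hout'
      refine hw.np_strong_le hδ hfronts rfl hf hg ?_ hout' hF.le
      obtain ⟨h0, b, hb, hgw⟩ := hg
      rw [hf]
      simp [genOrder, hgw, h0, Wave.family]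
    | np_weak hf hg =>
      refine hw.weak_le hδ hfronts rfl ?_ hg.2 (if_pos (Or.inr ⟨hf, hg⟩)) hout hPφ hF.le
      rintro ⟨-, b, -, hfw⟩
      simp [Front.IsNP, hfw, Wave.family] at hf
  | reflect hi out f a b s Um hfronts hwave hmeet honly hpres hjoin hsolver =>
    have hcon := hc.connects
    have hpb := hc.pres_bottom
    have hfs : f.strength < φ := hc.strength_lt hδφ hW (by rw [hfronts]; simp)
    have hsa : f.strength = |a| := by rw [Front.strength, hwave]; rfl
    rw [hsa] at hfs
    obtain ⟨t, ht, hU⟩ := hnear _ _ hcon hc.small (by linarith) hW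
    rw [hfronts] at hcon
    obtain ⟨hfb, haf, -⟩ := hcon
    have hJ := haf.waveJoin (by simp [Front.IsNP, hwave, Wave.family])
    rw [hwave] at hJ
    have hJ3 : AcJoin P.γ .three b Um f.above := by
      rcases hjoin with ⟨hb, hr, -⟩ | ⟨hb, hr⟩
      · exact Or.inl ⟨hb.le, hr⟩
      · exact Or.inr ⟨hb, s, hr⟩
    -- The new state at the boundary and the old one below the 1-front both have the static
    -- pressure.
    obtain ⟨q1, q2⟩ := (hT.est t ht).reflect a b f.below f.above Um hJ hJ3
      (by rw [hpres, hfb, hpb]) (by linarith) (by rw [hfb, mem_ball, dist_eq_norm]; linarith)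
    have hle : C * |a| ≤ 2 * C ^ 2 * |a| := by
      gcongr
      linarith
    have h0 : |(0 : ℝ)| ≤ 2 * C ^ 2 * |a| := by rw [abs_zero]; positivity
    rcases hsolver with ⟨-, hsol⟩ | ⟨-, e, hsol⟩
    · refine hw.reflect_le hδ hfronts rfl hwave (ord := fun _ => f.order) (b := b) (e := 0) ?_
        (q1.trans hle) h0 hF.le
      refine hsol.2.2.trans ?_
      simp [fanTags, pieces_acoustic_zero, pieces_contact_zero, pieces_nonphysical_zero]
    · have he : e = ‖f.above - Um‖ := by
        refine hsol.2.1.nonphysical (k := f.order) (hsol.2.2.trans ?_)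
        simp
      refine hw.reflect_le hδ hfronts rfl hwave (ord := fun _ => f.order) (b := 0) (e := e) ?_
        h0 ?_ hF.le
      · refine hsol.2.2.trans ?_
        simp [fanTags, pieces_acoustic_zero, pieces_contact_zero]
      · rw [he, abs_norm]
        exact q2.trans hle

end SteadyEuler
end

theorem theoremT (γ : ℝ) (hγ : 1 < γ) (Up Um : SteadyEuler.State) (S : ℝ)
    (hbg : SteadyEuler.IsBackground γ Up Um S) (δ₀ : ℝ) (hδ₀ : 0 < δ₀) :
    ∃ (w : SteadyEuler.Weights) (δstar : ℝ), w.Positive ∧ 0 < δstar ∧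
      ∀ lamHat : ℝ,
        (∀ U ∈ SteadyEuler.nbhdD γ Up (SteadyEuler.pres Um) δ₀,
          SteadyEuler.lam γ .one U < lamHat ∧ SteadyEuler.lamTwo U < lamHat ∧
            SteadyEuler.lam γ .three U < lamHat) →
        ∀ δ μ η : ℝ, 0 < δ → δ < δstar → 0 < μ → 0 ≤ η →
          ∀ A : SteadyEuler.ApproxSolution
            ⟨γ, Up, SteadyEuler.pres Um, lamHat, δ, μ, η⟩,
          ∀ n < A.N,
            SteadyEuler.glimm w S (A.slab n) < δstar →
              SteadyEuler.glimm w S (A.slab (n + 1)) - SteadyEuler.glimm w S (A.slab n) ≤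
                -(1 / 4) * A.E n := by
  obtain ⟨ψ, C, ε, hT, hψ⟩ := hbg.exists_tube hγ
  have hC := hT.one_le
  have hε := hT.eps_pos
  obtain ⟨d, hd, hnear⟩ := hT.exists_near (r := ε / 4) (by positivity) (by linarith)
  -- The constant 2C² covers the bounds of both Riemann solvers. The bound φ ≤ d keeps all states
  -- near the background curve, φ ≤ ε/(4C) keeps each front within the range of the local estimates,
  -- and φ becomes δ*.
  obtain ⟨K, K₀, Kω, Knp, φ, hw, hφ⟩ := SteadyEuler.exists_goodWeights S
    (show 1 ≤ 2 * C ^ 2 by nlinarith) (show 0 < min d (ε / (4 * C)) by positivity)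
  refine ⟨SteadyEuler.weightsOf K K₀ Kω Knp, φ, ?_, hw.pos, ?_⟩
  · have := hw.one_le_K
    exact ⟨by simp only [SteadyEuler.weightsOf]; linarith, hw.K₀_pos, one_pos, one_pos, two_pos,
      one_pos, hw.Kω_pos, hw.Knp_pos, one_pos⟩
  · intro lamHat _ δ μ η hδ hδφ _ _ A n hn hF
    have hφd : φ ≤ d := hφ.trans (min_le_left _ _)
    have hφε : 4 * C * φ ≤ ε := by
      have := hφ.trans (min_le_right _ _)
      rw [le_div_iff₀ (by positivity)] at this
      linarith
    refine (A.interaction n hn).glimm_sub_le hγ hT hw hδ hδφ hφε ?_ (A.good hδ n hn.le) hF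
    intro fs U hcon hsmall hs hweak
    exact hnear _ rfl hδ (hδφ.trans_le hφd) fs U (hψ ▸ hcon) hsmall (by linarith) (by linarith)
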